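/- Let $(M,g)$ be a compact connected Riemannian manifold without boundary of class $C^{1,1}$ (with Lipschitz metric), of dimension $d$, with Riemannian measure $\mu$, and let $\mathbf G$ be the inner product induced by $g$ on $T^*M$. Let $\Omega\subsetneq M$ be a non-empty open set, and let $\mathcal V=\{(V,\kappa_V)\}$ be a $C^{1,1}$ atlas of $M$ in which $\partial\Omega$ is Hölder continuous of order $\gamma_\Omega\in(0,1]$: for every chart of $\mathcal V$ there are a unit vector $\xi_V\in\mathbb R^d$ and a $\gamma_\Omega$-Hölder function $g_V:\xi_V^\perp\to\mathbb R$ such that $\kappa_V(V\cap\partial\Omega)$ lies in the graph of $g_V$ and $\kappa_V(V\cap\Omega)$ does not meet its epigraph. Let $\mathring H^1(\Omega)$ be the closure in $H^1(M)$ of the $C^1$ functions with compact support in $\Omega$, with norm $\|u\|_{\mathring H^1(\Omega)}=(\int_\Omega \mathbf G(\nabla u,\nabla u)\,d\mu)^{1/2}$. Let $\mathbf A$ be a symmetric section of $T^2M$, $\mathbf b$ a vector field, $c$ a linear functional on (the span of) products of elements of $\mathring H^1(\Omega)$, and $$\Phi=\Phi_0+\Phi_r,\qquad \Phi_0(u,v)=\int_M\mathbf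 A(\nabla u,\nabla v)\,d\mu,\qquad \Phi_r(u,v)=\int_\Omega \mathbf b(\nabla u)\,v\,d\mu+\langle c,uv\rangle .$$ Assume: (A1) $\alpha\,\mathbf G_x(\xi,\xi)\le\mathbf A_x(\xi,\xi)$ for some $\alpha>0$ and all $x\in M$, $\xi\in T_x^*M$; (A2) $\mathbf A$ is of class $C^{0,\gamma_c}(M)$, $\gamma_c\in(0,1]$; (A3) $\Phi$ is well defined, continuous and positive ($\Phi(u,u)>0$ for $u\ne0$) on $\mathring H^1(\Omega)$. For $f\in H^{-1}(\Omega)=(\mathring H^1(\Omega))'$ write $\tau(f,v)=\langle f,v\rangle$; $u\in\mathring H^1(\Omega)$ is a solution of $\mathcal A u=f$ if $\Phi_0(u,v)+\Phi_r(u,v)=\tau(f,v)$ for all $v\in\mathring H^1(\Omega)$. For $\sigma\in(0,1)$ let $N_2^{1+\sigma}(\mathbb R^d)$ be the space of $v\in W_2^1(\mathbb R^d)$ with finite norm $\|v\|_{W^1_2}+\max_i\sup_{h\ne0}|h|^{-\sigma}\|\partial_iv(\cdot+h)-\partial_iv\|_{L_2}$. Fix a finite $C^{1,1}$ atlas $\{(U,\kappa_U)\}$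 of $M$ and a subordinate $C^{1,1}$ partition of unity $\{\psi_U\}$. Let $N_2^{1+\sigma}(M)$ consist of the $u\in L_2(M)$ such that every $\psi_Uu$, in the coordinates $\kappa_U$ and extended by zero, is in $N_2^{1+\sigma}(\mathbb R^d)$, with the sum of these norms as norm, and let $\tilde N_2^{1+\sigma}(\Omega)$ be the subspace of the $u$ with $\operatorname{supp}u\subset\bar\Omega$. Fix constants $C_{V,\varphi}$ for all charts $(V,\kappa_V)\in\mathcal V$ and all $\varphi\in C^{1,1}(M)$ with $\operatorname{supp}\varphi\subset V$. Let $H$ be $\mathring H^1(\Omega)$ or one of the spaces $\tilde N_2^{1+s}(\Omega)$. A form $\zeta$ on $\mathring H^1(\Omega)$ is called Hölder continuous of order $\beta$ in $H$ with constant $C_\zeta^H\ge0$ if for all such $V,\varphi$, all $w\in H$ and all $h\in\mathbb R^d$ with $|h|<\operatorname{dist}(\kappa_V(\operatorname{supp}\varphi),\partial\kappa_V(V))$, $$z=\varphi\,(w-w_h)\in H\cap\mathring H^1(\Omega)\ \Longrightarrow\ |\zeta(z)|\le C_{V,\varphi}\,C^H_\zeta\,\|w\|_H\,|h|^\beta ,$$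 where $w_h=w\circ\kappa_V^{-1}\circ(\cdot+h)\circ\kappa_V$ on $\operatorname{supp}\varphi$ and $z=0$ elsewhere. Then there is a constant $C>0$, depending only on $M$ (with the fixed finite atlas and partition of unity), on $\Omega$, $\mathcal V$, $\gamma_\Omega$, $\{C_{V,\varphi}\}$ and on $\mathcal A$ (that is, on $\mathbf A,\gamma_c,\mathbf b,c$), such that for all $f\in H^{-1}(\Omega)$ and every solution $u\in\mathring H^1(\Omega)$ of $\mathcal Au=f$: 1. If $\beta_0\in(0,1]$ and $\tau(f,\cdot)$, $\Phi_r(u,\cdot)$ are Hölder continuous of order $\beta_0$ in $\mathring H^1(\Omega)$ with constants $C_{\tau(f,\cdot)}$, $C_{\Phi_r(u,\cdot)}$, then, with $\gamma_0=\min\{\gamma_c,\beta_0\}$, $u\in\tilde N_2^{1+\gamma_\Omega\gamma_0/2}(\Omega)$ and $$\|u\|^2_{\tilde N_2^{1+\gamma_\Omega\gamma_0/2}(\Omega)}\le C\,\|u\|_{\mathring H^1(\Omega)}\left[\|u\|_{\mathring H^1(\Omega)}+C_{\tau(f,\cdot)}+C_{\Phi_r(u,\cdot)}\right].$$ 2.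 If $s\in(0,1/2)$, $u\in\tilde N_2^{1+s}(\Omega)$, $\beta_s\in(0,1]$ and $\tau(f,\cdot)$, $\Phi_r(u,\cdot)$ are Hölder continuous of order $\beta_s$ in $\tilde N_2^{1+s}(\Omega)$ with constants $C_{\tau(f,\cdot)}$, $C_{\Phi_r(u,\cdot)}$, then, with $\gamma_s=\min\{\gamma_c,\beta_s\}$, $u\in\tilde N_2^{1+\gamma_\Omega\gamma_s/2}(\Omega)$ and $$\|u\|^2_{\tilde N_2^{1+\gamma_\Omega\gamma_s/2}(\Omega)}\le C\left[\|u\|^2_{\mathring H^1(\Omega)}+\|u\|_{\tilde N_2^{1+s}(\Omega)}\left(C_{\tau(f,\cdot)}+C_{\Phi_r(u,\cdot)}\right)\right].$$ -/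

import Mathlib

open Set Filter Topology MeasureTheory
open scoped NNReal ENNReal Manifold

noncomputable section

namespace HolderElliptic

/-! ## Charts, `C^{1,1}` manifolds and functions -/

/-- The model space `ℝ^d` with its Euclidean norm. -/
abbrev E (d : ℕ) : Type := EuclideanSpace ℝ (Fin d)

/-- A local chart, i.e. a homeomorphism from an open set `e.source` of `M` onto an open set
`e.target` of `ℝ^d`. -/
abbrev Chart (d : ℕ) (M : Type*) [TopologicalSpace M] : Type _ := OpenPartialHomeomorph M (E d)

/-- `f` is locally Hölder continuous of order `γ` on `s`. -/
def LocHolderOn {X Y : Type*} [NormedAddCommGroup X] [NormedAddCommGroup Y]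
    (γ : ℝ) (f : X → Y) (s : Set X) : Prop :=
  ∀ x ∈ s, ∃ K : ℝ, ∃ t ∈ 𝓝[s] x, ∀ y ∈ t, ∀ z ∈ t, ‖f y - f z‖ ≤ K * ‖y - z‖ ^ γ

/-- `f` is of class `C^{1,1}` (locally) on the open set `s`. -/
def C11On {X Y : Type*} [NormedAddCommGroup X] [NormedSpace ℝ X]
    [NormedAddCommGroup Y] [NormedSpace ℝ Y] (f : X → Y) (s : Set X) : Prop :=
  ContDiffOn ℝ 1 f s ∧ LocallyLipschitzOn s (fderiv ℝ f)

section Manifold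

variable {d : ℕ} {M : Type*} [TopologicalSpace M] [ChartedSpace (E d) M]

/-- `e` is a chart of the `C^{1,1}` structure: its transition maps to and from the charts of
the given atlas are of class `C^{1,1}`. -/
def IsC11Chart (e : Chart d M) : Prop :=
  ∀ e' ∈ atlas (E d) M,
    C11On (e' ∘ e.symm) (e.symm.trans e').source ∧ C11On (e ∘ e'.symm) (e'.symm.trans e).source

variable (d M) in
/-- The given atlas defines a `C^{1,1}` structure on `M`. -/
def IsC11Manifold : Prop := ∀ e ∈ atlas (E d) M, IsC11Chart e

variable (d) in
/-- Real functions of class `C^{1,1}` on `M`. -/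
def IsC11Fun (φ : M → ℝ) : Prop :=
  ∀ e ∈ atlas (E d) M, C11On (φ ∘ e.symm) e.target

/-- An atlas of the `C^{1,1}` manifold `M`. -/
def IsC11Atlas (V : Set (Chart d M)) : Prop :=
  (∀ e ∈ V, IsC11Chart e) ∧ ∀ x : M, ∃ e ∈ V, x ∈ e.source

variable (d M) in
/-- A finite `C^{1,1}` atlas of `M` with a subordinate `C^{1,1}` partition of unity. -/
structure FiniteAtlas where
  n : ℕ
  chart : Fin n → Chart d M
  ψ : Fin n → M → ℝ
  isC11Chart : ∀ i, IsC11Chart (chart i)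
  isC11Fun : ∀ i, IsC11Fun d (ψ i)
  nonneg : ∀ i x, 0 ≤ ψ i x
  sum_eq_one : ∀ x, ∑ i, ψ i x = 1
  tsupport_subset : ∀ i, tsupport (ψ i) ⊆ (chart i).source

/-! ## Tensors -/

variable (d) in
/-- Tangent space `T_x M`. -/
abbrev Tan (x : M) : Type := TangentSpace (𝓡 d) x

variable (d) in
/-- Cotangent space `T*_x M`. -/
abbrev Cot (x : M) : Type := Tan d x →L[ℝ] ℝ

variable (d M) in
/-- (Not necessarily regular) Riemannian metrics. -/
abbrev Metric : Type _ := Bundle.RiemannianMetric (fun x : M => Tan d x)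

/-- Coordinate vector field `∂_i` of the chart `e`, at the point of `M` with coordinates `y`. -/
def coordVec (e : Chart d M) (y : E d) (i : Fin d) : Tan d (e.symm y) :=
  mfderiv (𝓡 d) (𝓡 d) e.symm y (EuclideanSpace.single i (1 : ℝ))

/-- Coordinate covector field `dx^i` of the chart `e`, at the point of `M` with coordinates `y`. -/
def coordCovec (e : Chart d M) (y : E d) (i : Fin d) : Cot d (e.symm y) :=
  (EuclideanSpace.proj i : E d →L[ℝ] ℝ).comp
    (mfderiv (𝓡 d) (𝓡 d) e (e.symm y) : Tan d (e.symm y) →L[ℝ] E d)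

/-- The matrix `g_{ij}` of the metric in the chart `e`. -/
def gram (g : Metric d M) (e : Chart d M) (y : E d) : Matrix (Fin d) (Fin d) ℝ :=
  Matrix.of fun i j => g.inner (e.symm y) (coordVec e y i) (coordVec e y j)

/-- The metric is Lipschitz continuous in the charts of the given atlas. -/
def IsLipschitzMetric (g : Metric d M) : Prop :=
  ∀ e ∈ atlas (E d) M, ∀ i j, LocHolderOn 1 (fun y => gram g e y i j) e.target

/-- The inner product `G_x` induced by the metric on `T*_x M`: `G_x(ξ, η) = ξ(v)` where `v` is the
vector with `g_x(v, ·) = η`. -/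
def cometric (g : Metric d M) (x : M) (ξ η : Cot d x) : ℝ :=
  ξ ((g.inner x).inverse η)

/-- Sections of `T²M`, as bilinear forms on the cotangent spaces. -/
abbrev Tensor2 (d : ℕ) (M : Type*) [TopologicalSpace M] [ChartedSpace (E d) M] : Type _ :=
  ∀ x : M, Cot d x →ₗ[ℝ] Cot d x →ₗ[ℝ] ℝ

/-- The section `A` is of class `C^{0,γ}`: its coordinates `a^{ij}` are. -/
def IsHolderTensor (γ : ℝ) (A : Tensor2 d M) : Prop :=
  ∀ e ∈ atlas (E d) M, ∀ i j,
    LocHolderOn γ (fun y => A (e.symm y) (coordCovec e y i) (coordCovec e y j)) e.target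

/-! ## The Riemannian measure -/

/-- The Riemannian measure: in a chart it is `√(det g_{ij}) dy`, and the chart measures are glued
by the partition of unity. -/
def riemannianMeasure [MeasurableSpace M] (P : FiniteAtlas d M) (g : Metric d M) : Measure M :=
  ∑ i, Measure.map (P.chart i).symm
    ((volume.restrict (P.chart i).target).withDensity fun y =>
      ENNReal.ofReal (P.ψ i ((P.chart i).symm y) * √((gram g (P.chart i) y).det)))

/-! ## The space `H^1_0(Ω)` -/

/-- The differential of a real function on `M`. -/
def diff (φ : M → ℝ) (x : M) : Cot d x := mfderiv (𝓡 d) 𝓘(ℝ, ℝ) φ x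

variable (d) in
/-- `C^1` functions with compact support in `Ω` (`M` will be compact). -/
def IsTest (Ω : Set M) (φ : M → ℝ) : Prop :=
  ContMDiff (𝓡 d) 𝓘(ℝ, ℝ) 1 φ ∧ tsupport φ ⊆ Ω

/-- `u` belongs to `H^1_0(Ω)` (extended by zero to `M`) and `θ` is its differential: there are test
functions `φ n` on `Ω` with `φ n → u` in `L_2` and `dφ n → θ` in `L_2`.  The second convergence is
expressed through measurable upper bounds `F n` of the squared norm of `θ - dφ n`, which makes the
measurability of `θ` part of the definition. -/
def IsH10Diff [MeasurableSpace M] (g : Metric d M) (μ : Measure M) (Ω : Set M)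
    (u : M → ℝ) (θ : ∀ x : M, Cot d x) : Prop :=
  MemLp u 2 μ ∧ ∃ (φ : ℕ → M → ℝ) (F : ℕ → M → ℝ≥0∞),
    (∀ n, IsTest d Ω (φ n)) ∧
    Tendsto (fun n => eLpNorm (u - φ n) 2 μ) atTop (𝓝 0) ∧
    (∀ n, AEMeasurable (F n) μ) ∧
    (∀ n, ∀ᵐ x ∂μ,
      ENNReal.ofReal (cometric g x (θ x - diff (φ n) x) (θ x - diff (φ n) x)) ≤ F n x) ∧
    Tendsto (fun n => ∫⁻ x, F n x ∂μ) atTop (𝓝 0)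

lemma cometric_self_nonneg (g : Metric d M) (x : M) (ξ : Cot d x) : 0 ≤ cometric g x ξ ξ := by
  unfold cometric
  by_cases h : (g.inner x).IsInvertible
  · obtain ⟨f, hf⟩ := h
    have h1 : (g.inner x).inverse = (f.symm : _ →L[ℝ] _) := by
      rw [← hf, ContinuousLinearMap.inverse_equiv]
    have h2 : ξ = g.inner x (f.symm ξ) := by
      rw [← hf]; simp
    rw [h1]
    have h3 : ξ (f.symm ξ) = g.inner x (f.symm ξ) (f.symm ξ) :=
      congrArg (fun η : Cot d x => η (f.symm ξ)) h2
    change 0 ≤ ξ (f.symm ξ)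
    rw [h3]
    by_cases hv : f.symm ξ = 0
    · rw [hv]; simp
    · exact (g.pos x _ hv).le
  · rw [ContinuousLinearMap.inverse_of_not_isInvertible h]; simp

lemma cometric_add_le (g : Metric d M) (x : M) (ξ η : Cot d x) :
    cometric g x (ξ + η) (ξ + η) ≤ 2 * cometric g x ξ ξ + 2 * cometric g x η η := by
  have h := cometric_self_nonneg g x (ξ - η)
  unfold cometric at *
  simp only [map_add, map_sub, add_apply, sub_apply] at *
  linarith

lemma cometric_smul (g : Metric d M) (x : M) (c : ℝ) (ξ : Cot d x) :
    cometric g x (c • ξ) (c • ξ) = c ^ 2 * cometric g x ξ ξ := by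
  unfold cometric
  simp only [map_smul, smul_apply, smul_eq_mul]
  ring

lemma IsTest.mdifferentiableAt {Ω : Set M} {φ : M → ℝ} (h : IsTest d Ω φ) (x : M) :
    MDifferentiableAt (𝓡 d) 𝓘(ℝ, ℝ) φ x :=
  (h.1.mdifferentiable one_ne_zero) x

lemma diff_add {φ χ : M → ℝ} {x : M} (h : MDifferentiableAt (𝓡 d) 𝓘(ℝ, ℝ) φ x)
    (h' : MDifferentiableAt (𝓡 d) 𝓘(ℝ, ℝ) χ x) :
    diff (d := d) (φ + χ) x = diff φ x + diff χ x :=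
  mfderiv_add h h'

lemma diff_smul {φ : M → ℝ} {x : M} (h : MDifferentiableAt (𝓡 d) 𝓘(ℝ, ℝ) φ x) (c : ℝ) :
    diff (d := d) (c • φ) x = c • diff φ x :=
  const_smul_mfderiv h c

lemma IsTest.add {Ω : Set M} {φ χ : M → ℝ} (h : IsTest d Ω φ) (h' : IsTest d Ω χ) :
    IsTest d Ω (φ + χ) :=
  ⟨h.1.add h'.1, (tsupport_add φ χ).trans (union_subset h.2 h'.2)⟩

lemma IsTest.smul {Ω : Set M} {φ : M → ℝ} (h : IsTest d Ω φ) (c : ℝ) : IsTest d Ω (c • φ) :=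
  ⟨(contMDiff_const (c := c) : ContMDiff (𝓡 d) 𝓘(ℝ, ℝ) 1 (fun _ : M => c)).smul h.1, (tsupport_smul_subset_right (fun _ => c) φ).trans h.2⟩

lemma IsTest.zero (Ω : Set M) : IsTest d Ω (0 : M → ℝ) :=
  ⟨contMDiff_const, by simp⟩

section Measure

variable [MeasurableSpace M] [BorelSpace M]

lemma IsTest.aestronglyMeasurable {Ω : Set M} {φ : M → ℝ} (h : IsTest d Ω φ) (μ : Measure M) :
    AEStronglyMeasurable φ μ :=
  h.1.continuous.aestronglyMeasurable

lemma IsH10Diff.add {g : Metric d M} {μ : Measure M} {Ω : Set M} {u v : M → ℝ}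
    {θ η : ∀ x : M, Cot d x} (hu : IsH10Diff g μ Ω u θ) (hv : IsH10Diff g μ Ω v η) :
    IsH10Diff g μ Ω (u + v) (fun x => θ x + η x) := by
  obtain ⟨hu0, φ, F, hφ, hφu, hFm, hF, hF0⟩ := hu
  obtain ⟨hv0, χ, G, hχ, hχv, hGm, hG, hG0⟩ := hv
  refine ⟨hu0.add hv0, fun n => φ n + χ n, fun n x => 2 * F n x + 2 * G n x,
    fun n => (hφ n).add (hχ n), ?_, fun n => ((hFm n).const_mul 2).add ((hGm n).const_mul 2),
    fun n => ?_, ?_⟩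
  · have h := hφu.add hχv
    rw [add_zero] at h
    refine tendsto_of_tendsto_of_tendsto_of_le_of_le tendsto_const_nhds h (fun _ => bot_le)
      fun n => ?_
    have h1 : u + v - (φ n + χ n) = (u - φ n) + (v - χ n) := by abel
    simp only [h1]
    exact eLpNorm_add_le (hu0.1.sub ((hφ n).aestronglyMeasurable μ))
      (hv0.1.sub ((hχ n).aestronglyMeasurable μ)) one_le_two
  · filter_upwards [hF n, hG n] with x h1 h2
    have h3 : θ x + η x - diff (φ n + χ n) x = (θ x - diff (φ n) x) + (η x - diff (χ n) x) := by
      rw [diff_add ((hφ n).mdifferentiableAt x) ((hχ n).mdifferentiableAt x)]; abel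
    rw [h3]
    refine (ENNReal.ofReal_le_ofReal (cometric_add_le g x _ _)).trans ?_
    rw [ENNReal.ofReal_add (mul_nonneg zero_le_two (cometric_self_nonneg g x _))
      (mul_nonneg zero_le_two (cometric_self_nonneg g x _)), ENNReal.ofReal_mul zero_le_two,
      ENNReal.ofReal_mul zero_le_two, ENNReal.ofReal_ofNat]
    gcongr
  · have h := (ENNReal.Tendsto.const_mul hF0 (Or.inr ENNReal.ofNat_ne_top) (a := 2)).add
      (ENNReal.Tendsto.const_mul hG0 (Or.inr ENNReal.ofNat_ne_top) (a := 2))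
    simp only [mul_zero, add_zero] at h
    refine h.congr fun n => ?_
    rw [lintegral_add_left' ((hFm n).const_mul 2), lintegral_const_mul'' _ (hFm n),
      lintegral_const_mul'' _ (hGm n)]

lemma IsH10Diff.smul {g : Metric d M} {μ : Measure M} {Ω : Set M} {u : M → ℝ}
    {θ : ∀ x : M, Cot d x} (c : ℝ) (hu : IsH10Diff g μ Ω u θ) :
    IsH10Diff g μ Ω (c • u) (fun x => c • θ x) := by
  obtain ⟨hu0, φ, F, hφ, hφu, hFm, hF, hF0⟩ := hu
  refine ⟨hu0.const_smul c, fun n => c • φ n, fun n x => ENNReal.ofReal (c ^ 2) * F n x,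
    fun n => (hφ n).smul c, ?_, fun n => (hFm n).const_mul _, fun n => ?_, ?_⟩
  · have h := ENNReal.Tendsto.const_mul hφu (Or.inr (enorm_ne_top (x := c))) (a := ‖c‖ₑ)
    rw [mul_zero] at h
    refine h.congr fun n => ?_
    rw [← smul_sub, eLpNorm_const_smul]
  · filter_upwards [hF n] with x h1
    have h2 : c • θ x - diff (c • φ n) x = c • (θ x - diff (φ n) x) := by
      rw [diff_smul ((hφ n).mdifferentiableAt x)]
      ext t
      simp only [sub_apply, smul_apply, smul_eq_mul]
      ring
    rw [h2, cometric_smul, ENNReal.ofReal_mul (sq_nonneg c)]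
    gcongr
  · have h := ENNReal.Tendsto.const_mul hF0 (Or.inr ENNReal.ofReal_ne_top)
      (a := ENNReal.ofReal (c ^ 2))
    rw [mul_zero] at h
    refine h.congr fun n => ?_
    rw [lintegral_const_mul'' _ (hFm n)]

lemma IsH10Diff.zero (g : Metric d M) (μ : Measure M) (Ω : Set M) :
    IsH10Diff g μ Ω 0 (fun _ => 0) := by
  refine ⟨MemLp.zero, fun _ => 0, fun _ _ => 0, fun _ => IsTest.zero Ω, by simp,
    fun _ => aemeasurable_const, fun _ => ae_of_all _ fun x => ?_, by simp⟩
  have h : diff (d := d) (0 : M → ℝ) x = 0 := mfderiv_const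
  rw [h]
  simp [cometric]

/-- The space `H^1_0(Ω)` of functions on `M` (vanishing a.e. outside `Ω`): the closure of the
test functions on `Ω` with respect to the `H^1` norm. -/
def H10 (g : Metric d M) (μ : Measure M) (Ω : Set M) : Submodule ℝ (M → ℝ) where
  carrier := {u | ∃ θ, IsH10Diff g μ Ω u θ}
  add_mem' := fun ⟨_, h⟩ ⟨_, h'⟩ => ⟨_, h.add h'⟩
  zero_mem' := ⟨_, IsH10Diff.zero g μ Ω⟩
  smul_mem' := fun c _ ⟨_, h⟩ => ⟨_, h.smul c⟩

variable {g : Metric d M} {μ : Measure M} {Ω : Set M}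

/-- The (weak) differential of an element of `H^1_0(Ω)`. -/
def h10Diff (u : H10 g μ Ω) : ∀ x : M, Cot d x := Classical.choose u.2

/-- The norm `(∫_Ω G(∇u, ∇u) dμ)^{1/2}` of `H^1_0(Ω)`. -/
def h10Norm (u : H10 g μ Ω) : ℝ := √(∫ x in Ω, cometric g x (h10Diff u x) (h10Diff u x) ∂μ)

/-! ## The forms -/

variable (g μ Ω) in
/-- The span of the products of two elements of `H^1_0(Ω)`. -/
def productSpace : Submodule ℝ (M → ℝ) :=
  Submodule.span ℝ {w | ∃ u v : H10 g μ Ω, w = (u : M → ℝ) * (v : M → ℝ)}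

/-- The product of two elements of `H^1_0(Ω)`. -/
def h10Mul (u v : H10 g μ Ω) : productSpace g μ Ω :=
  ⟨(u : M → ℝ) * (v : M → ℝ), Submodule.subset_span ⟨u, v, rfl⟩⟩

/-- `Φ_0(u, v) = ∫_M A(∇u, ∇v) dμ`. -/
def formΦ₀ (A : Tensor2 d M) (u v : H10 g μ Ω) : ℝ := ∫ x, A x (h10Diff u x) (h10Diff v x) ∂μ

/-- `Φ_r(u, v) = ∫_Ω b(∇u) v dμ + ∫_Ω c u v dμ`, the last integral being the action of the
functional `c` on the product `u v`. -/
def formΦr (b : ∀ x : M, Tan d x) (c : productSpace g μ Ω →ₗ[ℝ] ℝ) (u v : H10 g μ Ω) : ℝ :=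
  (∫ x in Ω, h10Diff u x (b x) * (v : M → ℝ) x ∂μ) + c (h10Mul u v)

/-- `Φ = Φ_0 + Φ_r`. -/
def formΦ (A : Tensor2 d M) (b : ∀ x : M, Tan d x) (c : productSpace g μ Ω →ₗ[ℝ] ℝ)
    (u v : H10 g μ Ω) : ℝ :=
  formΦ₀ A u v + formΦr b c u v

/-- `A` is a symmetric section satisfying the ellipticity condition `α G ≤ A` for some `α > 0`. -/
def CondA1 (g : Metric d M) (A : Tensor2 d M) : Prop :=
  (∀ x (ξ η : Cot d x), A x ξ η = A x η ξ) ∧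
    ∃ α : ℝ, 0 < α ∧ ∀ x (ξ : Cot d x), α * cometric g x ξ ξ ≤ A x ξ ξ

/-- `A` is of class `C^{0,γ}`, `γ ∈ (0,1]`. -/
def CondA2 (γ : ℝ) (A : Tensor2 d M) : Prop := 0 < γ ∧ γ ≤ 1 ∧ IsHolderTensor γ A

/-- The form `Φ` is well defined, continuous and positive on `H^1_0(Ω)`. -/
def CondA3 (A : Tensor2 d M) (b : ∀ x : M, Tan d x) (c : productSpace g μ Ω →ₗ[ℝ] ℝ) : Prop :=
  (∀ u v : H10 g μ Ω, IntegrableOn (fun x => h10Diff u x (b x) * (v : M → ℝ) x) Ω μ) ∧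
  (∃ K : ℝ, ∀ u v : H10 g μ Ω, |formΦ A b c u v| ≤ K * h10Norm u * h10Norm v) ∧
  ∀ u : H10 g μ Ω, ¬ ((u : M → ℝ) =ᵐ[μ] 0) → 0 < formΦ A b c u u

/-- `f ∈ H^{-1}(Ω)`: a bounded linear functional on `H^1_0(Ω)`; `τ(f, v) = f v`. -/
def IsHm1 (f : H10 g μ Ω →ₗ[ℝ] ℝ) : Prop :=
  ∃ K : ℝ, ∀ v : H10 g μ Ω, |f v| ≤ K * h10Norm v

/-- `u` is a variational solution of `𝒜 u = f`. -/
def IsWeakSolution (A : Tensor2 d M) (b : ∀ x : M, Tan d x) (c : productSpace g μ Ω →ₗ[ℝ] ℝ)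
    (f : H10 g μ Ω →ₗ[ℝ] ℝ) (u : H10 g μ Ω) : Prop :=
  ∀ v : H10 g μ Ω, formΦ₀ A u v + formΦr b c u v = f v

end Measure

/-! ## Domains with Hölder boundary -/

/-- The boundary of `Ω` is Hölder continuous of order `γ` with respect to the atlas `V`: in each
chart of `V` there are a unit vector `ξ` and a `γ`-Hölder function `k : ξ^⊥ → ℝ` such that `∂Ω` is
contained in the graph of `k` and `Ω` does not meet the epigraph of `k`. -/
def IsHolderBoundary (V : Set (Chart d M)) (γ : ℝ) (Ω : Set M) : Prop :=
  ∀ e ∈ V, ∃ ξ : E d, ‖ξ‖ = 1 ∧ ∃ k : (Submodule.span ℝ {ξ})ᗮ → ℝ,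
    (∃ K : ℝ, ∀ p q, |k p - k q| ≤ K * ‖p - q‖ ^ γ) ∧
    (∀ x ∈ e.source ∩ frontier Ω,
      inner ℝ (e x) ξ = k ((Submodule.span ℝ {ξ})ᗮ.orthogonalProjectionOnto (e x))) ∧
    (∀ x ∈ e.source ∩ Ω,
      ¬ k ((Submodule.span ℝ {ξ})ᗮ.orthogonalProjectionOnto (e x)) ≤ inner ℝ (e x) ξ)

/-! ## Nikolskii spaces -/

/-- `w` is the weak gradient of `v` on `ℝ^d`, and all these functions are in `L_2(ℝ^d)`. -/
def IsWeakGrad (v : E d → ℝ) (w : Fin d → E d → ℝ) : Prop :=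
  MemLp v 2 volume ∧ (∀ i, MemLp (w i) 2 volume) ∧
    ∀ i, ∀ φ : E d → ℝ, ContDiff ℝ ((⊤ : ℕ∞) : WithTop ℕ∞) φ → HasCompactSupport φ →
      ∫ y, v y * fderiv ℝ φ y (EuclideanSpace.single i 1) = - ∫ y, w i y * φ y

/-- The Sobolev space `W^1_2(ℝ^d)`. -/
def MemW12 (v : E d → ℝ) : Prop := ∃ w, IsWeakGrad v w

open Classical in
/-- The weak gradient of an element of `W^1_2(ℝ^d)`. -/
def weakGrad (v : E d → ℝ) : Fin d → E d → ℝ :=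
  if h : MemW12 v then Classical.choose h else 0

/-- The norm of `N_2^{1+σ}(ℝ^d)`, `σ ∈ (0,1)`, on `W^1_2(ℝ^d)`. -/
def nikNormRd (σ : ℝ) (v : E d → ℝ) : ℝ≥0∞ :=
  eLpNorm v 2 volume + ∑ i, eLpNorm (weakGrad v i) 2 volume +
    ⨆ i : Fin d, ⨆ h : {h : E d // h ≠ 0},
      eLpNorm (fun y => weakGrad v i (y + h.1) - weakGrad v i y) 2 volume /
        ENNReal.ofReal (‖h.1‖ ^ σ)

/-- The function `w` on `M` in the coordinates of the chart `e`, extended by zero to `ℝ^d`. -/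
def inChart (e : Chart d M) (w : M → ℝ) : E d → ℝ :=
  e.target.indicator (fun y => w (e.symm y))

variable [MeasurableSpace M]

/-- The space `N_2^{1+σ}(M)`, `σ ∈ (0,1)`. -/
def MemNik (P : FiniteAtlas d M) (μ : Measure M) (σ : ℝ) (u : M → ℝ) : Prop :=
  MemLp u 2 μ ∧ ∀ i, MemW12 (inChart (P.chart i) (P.ψ i * u)) ∧
    nikNormRd σ (inChart (P.chart i) (P.ψ i * u)) < ⊤

/-- The norm of `N_2^{1+σ}(M)`. -/
def nikNorm (P : FiniteAtlas d M) (σ : ℝ) (u : M → ℝ) : ℝ :=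
  ∑ i, (nikNormRd σ (inChart (P.chart i) (P.ψ i * u))).toReal

/-- The space `Ñ_2^{1+σ}(Ω)` of the elements of `N_2^{1+σ}(M)` with support in the closure of `Ω`. -/
def MemNikTilde (P : FiniteAtlas d M) (μ : Measure M) (Ω : Set M) (σ : ℝ) (u : M → ℝ) : Prop :=
  MemNik P μ σ u ∧ ∀ᵐ x ∂μ, x ∉ closure Ω → u x = 0

/-! ## Hölder continuous forms -/

/-- `φ (w - w_h)`, where the translate `w_h` is taken in the coordinates of `e`. -/
def translateDiff (e : Chart d M) (φ w : M → ℝ) (h : E d) : M → ℝ :=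
  fun x => φ x * (w x - w (e.symm (e x + h)))

/-- The form `ζ` on `H^1_0(Ω)` is Hölder continuous of order `β` in the space `H` (with norm `nH`),
with respect to the atlas `V` and with constants `K e φ` (depending on the chart and on the cut-off
function, not on `ζ`) and `Cζ`. -/
def IsHolderForm [BorelSpace M] {g : Metric d M} {μ : Measure M} {Ω : Set M}
    (V : Set (Chart d M)) (K : Chart d M → (M → ℝ) → ℝ) (H : Set (M → ℝ)) (nH : H → ℝ)
    (β : ℝ) (Cζ : ℝ) (ζ : H10 g μ Ω → ℝ) : Prop :=
  ∀ e ∈ V, ∀ φ : M → ℝ, IsC11Fun d φ → tsupport φ ⊆ e.source →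
    ∀ (w : H) (h : E d), (∀ x ∈ tsupport φ, ∀ y ∈ frontier e.target, ‖h‖ < dist (e x) y) →
      ∀ hz : translateDiff e φ w h ∈ H10 g μ Ω, translateDiff e φ w h ∈ H →
        |ζ ⟨translateDiff e φ w h, hz⟩| ≤ K e φ * Cζ * nH w * ‖h‖ ^ β

end Manifold

end HolderElliptic

end

set_option maxSynthPendingDepth 3
set_option linter.unusedSectionVars false

noncomputable section

/-! The theorem follows by difference quotients, in the form suited to quadratic energies. Fix a
chart of `V`, a cut-off function `φ` and a displacement `h`, and test the equation with `z = φ (u -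
u_h)`. Let `G` be the gradient of `u` in the chart, `G_h` its translate, `H` the gradient of `z`,
and `a` the coefficient matrix times the volume density. By symmetry `a(H,H) = a(G-H,G-H) - a(G,G) +
2 a(G,H)`. Up to a term containing `dφ` and `u - u_h`, `G - H` is the convex combination `(1-φ) G +
φ G_h`, so convexity gives `a(H,H) ≤ φ (a(G_h,G_h) - a(G,G)) + 2 a(G,H)` up to errors of order `|h|`
after integration (`bilin_energy_le`).

In the integral of the first term a translation of the variable moves the difference onto the
coefficient `φ a`, which is `γc`-Hölder (`integral_bilin_shift_le`). The integral of the second is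
`2 Φ₀(u,z) = 2 (f(z) - Φ_r(u,z))`, of order `|h|^β` by hypothesis. Ellipticity then bounds the local
integral of `|G - G_h|²` by `|h|^m`, with `m = min γc β` (`Geom.exists_energy_estimate`).

The test function is admissible only if `z` stays in `H^1_0(Ω)`, that is, if a point whose translate
by `h` is in `Ω` is itself in `Ω`. This holds for `h` in a cusp-shaped cone determined by the Hölder
graph (`GraphChart.mem_of_add_mem`). An arbitrary `h` is a difference of two vectors of the cone, of
length comparable with `|h|^γΩ` (`exists_nikOn_of_cone`). The mean square difference is therefore of
order `|h|^(γΩ m)`, which is the smoothness order `γΩ m / 2` of the gradient.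

It remains to globalize. The local condition passes to other charts although translations do not:
differences are averaged over balls, and such averages survive bi-Lipschitz maps
(`lintegral_comp_sub_le`, `Geom.exists_nikOn_chart_change`). It is stable under `C^{1,1}`
multipliers (`exists_nikOn_mul`), and finitely many local conditions give the norm in
`N_2^{1+σ}(ℝ^d)` (`exists_nikolskii_of_cover`, `nikNormRd_le`). The lower order terms are controlled
by a Poincaré inequality (`Geom.exists_eLpNorm_le_h10Norm`). For the second assertion, `z` must also
lie in `Ñ_2^{1+s}(Ω)`; this follows from a local description of that space
(`MemNikTilde.translateDiff`). Radii and constants are always chosen before `f`, `u` and the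
exponents, so one constant serves both assertions. -/

namespace HolderElliptic

/-! ### Local Hölder continuity and `C^{1,1}` calculus -/

section HolderCalculus

variable {X Y Z W : Type*} [NormedAddCommGroup X] [NormedAddCommGroup Y] [NormedAddCommGroup Z]
  [NormedAddCommGroup W] {γ : ℝ}

/-- Hölder continuity of order `γ` in a neighbourhood of `x`. -/
def HolderAt (γ : ℝ) (f : X → Y) (x : X) : Prop :=
  ∃ K : ℝ, 0 ≤ K ∧ ∃ t ∈ 𝓝 x, ∀ y ∈ t, ∀ z ∈ t, ‖f y - f z‖ ≤ K * ‖y - z‖ ^ γ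

lemma LocHolderOn.holderAt {f : X → Y} {s : Set X} (h : LocHolderOn γ f s) (hs : IsOpen s) {x : X}
    (hx : x ∈ s) : HolderAt γ f x := by
  obtain ⟨K, t, ht, H⟩ := h x hx
  rw [hs.nhdsWithin_eq hx] at ht
  refine ⟨max K 0, le_max_right _ _, t, ht, fun y hy z hz => (H y hy z hz).trans ?_⟩
  gcongr
  exact le_max_left _ _

lemma HolderAt.congr {f f' : X → Y} {x : X} (h : HolderAt γ f x) (he : f =ᶠ[𝓝 x] f') :
    HolderAt γ f' x := by
  obtain ⟨K, hK, t, ht, H⟩ := h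
  refine ⟨K, hK, t ∩ {y | f y = f' y}, inter_mem ht he, fun y hy z hz => ?_⟩
  rw [← hy.2, ← hz.2]
  exact H y hy.1 z hz.1

lemma holderAt_const (c : Y) (x : X) : HolderAt γ (fun _ : X => c) x :=
  ⟨0, le_rfl, univ, univ_mem, fun _ _ _ _ => by simp⟩

lemma HolderAt.add {f f' : X → Y} {x : X} (h : HolderAt γ f x) (h' : HolderAt γ f' x) :
    HolderAt γ (fun y => f y + f' y) x := by
  obtain ⟨K, hK, t, ht, H⟩ := h
  obtain ⟨K', hK', t', ht', H'⟩ := h'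
  refine ⟨K + K', add_nonneg hK hK', t ∩ t', inter_mem ht ht', fun y hy z hz => ?_⟩
  calc ‖f y + f' y - (f z + f' z)‖ = ‖(f y - f z) + (f' y - f' z)‖ := by congr 1; abel
    _ ≤ ‖f y - f z‖ + ‖f' y - f' z‖ := norm_add_le _ _
    _ ≤ K * ‖y - z‖ ^ γ + K' * ‖y - z‖ ^ γ := add_le_add (H y hy.1 z hz.1) (H' y hy.2 z hz.2)
    _ = _ := by ring

lemma HolderAt.sum {ι : Type*} (s : Finset ι) {f : ι → X → Y} {x : X}
    (h : ∀ i ∈ s, HolderAt γ (f i) x) : HolderAt γ (fun y => ∑ i ∈ s, f i y) x := by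
  classical
  induction s using Finset.induction_on with
  | empty => simpa using holderAt_const (γ := γ) (0 : Y) x
  | insert a s ha ih =>
    have := (h a (Finset.mem_insert_self a s)).add
      (ih fun i hi => h i (Finset.mem_insert_of_mem hi))
    simpa [Finset.sum_insert ha] using this

lemma HolderAt.continuousAt {f : X → Y} {x : X} (h : HolderAt γ f x) (hγ : 0 < γ) :
    ContinuousAt f x := by
  obtain ⟨K, hK, t, ht, H⟩ := h
  rw [ContinuousAt, tendsto_iff_norm_sub_tendsto_zero]
  have h1 : Tendsto (fun y => K * ‖y - x‖ ^ γ) (𝓝 x) (𝓝 0) := by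
    have h2 : Tendsto (fun y : X => ‖y - x‖) (𝓝 x) (𝓝 0) := by
      have : Continuous fun y : X => ‖y - x‖ := by fun_prop
      simpa using this.tendsto x
    have := (h2.rpow_const (Or.inr hγ.le)).const_mul K
    simpa [Real.zero_rpow hγ.ne'] using this
  refine squeeze_zero' (Eventually.of_forall fun _ => norm_nonneg _) ?_ h1
  filter_upwards [ht] with y hy
  exact H y hy x (mem_of_mem_nhds ht)

/-- In a ball of radius `1/2` all distances are at most 1, where lowering the exponent increases the
power. -/
lemma HolderAt.mono {γ' : ℝ} {f : X → Y} {x : X} (h : HolderAt γ f x) (h' : γ' ≤ γ) (h0 : 0 < γ') :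
    HolderAt γ' f x := by
  obtain ⟨K, hK, t, ht, H⟩ := h
  refine ⟨K, hK, t ∩ Metric.ball x (1 / 2), inter_mem ht (Metric.ball_mem_nhds _ (by norm_num)),
    fun y hy z hz => (H y hy.1 z hz.1).trans ?_⟩
  have h1 : ‖y - z‖ ≤ 1 := by
    have := dist_triangle_right y z x
    have h2 := hy.2; have h3 := hz.2
    rw [Metric.mem_ball] at h2 h3
    rw [← dist_eq_norm]; linarith
  gcongr ?_ * ?_
  rcases (norm_nonneg (y - z)).eq_or_lt with h2 | h2
  · rw [← h2, Real.zero_rpow h0.ne', Real.zero_rpow (h0.trans_le h').ne']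
  · exact Real.rpow_le_rpow_of_exponent_ge h2 h1 h'

lemma HolderAt.comp {f : Y → Z} {g : X → Y} {x : X} (hf : HolderAt γ f (g x))
    (hg : HolderAt 1 g x) (hγ : 0 < γ) : HolderAt γ (fun y => f (g y)) x := by
  have hc := hg.continuousAt one_pos
  obtain ⟨K, hK, t, ht, H⟩ := hf
  obtain ⟨K', hK', t', ht', H'⟩ := hg
  refine ⟨K * K' ^ γ, by positivity, t' ∩ g ⁻¹' t, inter_mem ht' (hc ht), fun y hy z hz => ?_⟩
  calc ‖f (g y) - f (g z)‖ ≤ K * ‖g y - g z‖ ^ γ := H _ hy.2 _ hz.2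
    _ ≤ K * (K' * ‖y - z‖) ^ γ := by
      gcongr
      simpa using H' y hy.1 z hz.1
    _ = _ := by rw [Real.mul_rpow hK' (norm_nonneg _)]; ring

variable [NormedSpace ℝ Y] [NormedSpace ℝ Z] [NormedSpace ℝ W]

/-- Products, scalar multiples, compositions of operators and pullbacks of forms are all bilinear,
so this one product rule serves for each of them. The factors are bounded near `x` by continuity. -/
lemma HolderAt.bilin (B : Y →L[ℝ] Z →L[ℝ] W) {f : X → Y} {g : X → Z} {x : X}
    (hf : HolderAt γ f x) (hg : HolderAt γ g x) (hγ : 0 < γ) :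
    HolderAt γ (fun y => B (f y) (g y)) x := by
  have cf := (hf.continuousAt hγ).norm.eventually (ge_mem_nhds (lt_add_one ‖f x‖))
  have cg := (hg.continuousAt hγ).norm.eventually (ge_mem_nhds (lt_add_one ‖g x‖))
  obtain ⟨K, hK, t, ht, H⟩ := hf
  obtain ⟨K', hK', t', ht', H'⟩ := hg
  refine ⟨‖B‖ * (K * (‖g x‖ + 1) + K' * (‖f x‖ + 1)), by positivity,
    (t ∩ t') ∩ ({y | ‖f y‖ ≤ ‖f x‖ + 1} ∩ {y | ‖g y‖ ≤ ‖g x‖ + 1}),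
    inter_mem (inter_mem ht ht') (inter_mem cf cg), fun y hy z hz => ?_⟩
  have h1 : B (f y) (g y) - B (f z) (g z) = B (f y - f z) (g y) + B (f z) (g y - g z) := by
    simp
  have h2 := H y hy.1.1 z hz.1.1
  have h3 := H' y hy.1.2 z hz.1.2
  have h4 : ‖g y‖ ≤ ‖g x‖ + 1 := hy.2.2
  have h5 : ‖f z‖ ≤ ‖f x‖ + 1 := hz.2.1
  calc ‖B (f y) (g y) - B (f z) (g z)‖ ≤ ‖B (f y - f z) (g y)‖ + ‖B (f z) (g y - g z)‖ := by
        rw [h1]; exact norm_add_le _ _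
    _ ≤ ‖B‖ * ‖f y - f z‖ * ‖g y‖ + ‖B‖ * ‖f z‖ * ‖g y - g z‖ :=
        add_le_add (B.le_opNorm₂ _ _) (B.le_opNorm₂ _ _)
    _ ≤ ‖B‖ * (K * ‖y - z‖ ^ γ) * (‖g x‖ + 1) + ‖B‖ * (‖f x‖ + 1) * (K' * ‖y - z‖ ^ γ) := by
        gcongr
    _ = _ := by ring

lemma HolderAt.clm (L : Y →L[ℝ] Z) {f : X → Y} {x : X} (hf : HolderAt γ f x) :
    HolderAt γ (fun y => L (f y)) x := by
  obtain ⟨K, hK, t, ht, H⟩ := hf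
  refine ⟨‖L‖ * K, by positivity, t, ht, fun y hy z hz => ?_⟩
  rw [← map_sub, mul_assoc]
  exact (L.le_opNorm _).trans (by gcongr; exact H y hy z hz)

lemma HolderAt.mul {f g : X → ℝ} {x : X} (hf : HolderAt γ f x) (hg : HolderAt γ g x)
    (hγ : 0 < γ) : HolderAt γ (fun y => f y * g y) x :=
  HolderAt.bilin (ContinuousLinearMap.mul ℝ ℝ) hf hg hγ

lemma HolderAt.smul {f : X → ℝ} {g : X → Y} {x : X} (hf : HolderAt γ f x) (hg : HolderAt γ g x)
    (hγ : 0 < γ) : HolderAt γ (fun y => f y • g y) x :=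
  HolderAt.bilin (ContinuousLinearMap.lsmul ℝ ℝ) hf hg hγ

variable [NormedSpace ℝ X]

lemma _root_.ContDiffAt.holderAt {f : X → Y} {x : X} (h : ContDiffAt ℝ 1 f x) :
    HolderAt 1 f x := by
  obtain ⟨K, t, ht, H⟩ := h.exists_lipschitzOnWith
  refine ⟨K, K.2, t, ht, fun y hy z hz => ?_⟩
  simpa [dist_eq_norm] using H.dist_le_mul y hy z hz

/-- `f` is of class `C^{1,1}` in a neighbourhood of `x`. -/
def C11At (f : X → Y) (x : X) : Prop := ContDiffAt ℝ 1 f x ∧ HolderAt 1 (fderiv ℝ f) x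

lemma C11On.c11At {f : X → Y} {s : Set X} (h : C11On f s) (hs : IsOpen s) {x : X} (hx : x ∈ s) :
    C11At f x := by
  refine ⟨h.1.contDiffAt (hs.mem_nhds hx), ?_⟩
  obtain ⟨K, t, ht, H⟩ := h.2 hx
  rw [hs.nhdsWithin_eq hx] at ht
  exact ⟨K, K.2, t, ht, fun y hy z hz => by simpa [dist_eq_norm] using H.dist_le_mul y hy z hz⟩

lemma c11On_of_c11At {f : X → Y} {s : Set X} (h : ∀ x ∈ s, C11At f x) : C11On f s := by
  refine ⟨fun x hx => (h x hx).1.contDiffWithinAt, fun x hx => ?_⟩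
  obtain ⟨K, hK, t, ht, H⟩ := (h x hx).2
  refine ⟨⟨K, hK⟩, t, mem_nhdsWithin_of_mem_nhds ht, LipschitzOnWith.of_dist_le_mul
    fun y hy z hz => ?_⟩
  have := H y hy z hz
  rw [Real.rpow_one] at this
  rw [dist_eq_norm, dist_eq_norm]
  exact this

lemma C11At.congr {f f' : X → Y} {x : X} (h : C11At f x) (he : f =ᶠ[𝓝 x] f') : C11At f' x :=
  ⟨h.1.congr_of_eventuallyEq he.symm, h.2.congr he.fderiv⟩

lemma C11At.holderAt {f : X → Y} {x : X} (h : C11At f x) : HolderAt 1 f x := h.1.holderAt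

lemma _root_.ContDiffAt.c11At {f : X → Y} {x : X} (h : ContDiffAt ℝ 2 f x) : C11At f x :=
  ⟨h.of_le one_le_two, (h.fderiv_right (m := 1) (by norm_num)).holderAt⟩

lemma _root_.ContDiffAt.eventually_differentiableAt {f : X → Y} {x : X} (h : ContDiffAt ℝ 1 f x) :
    ∀ᶠ y in 𝓝 x, DifferentiableAt ℝ f y :=
  (h.eventually (by simp)).mono fun _ hy => hy.differentiableAt one_ne_zero

lemma C11At.comp {f : Y → Z} {g : X → Y} {x : X} (hf : C11At f (g x)) (hg : C11At g x) :
    C11At (f ∘ g) x := by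
  refine ⟨hf.1.comp x hg.1, ?_⟩
  have h1 : HolderAt 1 (fun y => (fderiv ℝ f (g y)).comp (fderiv ℝ g y)) x :=
    HolderAt.bilin (ContinuousLinearMap.compL ℝ X Y Z) (hf.2.comp hg.holderAt one_pos) hg.2 one_pos
  refine h1.congr ?_
  filter_upwards [hg.1.eventually_differentiableAt,
    hg.1.continuousAt.eventually hf.1.eventually_differentiableAt] with y h2 h3
  exact (fderiv_comp y h3 h2).symm

lemma c11At_const (c : Y) (x : X) : C11At (fun _ : X => c) x :=
  contDiffAt_const.c11At

end HolderCalculus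

/-! ### Charts of the `C^{1,1}` structure, their differentials, covector fields in coordinates -/

section Charts

variable {d : ℕ} {M : Type*} [TopologicalSpace M] [ChartedSpace (E d) M]

/-- `IsC11Chart` compares a chart only with the given atlas. The transition between two arbitrary
`C^{1,1}` charts is factored through the preferred chart at the point. -/
lemma IsC11Chart.c11At_symm_trans {e e' : Chart d M} (he : IsC11Chart e) (he' : IsC11Chart e')
    {y : E d} (hy : y ∈ e.target) (hy' : e.symm y ∈ e'.source) : C11At (e' ∘ e.symm) y := by
  set c := chartAt (E d) (e.symm y)
  have hc : e.symm y ∈ c.source := mem_chart_source _ _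
  have h1 : C11At (c ∘ e.symm) y :=
    (he c (chart_mem_atlas _ _)).1.c11At (e.symm.trans c).open_source (by simp [hy, hc])
  have h2 : C11At (e' ∘ c.symm) ((c ∘ e.symm) y) :=
    (he' c (chart_mem_atlas _ _)).2.c11At (c.symm.trans e').open_source
      (by simp [hc, hy', c.map_source hc])
  refine (h2.comp h1).congr ?_
  filter_upwards [(e.continuousAt_symm hy).eventually (c.open_source.mem_nhds hc)] with z hz
  simp [c.left_inv hz]

lemma IsC11Chart.mem_maximalAtlas [IsManifold (𝓡 d) 1 M] {e : Chart d M} (he : IsC11Chart e) :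
    e ∈ IsManifold.maximalAtlas (𝓡 d) 1 M := by
  rw [IsManifold.maximalAtlas, mem_maximalAtlas_iff]
  intro e' he'
  have h := he e' he'
  constructor
  · rw [contDiffGroupoid, mem_groupoid_of_pregroupoid]
    refine ⟨?_, ?_⟩
    · simpa [contDiffPregroupoid, contDiffPregroupoid] using h.1.1
    · simpa [contDiffPregroupoid] using h.2.1
  · rw [contDiffGroupoid, mem_groupoid_of_pregroupoid]
    refine ⟨?_, ?_⟩
    · simpa [contDiffPregroupoid, contDiffPregroupoid] using h.2.1
    · simpa [contDiffPregroupoid] using h.1.1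

lemma IsC11Fun.c11At {φ : M → ℝ} (hφ : IsC11Fun d φ) {e : Chart d M} (he : IsC11Chart e)
    {y : E d} (hy : y ∈ e.target) : C11At (φ ∘ e.symm) y := by
  set c := chartAt (E d) (e.symm y)
  have hc : e.symm y ∈ c.source := mem_chart_source _ _
  have h1 : C11At (c ∘ e.symm) y :=
    (he c (chart_mem_atlas _ _)).1.c11At (e.symm.trans c).open_source (by simp [hy, hc])
  have h2 : C11At (φ ∘ c.symm) ((c ∘ e.symm) y) :=
    (hφ c (chart_mem_atlas _ _)).c11At c.open_target (c.map_source hc)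
  refine (h2.comp h1).congr ?_
  filter_upwards [(e.continuousAt_symm hy).eventually (c.open_source.mem_nhds hc)] with z hz
  simp [c.left_inv hz]

/-- The space of linear functionals on `ℝ^d`. -/
abbrev Du (d : ℕ) : Type := E d →L[ℝ] ℝ

/-- The differential of a chart, as an operator on `ℝ^d`. -/
def dch (e : Chart d M) (x : M) : E d →L[ℝ] E d := mfderiv (𝓡 d) (𝓡 d) e x

/-- The differential of the inverse of a chart, as an operator on `ℝ^d`. -/
def dsy (e : Chart d M) (y : E d) : E d →L[ℝ] E d := mfderiv (𝓡 d) (𝓡 d) e.symm y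

/-- The coordinates of a field of covectors in a chart. -/
def cgrad (e : Chart d M) (θ : ∀ x : M, Cot d x) (y : E d) : Du d :=
  (θ (e.symm y) : E d →L[ℝ] ℝ).comp (dsy e y)

variable [IsManifold (𝓡 d) 1 M]

section diffs
variable {e e' : Chart d M} (he : IsC11Chart e) (he' : IsC11Chart e')
include he

lemma IsC11Chart.mdifferentiableAt {x : M} (hx : x ∈ e.source) :
    MDifferentiableAt (𝓡 d) (𝓡 d) e x :=
  (contMDiffAt_of_mem_maximalAtlas he.mem_maximalAtlas hx).mdifferentiableAt one_ne_zero

lemma IsC11Chart.mdifferentiableAt_symm {y : E d} (hy : y ∈ e.target) :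
    MDifferentiableAt (𝓡 d) (𝓡 d) e.symm y :=
  (contMDiffAt_symm_of_mem_maximalAtlas he.mem_maximalAtlas hy).mdifferentiableAt one_ne_zero

lemma IsC11Chart.dch_dsy {y : E d} (hy : y ∈ e.target) :
    (dch e (e.symm y)).comp (dsy e y) = ContinuousLinearMap.id ℝ (E d) := by
  have h1 := mfderiv_comp y (he.mdifferentiableAt (e.map_target hy)) (he.mdifferentiableAt_symm hy)
  have h2 : mfderiv (𝓡 d) (𝓡 d) (e ∘ e.symm) y = mfderiv (𝓡 d) (𝓡 d) id y := by
    refine Filter.EventuallyEq.mfderiv_eq ?_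
    filter_upwards [e.open_target.mem_nhds hy] with z hz
    simp [e.right_inv hz]
  rw [h2, mfderiv_id] at h1
  exact h1.symm

lemma IsC11Chart.dsy_dch {x : M} (hx : x ∈ e.source) :
    (dsy e (e x)).comp (dch e x) = ContinuousLinearMap.id ℝ (E d) := by
  have h1 := mfderiv_comp x (he.mdifferentiableAt_symm (e.map_source hx)) (he.mdifferentiableAt hx)
  have h2 : mfderiv (𝓡 d) (𝓡 d) (e.symm ∘ e) x = mfderiv (𝓡 d) (𝓡 d) id x := by
    refine Filter.EventuallyEq.mfderiv_eq ?_
    filter_upwards [e.open_source.mem_nhds hx] with z hz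
    simp [e.left_inv hz]
  rw [h2, mfderiv_id] at h1
  exact h1.symm

include he'

lemma IsC11Chart.dsy_eq {y : E d} (hy : y ∈ e.target) (hy' : e.symm y ∈ e'.source) :
    dsy e y = (dsy e' (e' (e.symm y))).comp (fderiv ℝ (e' ∘ e.symm) y) := by
  have hd : MDifferentiableAt (𝓡 d) (𝓡 d) (e' ∘ e.symm) y :=
    (he'.mdifferentiableAt hy').comp y (he.mdifferentiableAt_symm hy)
  have h1 := mfderiv_comp y (he'.mdifferentiableAt_symm (e'.map_source hy')) hd
  have h2 : mfderiv (𝓡 d) (𝓡 d) (e'.symm ∘ e' ∘ e.symm) y = mfderiv (𝓡 d) (𝓡 d) e.symm y := by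
    refine Filter.EventuallyEq.mfderiv_eq ?_
    filter_upwards [(e.continuousAt_symm hy).eventually (e'.open_source.mem_nhds hy')] with z hz
    simp [e'.left_inv hz]
  rw [h2] at h1
  rw [← mfderiv_eq_fderiv]
  exact h1

/-- This is `dsy_eq` inverted, since `dch` and `dsy` are inverse to each other. -/
lemma IsC11Chart.dch_eq {x : M} (hx : x ∈ e.source) (hx' : x ∈ e'.source) :
    dch e' x = (fderiv ℝ (e' ∘ e.symm) (e x)).comp (dch e x) := by
  have h := he.dsy_eq he' (e.map_source hx) (by rwa [e.left_inv hx])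
  rw [e.left_inv hx] at h
  have h2 := he.dsy_dch hx
  rw [h] at h2
  have h3 := he'.dch_dsy (e'.map_source hx')
  rw [e'.left_inv hx'] at h3
  ext v : 1
  have h4 := congrArg (fun L : E d →L[ℝ] E d => dch e' x (L v)) h2
  have h5 := congrArg (fun L : E d →L[ℝ] E d => L (fderiv ℝ (e' ∘ e.symm) (e x) (dch e x v))) h3
  simp only [ContinuousLinearMap.comp_apply, ContinuousLinearMap.id_apply] at h4 h5 ⊢
  rw [← h4, h5]

end diffs

lemma IsC11Chart.cgrad_diff {e : Chart d M} (he : IsC11Chart e) {φ : M → ℝ} {y : E d}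
    (hy : y ∈ e.target) (hφ : MDifferentiableAt (𝓡 d) 𝓘(ℝ, ℝ) φ (e.symm y)) :
    cgrad e (diff φ) y = fderiv ℝ (φ ∘ e.symm) y := by
  have h1 := mfderiv_comp y hφ (he.mdifferentiableAt_symm hy)
  rw [← mfderiv_eq_fderiv]
  exact h1.symm

/-- The transformation law by which Hölder conditions on gradients are carried from chart to chart.
-/
lemma IsC11Chart.cgrad_eq {e e' : Chart d M} (he : IsC11Chart e) (he' : IsC11Chart e')
    (θ : ∀ x : M, Cot d x) {y : E d} (hy : y ∈ e.target) (hy' : e.symm y ∈ e'.source) :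
    cgrad e θ y = (cgrad e' θ (e' (e.symm y))).comp (fderiv ℝ (e' ∘ e.symm) y) := by
  rw [cgrad, he.dsy_eq he' hy hy', cgrad, e'.left_inv hy']
  rfl

end Charts

/-! ### Linear algebra on `ℝ^d` and its dual -/

section LinearAlgebra

variable {d : ℕ}

/-- The standard basis vectors of `ℝ^d`. -/
abbrev bas (i : Fin d) : E d := EuclideanSpace.single i (1 : ℝ)

lemma sum_coord_smul_bas (v : E d) : ∑ i, v i • bas i = v := by
  ext j
  simp [bas, Finset.sum_apply, Pi.single_apply]

/-- The standard basis functionals on `ℝ^d`. -/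
abbrev cobas (i : Fin d) : Du d := EuclideanSpace.proj i

lemma sum_coord_smul_cobas (G : Du d) : ∑ i, G (bas i) • cobas i = G := by
  ext v
  conv_rhs => rw [← sum_coord_smul_bas v, map_sum]
  simp [mul_comm]

lemma isInvertible_of_pos {L : E d →L[ℝ] Du d} (h : ∀ v, v ≠ 0 → 0 < L v v) : L.IsInvertible := by
  have hinj : Function.Injective (L : E d →ₗ[ℝ] Du d) := by
    rw [injective_iff_map_eq_zero]
    intro v hv
    by_contra h0
    have h1 := h v h0
    have h2 : L v = 0 := hv
    rw [h2] at h1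
    simp at h1
  have hf : Module.finrank ℝ (E d) = Module.finrank ℝ (Du d) := by
    rw [← Subspace.dual_finrank_eq (K := ℝ) (V := E d)]
    exact (LinearMap.toContinuousLinearMap (𝕜 := ℝ) (E := E d) (F' := ℝ)).finrank_eq
  refine ⟨(LinearMap.linearEquivOfInjective (L : E d →ₗ[ℝ] Du d) hinj hf).toContinuousLinearEquiv, ?_⟩
  ext v w
  rfl

lemma IsInvertible_apply_inverse {V W : Type*} [NormedAddCommGroup V] [NormedSpace ℝ V]
    [NormedAddCommGroup W] [NormedSpace ℝ W] {L : V →L[ℝ] W} (h : L.IsInvertible) (w : W) :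
    L (L.inverse w) = w := by
  obtain ⟨f, rfl⟩ := h
  simp

lemma IsInvertible_inverse_apply {V W : Type*} [NormedAddCommGroup V] [NormedSpace ℝ V]
    [NormedAddCommGroup W] [NormedSpace ℝ W] {L : V →L[ℝ] W} (h : L.IsInvertible) (v : V) :
    L.inverse (L v) = v := by
  obtain ⟨f, rfl⟩ := h
  simp

/-- The pullback of a bilinear form by a linear map. -/
def pullB {V V' : Type*} [NormedAddCommGroup V] [NormedSpace ℝ V] [NormedAddCommGroup V']
    [NormedSpace ℝ V'] (L : V →L[ℝ] V →L[ℝ] ℝ) (J : V' →L[ℝ] V) : V' →L[ℝ] V' →L[ℝ] ℝ :=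
  ((ContinuousLinearMap.compL ℝ V' V ℝ).flip J).comp (L.comp J)

lemma pullB_apply {V V' : Type*} [NormedAddCommGroup V] [NormedSpace ℝ V] [NormedAddCommGroup V']
    [NormedSpace ℝ V'] (L : V →L[ℝ] V →L[ℝ] ℝ) (J : V' →L[ℝ] V) (v w : V') :
    pullB L J v w = L (J v) (J w) := rfl

lemma HolderAt.pullB {X V V' : Type*} [NormedAddCommGroup X] [NormedAddCommGroup V]
    [NormedSpace ℝ V] [NormedAddCommGroup V'] [NormedSpace ℝ V'] {γ : ℝ} (hγ : 0 < γ)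
    {L : X → V →L[ℝ] V →L[ℝ] ℝ} {J : X → V' →L[ℝ] V} {x : X}
    (hL : HolderAt γ L x) (hJ : HolderAt γ J x) :
    HolderAt γ (fun y => HolderElliptic.pullB (L y) (J y)) x := by
  have h1 := HolderAt.bilin (ContinuousLinearMap.compL ℝ V' V (V →L[ℝ] ℝ)) hL hJ hγ
  have h2 := hJ.clm (ContinuousLinearMap.compL ℝ V' V ℝ).flip
  exact HolderAt.bilin (ContinuousLinearMap.compL ℝ V' (V →L[ℝ] ℝ) (V' →L[ℝ] ℝ)) h2 h1 hγ

lemma HolderAt.prod {X ι : Type*} [NormedAddCommGroup X] {γ : ℝ} (hγ : 0 < γ) (s : Finset ι)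
    {f : ι → X → ℝ} {x : X} (h : ∀ i ∈ s, HolderAt γ (f i) x) :
    HolderAt γ (fun y => ∏ i ∈ s, f i y) x := by
  classical
  induction s using Finset.induction_on with
  | empty => simpa using holderAt_const (γ := γ) (1 : ℝ) x
  | insert a s ha ih =>
    have := (h a (Finset.mem_insert_self a s)).mul
      (ih fun i hi => h i (Finset.mem_insert_of_mem hi)) hγ
    simpa [Finset.prod_insert ha] using this

end LinearAlgebra

/-! ### Metric, cometric, volume density and coefficients in coordinates -/

section Tensors

variable {d : ℕ} {M : Type*} [TopologicalSpace M] [ChartedSpace (E d) M]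

/-- The metric at a point, as a bilinear form on `ℝ^d`. -/
def metE (g : Metric d M) (x : M) : E d →L[ℝ] Du d := g.inner x

/-- The metric in the coordinates of a chart, as a bilinear form. -/
def gch (g : Metric d M) (e : Chart d M) (y : E d) : E d →L[ℝ] Du d :=
  pullB (metE g (e.symm y)) (dsy e y)

lemma metE_pos (g : Metric d M) (x : M) {v : E d} (hv : v ≠ 0) : 0 < metE g x v v := g.pos x v hv

lemma metE_symm (g : Metric d M) (x : M) (v w : E d) : metE g x v w = metE g x w v := g.symm x v w

lemma gch_symm (g : Metric d M) (e : Chart d M) (y : E d) (v w : E d) :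
    gch g e y v w = gch g e y w v := metE_symm g _ _ _

lemma gram_eq (g : Metric d M) (e : Chart d M) (y : E d) (i j : Fin d) :
    gram g e y i j = gch g e y (bas i) (bas j) := rfl

lemma gch_eq_sum (g : Metric d M) (e : Chart d M) (y : E d) :
    gch g e y = ∑ i, ∑ j, gram g e y i j • (cobas i).smulRight (cobas j) := by
  ext v w
  conv_lhs => rw [← sum_coord_smul_bas v, ← sum_coord_smul_bas w]
  simp only [map_sum, map_smul, sum_apply, smul_apply,
    ContinuousLinearMap.smulRight_apply, smul_eq_mul, gram_eq,EuclideanSpace.coe_proj]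
  rw [Finset.sum_comm]
  refine Finset.sum_congr rfl fun i _ => ?_
  rw [Finset.mul_sum] 
  refine Finset.sum_congr rfl fun j _ => by ring

/-- A section of `T²M` in the coordinates of a chart. -/
def ach (A : Tensor2 d M) (e : Chart d M) (y : E d) : Du d →L[ℝ] Du d →L[ℝ] ℝ :=
  ∑ i, ∑ j, A (e.symm y) (coordCovec e y i) (coordCovec e y j) •
    (ContinuousLinearMap.apply ℝ ℝ (bas i)).smulRight (ContinuousLinearMap.apply ℝ ℝ (bas j))

/-- The sum over basis covectors is the form to which the Hölder hypothesis applies. Its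
identification with the intrinsic pullback yields the transformation law and the ellipticity. -/
lemma ach_apply (A : Tensor2 d M) (e : Chart d M) (y : E d) (G H : Du d) :
    ach A e y G H =
      A (e.symm y) (G.comp (dch e (e.symm y)) : Du d) (H.comp (dch e (e.symm y)) : Du d) := by
  let B : Du d →ₗ[ℝ] Du d →ₗ[ℝ] ℝ := A (e.symm y)
  have h : ∀ G : Du d, G.comp (dch e (e.symm y)) =
      ∑ i, G (bas i) • (cobas i).comp (dch e (e.symm y)) := fun G => by
    conv_lhs => rw [← sum_coord_smul_cobas G]
    ext v
    simp only [sum_apply, smul_apply, ContinuousLinearMap.comp_apply]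
  change _ = B (G.comp (dch e (e.symm y))) (H.comp (dch e (e.symm y)))
  rw [h G, h H]
  simp only [map_sum, map_smul, LinearMap.sum_apply, LinearMap.smul_apply, smul_eq_mul, ach,
    sum_apply, smul_apply, ContinuousLinearMap.smulRight_apply,
    ContinuousLinearMap.apply_apply, Finset.mul_sum]
  rw [Finset.sum_comm]
  refine Finset.sum_congr rfl fun i _ => Finset.sum_congr rfl fun j _ => ?_
  change B ((cobas _).comp (dch e (e.symm y))) ((cobas _).comp (dch e (e.symm y))) * _ = _
  ring

variable [IsManifold (𝓡 d) 1 M]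

section
variable {e e' : Chart d M} (he : IsC11Chart e) (he' : IsC11Chart e')
include he

lemma IsC11Chart.gch_pos (g : Metric d M) {y : E d} (hy : y ∈ e.target) (v : E d) (hv : v ≠ 0) :
    0 < gch g e y v v := by
  refine metE_pos g (e.symm y) fun h0 => hv ?_
  have := congrArg (fun L : E d →L[ℝ] E d => L v) (he.dch_dsy hy)
  simp only [ContinuousLinearMap.comp_apply, ContinuousLinearMap.id_apply] at this
  rw [← this]
  exact (congrArg (dch e (e.symm y)) h0).trans (map_zero _)

lemma IsC11Chart.gch_isInvertible (g : Metric d M) {y : E d} (hy : y ∈ e.target) :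
    (gch g e y).IsInvertible := isInvertible_of_pos (he.gch_pos g hy)

include he'
lemma IsC11Chart.gch_eq (g : Metric d M) {y : E d} (hy : y ∈ e.target)
    (hy' : e.symm y ∈ e'.source) :
    gch g e y = pullB (gch g e' (e' (e.symm y))) (fderiv ℝ (e' ∘ e.symm) y) := by
  ext v w
  rw [pullB_apply, gch, gch, pullB_apply, pullB_apply, e'.left_inv hy', he.dsy_eq he' hy hy']
  rfl

end

/-- The metric is assumed Lipschitz only in the charts of the given atlas. The transformation law
extends this to every `C^{1,1}` chart, because the Jacobians of the transition maps are Lipschitz.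
-/
lemma IsC11Chart.holderAt_gch (hM : IsC11Manifold d M) {g : Metric d M} (hg : IsLipschitzMetric g)
    {e : Chart d M} (he : IsC11Chart e) {y : E d} (hy : y ∈ e.target) :
    HolderAt 1 (gch g e) y := by
  set c := chartAt (E d) (e.symm y)
  have hc : e.symm y ∈ c.source := mem_chart_source _ _
  have hca : c ∈ atlas (E d) M := chart_mem_atlas _ _
  have h1 : HolderAt 1 (gch g c) ((c ∘ e.symm) y) := by
    have : gch g c = fun y => ∑ i, ∑ j, gram g c y i j • (cobas i).smulRight (cobas j) := by
      ext y : 1; exact gch_eq_sum g c y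
    rw [this]
    refine HolderAt.sum _ fun i _ => HolderAt.sum _ fun j _ => HolderAt.smul ?_
      (holderAt_const _ _) one_pos
    exact (hg c hca i j).holderAt c.open_target (c.map_source hc)
  have h2 := he.c11At_symm_trans (hM c hca) hy hc
  refine ((h1.comp h2.holderAt one_pos).pullB one_pos h2.2).congr ?_
  filter_upwards [(e.continuousAt_symm hy).eventually (c.open_source.mem_nhds hc),
    e.open_target.mem_nhds hy] with z hz hz'
  exact (he.gch_eq (hM c hca) g hz' hz).symm

/-- The cometric in the coordinates of a chart. -/
def qch (g : Metric d M) (e : Chart d M) (y : E d) : Du d →L[ℝ] Du d →L[ℝ] ℝ :=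
  (ContinuousLinearMap.compL ℝ (Du d) (E d) ℝ).flip (gch g e y).inverse

/-- Both sides evaluate `θ` on the vector `w` dual to `η`; in the chart this vector has the
coordinates `dch e x w`. -/
lemma IsC11Chart.cometric_eq (g : Metric d M) {e : Chart d M} (he : IsC11Chart e) {y : E d}
    (hy : y ∈ e.target) (θ η : ∀ x : M, Cot d x) :
    cometric g (e.symm y) (θ (e.symm y)) (η (e.symm y)) =
      qch g e y (cgrad e θ y) (cgrad e η y) := by
  set x := e.symm y
  let m : E d →L[ℝ] Du d := metE g x
  have hm : m.IsInvertible := isInvertible_of_pos fun v hv => metE_pos g x hv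
  let w : E d := m.inverse (η x : E d →L[ℝ] ℝ)
  have hw : m w = (η x : E d →L[ℝ] ℝ) := IsInvertible_apply_inverse hm _
  have hv := congrArg (fun L : E d →L[ℝ] E d => L w) (he.dsy_dch (e.map_target hy))
  simp only [ContinuousLinearMap.comp_apply, ContinuousLinearMap.id_apply, e.right_inv hy] at hv
  have h1 : gch g e y (dch e x w) = cgrad e η y := by
    ext u
    change m (dsy e y (dch e x w)) (dsy e y u) = (η x : E d →L[ℝ] ℝ) (dsy e y u)
    rw [hv, hw]
    rfl
  have h2 : (gch g e y).inverse (cgrad e η y) = dch e x w := by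
    rw [← h1, IsInvertible_inverse_apply (he.gch_isInvertible g hy)]
  change (θ x : E d →L[ℝ] ℝ) w = (θ x : E d →L[ℝ] ℝ) (dsy e y ((gch g e y).inverse (cgrad e η y)))
  rw [h2, hv]

lemma IsC11Chart.continuousOn_qch (hM : IsC11Manifold d M) {g : Metric d M}
    (hg : IsLipschitzMetric g) {e : Chart d M} (he : IsC11Chart e) :
    ContinuousOn (qch g e) e.target := by
  intro y hy
  refine ContinuousAt.continuousWithinAt ?_
  have h1 := (he.holderAt_gch hM hg hy).continuousAt one_pos
  have h2 : ContinuousAt ContinuousLinearMap.inverse (gch g e y) :=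
    ((he.gch_isInvertible g hy).contDiffAt_map_inverse (n := 1)).continuousAt
  exact ((ContinuousLinearMap.compL ℝ (Du d) (E d) ℝ).flip.continuous.continuousAt).comp
    (ContinuousAt.comp (g := ContinuousLinearMap.inverse) h2 h1)

/-- The value at `G` is the metric form at the vector dual to `G`. -/
lemma IsC11Chart.qch_pos (g : Metric d M) {e : Chart d M} (he : IsC11Chart e) {y : E d}
    (hy : y ∈ e.target) {G : Du d} (hG : G ≠ 0) : 0 < qch g e y G G := by
  have h := he.gch_isInvertible g hy
  have h1 := IsInvertible_apply_inverse h G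
  change 0 < G ((gch g e y).inverse G)
  conv_rhs => enter [1]; rw [← h1]
  refine he.gch_pos g hy _ fun h0 => hG ?_
  rw [← h1, h0, map_zero]

/-- The density of the Riemannian measure in the coordinates of a chart. -/
def rho (g : Metric d M) (e : Chart d M) (y : E d) : ℝ := √((gram g e y).det)

lemma IsC11Chart.det_gram_pos (g : Metric d M) {e : Chart d M} (he : IsC11Chart e) {y : E d}
    (hy : y ∈ e.target) : 0 < (gram g e y).det := by
  refine Matrix.PosDef.det_pos (Matrix.PosDef.of_dotProduct_mulVec_pos ?_ fun v hv => ?_)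
  · exact Matrix.IsHermitian.ext fun i j => gch_symm g e y (bas j) (bas i)
  · refine (he.gch_pos g hy (WithLp.toLp 2 v) (by simpa using hv)).trans_eq ?_
    rw [gch_eq_sum]
    simp only [sum_apply, smul_apply, ContinuousLinearMap.smulRight_apply, smul_eq_mul,
      EuclideanSpace.coe_proj, dotProduct, Matrix.mulVec, Pi.star_apply, star_trivial,
      Finset.mul_sum]
    exact Finset.sum_congr rfl fun i _ => Finset.sum_congr rfl fun j _ => by ring

lemma IsC11Chart.rho_pos (g : Metric d M) {e : Chart d M} (he : IsC11Chart e) {y : E d}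
    (hy : y ∈ e.target) : 0 < rho g e y := Real.sqrt_pos.2 (he.det_gram_pos g hy)

/-- With `J` the Jacobian matrix, the Gram matrices are related by `Jᵀ (g_{ij}) J`; taking the root
of the determinant leaves the factor `|det J|` of the change of variables formula. -/
lemma IsC11Chart.rho_eq (g : Metric d M) {e e' : Chart d M} (he : IsC11Chart e)
    (he' : IsC11Chart e') {y : E d} (hy : y ∈ e.target) (hy' : e.symm y ∈ e'.source) :
    rho g e y = |(fderiv ℝ (e' ∘ e.symm) y).det| * rho g e' (e' (e.symm y)) := by
  set D := fderiv ℝ (e' ∘ e.symm) y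
  set b := (EuclideanSpace.basisFun (Fin d) ℝ).toBasis
  set J := LinearMap.toMatrix b b (D : E d →ₗ[ℝ] E d)
  have hJ : J.det = D.det := LinearMap.det_toMatrix b _
  have h1 : gram g e y = J.transpose * gram g e' (e' (e.symm y)) * J := by
    ext i j
    have hJ' : ∀ k l, J k l = D (bas l) k := fun k l => by
      simp [J, b, LinearMap.toMatrix_apply]
    rw [gram_eq, he.gch_eq he' g hy hy', pullB_apply, ← sum_coord_smul_bas (D (bas i)),
      ← sum_coord_smul_bas (D (bas j))]
    simp only [map_sum, map_smul, sum_apply, smul_apply, smul_eq_mul,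
      Matrix.mul_apply, Matrix.transpose_apply, hJ', gram_eq, Finset.sum_mul]
    refine Finset.sum_congr rfl fun k _ => ?_
    rw [Finset.mul_sum]
    refine Finset.sum_congr rfl fun l _ => by ring
  rw [rho, rho, h1, Matrix.det_mul, Matrix.det_mul, Matrix.det_transpose, hJ, ← Real.sqrt_sq_eq_abs,
    ← Real.sqrt_mul (sq_nonneg _)]
  congr 1; ring

lemma IsC11Chart.holderAt_rho (hM : IsC11Manifold d M) {g : Metric d M} (hg : IsLipschitzMetric g)
    {e : Chart d M} (he : IsC11Chart e) {y : E d} (hy : y ∈ e.target) :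
    HolderAt 1 (rho g e) y := by
  have h1 : ∀ i j, HolderAt 1 (fun z => gram g e z i j) y := fun i j => by
    have := (he.holderAt_gch hM hg hy).clm (ContinuousLinearMap.apply ℝ (Du d) (bas i))
    exact this.clm (ContinuousLinearMap.apply ℝ ℝ (bas j))
  have h2 : HolderAt 1 (fun z => (gram g e z).det) y := by
    simp only [Matrix.det_apply']
    exact HolderAt.sum _ fun σ _ => (holderAt_const _ _).mul
      (HolderAt.prod one_pos _ fun i _ => h1 _ _) one_pos
  have h3 : HolderAt 1 Real.sqrt ((gram g e y).det) :=
    (Real.contDiffAt_sqrt (he.det_gram_pos g hy).ne').holderAt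
  exact HolderAt.comp (g := fun z => (gram g e z).det) h3 h2 one_pos

lemma IsC11Chart.continuousOn_rho (hM : IsC11Manifold d M) {g : Metric d M}
    (hg : IsLipschitzMetric g) {e : Chart d M} (he : IsC11Chart e) :
    ContinuousOn (rho g e) e.target :=
  fun _ hy => ((he.holderAt_rho hM hg hy).continuousAt one_pos).continuousWithinAt

lemma IsC11Chart.ach_cgrad (A : Tensor2 d M) {e : Chart d M} (he : IsC11Chart e) {y : E d}
    (hy : y ∈ e.target) (θ η : ∀ x : M, Cot d x) :
    A (e.symm y) (θ (e.symm y)) (η (e.symm y)) = ach A e y (cgrad e θ y) (cgrad e η y) := by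
  rw [ach_apply]
  have h : ∀ θ : ∀ x : M, Cot d x, (cgrad e θ y).comp (dch e (e.symm y)) =
      (θ (e.symm y) : E d →L[ℝ] ℝ) := fun θ => by
    have := he.dsy_dch (e.map_target hy)
    rw [e.right_inv hy] at this
    let t : Du d := θ (e.symm y)
    change (t.comp (dsy e y)).comp _ = t
    rw [ContinuousLinearMap.comp_assoc, this, ContinuousLinearMap.comp_id]
  rw [h, h]

/-- The forms act on covectors, so the Jacobian is that of the inverse transition map, taken at the
image point. -/
lemma IsC11Chart.ach_eq (A : Tensor2 d M) {e e' : Chart d M} (he : IsC11Chart e)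
    (he' : IsC11Chart e') {y : E d} (hy : y ∈ e.target) (hy' : e.symm y ∈ e'.source) :
    ach A e y = pullB (ach A e' (e' (e.symm y)))
      ((ContinuousLinearMap.compL ℝ (E d) (E d) ℝ).flip
        (fderiv ℝ (e ∘ e'.symm) (e' (e.symm y)))) := by
  ext G H
  rw [pullB_apply, ach_apply, ach_apply, e'.left_inv hy', he'.dch_eq he hy' (e.map_target hy)]
  rfl

lemma IsC11Chart.holderAt_ach (hM : IsC11Manifold d M) {γ : ℝ} {A : Tensor2 d M} (hA : CondA2 γ A)
    {e : Chart d M} (he : IsC11Chart e) {y : E d} (hy : y ∈ e.target) :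
    HolderAt γ (ach A e) y := by
  obtain ⟨hγ0, hγ1, hA⟩ := hA
  set c := chartAt (E d) (e.symm y)
  have hc : e.symm y ∈ c.source := mem_chart_source _ _
  have hca : c ∈ atlas (E d) M := chart_mem_atlas _ _
  have h1 : HolderAt γ (ach A c) ((c ∘ e.symm) y) := by
    refine HolderAt.sum _ fun i _ => HolderAt.sum _ fun j _ => HolderAt.smul ?_
      (holderAt_const _ _) hγ0
    exact (hA c hca i j).holderAt c.open_target (c.map_source hc)
  have h2 := he.c11At_symm_trans (hM c hca) hy hc
  have h3 : C11At (e ∘ c.symm) ((c ∘ e.symm) y) :=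
    (hM c hca).c11At_symm_trans he (c.map_source hc)
      (by simpa [c.left_inv hc] using e.map_target hy)
  -- As `γ ≤ 1`, the Lipschitz Jacobian may be used as a `γ`-Hölder function.
  have h4 : HolderAt γ (fun z => (ContinuousLinearMap.compL ℝ (E d) (E d) ℝ).flip
      (fderiv ℝ (e ∘ c.symm) ((c ∘ e.symm) z))) y :=
    ((h3.2.comp h2.holderAt one_pos).mono hγ1 hγ0).clm _
  refine ((h1.comp h2.holderAt hγ0).pullB hγ0 h4).congr ?_
  filter_upwards [(e.continuousAt_symm hy).eventually (c.open_source.mem_nhds hc),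
    e.open_target.mem_nhds hy] with z hz hz'
  exact (he.ach_eq A (hM c hca) hz' hz).symm

end Tensors

/-! ### The Riemannian measure in an arbitrary chart -/

section ChartMeasure

variable {d : ℕ} {M : Type*} [TopologicalSpace M] [ChartedSpace (E d) M] [IsManifold (𝓡 d) 1 M]

lemma IsC11Fun.continuous {φ : M → ℝ} (hφ : IsC11Fun d φ) : Continuous φ := by
  rw [continuous_iff_continuousAt]
  intro x
  set c := chartAt (E d) x
  have hx : x ∈ c.source := mem_chart_source _ _
  have h := ((hφ c (chart_mem_atlas _ _)).c11At c.open_target (c.map_source hx)).1.continuousAt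
  have h2 := ContinuousAt.comp (f := c) (x := x) h (c.continuousAt hx)
  refine h2.congr ?_
  filter_upwards [c.open_source.mem_nhds hx] with z hz
  simp [c.left_inv hz]

variable [MeasurableSpace M] [BorelSpace M]

lemma measurableSet_target (e : Chart d M) : MeasurableSet e.target := e.open_target.measurableSet

lemma aemeasurable_symm (e : Chart d M) (f : E d → ℝ≥0∞) :
    AEMeasurable e.symm ((volume.restrict e.target).withDensity f) :=
  (e.continuousOn_symm.aemeasurable (measurableSet_target e)).mono_ac
    (withDensity_absolutelyContinuous _ _)

/-- Outside its target `e.symm` is arbitrary, so measurability is obtained on the subtype, where the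
map is continuous. -/
lemma measurableSet_preimage_symm (e : Chart d M) {S : Set M} (hS : MeasurableSet S) :
    MeasurableSet (e.symm ⁻¹' S ∩ e.target) := by
  have h : Measurable (e.target.domRestrict e.symm) :=
    (continuousOn_iff_continuous_domRestrict.1 e.continuousOn_symm).measurable
  have h2 := (MeasurableEmbedding.subtype_coe (measurableSet_target e)).measurableSet_image.2 (h hS)
  convert h2 using 1
  ext y
  simp only [mem_inter_iff, mem_preimage, mem_image, Subtype.exists, exists_and_right,
    exists_eq_right]
  exact ⟨fun h => ⟨h.2, h.1⟩, fun ⟨h, h'⟩ => ⟨h', h⟩⟩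

lemma map_symm_apply (e : Chart d M) (f : E d → ℝ≥0∞) {S : Set M} (hS : MeasurableSet S) :
    Measure.map e.symm ((volume.restrict e.target).withDensity f) S =
      ∫⁻ y in e.symm ⁻¹' S ∩ e.target, f y := by
  rw [Measure.map_apply_of_aemeasurable (aemeasurable_symm e f) hS, withDensity_apply',
    Measure.restrict_restrict' (measurableSet_target e)]

/-- Change of variables along the transition map; the Jacobian determinant is absorbed by
`IsC11Chart.rho_eq`. -/
lemma lintegral_chart_change {g : Metric d M} {e e' : Chart d M} (he : IsC11Chart e)
    (he' : IsC11Chart e') {ψ : M → ℝ} {S : Set M} (hS : MeasurableSet S) :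
    ∫⁻ y in e'.symm ⁻¹' (S ∩ e.source) ∩ e'.target,
        ENNReal.ofReal (ψ (e'.symm y) * rho g e' y) =
      ∫⁻ y in e.symm ⁻¹' (S ∩ e'.source) ∩ e.target,
        ENNReal.ofReal (ψ (e.symm y) * rho g e y) := by
  set D := e.symm ⁻¹' (S ∩ e'.source) ∩ e.target
  have hD : MeasurableSet D :=
    measurableSet_preimage_symm e (hS.inter e'.open_source.measurableSet)
  have him : e'.symm ⁻¹' (S ∩ e.source) ∩ e'.target = (e' ∘ e.symm) '' D := by
    ext z
    constructor
    · rintro ⟨⟨h1, h2⟩, h3⟩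
      refine ⟨e (e'.symm z), ⟨⟨?_, ?_⟩, e.map_source h2⟩, ?_⟩
      · rwa [e.left_inv h2]
      · rw [e.left_inv h2]; exact e'.map_target h3
      · simp [e.left_inv h2, e'.right_inv h3]
    · rintro ⟨y, ⟨⟨h1, h2⟩, h3⟩, rfl⟩
      refine ⟨⟨?_, ?_⟩, e'.map_source h2⟩
      · simpa [e'.left_inv h2] using h1
      · simpa [e'.left_inv h2] using e.map_target h3
  have hinj : InjOn (e' ∘ e.symm) D := fun y hy z hz hyz =>
    e.symm.injOn hy.2 hz.2 (e'.injOn hy.1.2 hz.1.2 hyz)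
  rw [him, lintegral_image_eq_lintegral_abs_det_fderiv_mul volume hD
    (f' := fderiv ℝ (e' ∘ e.symm)) (fun y hy => (((he.c11At_symm_trans he' hy.2
      hy.1.2).1.differentiableAt one_ne_zero).hasFDerivAt).hasFDerivWithinAt) hinj]
  refine setLIntegral_congr_fun hD fun y hy => ?_
  simp only [Function.comp_apply]
  rw [e'.left_inv hy.1.2, he.rho_eq g he' hy.2 hy.1.2, ← ENNReal.ofReal_mul (abs_nonneg _)]
  congr 1; ring

/-- In every chart of the `C^{1,1}` structure, the Riemannian measure is `√(det g_{ij}) dy`. -/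
lemma IsC11Chart.restrict_source_eq (hM : IsC11Manifold d M) {g : Metric d M}
    (hg : IsLipschitzMetric g) (P : FiniteAtlas d M) {e : Chart d M} (he : IsC11Chart e) :
    (riemannianMeasure P g).restrict e.source =
      Measure.map e.symm ((volume.restrict e.target).withDensity
        fun y => ENNReal.ofReal (rho g e y)) := by
  ext S hS
  have hsm : MeasurableSet (S ∩ e.source) := hS.inter e.open_source.measurableSet
  rw [Measure.restrict_apply hS, riemannianMeasure, Measure.finsetSum_apply, map_symm_apply e _ hS]
  have h1 : ∀ i, Measure.map (P.chart i).symm ((volume.restrict (P.chart i).target).withDensity fun y =>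
      ENNReal.ofReal (P.ψ i ((P.chart i).symm y) * √((gram g (P.chart i) y).det))) (S ∩ e.source) =
      ∫⁻ y in e.symm ⁻¹' S ∩ e.target, ENNReal.ofReal (P.ψ i (e.symm y) * rho g e y) := fun i => by
    rw [map_symm_apply _ _ hsm]
    refine (lintegral_chart_change (g := g) he (P.isC11Chart i) (ψ := P.ψ i) hS).trans ?_
    have hm1 := measurableSet_preimage_symm e hS
    have hm2 := measurableSet_preimage_symm e (hS.inter (P.chart i).open_source.measurableSet)
    rw [← lintegral_indicator hm1, ← lintegral_indicator hm2]
    refine lintegral_congr fun y => ?_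
    by_cases hy : y ∈ e.symm ⁻¹' S ∩ e.target
    · by_cases hy' : e.symm y ∈ (P.chart i).source
      · rw [indicator_of_mem hy, indicator_of_mem (show y ∈ e.symm ⁻¹' (S ∩ (P.chart i).source) ∩ e.target from
          ⟨⟨hy.1, hy'⟩, hy.2⟩)]
      · rw [indicator_of_mem hy, indicator_of_notMem fun h => hy' h.1.2]
        have : P.ψ i (e.symm y) = 0 := by
          by_contra h0
          exact hy' (P.tsupport_subset i (subset_tsupport _ h0))
        simp [this]
    · rw [indicator_of_notMem hy, indicator_of_notMem fun h => hy ⟨h.1.1, h.2⟩]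
  -- All summands are now integrals over the same set, and the weights `ψ i` add up to 1.
  rw [Finset.sum_congr rfl fun i _ => h1 i, ← lintegral_finsetSum']
  · refine setLIntegral_congr_fun (measurableSet_preimage_symm e hS) fun y hy => ?_
    rw [← ENNReal.ofReal_sum_of_nonneg fun i _ => mul_nonneg (P.nonneg i _) (he.rho_pos g hy.2).le,
      ← Finset.sum_mul, P.sum_eq_one, one_mul]
  · intro i _
    refine AEMeasurable.ennreal_ofReal (ContinuousOn.aemeasurable ?_
      (measurableSet_preimage_symm e hS))
    refine ContinuousOn.mono ?_ inter_subset_right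
    exact ((P.isC11Fun i).continuous.comp_continuousOn e.continuousOn_symm).mul
      (he.continuousOn_rho hM hg)

end ChartMeasure

/-! ### Uniform bounds for continuous families of bilinear forms -/

section PositiveForms

variable {X V : Type*} [TopologicalSpace X] [NormedAddCommGroup V] [NormedSpace ℝ V]
  [FiniteDimensional ℝ V] {q : X → V →L[ℝ] V →L[ℝ] ℝ} {K : Set X}

lemma exists_bilin_le (hK : IsCompact K) (hq : ContinuousOn q K) :
    ∃ C : ℝ, 0 < C ∧ ∀ y ∈ K, ‖q y‖ ≤ C := by
  obtain ⟨C, hC⟩ := hK.bddAbove_image hq.norm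
  exact ⟨max C 1, by positivity, fun y hy =>
    (hC (mem_image_of_mem _ hy)).trans (le_max_left _ _)⟩

/-- The minimum over the compact product of `K` with the unit sphere is positive; homogeneity gives
the other vectors. -/
lemma exists_le_bilin_of_pos (hK : IsCompact K) (hq : ContinuousOn q K)
    (hp : ∀ y ∈ K, ∀ G : V, G ≠ 0 → 0 < q y G G) :
    ∃ c : ℝ, 0 < c ∧ ∀ y ∈ K, ∀ G : V, c * ‖G‖ ^ 2 ≤ q y G G := by
  have hcs : ContinuousOn (fun p : X × V => q p.1 p.2 p.2) (K ×ˢ Metric.sphere 0 1) := by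
    have h1 : ContinuousOn (fun p : X × V => q p.1) (K ×ˢ Metric.sphere 0 1) :=
      hq.comp continuousOn_fst fun p hp => hp.1
    exact (h1.clm_apply continuousOn_snd).clm_apply continuousOn_snd
  have hK2 : IsCompact (K ×ˢ (Metric.sphere 0 1 : Set V)) := hK.prod (isCompact_sphere _ _)
  have key : ∃ c : ℝ, 0 < c ∧ ∀ p ∈ K ×ˢ (Metric.sphere 0 1 : Set V), c ≤ q p.1 p.2 p.2 := by
    rcases (K ×ˢ (Metric.sphere 0 1 : Set V)).eq_empty_or_nonempty with hem | hne
    · exact ⟨1, one_pos, by simp [hem]⟩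
    · obtain ⟨p, hp', hmin⟩ := hK2.exists_isMinOn hne hcs
      refine ⟨_, hp p.1 hp'.1 p.2 ?_, fun p' hp' => hmin hp'⟩
      rintro h
      simpa [h] using hp'.2
  obtain ⟨c, hc, H⟩ := key
  refine ⟨c, hc, fun y hy G => ?_⟩
  rcases eq_or_ne G 0 with rfl | hG
  · simp
  have h3 : 0 < ‖G‖ := norm_pos_iff.2 hG
  have h2 := H (y, ‖G‖⁻¹ • G) ⟨hy, by simp [norm_smul, hG]⟩
  simp only [map_smul, smul_apply, smul_eq_mul] at h2
  calc c * ‖G‖ ^ 2 ≤ (‖G‖⁻¹ * (‖G‖⁻¹ * q y G G)) * ‖G‖ ^ 2 := by gcongr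
    _ = q y G G := by field_simp

end PositiveForms

/-! ### Transfer of null sets, measurability and integrals between manifold and chart -/

section Geometry

variable {d : ℕ} {M : Type*} [TopologicalSpace M] [ChartedSpace (E d) M] [IsManifold (𝓡 d) 1 M]
  [MeasurableSpace M] [BorelSpace M]

/-- A `C^{1,1}` manifold with a Lipschitz metric and its Riemannian measure, given by its
expression in charts. -/
structure Geom (g : Metric d M) (μ : Measure M) : Prop where
  c11 : IsC11Manifold d M
  lip : IsLipschitzMetric g
  meas : ∀ e : Chart d M, IsC11Chart e → μ.restrict e.source =
    Measure.map e.symm ((volume.restrict e.target).withDensity fun y => ENNReal.ofReal (rho g e y))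

variable {g : Metric d M} {μ : Measure M} (S : Geom g μ) {e : Chart d M} (he : IsC11Chart e)

/-- The Riemannian measure in the coordinates of a chart. -/
def nu (g : Metric d M) (e : Chart d M) : Measure (E d) :=
  (volume.restrict e.target).withDensity fun y => ENNReal.ofReal (rho g e y)

lemma nu_ac (g : Metric d M) (e : Chart d M) : nu g e ≪ volume.restrict e.target :=
  withDensity_absolutelyContinuous _ _

lemma aemeasurable_symm_nu (g : Metric d M) (e : Chart d M) : AEMeasurable e.symm (nu g e) :=
  aemeasurable_symm e _

-- The density is positive on the target, so with `nu_ac` the null sets of Lebesgue measure and of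
-- the Riemannian measure in coordinates coincide.
include he in
lemma IsC11Chart.ac_nu (hM : IsC11Manifold d M) (hg : IsLipschitzMetric g) :
    volume.restrict e.target ≪ nu g e := by
  refine withDensity_absolutelyContinuous' ?_ ?_
  · exact ((he.continuousOn_rho hM hg).aemeasurable (measurableSet_target e)).ennreal_ofReal
  · filter_upwards [ae_restrict_mem (measurableSet_target e)] with y hy
    simpa using he.rho_pos g hy

lemma aemeasurable_chart (e : Chart d M) (μ : Measure M) : AEMeasurable e (μ.restrict e.source) :=
  e.continuousOn.aemeasurable e.open_source.measurableSet

include S he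

lemma Geom.map_symm_nu : Measure.map e.symm (nu g e) = μ.restrict e.source := (S.meas e he).symm

lemma Geom.map_chart : Measure.map e (μ.restrict e.source) = nu g e := by
  have h1 : AEMeasurable e (Measure.map e.symm (nu g e)) := by
    rw [S.map_symm_nu he]; exact aemeasurable_chart e μ
  rw [← S.map_symm_nu he, AEMeasurable.map_map_of_aemeasurable h1 (aemeasurable_symm_nu g e)]
  conv_rhs => rw [← Measure.map_id (μ := nu g e)]
  refine Measure.map_congr ((nu_ac g e).ae_le ?_)
  filter_upwards [ae_restrict_mem (measurableSet_target e)] with y hy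
  exact e.right_inv hy

lemma Geom.ae_target {p : M → Prop} (h : ∀ᵐ x ∂μ, p x) :
    ∀ᵐ y ∂(volume.restrict e.target), p (e.symm y) := by
  refine (he.ac_nu S.c11 S.lip).ae_le (ae_of_ae_map (aemeasurable_symm_nu g e) ?_)
  change ∀ᵐ x ∂Measure.map e.symm (nu g e), p x
  rw [S.map_symm_nu he]
  exact ae_restrict_of_ae h

lemma Geom.ae_source {q : E d → Prop} (h : ∀ᵐ y ∂(volume.restrict e.target), q y) :
    ∀ᵐ x ∂(μ.restrict e.source), q (e x) := by
  refine ae_of_ae_map (aemeasurable_chart e μ) ?_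
  rw [S.map_chart he]
  exact (nu_ac g e).ae_le h

lemma Geom.aestronglyMeasurable_comp_symm {Y : Type*} [TopologicalSpace Y] {f : M → Y}
    (hf : AEStronglyMeasurable f μ) :
    AEStronglyMeasurable (fun y => f (e.symm y)) (volume.restrict e.target) := by
  refine AEStronglyMeasurable.mono_ac (he.ac_nu S.c11 S.lip) ?_
  refine AEStronglyMeasurable.comp_aemeasurable ?_ (aemeasurable_symm_nu g e)
  rw [S.map_symm_nu he]
  exact hf.restrict

lemma Geom.aestronglyMeasurable_comp_chart {Y : Type*} [TopologicalSpace Y] {f : E d → Y}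
    (hf : AEStronglyMeasurable f (volume.restrict e.target)) :
    AEStronglyMeasurable (fun x => f (e x)) (μ.restrict e.source) := by
  refine AEStronglyMeasurable.comp_aemeasurable ?_ (aemeasurable_chart e μ)
  rw [S.map_chart he]
  exact hf.mono_ac (nu_ac g e)

lemma Geom.lintegral_source {f : M → ℝ≥0∞} (hf : AEMeasurable f (μ.restrict e.source)) :
    ∫⁻ x in e.source, f x ∂μ = ∫⁻ y in e.target, ENNReal.ofReal (rho g e y) * f (e.symm y) := by
  rw [← S.map_symm_nu he] at hf ⊢
  rw [lintegral_map' hf (aemeasurable_symm_nu g e)]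
  rw [nu] at hf ⊢
  rw [lintegral_withDensity_eq_lintegral_mul₀' (((he.continuousOn_rho S.c11 S.lip).aemeasurable
      (measurableSet_target e)).ennreal_ofReal) (by
      exact hf.comp_aemeasurable (aemeasurable_symm_nu g e))]
  rfl

lemma Geom.integral_source {f : M → ℝ} (hf : AEStronglyMeasurable f (μ.restrict e.source)) :
    ∫ x in e.source, f x ∂μ = ∫ y in e.target, rho g e y * f (e.symm y) := by
  rw [← S.map_symm_nu he] at hf ⊢
  rw [integral_map (aemeasurable_symm_nu g e) hf, nu, integral_withDensity_eq_integral_toReal_smul₀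
    (((he.continuousOn_rho S.c11 S.lip).aemeasurable (measurableSet_target e)).ennreal_ofReal)
    (by simp)]
  refine setIntegral_congr_fun (measurableSet_target e) fun y hy => ?_
  simp [ENNReal.toReal_ofReal (he.rho_pos g hy).le]

lemma Geom.rho_bounds {K : Set (E d)} (hK : IsCompact K) (hKt : K ⊆ e.target) :
    ∃ c C : ℝ, 0 < c ∧ 0 < C ∧ ∀ y ∈ K, c ≤ rho g e y ∧ rho g e y ≤ C := by
  have hc := (he.continuousOn_rho S.c11 S.lip).mono hKt
  obtain ⟨C, hC⟩ := hK.bddAbove_image hc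
  rcases K.eq_empty_or_nonempty with rfl | hne
  · exact ⟨1, 1, one_pos, one_pos, by simp⟩
  obtain ⟨y0, hy0, hmin⟩ := hK.exists_isMinOn hne hc
  refine ⟨rho g e y0, max C 1, he.rho_pos g (hKt hy0), by positivity, fun y hy => ⟨hmin hy, ?_⟩⟩
  exact (hC (mem_image_of_mem _ hy)).trans (le_max_left _ _)

lemma Geom.qch_bounds {K : Set (E d)} (hK : IsCompact K) (hKt : K ⊆ e.target) :
    ∃ c C : ℝ, 0 < c ∧ 0 < C ∧ ∀ y ∈ K, ∀ G : Du d,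
      c * ‖G‖ ^ 2 ≤ qch g e y G G ∧ qch g e y G G ≤ C * ‖G‖ ^ 2 := by
  have hc := (he.continuousOn_qch S.c11 S.lip).mono hKt
  obtain ⟨C, hC, hup⟩ := exists_bilin_le hK hc
  obtain ⟨c, hc0, hlo⟩ := exists_le_bilin_of_pos hK hc fun y hy G hG => he.qch_pos g (hKt hy) hG
  refine ⟨c, C, hc0, hC, fun y hy G => ⟨hlo y hy G, (le_abs_self _).trans ?_⟩⟩
  refine ((qch g e y).le_opNorm₂ G G).trans ?_
  rw [mul_assoc, ← sq]
  gcongr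
  exact hup y hy

end Geometry

/-! ### `L_2` norms as integrals of squares -/

lemma eLpNorm_two_sq {α Y : Type*} [MeasurableSpace α] [NormedAddCommGroup Y] (f : α → Y)
    (μ : Measure α) : eLpNorm f 2 μ ^ 2 = ∫⁻ x, ‖f x‖ₑ ^ 2 ∂μ := by
  have := eLpNorm_nnreal_pow_eq_lintegral (f := f) (μ := μ) (p := 2) two_ne_zero
  simpa only [NNReal.coe_ofNat, ENNReal.coe_ofNat, ENNReal.rpow_two] using this

lemma eLpNorm_two_le_of_sq_le {α Y : Type*} [MeasurableSpace α] [NormedAddCommGroup Y] {f : α → Y}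
    {μ : Measure α} {C : ℝ≥0∞} (h : ∫⁻ x, ‖f x‖ₑ ^ 2 ∂μ ≤ C ^ 2) : eLpNorm f 2 μ ≤ C := by
  rw [← eLpNorm_two_sq] at h
  exact (ENNReal.pow_le_pow_left_iff two_ne_zero).1 h

lemma tendsto_eLpNorm_two_zero_iff {α Y : Type*} [MeasurableSpace α] [NormedAddCommGroup Y]
    {f : ℕ → α → Y} {μ : Measure α} :
    Tendsto (fun n => eLpNorm (f n) 2 μ) atTop (𝓝 0) ↔
      Tendsto (fun n => ∫⁻ x, ‖f n x‖ₑ ^ 2 ∂μ) atTop (𝓝 0) := by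
  simp_rw [← eLpNorm_two_sq]
  constructor
  · intro h
    simpa using ENNReal.Tendsto.pow (n := 2) h
  · intro h
    have := (ENNReal.continuous_rpow_const (y := (1 / 2 : ℝ))).tendsto 0 |>.comp h
    simp only [Function.comp_def, ← ENNReal.rpow_natCast, ← ENNReal.rpow_mul] at this
    simpa using this

lemma enorm_sq_eq_ofReal {Y : Type*} [NormedAddCommGroup Y] (v : Y) :
    ‖v‖ₑ ^ 2 = ENNReal.ofReal (‖v‖ ^ 2) := by
  rw [ENNReal.ofReal_pow (norm_nonneg _), ofReal_norm]

/-- Along a subsequence with summable integrals the series of the functions has finite integral, so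
it converges almost everywhere and its terms tend to zero. -/
lemma exists_subseq_ae_tendsto_zero {α : Type*} [MeasurableSpace α] {μ : Measure α}
    {F : ℕ → α → ℝ≥0∞} (hm : ∀ n, AEMeasurable (F n) μ)
    (h : Tendsto (fun n => ∫⁻ x, F n x ∂μ) atTop (𝓝 0)) :
    ∃ k : ℕ → ℕ, StrictMono k ∧ ∀ᵐ x ∂μ, Tendsto (fun n => F (k n) x) atTop (𝓝 0) := by
  obtain ⟨ε, hε, hs⟩ := ENNReal.exists_pos_sum_of_countable (ε := 1) one_ne_zero ℕ
  have h1 : ∀ n, ∀ᶠ m in atTop, ∫⁻ x, F m x ∂μ ≤ ε n := fun n =>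
    h.eventually (ge_mem_nhds (by simpa using hε n))
  obtain ⟨k, hk, hk'⟩ := Filter.extraction_forall_of_eventually h1
  refine ⟨k, hk, ?_⟩
  have h2 : ∫⁻ x, ∑' n, F (k n) x ∂μ ≠ ⊤ := by
    rw [lintegral_tsum fun n => hm _]
    refine ((ENNReal.tsum_le_tsum hk').trans_lt (hs.trans ENNReal.one_lt_top)).ne
  filter_upwards [ae_lt_top' (AEMeasurable.tsum fun n => hm _) h2] with x hx
  exact ENNReal.tendsto_atTop_zero_of_tsum_ne_top hx.ne

/-! ### Elements of `H^1_0(Ω)` and their approximations in coordinates -/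

section H10

variable {d : ℕ} {M : Type*} [TopologicalSpace M] [ChartedSpace (E d) M]
  [MeasurableSpace M]

/-- `φ n` are test functions on `Ω` which approximate `u`, and their differentials approximate
`θ`. -/
structure Approx (g : Metric d M) (μ : Measure M) (Ω : Set M) (u : M → ℝ)
    (θ : ∀ x : M, Cot d x) (φ : ℕ → M → ℝ) (F : ℕ → M → ℝ≥0∞) : Prop where
  memLp : MemLp u 2 μ
  test : ∀ n, IsTest d Ω (φ n)
  tendsto : Tendsto (fun n => eLpNorm (u - φ n) 2 μ) atTop (𝓝 0)
  meas : ∀ n, AEMeasurable (F n) μ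
  le : ∀ n, ∀ᵐ x ∂μ,
      ENNReal.ofReal (cometric g x (θ x - diff (φ n) x) (θ x - diff (φ n) x)) ≤ F n x
  tendsto_F : Tendsto (fun n => ∫⁻ x, F n x ∂μ) atTop (𝓝 0)

lemma IsH10Diff.exists_approx {g : Metric d M} {μ : Measure M} {Ω : Set M} {u : M → ℝ}
    {θ : ∀ x : M, Cot d x} (h : IsH10Diff g μ Ω u θ) : ∃ φ F, Approx g μ Ω u θ φ F := by
  obtain ⟨h0, φ, F, h1, h2, h3, h4, h5⟩ := h
  exact ⟨φ, F, h0, h1, h2, h3, h4, h5⟩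

lemma Approx.isH10Diff {g : Metric d M} {μ : Measure M} {Ω : Set M} {u : M → ℝ}
    {θ : ∀ x : M, Cot d x} {φ F} (h : Approx g μ Ω u θ φ F) : IsH10Diff g μ Ω u θ :=
  ⟨h.memLp, φ, F, h.test, h.tendsto, h.meas, h.le, h.tendsto_F⟩

lemma Approx.subseq {g : Metric d M} {μ : Measure M} {Ω : Set M} {u : M → ℝ}
    {θ : ∀ x : M, Cot d x} {φ : ℕ → M → ℝ} {F} (h : Approx g μ Ω u θ φ F) {k : ℕ → ℕ}
    (hk : StrictMono k) : Approx g μ Ω u θ (fun n => φ (k n)) (fun n => F (k n)) :=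
  ⟨h.memLp, fun _ => h.test _, h.tendsto.comp hk.tendsto_atTop, fun _ => h.meas _,
    fun _ => h.le _, h.tendsto_F.comp hk.tendsto_atTop⟩

variable [IsManifold (𝓡 d) 1 M] [BorelSpace M] {g : Metric d M} {μ : Measure M} (S : Geom g μ)
  {e : Chart d M} (he : IsC11Chart e) {Ω : Set M} {u : M → ℝ} {θ : ∀ x : M, Cot d x}
  {φ : ℕ → M → ℝ} {F : ℕ → M → ℝ≥0∞}

lemma IsTest.cgrad_eq {φ : M → ℝ} (h : IsTest d Ω φ) (he : IsC11Chart e) {y : E d}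
    (hy : y ∈ e.target) : cgrad e (diff φ) y = fderiv ℝ (φ ∘ e.symm) y :=
  he.cgrad_diff hy (h.mdifferentiableAt _)

lemma IsTest.contDiffAt {φ : M → ℝ} (h : IsTest d Ω φ) (he : IsC11Chart e) {y : E d}
    (hy : y ∈ e.target) : ContDiffAt ℝ 1 (φ ∘ e.symm) y := by
  rw [← contMDiffAt_iff_contDiffAt]
  exact (h.1 _).comp y (contMDiffAt_symm_of_mem_maximalAtlas he.mem_maximalAtlas hy)

lemma IsTest.contDiffOn {φ : M → ℝ} (h : IsTest d Ω φ) (he : IsC11Chart e) :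
    ContDiffOn ℝ 1 (φ ∘ e.symm) e.target :=
  fun _ hy => (h.contDiffAt he hy).contDiffWithinAt

lemma IsTest.continuousOn_fderiv {φ : M → ℝ} (h : IsTest d Ω φ) (he : IsC11Chart e) :
    ContinuousOn (fderiv ℝ (φ ∘ e.symm)) e.target :=
  (h.contDiffOn he).continuousOn_fderiv_of_isOpen e.open_target le_rfl

lemma IsTest.aestronglyMeasurable_fderiv {φ : M → ℝ} (h : IsTest d Ω φ) (he : IsC11Chart e) :
    AEStronglyMeasurable (fderiv ℝ (φ ∘ e.symm)) (volume.restrict e.target) :=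
  (h.continuousOn_fderiv he).aestronglyMeasurable (measurableSet_target e)

lemma cgrad_sub (e : Chart d M) (θ η : ∀ x : M, Cot d x) (y : E d) :
    cgrad e (fun x => θ x - η x) y = cgrad e θ y - cgrad e η y := rfl

include S he

lemma Geom.cometric_bounds {K : Set (E d)} (hK : IsCompact K) (hKt : K ⊆ e.target) :
    ∃ c C : ℝ, 0 < c ∧ 0 < C ∧ ∀ y ∈ K, ∀ θ : ∀ x : M, Cot d x,
      ‖cgrad e θ y‖ ^ 2 ≤ c * cometric g (e.symm y) (θ (e.symm y)) (θ (e.symm y)) ∧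
      cometric g (e.symm y) (θ (e.symm y)) (θ (e.symm y)) ≤ C * ‖cgrad e θ y‖ ^ 2 := by
  obtain ⟨c, C, hc, hC, H⟩ := S.qch_bounds he hK hKt
  refine ⟨c⁻¹, C, by positivity, hC, fun y hy θ => ?_⟩
  rw [he.cometric_eq g (hKt hy)]
  refine ⟨?_, (H y hy _).2⟩
  rw [inv_mul_eq_div, le_div_iff₀ hc, mul_comm]
  exact (H y hy _).1

-- The definition of `IsH10Diff` only bounds the distance of `θ` to the differentials of test
-- functions. Almost everywhere convergence is what makes the coordinates of `θ` measurable
-- (`Geom.aestronglyMeasurable_cgrad`).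
omit S he in
lemma Approx.ae_tendsto_cgrad (h : Approx g μ Ω u θ φ F) (S : Geom g μ)
    (hF : ∀ᵐ x ∂μ, Tendsto (fun n => F n x) atTop (𝓝 0)) (he : IsC11Chart e) :
    ∀ᵐ y ∂(volume.restrict e.target),
      Tendsto (fun n => fderiv ℝ (φ n ∘ e.symm) y) atTop (𝓝 (cgrad e θ y)) := by
  have h1 := S.ae_target he hF
  have h2 := S.ae_target he (ae_all_iff.2 h.le)
  filter_upwards [h1, h2, ae_restrict_mem (measurableSet_target e)] with y h1 h2 hy
  -- Convergence at one point needs comparability of the norms at that point only, hence the compact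
  -- set `{y}`.
  obtain ⟨c, C, hc, hC, H⟩ := S.cometric_bounds he (isCompact_singleton (x := y)) (by simpa using hy)
  rw [tendsto_iff_norm_sub_tendsto_zero]
  have h3 : Tendsto (fun n => ENNReal.ofReal c * F n (e.symm y)) atTop (𝓝 0) := by
    simpa using ENNReal.Tendsto.const_mul h1 (Or.inr ENNReal.ofReal_ne_top)
  have h4 : Tendsto (fun n => ENNReal.ofReal (‖fderiv ℝ (φ n ∘ e.symm) y - cgrad e θ y‖ ^ 2)) atTop
      (𝓝 0) := by
    refine tendsto_of_tendsto_of_tendsto_of_le_of_le tendsto_const_nhds h3 (fun _ => bot_le)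
      fun n => ?_
    have h5 := (H y rfl (fun x => θ x - diff (φ n) x)).1
    rw [cgrad_sub, (h.test n).cgrad_eq he hy, norm_sub_rev] at h5
    refine (ENNReal.ofReal_le_ofReal h5).trans ?_
    rw [ENNReal.ofReal_mul hc.le]
    gcongr
    exact h2 n
  have h6 : Tendsto (fun n => ‖fderiv ℝ (φ n ∘ e.symm) y - cgrad e θ y‖ ^ 2) atTop (𝓝 0) := by
    have := (ENNReal.tendsto_toReal ENNReal.zero_ne_top).comp h4
    simpa [Function.comp_def] using this
  have := h6.sqrt
  simpa using this

lemma Geom.aestronglyMeasurable_cgrad (h : IsH10Diff g μ Ω u θ) :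
    AEStronglyMeasurable (cgrad e θ) (volume.restrict e.target) := by
  obtain ⟨φ, F, h⟩ := h.exists_approx
  obtain ⟨k, hk, hk'⟩ := exists_subseq_ae_tendsto_zero h.meas h.tendsto_F
  exact aestronglyMeasurable_of_tendsto_ae atTop
    (fun n => (h.test (k n)).aestronglyMeasurable_fderiv he)
    ((h.subseq hk).ae_tendsto_cgrad S hk' he)

/-- Integrals over compact parts of a chart are controlled by integrals over the manifold. -/
lemma Geom.exists_lintegral_le {K : Set (E d)} (hK : IsCompact K) (hKt : K ⊆ e.target) :
    ∃ C : ℝ≥0, ∀ f : M → ℝ≥0∞, AEMeasurable f μ →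
      ∫⁻ y in K, f (e.symm y) ≤ C * ∫⁻ x in e.source, f x ∂μ := by
  obtain ⟨c, C, hc, hC, H⟩ := S.rho_bounds he hK hKt
  refine ⟨c⁻¹.toNNReal, fun f hf => ?_⟩
  rw [S.lintegral_source he hf.restrict, ← lintegral_const_mul' _ _ ENNReal.coe_ne_top]
  have h1 : ∀ y ∈ K, f (e.symm y) ≤
      ENNReal.ofReal c⁻¹ * (ENNReal.ofReal (rho g e y) * f (e.symm y)) := fun y hy => by
    have h2 : 1 ≤ c⁻¹ * rho g e y := by
      rw [inv_mul_eq_div, one_le_div hc]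
      exact (H y hy).1
    rw [← mul_assoc, ← ENNReal.ofReal_mul (inv_nonneg.2 hc.le)]
    exact le_mul_of_one_le_left' (ENNReal.one_le_ofReal.2 h2)
  calc ∫⁻ y in K, f (e.symm y)
      ≤ ∫⁻ y in K, ENNReal.ofReal c⁻¹ * (ENNReal.ofReal (rho g e y) * f (e.symm y)) :=
        setLIntegral_mono' hK.measurableSet h1
    _ ≤ _ := lintegral_mono_set hKt

lemma Geom.exists_eLpNorm_le {K : Set (E d)} (hK : IsCompact K) (hKt : K ⊆ e.target) :
    ∃ C : ℝ≥0, ∀ f : M → ℝ, AEStronglyMeasurable f μ →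
      eLpNorm (fun y => f (e.symm y)) 2 (volume.restrict K) ≤ C * eLpNorm f 2 μ := by
  obtain ⟨C, hC⟩ := S.exists_lintegral_le he hK hKt
  refine ⟨NNReal.sqrt C, fun f hf => eLpNorm_two_le_of_sq_le ?_⟩
  refine (hC (fun x => ‖f x‖ₑ ^ 2) (hf.enorm.pow_const 2)).trans ?_
  rw [mul_pow, eLpNorm_two_sq]
  norm_cast
  rw [NNReal.sq_sqrt]
  gcongr
  exact Measure.restrict_le_self

lemma Approx.tendsto_chart (h : Approx g μ Ω u θ φ F) {K : Set (E d)} (hK : IsCompact K)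
    (hKt : K ⊆ e.target) :
    Tendsto (fun n => eLpNorm (fun y => u (e.symm y) - φ n (e.symm y)) 2 (volume.restrict K)) atTop
      (𝓝 0) := by
  obtain ⟨C, hC⟩ := S.exists_eLpNorm_le he hK hKt
  have h1 : Tendsto (fun n => C * eLpNorm (u - φ n) 2 μ) atTop (𝓝 0) := by
    simpa using ENNReal.Tendsto.const_mul h.tendsto (Or.inr ENNReal.coe_ne_top)
  exact tendsto_of_tendsto_of_tendsto_of_le_of_le tendsto_const_nhds h1 (fun _ => bot_le)
    fun n => hC (u - φ n) (h.memLp.1.sub ((h.test n).aestronglyMeasurable μ))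

lemma Approx.tendsto_chart_fderiv (h : Approx g μ Ω u θ φ F) {K : Set (E d)} (hK : IsCompact K)
    (hKt : K ⊆ e.target) :
    Tendsto (fun n => eLpNorm (fun y => cgrad e θ y - fderiv ℝ (φ n ∘ e.symm) y) 2
      (volume.restrict K)) atTop (𝓝 0) := by
  obtain ⟨C, hC⟩ := S.exists_lintegral_le he hK hKt
  obtain ⟨c, _, hc, _, H⟩ := S.cometric_bounds he hK hKt
  rw [tendsto_eLpNorm_two_zero_iff]
  have h1 : Tendsto (fun n => ENNReal.ofReal c * (C * ∫⁻ x, F n x ∂μ)) atTop (𝓝 0) := by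
    have := ENNReal.Tendsto.const_mul h.tendsto_F (Or.inr (ENNReal.coe_ne_top (r := C)))
    simpa using ENNReal.Tendsto.const_mul this (Or.inr ENNReal.ofReal_ne_top)
  refine tendsto_of_tendsto_of_tendsto_of_le_of_le tendsto_const_nhds h1 (fun _ => bot_le)
    fun n => ?_
  have h2 : ∀ᵐ y ∂(volume.restrict K), ‖cgrad e θ y - fderiv ℝ (φ n ∘ e.symm) y‖ₑ ^ 2 ≤
      ENNReal.ofReal c * F n (e.symm y) := by
    filter_upwards [ae_restrict_of_ae_restrict_of_subset hKt (S.ae_target he (h.le n)),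
      ae_restrict_mem hK.measurableSet] with y h2 hy
    rw [enorm_sq_eq_ofReal]
    have h5 := (H y hy (fun x => θ x - diff (φ n) x)).1
    rw [cgrad_sub, (h.test n).cgrad_eq he (hKt hy)] at h5
    refine (ENNReal.ofReal_le_ofReal h5).trans ?_
    rw [ENNReal.ofReal_mul hc.le]
    gcongr
  refine (lintegral_mono_ae h2).trans ?_
  rw [lintegral_const_mul' _ _ ENNReal.ofReal_ne_top]
  gcongr
  refine (hC _ (h.meas n)).trans ?_
  gcongr
  exact Measure.restrict_le_self

end H10

/-! ### Local `L_2` limits of `C^1` functions and their weak differentials -/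

section LocalSobolev

variable {V : Type*} [NormedAddCommGroup V] [NormedSpace ℝ V] [FiniteDimensional ℝ V]
  [MeasureSpace V] [BorelSpace V] [(volume : Measure V).IsAddHaarMeasure]
  {Y : Type*} [NormedAddCommGroup Y]

lemma eLpNorm_comp_add_right (f : V → Y) (h : V) {s : Set V} (hs : MeasurableSet s) :
    eLpNorm (fun y => f (y + h)) 2 (volume.restrict ((fun y => y + h) ⁻¹' s)) =
      eLpNorm f 2 (volume.restrict s) := by
  have h1 := ((measurePreserving_add_right (volume : Measure V) h).restrict_preimage hs)
  rw [← h1.map_eq, (measurableEmbedding_addRight h).eLpNorm_map_measure]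
  rfl

lemma aestronglyMeasurable_comp_add_right {f : V → Y} (h : V) {s : Set V} (hs : MeasurableSet s)
    (hf : AEStronglyMeasurable f (volume.restrict s)) :
    AEStronglyMeasurable (fun y => f (y + h)) (volume.restrict ((fun y => y + h) ⁻¹' s)) :=
  hf.comp_measurePreserving
    ((measurePreserving_add_right (volume : Measure V) h).restrict_preimage hs)

lemma eLpNorm_comp_add_right_le (f : V → Y) (h : V) {s t : Set V} (ht : MeasurableSet t)
    (hst : ∀ y ∈ s, y + h ∈ t) :
    eLpNorm (fun y => f (y + h)) 2 (volume.restrict s) ≤ eLpNorm f 2 (volume.restrict t) := by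
  rw [← eLpNorm_comp_add_right f h ht]
  exact eLpNorm_mono_measure _ (Measure.restrict_mono hst le_rfl)

/-- `u` has the weak differential `G` on `U`, both being locally the `L_2` limits of the functions
`w n` of class `C^1` and of their differentials. -/
structure H1Lim (U : Set V) (u : V → ℝ) (G : V → V →L[ℝ] ℝ) (w : ℕ → V → ℝ) : Prop where
  contDiffOn : ∀ n, ContDiffOn ℝ 1 (w n) U
  meas : AEStronglyMeasurable u (volume.restrict U)
  meas_grad : AEStronglyMeasurable G (volume.restrict U)
  lim : ∀ K, IsCompact K → K ⊆ U →
    Tendsto (fun n => eLpNorm (fun y => u y - w n y) 2 (volume.restrict K)) atTop (𝓝 0)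
  lim_grad : ∀ K, IsCompact K → K ⊆ U →
    Tendsto (fun n => eLpNorm (fun y => G y - fderiv ℝ (w n) y) 2 (volume.restrict K)) atTop (𝓝 0)

lemma _root_.ContinuousOn.memLp_two {f : V → Y} [SecondCountableTopology Y] {K : Set V}
    (hf : ContinuousOn f K) (hK : IsCompact K) : MemLp f 2 (volume.restrict K) := by
  obtain ⟨C, hC⟩ := hK.bddAbove_image hf.norm
  have : IsFiniteMeasure (volume.restrict K) := ⟨by simpa using hK.measure_lt_top⟩
  borelize Y
  refine MemLp.of_bound (hf.aestronglyMeasurable hK.measurableSet) C ?_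
  filter_upwards [ae_restrict_mem hK.measurableSet] with y hy
  exact hC (mem_image_of_mem _ hy)

lemma memLp_two_of_tendsto {μ : Measure V} {f : V → Y} {f' : ℕ → V → Y}
    (hf : AEStronglyMeasurable f μ) (hf' : ∀ n, MemLp (f' n) 2 μ)
    (h : Tendsto (fun n => eLpNorm (fun y => f y - f' n y) 2 μ) atTop (𝓝 0)) : MemLp f 2 μ := by
  obtain ⟨n, hn⟩ := (h.eventually (gt_mem_nhds one_pos)).exists
  have h1 : MemLp (fun y => f y - f' n y) 2 μ := ⟨hf.sub (hf' n).1, hn.trans ENNReal.one_lt_top⟩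
  have := h1.add (hf' n)
  refine this.ae_eq (ae_of_all _ fun y => ?_)
  simp

variable {U U' : Set V} {u u' : V → ℝ} {G G' : V → V →L[ℝ] ℝ} {w w' : ℕ → V → ℝ}

lemma H1Lim.continuousOn_fderiv (h : H1Lim U u G w) (hU : IsOpen U) (n : ℕ) :
    ContinuousOn (fderiv ℝ (w n)) U :=
  (h.contDiffOn n).continuousOn_fderiv_of_isOpen hU le_rfl

lemma H1Lim.memLp (h : H1Lim U u G w) {K : Set V} (hK : IsCompact K) (hKU : K ⊆ U) :
    MemLp u 2 (volume.restrict K) :=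
  memLp_two_of_tendsto (h.meas.mono_set hKU)
    (fun n => ((h.contDiffOn n).continuousOn.mono hKU).memLp_two hK) (h.lim K hK hKU)

lemma H1Lim.memLp_grad (h : H1Lim U u G w) (hU : IsOpen U) {K : Set V} (hK : IsCompact K)
    (hKU : K ⊆ U) : MemLp G 2 (volume.restrict K) :=
  memLp_two_of_tendsto (h.meas_grad.mono_set hKU)
    (fun n => ((h.continuousOn_fderiv hU n).mono hKU).memLp_two hK) (h.lim_grad K hK hKU)

lemma H1Lim.mono (h : H1Lim U u G w) (hU : U' ⊆ U) : H1Lim U' u G w :=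
  ⟨fun n => (h.contDiffOn n).mono hU, h.meas.mono_set hU, h.meas_grad.mono_set hU,
    fun K hK hKU => h.lim K hK (hKU.trans hU), fun K hK hKU => h.lim_grad K hK (hKU.trans hU)⟩

lemma H1Lim.sub (h : H1Lim U u G w) (h' : H1Lim U u' G' w') (hU : IsOpen U) :
    H1Lim U (fun y => u y - u' y) (fun y => G y - G' y) (fun n y => w n y - w' n y) := by
  refine ⟨fun n => (h.contDiffOn n).sub (h'.contDiffOn n), h.meas.sub h'.meas,
    h.meas_grad.sub h'.meas_grad, fun K hK hKU => ?_, fun K hK hKU => ?_⟩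
  · have h1 := (h.lim K hK hKU).add (h'.lim K hK hKU)
    rw [add_zero] at h1
    refine tendsto_of_tendsto_of_tendsto_of_le_of_le tendsto_const_nhds h1 (fun _ => bot_le)
      fun n => ?_
    have h2 : (fun y => u y - u' y - (w n y - w' n y)) =
        (fun y => u y - w n y) - (fun y => u' y - w' n y) := by
      ext y; simp only [Pi.sub_apply]; abel
    rw [h2]
    have h3 := ((h.contDiffOn n).continuousOn.mono hKU).memLp_two hK
    have h4 := ((h'.contDiffOn n).continuousOn.mono hKU).memLp_two hK
    exact eLpNorm_sub_le ((h.meas.mono_set hKU).sub h3.1) ((h'.meas.mono_set hKU).sub h4.1)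
      one_le_two
  · have h1 := (h.lim_grad K hK hKU).add (h'.lim_grad K hK hKU)
    rw [add_zero] at h1
    refine tendsto_of_tendsto_of_tendsto_of_le_of_le tendsto_const_nhds h1 (fun _ => bot_le)
      fun n => ?_
    have h3 := ((h.continuousOn_fderiv hU n).mono hKU).memLp_two hK
    have h4 := ((h'.continuousOn_fderiv hU n).mono hKU).memLp_two hK
    refine le_trans (eLpNorm_congr_ae ?_).le (eLpNorm_sub_le ((h.meas_grad.mono_set hKU).sub h3.1)
      ((h'.meas_grad.mono_set hKU).sub h4.1) one_le_two)
    filter_upwards [ae_restrict_mem hK.measurableSet] with y hy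
    have hUy := hU.mem_nhds (hKU hy)
    have h5 := ((h.contDiffOn n).contDiffAt hUy).differentiableAt one_ne_zero
    have h6 := ((h'.contDiffOn n).contDiffAt hUy).differentiableAt one_ne_zero
    simp only [Pi.sub_apply]
    rw [fderiv_fun_sub h5 h6]
    abel

lemma eLpNorm_smul_le_of_bound {Z : Type*} [NormedAddCommGroup Z] {K : Set V} (hK : MeasurableSet K)
    {f : V → Y} {f' : V → Z} {C : ℝ} (h : ∀ y ∈ K, ‖f y‖ ≤ C * ‖f' y‖) :
    eLpNorm f 2 (volume.restrict K) ≤ ENNReal.ofReal C * eLpNorm f' 2 (volume.restrict K) := by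
  refine eLpNorm_le_mul_eLpNorm_of_ae_le_mul ?_ 2
  filter_upwards [ae_restrict_mem hK] with y hy using h y hy

lemma H1Lim.mul (h : H1Lim U u G w) {η : V → ℝ} (hη : ContDiffOn ℝ 1 η U) (hU : IsOpen U) :
    H1Lim U (fun y => η y * u y) (fun y => η y • G y + u y • fderiv ℝ η y)
      (fun n y => η y * w n y) := by
  have hc := hη.continuousOn
  have hc' := hη.continuousOn_fderiv_of_isOpen hU le_rfl
  have m1 := hc.aestronglyMeasurable (μ := volume) hU.measurableSet
  have m2 := hc'.aestronglyMeasurable (μ := volume) hU.measurableSet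
  refine ⟨fun n => hη.mul (h.contDiffOn n), m1.mul h.meas, (m1.smul h.meas_grad).add
    (h.meas.smul m2), fun K hK hKU => ?_, fun K hK hKU => ?_⟩
  · obtain ⟨C, hC⟩ := hK.bddAbove_image (hc.mono hKU).norm
    have h1 := ENNReal.Tendsto.const_mul (h.lim K hK hKU)
      (Or.inr (ENNReal.ofReal_ne_top (r := C)))
    rw [mul_zero] at h1
    refine tendsto_of_tendsto_of_tendsto_of_le_of_le tendsto_const_nhds h1 (fun _ => bot_le)
      fun n => eLpNorm_smul_le_of_bound hK.measurableSet fun y hy => ?_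
    rw [← mul_sub, norm_mul]
    gcongr
    exact hC (mem_image_of_mem _ hy)
  · obtain ⟨C, hC⟩ := hK.bddAbove_image (hc.mono hKU).norm
    obtain ⟨C', hC'⟩ := hK.bddAbove_image (hc'.mono hKU).norm
    have h1 := (ENNReal.Tendsto.const_mul (h.lim_grad K hK hKU)
      (Or.inr (ENNReal.ofReal_ne_top (r := C)))).add (ENNReal.Tendsto.const_mul (h.lim K hK hKU)
      (Or.inr (ENNReal.ofReal_ne_top (r := C'))))
    rw [mul_zero, mul_zero, add_zero] at h1
    refine tendsto_of_tendsto_of_tendsto_of_le_of_le tendsto_const_nhds h1 (fun _ => bot_le)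
      fun n => ?_
    have h3 := ((h.contDiffOn n).continuousOn.mono hKU).memLp_two hK
    have h4 := ((h.continuousOn_fderiv hU n).mono hKU).memLp_two hK
    have h5 : eLpNorm (fun y => η y • (G y - fderiv ℝ (w n) y)) 2 (volume.restrict K) ≤
        ENNReal.ofReal C * eLpNorm (fun y => G y - fderiv ℝ (w n) y) 2 (volume.restrict K) :=
      eLpNorm_smul_le_of_bound hK.measurableSet fun y hy => by
        rw [norm_smul]; gcongr; exact hC (mem_image_of_mem _ hy)
    have h6 : eLpNorm (fun y => (u y - w n y) • fderiv ℝ η y) 2 (volume.restrict K) ≤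
        ENNReal.ofReal C' * eLpNorm (fun y => u y - w n y) 2 (volume.restrict K) :=
      eLpNorm_smul_le_of_bound hK.measurableSet fun y hy => by
        rw [norm_smul, mul_comm]; gcongr; exact hC' (mem_image_of_mem _ hy)
    refine le_trans (le_trans (eLpNorm_congr_ae ?_).le (eLpNorm_add_le ((m1.mono_set hKU).smul
      ((h.meas_grad.mono_set hKU).sub h4.1)) (((h.meas.mono_set hKU).sub h3.1).smul
      (m2.mono_set hKU)) one_le_two)) (add_le_add h5 h6)
    filter_upwards [ae_restrict_mem hK.measurableSet] with y hy
    have hUy := hU.mem_nhds (hKU hy)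
    have h7 := ((h.contDiffOn n).contDiffAt hUy).differentiableAt one_ne_zero
    have h8 := (hη.contDiffAt hUy).differentiableAt one_ne_zero
    simp only [Pi.add_apply, Pi.smul_apply', Pi.sub_apply]
    rw [fderiv_fun_mul h8 h7]
    module

lemma H1Lim.translate (h : H1Lim U u G w) (hU : IsOpen U) {v : V} (hv : ∀ y ∈ U', y + v ∈ U) :
    H1Lim U' (fun y => u (y + v)) (fun y => G (y + v)) (fun n y => w n (y + v)) := by
  refine ⟨fun n => (h.contDiffOn n).comp (by fun_prop) hv,
    (aestronglyMeasurable_comp_add_right v hU.measurableSet h.meas).mono_set hv,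
    (aestronglyMeasurable_comp_add_right v hU.measurableSet h.meas_grad).mono_set hv,
    fun K hK hKU => ?_, fun K hK hKU => ?_⟩
  · have hK' : IsCompact ((fun y => y + v) '' K) := hK.image (by fun_prop)
    have hKU' : (fun y => y + v) '' K ⊆ U := by
      rintro _ ⟨y, hy, rfl⟩; exact hv y (hKU hy)
    exact tendsto_of_tendsto_of_tendsto_of_le_of_le tendsto_const_nhds (h.lim _ hK' hKU')
      (fun _ => bot_le) fun n => eLpNorm_comp_add_right_le (fun y => u y - w n y) v
        hK'.measurableSet fun y hy => mem_image_of_mem _ hy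
  · have hK' : IsCompact ((fun y => y + v) '' K) := hK.image (by fun_prop)
    have hKU' : (fun y => y + v) '' K ⊆ U := by
      rintro _ ⟨y, hy, rfl⟩; exact hv y (hKU hy)
    refine tendsto_of_tendsto_of_tendsto_of_le_of_le tendsto_const_nhds (h.lim_grad _ hK' hKU')
      (fun _ => bot_le) fun n => ?_
    simp only [fderiv_comp_add_right]
    exact eLpNorm_comp_add_right_le (fun y => G y - fderiv ℝ (w n) y) v
        hK'.measurableSet fun y hy => mem_image_of_mem _ hy

/-- Integration by parts against `C^1` functions with compact support. -/
lemma H1Lim.integral_mul_fderiv (h : H1Lim U u G w) (hU : IsOpen U) {χ : V → ℝ}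
    (hχ : ContDiff ℝ 1 χ) (hs : HasCompactSupport χ) (hsU : tsupport χ ⊆ U) (v : V) :
    ∫ y, u y * fderiv ℝ χ y v = - ∫ y, G y v * χ y := by
  set K := tsupport χ
  have hK : IsCompact K := hs
  have : IsFiniteMeasure (volume.restrict K) := ⟨by simpa using hK.measure_lt_top⟩
  have hχ' : Continuous (fun y => fderiv ℝ χ y v) :=
    (hχ.continuous_fderiv one_ne_zero).clm_apply continuous_const
  have e1 : ∀ f : V → ℝ, ∫ y, f y * fderiv ℝ χ y v = ∫ y in K, f y * fderiv ℝ χ y v := fun f => by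
    refine (setIntegral_eq_integral_of_forall_compl_eq_zero fun y hy => ?_).symm
    rw [image_eq_zero_of_notMem_tsupport fun h => hy (tsupport_fderiv_subset ℝ h)]
    simp
  have e2 : ∀ f : V → ℝ, ∫ y, f y * χ y = ∫ y in K, f y * χ y := fun f => by
    refine (setIntegral_eq_integral_of_forall_compl_eq_zero fun y hy => ?_).symm
    rw [image_eq_zero_of_notMem_tsupport hy, mul_zero]
  have mχ : MemLp χ 2 (volume.restrict K) := hχ.continuous.continuousOn.memLp_two hK
  have mχ' : MemLp (fun y => fderiv ℝ χ y v) 2 (volume.restrict K) :=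
    hχ'.continuousOn.memLp_two hK
  -- For the approximants this is classical integration by parts; `lim` below passes to the limit by
  -- the Cauchy–Schwarz inequality on the support of `χ`.
  have key : ∀ n, ∫ y in K, w n y * fderiv ℝ χ y v = - ∫ y in K, fderiv ℝ (w n) y v * χ y := by
    intro n
    have c1 := (h.contDiffOn n).continuousOn.mono hsU
    have c2 := ((h.continuousOn_fderiv hU n).mono hsU).clm_apply
      (continuousOn_const (c := v))
    rw [← e1, ← e2 fun y => fderiv ℝ (w n) y v]
    have i1 : ∀ f f' : V → ℝ, ContinuousOn f K → Continuous f' → (∀ y ∉ K, f' y = 0) →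
        Integrable (fun y => f y * f' y) volume := fun f f' hf hf' h0 => by
      rw [← integrableOn_iff_integrable_of_support_subset (s := K) fun y hy => by
        by_contra hyK; exact hy (by simp [h0 y hyK])]
      exact (hf.mul hf'.continuousOn).integrableOn_compact hK
    refine integral_mul_fderiv_eq_neg_fderiv_mul_of_integrable
      (i1 _ _ c2 hχ.continuous fun y hy => image_eq_zero_of_notMem_tsupport hy)
      (i1 _ _ c1 hχ' fun y hy => ?_)
      (i1 _ _ c1 hχ.continuous fun y hy => image_eq_zero_of_notMem_tsupport hy)
      (fun y hy => ((h.contDiffOn n).contDiffAt (hU.mem_nhds (hsU hy))).differentiableAt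
        one_ne_zero) fun y _ => (hχ.differentiable one_ne_zero) y
    rw [image_eq_zero_of_notMem_tsupport fun h => hy (tsupport_fderiv_subset ℝ h)]
    simp
  have lim : ∀ (f : V → ℝ) (f' : ℕ → V → ℝ) (k : V → ℝ), MemLp f 2 (volume.restrict K) →
      (∀ n, MemLp (f' n) 2 (volume.restrict K)) → MemLp k 2 (volume.restrict K) →
      Tendsto (fun n => eLpNorm (fun y => f y - f' n y) 2 (volume.restrict K)) atTop (𝓝 0) →
      Tendsto (fun n => ∫ y in K, f' n y * k y) atTop (𝓝 (∫ y in K, f y * k y)) := by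
    intro f f' k hf hf' hk hl
    refine tendsto_integral_of_L1' _ (hf.integrable_mul hk).1
      (Eventually.of_forall fun n => (hf' n).integrable_mul hk) ?_
    have h1 := ENNReal.Tendsto.mul_const hl (Or.inr hk.2.ne)
    rw [zero_mul] at h1
    refine tendsto_of_tendsto_of_tendsto_of_le_of_le tendsto_const_nhds h1 (fun _ => bot_le)
      fun n => ?_
    have h2 := eLpNorm_smul_le_mul_eLpNorm (p := 2) (q := 2) (r := 1) hk.1 (hf.1.sub (hf' n).1)
    refine le_trans (eLpNorm_congr_norm_ae (ae_of_all _ fun y => ?_)).le h2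
    simp only [Pi.sub_apply, Pi.smul_apply', Pi.mul_apply, smul_eq_mul]
    rw [sub_mul, norm_sub_rev]
  rw [e1, e2 fun y => G y v]
  have mG : MemLp (fun y => G y v) 2 (volume.restrict K) :=
    (h.memLp_grad hU hK hsU).continuousLinearMap_comp (ContinuousLinearMap.apply ℝ ℝ v)
  have mw : ∀ n, MemLp (fun y => fderiv ℝ (w n) y v) 2 (volume.restrict K) := fun n =>
    (((h.continuousOn_fderiv hU n).mono hsU).memLp_two hK).continuousLinearMap_comp
      (ContinuousLinearMap.apply ℝ ℝ v)
  have l1 := lim u w _ (h.memLp hK hsU)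
    (fun n => ((h.contDiffOn n).continuousOn.mono hsU).memLp_two hK) mχ' (h.lim K hK hsU)
  have l2 := lim _ (fun n y => fderiv ℝ (w n) y v) _ mG mw mχ (by
    have h1 := ENNReal.Tendsto.const_mul (h.lim_grad K hK hsU)
      (Or.inr (ENNReal.ofReal_ne_top (r := ‖v‖)))
    rw [mul_zero] at h1
    refine tendsto_of_tendsto_of_tendsto_of_le_of_le tendsto_const_nhds h1 (fun _ => bot_le)
      fun n => eLpNorm_smul_le_of_bound hK.measurableSet fun y _ => ?_
    rw [mul_comm]
    exact (G y - fderiv ℝ (w n) y).le_opNorm v)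
  refine tendsto_nhds_unique l1 ?_
  simp_rw [key]
  exact l2.neg

/-- The weak differential is unique. -/
lemma H1Lim.grad_ae_eq (h : H1Lim U u G w) (h' : H1Lim U u' G' w') (hU : IsOpen U)
    (he : ∀ᵐ y ∂(volume.restrict U), u y = u' y) :
    ∀ᵐ y ∂(volume.restrict U), G y = G' y := by
  set b := Module.finBasis ℝ V
  have hL : ∀ i, LocallyIntegrableOn (fun y => G y (b i) - G' y (b i)) U volume := fun i => by
    rw [locallyIntegrableOn_iff hU.isLocallyClosed]
    intro K hKU hK
    have : IsFiniteMeasure (volume.restrict K) := ⟨by simpa using hK.measure_lt_top⟩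
    have m1 := (h.memLp_grad hU hK hKU).continuousLinearMap_comp
      (ContinuousLinearMap.apply ℝ ℝ (b i))
    have m2 := (h'.memLp_grad hU hK hKU).continuousLinearMap_comp
      (ContinuousLinearMap.apply ℝ ℝ (b i))
    exact (m1.sub m2).integrable one_le_two
  -- Each component of the difference is orthogonal to all test functions, since both differentials
  -- are determined by the same integrals of `u`.
  have key : ∀ i, ∀ᵐ y ∂volume, y ∈ U → G y (b i) - G' y (b i) = 0 := fun i => by
    refine hU.ae_eq_zero_of_integral_contDiff_smul_eq_zero (hL i) fun χ hχ hs hsU => ?_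
    have hχ1 : ContDiff ℝ 1 χ := hχ.of_le (by exact_mod_cast le_top)
    have h1 := h.integral_mul_fderiv hU hχ1 hs hsU (b i)
    have h2 := h'.integral_mul_fderiv hU hχ1 hs hsU (b i)
    have h3 : ∫ y, u y * fderiv ℝ χ y (b i) = ∫ y, u' y * fderiv ℝ χ y (b i) := by
      refine integral_congr_ae ?_
      filter_upwards [(ae_restrict_iff' hU.measurableSet).1 he] with y hy
      by_cases hyU : y ∈ U
      · rw [hy hyU]
      · rw [image_eq_zero_of_notMem_tsupport fun h => hyU (hsU (tsupport_fderiv_subset ℝ h))]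
        simp
    have hi : ∀ (G : V → V →L[ℝ] ℝ), MemLp G 2 (volume.restrict (tsupport χ)) →
        Integrable (fun y => G y (b i) * χ y) volume := fun G hG => by
      rw [← integrableOn_iff_integrable_of_support_subset (s := tsupport χ) fun y hy => by
        by_contra hyK
        exact hy (by simp [image_eq_zero_of_notMem_tsupport hyK])]
      exact (hG.continuousLinearMap_comp (ContinuousLinearMap.apply ℝ ℝ (b i))).integrable_mul
        (hχ1.continuous.continuousOn.memLp_two hs)
    have i1 := hi G (h.memLp_grad hU hs hsU)
    have i2 := hi G' (h'.memLp_grad hU hs hsU)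
    have h4 : ∀ y, χ y • (G y (b i) - G' y (b i)) = G y (b i) * χ y - G' y (b i) * χ y :=
      fun y => by rw [smul_eq_mul]; ring
    simp_rw [h4]
    rw [integral_sub i1 i2]
    linarith
  rw [ae_restrict_iff' hU.measurableSet]
  filter_upwards [ae_all_iff.2 key] with y hy hyU
  have := b.ext (f₁ := (G y : V →ₗ[ℝ] ℝ)) (f₂ := (G' y : V →ₗ[ℝ] ℝ))
    fun i => sub_eq_zero.1 (hy i hyU)
  exact ContinuousLinearMap.coe_injective this

end LocalSobolev

/-! ### `L_2` estimates for translates, and averaged oscillation -/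

section Translation

variable {V : Type*} [NormedAddCommGroup V] [NormedSpace ℝ V] [FiniteDimensional ℝ V]
  [MeasureSpace V] [BorelSpace V] [(volume : Measure V).IsAddHaarMeasure]
  {Y : Type*} [NormedAddCommGroup Y]

lemma ennreal_add_sq_le (a b : ℝ≥0∞) : (a + b) ^ 2 ≤ 2 * (a ^ 2 + b ^ 2) := by
  rcases eq_or_ne a ⊤ with rfl | ha
  · simp
  rcases eq_or_ne b ⊤ with rfl | hb
  · simp
  lift a to ℝ≥0 using ha
  lift b to ℝ≥0 using hb
  have : (a + b) ^ 2 ≤ 2 * (a ^ 2 + b ^ 2) := add_sq_le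
  exact_mod_cast this

/-- The difference is the integral of the derivative along the segment from `y` to `y + h`; the
square of this mean is at most the mean of the squares, and Tonelli's theorem exchanges the
integrals. Each translate `K + t h` lies in `K'`. -/
lemma eLpNorm_translate_sub_le_of_contDiffOn {w : V → ℝ} {U K K' : Set V} (hU : IsOpen U)
    (hw : ContDiffOn ℝ 1 w U) (hK : MeasurableSet K) (hK' : MeasurableSet K') (hKU : K' ⊆ U) {h : V}
    (hh : ∀ y ∈ K, ∀ t ∈ Icc (0 : ℝ) 1, y + t • h ∈ K') :
    eLpNorm (fun y => w (y + h) - w y) 2 (volume.restrict K) ≤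
      ‖h‖ₑ * eLpNorm (fderiv ℝ w) 2 (volume.restrict K') := by
  refine eLpNorm_two_le_of_sq_le ?_
  set I : Measure ℝ := volume.restrict (Ioc 0 1)
  have : IsProbabilityMeasure I := ⟨by simp [I]⟩
  have hD : Measurable (fderiv ℝ w) := measurable_fderiv ℝ w
  have hDc := hw.continuousOn_fderiv_of_isOpen hU le_rfl
  have h1 : ∀ y ∈ K, ‖w (y + h) - w y‖ₑ ^ 2 ≤
      ∫⁻ t, ‖h‖ₑ ^ 2 * ‖fderiv ℝ w (y + t • h)‖ₑ ^ 2 ∂I := fun y hy => by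
    have hc : ContinuousOn (fun t : ℝ => fderiv ℝ w (y + t • h) h) (Icc 0 1) :=
      (hDc.comp (by fun_prop) fun t ht => hKU (hh y hy t ht)).clm_apply continuousOn_const
    have hi : ∫ t in (0 : ℝ)..1, fderiv ℝ w (y + t • h) h = w (y + (1 : ℝ) • h) - w (y + (0 : ℝ) • h) := by
      refine intervalIntegral.integral_eq_sub_of_hasDerivAt (f := fun t : ℝ => w (y + t • h))
        (fun t ht => ?_) ?_
      · rw [uIcc_of_le zero_le_one] at ht
        have hd := ((hw.contDiffAt (hU.mem_nhds (hKU (hh y hy t ht)))).differentiableAt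
          one_ne_zero).hasFDerivAt
        have hl : HasDerivAt (fun t : ℝ => y + t • h) h t := by
          simpa using ((hasDerivAt_id t).smul_const h).const_add y
        exact hd.comp_hasDerivAt t hl
      · exact (hc.mono (by rw [uIcc_of_le zero_le_one])).intervalIntegrable
    rw [one_smul, zero_smul, add_zero, intervalIntegral.integral_of_le zero_le_one] at hi
    have hm : AEStronglyMeasurable (fun t : ℝ => fderiv ℝ w (y + t • h) h) I :=
      (hc.mono Ioc_subset_Icc_self).aestronglyMeasurable measurableSet_Ioc
    have h2 : ‖w (y + h) - w y‖ₑ ≤ eLpNorm (fun t : ℝ => fderiv ℝ w (y + t • h) h) 2 I := by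
      rw [← hi]
      refine (enorm_integral_le_lintegral_enorm _).trans ?_
      rw [← eLpNorm_one_eq_lintegral_enorm]
      exact eLpNorm_le_eLpNorm_of_exponent_le one_le_two hm
    calc ‖w (y + h) - w y‖ₑ ^ 2 ≤ eLpNorm (fun t : ℝ => fderiv ℝ w (y + t • h) h) 2 I ^ 2 := by
          gcongr
      _ = ∫⁻ t, ‖fderiv ℝ w (y + t • h) h‖ₑ ^ 2 ∂I := eLpNorm_two_sq _ _
      _ ≤ _ := by
        refine lintegral_mono fun t => ?_
        rw [← mul_pow, mul_comm]
        gcongr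
        exact ContinuousLinearMap.le_opENorm _ _
  calc ∫⁻ y in K, ‖w (y + h) - w y‖ₑ ^ 2
      ≤ ∫⁻ y in K, (∫⁻ t, ‖h‖ₑ ^ 2 * ‖fderiv ℝ w (y + t • h)‖ₑ ^ 2 ∂I) := setLIntegral_mono' hK h1
    _ = ∫⁻ t, (∫⁻ y in K, ‖h‖ₑ ^ 2 * ‖fderiv ℝ w (y + t • h)‖ₑ ^ 2) ∂I := by
        refine lintegral_lintegral_swap (Measurable.aemeasurable ?_)
        have : Measurable (fun p : V × ℝ => p.1 + p.2 • h) := by fun_prop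
        exact ((hD.comp this).enorm.pow_const 2).const_mul _
    _ ≤ ∫⁻ _, ‖h‖ₑ ^ 2 * eLpNorm (fderiv ℝ w) 2 (volume.restrict K') ^ 2 ∂I := by
        refine setLIntegral_mono' measurableSet_Ioc fun t ht => ?_
        rw [lintegral_const_mul' _ _ (by simp), ← eLpNorm_two_sq (fun y => fderiv ℝ w (y + t • h))]
        gcongr
        exact eLpNorm_comp_add_right_le (fderiv ℝ w) (t • h) hK'
          fun y hy => hh y hy t (Ioc_subset_Icc_self ht)
    _ = _ := by rw [lintegral_const, measure_univ, mul_one, mul_pow]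

lemma H1Lim.eLpNorm_translate_sub_le {U : Set V} {u : V → ℝ} {G : V → V →L[ℝ] ℝ}
    {w : ℕ → V → ℝ} (H : H1Lim U u G w) (hU : IsOpen U) {K K' : Set V} (hK : IsCompact K)
    (hK' : IsCompact K') (hKU : K' ⊆ U) {h : V}
    (hh : ∀ y ∈ K, ∀ t ∈ Icc (0 : ℝ) 1, y + t • h ∈ K') :
    eLpNorm (fun y => u (y + h) - u y) 2 (volume.restrict K) ≤
      ‖h‖ₑ * eLpNorm G 2 (volume.restrict K') := by
  have hKK : K ⊆ K' := fun y hy => by simpa using hh y hy 0 (by simp)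
  have hKh : ∀ y ∈ K, y + h ∈ K' := fun y hy => by simpa using hh y hy 1 (by simp)
  have l1 := H.lim K' hK' hKU
  have l2 := H.lim_grad K' hK' hKU
  -- The bound for the `n`-th approximant: two errors from replacing `u` and its translate by `w n`,
  -- and one from the gradient. All three vanish in the limit.
  have l3 := (l1.add l1).add (ENNReal.Tendsto.const_mul
    ((tendsto_const_nhds (x := eLpNorm G 2 (volume.restrict K'))).add l2)
    (Or.inr (enorm_ne_top (x := h))))
  simp only [add_zero, zero_add] at l3
  refine ge_of_tendsto' l3 fun n => ?_
  have mw := ((H.contDiffOn n).continuousOn.mono hKU).memLp_two hK'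
  have md := ((H.continuousOn_fderiv hU n).mono hKU).memLp_two hK'
  have m0 : AEStronglyMeasurable (fun y => u y - w n y) (volume.restrict K') :=
    (H.meas.mono_set hKU).sub mw.1
  have b1 : eLpNorm (fun y => u (y + h) - w n (y + h)) 2 (volume.restrict K) ≤
      eLpNorm (fun y => u y - w n y) 2 (volume.restrict K') :=
    eLpNorm_comp_add_right_le (fun y => u y - w n y) h hK'.measurableSet hKh
  have b2 : eLpNorm (fun y => u y - w n y) 2 (volume.restrict K) ≤
      eLpNorm (fun y => u y - w n y) 2 (volume.restrict K') :=
    eLpNorm_mono_measure _ (Measure.restrict_mono hKK le_rfl)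
  have b3 := eLpNorm_translate_sub_le_of_contDiffOn hU (H.contDiffOn n) hK.measurableSet
    hK'.measurableSet hKU hh
  have b4 : eLpNorm (fderiv ℝ (w n)) 2 (volume.restrict K') ≤ eLpNorm G 2 (volume.restrict K') +
      eLpNorm (fun y => G y - fderiv ℝ (w n) y) 2 (volume.restrict K') := by
    have : fderiv ℝ (w n) = G - fun y => G y - fderiv ℝ (w n) y := by ext y : 1; simp
    conv_lhs => rw [this]
    exact eLpNorm_sub_le (H.meas_grad.mono_set hKU) ((H.meas_grad.mono_set hKU).sub md.1) one_le_two
  have mt : ∀ {f : V → ℝ}, AEStronglyMeasurable f (volume.restrict K') →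
      AEStronglyMeasurable (fun y => f (y + h)) (volume.restrict K) := fun hf =>
    (aestronglyMeasurable_comp_add_right h hK'.measurableSet hf).mono_set hKh
  have e1 : (fun y => u (y + h) - u y) = ((fun y => u (y + h) - w n (y + h)) -
      (fun y => u y - w n y)) + fun y => w n (y + h) - w n y := by
    ext y; simp only [Pi.add_apply, Pi.sub_apply]; ring
  rw [e1]
  refine (eLpNorm_add_le ((mt m0).sub (m0.mono_set hKK))
    ((mt mw.1).sub (mw.1.mono_set hKK)) one_le_two).trans ?_
  refine add_le_add ((eLpNorm_sub_le (mt m0) (m0.mono_set hKK) one_le_two).trans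
    (add_le_add b1 b2)) (b3.trans ?_)
  gcongr

/-- The square of the oscillation of `G` at `p`, averaged over a set of displacements. -/
def osc (G : V → Y) (b : Set V) (p : V) : ℝ≥0∞ := ∫⁻ η in b, ‖G (p + η) - G p‖ₑ ^ 2

lemma measurable_osc_kernel {G : V → Y} (hG : StronglyMeasurable G) :
    Measurable (fun z : V × V => ‖G (z.1 + z.2) - G z.1‖ₑ ^ 2) := by
  have h1 : StronglyMeasurable (fun z : V × V => G (z.1 + z.2)) :=
    hG.comp_measurable (measurable_fst.add measurable_snd)
  have h2 : StronglyMeasurable (fun z : V × V => G z.1) := hG.comp_measurable measurable_fst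
  exact (h1.sub h2).enorm.pow_const 2

lemma measurable_osc {G : V → Y} (hG : StronglyMeasurable G) (b : Set V) : Measurable (osc G b) :=
  Measurable.lintegral_prod_right' (measurable_osc_kernel hG)

lemma lintegral_osc_le {G : V → Y} (hG : StronglyMeasurable G) {b D : Set V} (hb : MeasurableSet b)
    {R : ℝ≥0∞} (hR : ∀ η ∈ b, ∫⁻ p in D, ‖G (p + η) - G p‖ₑ ^ 2 ≤ R) :
    ∫⁻ p in D, osc G b p ≤ R * volume b := by
  unfold osc
  rw [lintegral_lintegral_swap (measurable_osc_kernel hG).aemeasurable]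
  calc ∫⁻ η in b, (∫⁻ p in D, ‖G (p + η) - G p‖ₑ ^ 2) ≤ ∫⁻ _ in b, R :=
        setLIntegral_mono' hb hR
    _ = _ := by simp

/-- Both values are compared with `G (p + η)` and the result is integrated over small `η`. Seen from
`q`, the displacement is `η + (p - q)`, hence the larger radius. A difference at two arbitrary
points is thus bounded by quantities depending on one point each. -/
lemma measure_mul_sub_sq_le_osc {G : V → Y} (hG : StronglyMeasurable G) {p q : V} {s s' : ℝ}
    (hs : s + ‖q - p‖ ≤ s') :
    volume (Metric.closedBall (0 : V) s) * ‖G q - G p‖ₑ ^ 2 ≤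
      2 * (osc G (Metric.closedBall 0 s') q + osc G (Metric.closedBall 0 s') p) := by
  set b := Metric.closedBall (0 : V) s
  set b' := Metric.closedBall (0 : V) s'
  have hb'm : MeasurableSet b' := Metric.isClosed_closedBall.measurableSet
  have hbb : b ⊆ b' := Metric.closedBall_subset_closedBall (by linarith [norm_nonneg (q - p)])
  have h1 : ∀ η, ‖G q - G p‖ₑ ^ 2 ≤
      2 * (‖G (q + (η + (p - q))) - G q‖ₑ ^ 2 + ‖G (p + η) - G p‖ₑ ^ 2) := fun η => by
    have h2 : G q - G p = -(G (q + (η + (p - q))) - G q) + (G (p + η) - G p) := by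
      have : q + (η + (p - q)) = p + η := by abel
      rw [this]; abel
    have h3 : ‖G q - G p‖ₑ ≤ ‖G (q + (η + (p - q))) - G q‖ₑ + ‖G (p + η) - G p‖ₑ := by
      rw [h2]
      refine (enorm_add_le _ _).trans ?_
      rw [enorm_neg]
    calc ‖G q - G p‖ₑ ^ 2 ≤ (‖G (q + (η + (p - q))) - G q‖ₑ + ‖G (p + η) - G p‖ₑ) ^ 2 := by
          gcongr
      _ ≤ _ := ennreal_add_sq_le _ _
  have hm : ∀ q, Measurable (fun η => ‖G (q + η) - G q‖ₑ ^ 2) := fun q =>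
    ((hG.comp_measurable (measurable_const_add q)).sub stronglyMeasurable_const).enorm.pow_const 2
  have h4 : ∫⁻ η in b, ‖G (q + (η + (p - q))) - G q‖ₑ ^ 2 ≤ osc G b' q := by
    have h5 := ((measurePreserving_add_right (volume : Measure V) (p - q)).restrict_preimage
      hb'm).lintegral_comp (hm q)
    unfold osc
    rw [← h5]
    refine lintegral_mono_set fun η hη => ?_
    have h6 : ‖η‖ ≤ s := by simpa [b] using hη
    have h7 : ‖η + (p - q)‖ ≤ s' := by
      refine (norm_add_le _ _).trans ?_
      rw [norm_sub_rev p q]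
      linarith
    exact mem_closedBall_zero_iff.2 h7
  have h8 : ∫⁻ η in b, ‖G (p + η) - G p‖ₑ ^ 2 ≤ osc G b' p := lintegral_mono_set hbb
  calc volume b * ‖G q - G p‖ₑ ^ 2 = ∫⁻ _ in b, ‖G q - G p‖ₑ ^ 2 := by
        rw [lintegral_const, Measure.restrict_apply_univ, mul_comm]
    _ ≤ ∫⁻ η in b, 2 * (‖G (q + (η + (p - q))) - G q‖ₑ ^ 2 + ‖G (p + η) - G p‖ₑ ^ 2) :=
        lintegral_mono h1
    _ = 2 * ((∫⁻ η in b, ‖G (q + (η + (p - q))) - G q‖ₑ ^ 2) +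
          ∫⁻ η in b, ‖G (p + η) - G p‖ₑ ^ 2) := by
        rw [lintegral_const_mul' _ _ (by simp), lintegral_add_right _ (hm p)]
    _ ≤ _ := by gcongr

/-- `L_2` moduli of continuity are stable under composition with a bi-Lipschitz map. -/
lemma lintegral_comp_sub_le {G : V → Y} (hG : StronglyMeasurable G) {τ : V → V} {B D : Set V}
    {h : V} (hh : h ≠ 0) {L : ℝ} (hL : 0 ≤ L) {c R : ℝ≥0∞} (hB : MeasurableSet B)
    (hτ : AEMeasurable τ (volume.restrict B))
    (hc : ∀ f : V → ℝ≥0∞, ∫⁻ y in B, f (τ y) ≤ c * ∫⁻ p in D, f p)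
    (hc' : ∀ f : V → ℝ≥0∞, ∫⁻ y in B, f (τ (y + h)) ≤ c * ∫⁻ p in D, f p)
    (hlip : ∀ y ∈ B, ‖τ (y + h) - τ y‖ ≤ L * ‖h‖)
    (hR : ∀ η : V, ‖η‖ ≤ (L + 1) * ‖h‖ → ∫⁻ p in D, ‖G (p + η) - G p‖ₑ ^ 2 ≤ R) :
    ∫⁻ y in B, ‖G (τ (y + h)) - G (τ y)‖ₑ ^ 2 ≤
      4 * ENNReal.ofReal ((L + 1) ^ Module.finrank ℝ V) * (c * R) := by
  have hs : 0 < ‖h‖ := norm_pos_iff.2 hh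
  set b := Metric.closedBall (0 : V) ‖h‖
  set b' := Metric.closedBall (0 : V) ((L + 1) * ‖h‖)
  -- The ratio of the volumes does not depend on `h`, so the final division by `volume b` costs only
  -- a constant.
  have hvol : volume b' = ENNReal.ofReal ((L + 1) ^ Module.finrank ℝ V) * volume b :=
    Measure.addHaar_closedBall_mul (volume : Measure V) 0 (by positivity) hs.le
  have hb0 : volume b ≠ 0 := (Metric.measure_closedBall_pos _ _ hs).ne'
  have hbt : volume b ≠ ⊤ := measure_closedBall_lt_top.ne
  have hΦ : ∫⁻ p in D, osc G b' p ≤ R * volume b' :=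
    lintegral_osc_le hG Metric.isClosed_closedBall.measurableSet
      fun η hη => hR η (mem_closedBall_zero_iff.1 hη)
  -- The vector `τ (y + h) - τ y` varies with `y`, so `hR` cannot be applied to it directly.
  -- Averaging over balls replaces it by displacements independent of `y`.
  have hpt : ∀ y ∈ B, volume b * ‖G (τ (y + h)) - G (τ y)‖ₑ ^ 2 ≤
      2 * (osc G b' (τ (y + h)) + osc G b' (τ y)) := fun y hy =>
    measure_mul_sub_sq_le_osc hG (by linarith [hlip y hy])
  have hint : volume b * ∫⁻ y in B, ‖G (τ (y + h)) - G (τ y)‖ₑ ^ 2 ≤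
      volume b * (4 * ENNReal.ofReal ((L + 1) ^ Module.finrank ℝ V) * (c * R)) := by
    rw [← lintegral_const_mul' _ _ hbt]
    calc ∫⁻ y in B, volume b * ‖G (τ (y + h)) - G (τ y)‖ₑ ^ 2
        ≤ ∫⁻ y in B, 2 * (osc G b' (τ (y + h)) + osc G b' (τ y)) := setLIntegral_mono' hB hpt
      _ = 2 * ((∫⁻ y in B, osc G b' (τ (y + h))) + ∫⁻ y in B, osc G b' (τ y)) := by
          rw [lintegral_const_mul' _ _ (by simp), lintegral_add_right']
          exact (measurable_osc hG b').comp_aemeasurable hτ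
      _ ≤ 2 * (c * (R * volume b') + c * (R * volume b')) := by
          gcongr
          · exact (hc' (osc G b')).trans (by gcongr)
          · exact (hc (osc G b')).trans (by gcongr)
      _ = _ := by rw [hvol]; ring
  exact (ENNReal.mul_le_mul_iff_right hb0 hbt).1 hint

end Translation

/-! ### The norm of `H^1_0(Ω)` as an integral over the manifold, and its control of gradients -/

section Energy

variable {d : ℕ} {M : Type*} [TopologicalSpace M] [ChartedSpace (E d) M]
  [MeasurableSpace M] [IsManifold (𝓡 d) 1 M] [BorelSpace M] {g : Metric d M} {μ : Measure M}
  {e : Chart d M} {Ω : Set M} {u : M → ℝ} {θ : ∀ x : M, Cot d x}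
  {φ : ℕ → M → ℝ} {F : ℕ → M → ℝ≥0∞}

lemma Approx.h1Lim (h : Approx g μ Ω u θ φ F) (S : Geom g μ) (he : IsC11Chart e) :
    H1Lim e.target (fun y => u (e.symm y)) (cgrad e θ) (fun n => φ n ∘ e.symm) :=
  ⟨fun n => (h.test n).contDiffOn he, S.aestronglyMeasurable_comp_symm he h.memLp.1,
    S.aestronglyMeasurable_cgrad he h.isH10Diff, fun _ hK hKt => h.tendsto_chart S he hK hKt,
    fun _ hK hKt => h.tendsto_chart_fderiv S he hK hKt⟩

lemma IsH10Diff.exists_h1Lim (h : IsH10Diff g μ Ω u θ) (S : Geom g μ) (he : IsC11Chart e) :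
    ∃ w, H1Lim e.target (fun y => u (e.symm y)) (cgrad e θ) w := by
  obtain ⟨φ, F, h⟩ := h.exists_approx
  exact ⟨_, h.h1Lim S he⟩

lemma h10Diff_spec (u : H10 g μ Ω) : IsH10Diff g μ Ω u (h10Diff u) := Classical.choose_spec u.2

lemma IsH10Diff.ae_eq_zero (h : IsH10Diff g μ Ω u θ) : ∀ᵐ x ∂μ, x ∉ Ω → u x = 0 := by
  obtain ⟨φ, F, h⟩ := h.exists_approx
  have hm : ∀ n, AEMeasurable (fun x => ‖u x - φ n x‖ₑ ^ 2) μ := fun n =>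
    (h.memLp.1.sub ((h.test n).aestronglyMeasurable μ)).enorm.pow_const 2
  obtain ⟨k, -, hk⟩ := exists_subseq_ae_tendsto_zero hm (tendsto_eLpNorm_two_zero_iff.1 h.tendsto)
  filter_upwards [hk] with x hx hxΩ
  have h0 : ∀ n, φ n x = 0 := fun n =>
    image_eq_zero_of_notMem_tsupport fun hx => hxΩ ((h.test n).2 hx)
  simp only [h0, sub_zero] at hx
  simpa using tendsto_nhds_unique tendsto_const_nhds hx

lemma diff_eq_zero {φ : M → ℝ} {x : M} (hx : x ∉ tsupport φ) :
    diff (d := d) φ x = 0 := by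
  have h1 : φ =ᶠ[𝓝 x] fun _ => 0 := notMem_tsupport_iff_eventuallyEq.1 hx
  exact h1.mfderiv_eq.trans mfderiv_const

/-- The differentials of the test functions vanish outside `Ω`. Hence the integral over `Ω` in
`h10Norm` may be taken over all of `M`. -/
lemma IsH10Diff.ae_cometric_eq_zero (h : IsH10Diff g μ Ω u θ) :
    ∀ᵐ x ∂μ, x ∉ Ω → cometric g x (θ x) (θ x) = 0 := by
  obtain ⟨φ, F, h⟩ := h.exists_approx
  obtain ⟨k, -, hk⟩ := exists_subseq_ae_tendsto_zero h.meas h.tendsto_F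
  filter_upwards [hk, ae_all_iff.2 h.le] with x hx hle hxΩ
  have h0 : ∀ n, θ x - diff (φ n) x = θ x := fun n => by
    rw [diff_eq_zero fun hx => hxΩ ((h.test n).2 hx)]
    exact sub_zero (θ x : Du d)
  have h1 : ENNReal.ofReal (cometric g x (θ x) (θ x)) ≤ 0 := by
    refine ge_of_tendsto' hx fun n => ?_
    have := hle (k n)
    rwa [h0] at this
  exact le_antisymm (ENNReal.ofReal_eq_zero.1 (le_antisymm h1 bot_le)) (cometric_self_nonneg g x _)

lemma aestronglyMeasurable_bilin_apply {X V : Type*} [MeasurableSpace X] [NormedAddCommGroup V]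
    [NormedSpace ℝ V] {ν : Measure X} {b : X → V →L[ℝ] V →L[ℝ] ℝ} {P Q : X → V}
    (hb : AEStronglyMeasurable b ν) (hP : AEStronglyMeasurable P ν)
    (hQ : AEStronglyMeasurable Q ν) : AEStronglyMeasurable (fun x => b x (P x) (Q x)) ν := by
  have h : Continuous fun p : (V →L[ℝ] V →L[ℝ] ℝ) × V × V => p.1 p.2.1 p.2.2 :=
    (continuous_fst.clm_apply (continuous_fst.comp continuous_snd)).clm_apply
      (continuous_snd.comp continuous_snd)
  exact h.comp_aestronglyMeasurable (hb.prodMk (hP.prodMk hQ))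

lemma Geom.aestronglyMeasurable_cometric_source (S : Geom g μ) (he : IsC11Chart e)
    (h : IsH10Diff g μ Ω u θ) :
    AEStronglyMeasurable (fun x => cometric g x (θ x) (θ x)) (μ.restrict e.source) := by
  have h1 : AEStronglyMeasurable (fun y => qch g e y (cgrad e θ y) (cgrad e θ y))
      (volume.restrict e.target) := by
    have h2 : AEStronglyMeasurable (qch g e) (volume.restrict e.target) :=
      (he.continuousOn_qch S.c11 S.lip).aestronglyMeasurable (measurableSet_target e)
    have h3 := S.aestronglyMeasurable_cgrad he h
    exact aestronglyMeasurable_bilin_apply h2 h3 h3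
  refine (S.aestronglyMeasurable_comp_chart he h1).congr ?_
  filter_upwards [ae_restrict_mem e.open_source.measurableSet] with x hx
  have := he.cometric_eq g (e.map_source hx) θ θ
  rw [e.left_inv hx] at this
  exact this.symm

lemma aestronglyMeasurable_of_charts [CompactSpace M] {Y : Type*} [TopologicalSpace Y]
    [TopologicalSpace.PseudoMetrizableSpace Y] {f : M → Y}
    (h : ∀ e ∈ atlas (E d) M, AEStronglyMeasurable f (μ.restrict e.source)) :
    AEStronglyMeasurable f μ := by
  obtain ⟨t, -, ht⟩ := isCompact_univ.elim_nhds_subcover (fun x : M => (chartAt (E d) x).source)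
    fun x _ => (chartAt (E d) x).open_source.mem_nhds (mem_chart_source _ _)
  have h1 : AEStronglyMeasurable f (μ.restrict (⋃ x : t, (chartAt (E d) (x : M)).source)) :=
    aestronglyMeasurable_iUnion_iff.2 fun x => h _ (chart_mem_atlas _ _)
  have h2 : (⋃ x : t, (chartAt (E d) (x : M)).source) = univ := by
    refine eq_univ_of_univ_subset (ht.trans ?_)
    rw [iUnion_subtype]
  rwa [h2, Measure.restrict_univ] at h1

lemma Geom.aestronglyMeasurable_cometric [CompactSpace M] (S : Geom g μ)
    (h : IsH10Diff g μ Ω u θ) : AEStronglyMeasurable (fun x => cometric g x (θ x) (θ x)) μ :=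
  aestronglyMeasurable_of_charts fun e he => S.aestronglyMeasurable_cometric_source (S.c11 e he) h

lemma measurableSet_source_inter_preimage (e : Chart d M) {K : Set (E d)} (hK : MeasurableSet K) :
    MeasurableSet (e.source ∩ e ⁻¹' K) := by
  have h := e.continuousOn.domRestrict.measurable hK
  have h2 := e.open_source.measurableSet.subtype_image h
  convert h2 using 1
  ext x
  simp [and_comm]

/-- Integrals over the part of the manifold with coordinates in a compact set are controlled by
integrals over that set. -/
lemma Geom.exists_lintegral_preimage_le (S : Geom g μ) (he : IsC11Chart e) {K : Set (E d)}
    (hK : IsCompact K) (hKt : K ⊆ e.target) :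
    ∃ C : ℝ≥0, ∀ f : M → ℝ≥0∞, AEMeasurable f (μ.restrict e.source) →
      ∫⁻ x in e.source ∩ e ⁻¹' K, f x ∂μ ≤ C * ∫⁻ y in K, f (e.symm y) := by
  obtain ⟨c, C, hc, hC, H⟩ := S.rho_bounds he hK hKt
  refine ⟨C.toNNReal, fun f hf => ?_⟩
  have hm := measurableSet_source_inter_preimage e hK.measurableSet
  have h1 : ∫⁻ x in e.source ∩ e ⁻¹' K, f x ∂μ =
      ∫⁻ x in e.source, (e.source ∩ e ⁻¹' K).indicator f x ∂μ := by
    rw [lintegral_indicator hm, Measure.restrict_restrict hm, inter_eq_left.2 inter_subset_left]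
  rw [h1, S.lintegral_source he (hf.indicator hm), ← lintegral_const_mul' _ _ ENNReal.coe_ne_top]
  have h2 : ∀ y ∈ e.target, ENNReal.ofReal (rho g e y) *
      (e.source ∩ e ⁻¹' K).indicator f (e.symm y) ≤
        K.indicator (fun y => ENNReal.ofReal C * f (e.symm y)) y := fun y hy => by
    by_cases hyK : y ∈ K
    · rw [indicator_of_mem hyK, indicator_of_mem (show e.symm y ∈ e.source ∩ e ⁻¹' K from
        ⟨e.map_target hy, by simpa [e.right_inv hy]⟩)]
      gcongr
      exact (H y hyK).2
    · rw [indicator_of_notMem hyK, indicator_of_notMem fun h => hyK (by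
        simpa [e.right_inv hy] using h.2), mul_zero]
  refine (setLIntegral_mono' (measurableSet_target e) h2).trans ?_
  rw [lintegral_indicator hK.measurableSet]
  exact lintegral_mono' (Measure.restrict_mono_measure Measure.restrict_le_self _) le_rfl

lemma preimage_mem_nhds {x : M} (hx : x ∈ e.source) {K : Set (E d)} (hK : K ∈ 𝓝 (e x)) :
    e.source ∩ e ⁻¹' K ∈ 𝓝 x :=
  inter_mem (e.open_source.mem_nhds hx) (e.continuousAt hx hK)

lemma exists_closedBall_subset (e : Chart d M) {x : M} (hx : x ∈ e.source) :
    ∃ r > 0, Metric.closedBall (e x) r ⊆ e.target :=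
  Metric.nhds_basis_closedBall.mem_iff.1 (e.open_target.mem_nhds (e.map_source hx))

/-- Without this the integral in `h10Norm` could have its default value 0 and control nothing.
Finiteness is a local matter on the compact `M`, once the integral is read as the mass of a measure
with density. -/
lemma Geom.lintegral_cometric_lt_top [CompactSpace M] (S : Geom g μ) (h : IsH10Diff g μ Ω u θ) :
    ∫⁻ x, ENNReal.ofReal (cometric g x (θ x) (θ x)) ∂μ < ⊤ := by
  rw [← setLIntegral_univ, ← withDensity_apply _ MeasurableSet.univ]
  refine isCompact_univ.measure_lt_top_of_nhdsWithin fun x _ => ?_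
  set e := chartAt (E d) x
  have hx : x ∈ e.source := mem_chart_source _ _
  have he : IsC11Chart e := S.c11 _ (chart_mem_atlas _ _)
  obtain ⟨r, hr, hrt⟩ := exists_closedBall_subset e hx
  have hK := isCompact_closedBall (e x) r
  obtain ⟨C, hC⟩ := S.exists_lintegral_preimage_le he hK hrt
  obtain ⟨_, c, _, hc, H⟩ := S.cometric_bounds he hK hrt
  obtain ⟨w, hw⟩ := h.exists_h1Lim S he
  have hm := measurableSet_source_inter_preimage e hK.measurableSet
  refine ⟨e.source ∩ e ⁻¹' Metric.closedBall (e x) r, mem_nhdsWithin_of_mem_nhds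
    (preimage_mem_nhds hx (Metric.closedBall_mem_nhds _ hr)), ?_⟩
  rw [withDensity_apply _ hm]
  refine (hC _ (S.aestronglyMeasurable_cometric_source he h).aemeasurable.ennreal_ofReal).trans_lt
    (ENNReal.mul_lt_top ENNReal.coe_lt_top ?_)
  have h1 : ∫⁻ y in Metric.closedBall (e x) r,
      ENNReal.ofReal (cometric g (e.symm y) (θ (e.symm y)) (θ (e.symm y))) ≤
      ∫⁻ y in Metric.closedBall (e x) r, ENNReal.ofReal c * ‖cgrad e θ y‖ₑ ^ 2 := by
    refine setLIntegral_mono' hK.measurableSet fun y hy => ?_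
    rw [enorm_sq_eq_ofReal, ← ENNReal.ofReal_mul hc.le]
    exact ENNReal.ofReal_le_ofReal (H y hy θ).2
  refine h1.trans_lt ?_
  rw [lintegral_const_mul' _ _ ENNReal.ofReal_ne_top, ← eLpNorm_two_sq]
  exact ENNReal.mul_lt_top ENNReal.ofReal_lt_top
    (ENNReal.pow_lt_top (hw.memLp_grad e.open_target hK hrt).2)

lemma h10Norm_nonneg (u : H10 g μ Ω) : 0 ≤ h10Norm u := Real.sqrt_nonneg _

lemma Geom.lintegral_cometric_eq [CompactSpace M] (S : Geom g μ)
    (u : H10 g μ Ω) :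
    ∫⁻ x, ENNReal.ofReal (cometric g x (h10Diff u x) (h10Diff u x)) ∂μ =
      ENNReal.ofReal (h10Norm u) ^ 2 := by
  have h := h10Diff_spec u
  have hm := S.aestronglyMeasurable_cometric h
  have hi : Integrable (fun x => cometric g x (h10Diff u x) (h10Diff u x)) μ := by
    refine ⟨hm, ?_⟩
    rw [hasFiniteIntegral_iff_ofReal (ae_of_all _ fun x => cometric_self_nonneg g x _)]
    exact S.lintegral_cometric_lt_top h
  rw [← ofReal_integral_eq_lintegral_ofReal hi (ae_of_all _ fun x => cometric_self_nonneg g x _),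
    ← ENNReal.ofReal_pow (h10Norm_nonneg u), h10Norm, Real.sq_sqrt
    (integral_nonneg fun x => cometric_self_nonneg g x _),
    setIntegral_eq_integral_of_ae_compl_eq_zero h.ae_cometric_eq_zero]

lemma Geom.exists_eLpNorm_cgrad_le [CompactSpace M] (S : Geom g μ)
    (he : IsC11Chart e) {K : Set (E d)} (hK : IsCompact K) (hKt : K ⊆ e.target) :
    ∃ C : ℝ≥0, ∀ u : H10 g μ Ω, eLpNorm (cgrad e (h10Diff u)) 2 (volume.restrict K) ≤
      C * ENNReal.ofReal (h10Norm u) := by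
  obtain ⟨C, hC⟩ := S.exists_lintegral_le he hK hKt
  obtain ⟨c, _, hc, _, H⟩ := S.cometric_bounds he hK hKt
  refine ⟨NNReal.sqrt (c.toNNReal * C), fun u => eLpNorm_two_le_of_sq_le ?_⟩
  have h1 : ∫⁻ y in K, ‖cgrad e (h10Diff u) y‖ₑ ^ 2 ≤ ∫⁻ y in K, ENNReal.ofReal c *
      ENNReal.ofReal (cometric g (e.symm y) (h10Diff u (e.symm y)) (h10Diff u (e.symm y))) := by
    refine setLIntegral_mono' hK.measurableSet fun y hy => ?_
    rw [enorm_sq_eq_ofReal, ← ENNReal.ofReal_mul hc.le]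
    exact ENNReal.ofReal_le_ofReal (H y hy _).1
  have h2 := hC (fun x => ENNReal.ofReal (cometric g x (h10Diff u x) (h10Diff u x)))
    (S.aestronglyMeasurable_cometric (h10Diff_spec u)).aemeasurable.ennreal_ofReal
  have h3 := h2.trans (mul_le_mul_right (setLIntegral_le_lintegral _ _) (C : ℝ≥0∞))
  rw [S.lintegral_cometric_eq] at h3
  refine h1.trans ?_
  rw [lintegral_const_mul' _ _ ENNReal.ofReal_ne_top, mul_pow, ← ENNReal.coe_pow, NNReal.sq_sqrt,
    ENNReal.coe_mul, mul_assoc]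
  exact mul_le_mul_right h3 _

end Energy

/-! ### A Poincaré inequality by connectedness -/

section Poincare

variable {d : ℕ} {M : Type*} [TopologicalSpace M] [CompactSpace M] [ChartedSpace (E d) M]
  [MeasurableSpace M] [IsManifold (𝓡 d) 1 M] [BorelSpace M] {g : Metric d M} {μ : Measure M}
  {e : Chart d M} {Ω : Set M}

/-- The `L_2` norm over a neighbourhood of `x` is controlled by the norm of `H^1_0(Ω)`. -/
def PoincareAt (g : Metric d M) (μ : Measure M) (Ω : Set M) (x : M) : Prop :=
  ∃ N ∈ 𝓝 x, ∃ C : ℝ≥0, ∀ u : H10 g μ Ω,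
    eLpNorm (u : M → ℝ) 2 (μ.restrict N) ≤ C * ENNReal.ofReal (h10Norm u)

/-- A point `z` close to `x` has the property. Translation by `e z - e x` takes a small ball around
`e x` into the good neighbourhood of `z`, and the change of `u` under this translation is controlled
by its gradient. -/
lemma Geom.poincareAt_of_mem_closure (S : Geom g μ) {x : M}
    (hx : x ∈ closure {x | PoincareAt g μ Ω x}) : PoincareAt g μ Ω x := by
  set e := chartAt (E d) x
  have hxs : x ∈ e.source := mem_chart_source _ _
  have he : IsC11Chart e := S.c11 _ (chart_mem_atlas _ _)
  obtain ⟨r, hr, hrt⟩ := exists_closedBall_subset e hxs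
  obtain ⟨z, ⟨hzs, hzb⟩, N₀, hN₀, C, hC⟩ := mem_closure_iff_nhds.1 hx _
    (preimage_mem_nhds hxs (Metric.ball_mem_nhds (e x) (half_pos hr)))
  have hzb' : dist (e z) (e x) < r / 2 := hzb
  obtain ⟨N, hNN, hNo, hzN⟩ := mem_nhds_iff.1 hN₀
  have hN := hNo.mem_nhds hzN
  have h1 : e.target ∩ e.symm ⁻¹' N ∈ 𝓝 (e z) := inter_mem (e.open_target.mem_nhds (e.map_source hzs))
    (e.continuousAt_symm (e.map_source hzs) (by rwa [e.left_inv hzs]))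
  obtain ⟨s, hs, hsN⟩ := Metric.nhds_basis_closedBall.mem_iff.1 h1
  -- The bound `s` keeps the ball around `e z` in the good neighbourhood; `r / 2` keeps the segments
  -- joining the two balls in the ball of radius `r`.
  set t := min s (r / 2)
  have ht : 0 < t := lt_min hs (half_pos hr)
  set B := Metric.closedBall (e x) t
  set B' := Metric.closedBall (e z) t
  set K := Metric.closedBall (e x) r
  have hB : IsCompact B := isCompact_closedBall _ _
  have hB' : IsCompact B' := isCompact_closedBall _ _
  have hK : IsCompact K := isCompact_closedBall _ _
  have hBt : B ⊆ e.target := (Metric.closedBall_subset_closedBall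
    ((min_le_right _ _).trans (by linarith))).trans hrt
  have hB'N : B' ⊆ e.target ∩ e.symm ⁻¹' N :=
    (Metric.closedBall_subset_closedBall (min_le_left _ _)).trans hsN
  have hB't : B' ⊆ e.target := fun y hy => (hB'N hy).1
  obtain ⟨C1, h1⟩ := S.exists_lintegral_preimage_le he hB hBt
  obtain ⟨C2, h2⟩ := S.exists_lintegral_le he hB' hB't
  obtain ⟨C3, h3⟩ := S.exists_eLpNorm_cgrad_le he hK hrt
  refine ⟨e.source ∩ e ⁻¹' B, preimage_mem_nhds hxs (Metric.closedBall_mem_nhds _ ht),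
    NNReal.sqrt C1 * (NNReal.sqrt C2 * C + ‖e z - e x‖₊ * C3), fun u => ?_⟩
  have hu := h10Diff_spec u
  obtain ⟨w, hw⟩ := hu.exists_h1Lim S he
  have hm : AEStronglyMeasurable (u : M → ℝ) μ := hu.1.1
  set f : E d → ℝ := fun y => (u : M → ℝ) (e.symm y)
  have hBh : ∀ y ∈ B, y + (e z - e x) ∈ B' := fun y hy => by
    have : dist y (e x) ≤ t := hy
    rw [dist_eq_norm] at this
    rw [mem_closedBall_iff_norm]
    convert this using 2; abel
  have b1 : eLpNorm f 2 (volume.restrict B') ≤ NNReal.sqrt C2 * (C * ENNReal.ofReal (h10Norm u)) := by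
    refine eLpNorm_two_le_of_sq_le ?_
    have h4 : ∫⁻ y in B', ‖f y‖ₑ ^ 2 ≤ C2 * ∫⁻ x in N, ‖(u : M → ℝ) x‖ₑ ^ 2 ∂μ := by
      have h5 : ∫⁻ y in B', ‖f y‖ₑ ^ 2 =
          ∫⁻ y in B', N.indicator (fun x => ‖(u : M → ℝ) x‖ₑ ^ 2) (e.symm y) :=
        setLIntegral_congr_fun hB'.measurableSet fun y hy => by
          rw [indicator_of_mem (show e.symm y ∈ N from (hB'N hy).2)]
      rw [h5, ← lintegral_indicator hNo.measurableSet]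
      exact (h2 _ ((hm.enorm.pow_const 2).indicator hNo.measurableSet)).trans
        (mul_le_mul_right (setLIntegral_le_lintegral _ _) _)
    refine h4.trans ?_
    rw [← eLpNorm_two_sq, mul_pow, ← ENNReal.coe_pow, NNReal.sq_sqrt]
    gcongr
    exact (eLpNorm_mono_measure _ (Measure.restrict_mono_set _ hNN)).trans (hC u)
  have b2 : eLpNorm f 2 (volume.restrict B) ≤ eLpNorm f 2 (volume.restrict B') +
      ‖e z - e x‖₊ * (C3 * ENNReal.ofReal (h10Norm u)) := by
    have m1 : AEStronglyMeasurable (fun y => f (y + (e z - e x))) (volume.restrict B) :=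
      (aestronglyMeasurable_comp_add_right (e z - e x) hB'.measurableSet
        (hw.meas.mono_set hB't)).mono_set hBh
    have e1 : f = (fun y => f (y + (e z - e x))) - fun y => f (y + (e z - e x)) - f y := by
      ext y; simp
    conv_lhs => rw [e1]
    refine (eLpNorm_sub_le m1 (m1.sub (hw.meas.mono_set hBt)) one_le_two).trans ?_
    refine add_le_add (eLpNorm_comp_add_right_le f _ hB'.measurableSet hBh) ?_
    refine (hw.eLpNorm_translate_sub_le e.open_target hB hK hrt fun y hy a ha => ?_).trans ?_
    · have h5 : dist y (e x) ≤ t := hy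
      rw [dist_eq_norm] at h5 hzb'
      rw [mem_closedBall_iff_norm]
      have h6 : ‖a • (e z - e x)‖ ≤ ‖e z - e x‖ := by
        rw [norm_smul, Real.norm_of_nonneg ha.1]
        exact mul_le_of_le_one_left (norm_nonneg _) ha.2
      have h7 : t ≤ r / 2 := min_le_right _ _
      calc ‖y + a • (e z - e x) - e x‖ = ‖(y - e x) + a • (e z - e x)‖ := by congr 1; abel
        _ ≤ ‖y - e x‖ + ‖a • (e z - e x)‖ := norm_add_le _ _
        _ ≤ r := by linarith
    · exact mul_le_mul_right (h3 u) _
  refine eLpNorm_two_le_of_sq_le ?_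
  have h8 := h1 (fun x => ‖(u : M → ℝ) x‖ₑ ^ 2) (hm.restrict.enorm.pow_const 2)
  refine h8.trans ?_
  rw [← eLpNorm_two_sq f, ENNReal.coe_mul, mul_assoc, mul_pow, ← ENNReal.coe_pow, NNReal.sq_sqrt]
  gcongr
  refine b2.trans ((add_le_add b1 le_rfl).trans_eq ?_)
  push_cast
  ring

end Poincare

section Poincare

variable {d : ℕ} {M : Type*} [TopologicalSpace M] [CompactSpace M] [ChartedSpace (E d) M]
  [MeasurableSpace M] [IsManifold (𝓡 d) 1 M] [BorelSpace M] {g : Metric d M} {μ : Measure M}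
  {e : Chart d M} {Ω : Set M}

lemma poincareAt_of_notMem_closure {x : M} (hx : x ∉ closure Ω) : PoincareAt g μ Ω x := by
  refine ⟨(closure Ω)ᶜ, isClosed_closure.isOpen_compl.mem_nhds hx, 0, fun u => ?_⟩
  have h : (u : M → ℝ) =ᵐ[μ.restrict (closure Ω)ᶜ] 0 := by
    filter_upwards [ae_restrict_of_ae (h10Diff_spec u).ae_eq_zero,
      ae_restrict_mem isClosed_closure.isOpen_compl.measurableSet] with x hx hx'
    exact hx fun h => hx' (subset_closure h)
  rw [eLpNorm_congr_ae h]
  simp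

/-- The set of points with a local inequality is open, closed by `Geom.poincareAt_of_mem_closure`,
and contains the exterior of `Ω`, where `u` vanishes. Connectedness makes it all of `M`, and
compactness gives one constant. -/
lemma Geom.exists_eLpNorm_le_h10Norm [ConnectedSpace M] (S : Geom g μ)
    (hΩ : (closure Ω)ᶜ.Nonempty) :
    ∃ C : ℝ≥0, ∀ u : H10 g μ Ω, eLpNorm (u : M → ℝ) 2 μ ≤ C * ENNReal.ofReal (h10Norm u) := by
  have hclosed : IsClosed {x | PoincareAt g μ Ω x} :=
    isClosed_of_closure_subset fun x hx => S.poincareAt_of_mem_closure hx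
  have hopen : IsOpen {x | PoincareAt g μ Ω x} := isOpen_iff_mem_nhds.2 fun x hx => by
    obtain ⟨N, hN, C, hC⟩ := hx
    filter_upwards [eventually_mem_nhds_iff.2 hN] with y hy using ⟨N, hy, C, hC⟩
  have huniv : {x | PoincareAt g μ Ω x} = univ :=
    IsClopen.eq_univ ⟨hclosed, hopen⟩ (hΩ.mono fun x hx => poincareAt_of_notMem_closure hx)
  have h := (isCompact_univ (X := M)).induction_on (p := fun s => ∃ C : ℝ≥0, ∀ u : H10 g μ Ω,
    eLpNorm (u : M → ℝ) 2 (μ.restrict s) ≤ C * ENNReal.ofReal (h10Norm u))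
    ⟨0, fun u => by simp⟩
    (fun s t hst ⟨C, hC⟩ => ⟨C, fun u =>
      (eLpNorm_mono_measure _ (Measure.restrict_mono_set _ hst)).trans (hC u)⟩)
    (fun s t ⟨C, hC⟩ ⟨C', hC'⟩ => ⟨C + C', fun u => eLpNorm_two_le_of_sq_le ?_⟩)
    (fun x _ => ?_)
  · obtain ⟨C, hC⟩ := h
    exact ⟨C, fun u => by simpa using hC u⟩
  · refine (lintegral_union_le _ _ _).trans ?_
    rw [← eLpNorm_two_sq, ← eLpNorm_two_sq]
    calc _ ≤ (C * ENNReal.ofReal (h10Norm u)) ^ 2 + (C' * ENNReal.ofReal (h10Norm u)) ^ 2 := by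
          gcongr
          · exact hC u
          · exact hC' u
      _ ≤ (C * ENNReal.ofReal (h10Norm u) + C' * ENNReal.ofReal (h10Norm u)) ^ 2 := by
          rw [add_sq, add_right_comm]
          exact le_self_add
      _ = _ := by push_cast; ring
  · have hx : PoincareAt g μ Ω x := huniv.ge (mem_univ x)
    obtain ⟨N, hN, C, hC⟩ := hx
    exact ⟨N, mem_nhdsWithin_of_mem_nhds hN, C, hC⟩

lemma Geom.exists_eLpNorm_chart_le [ConnectedSpace M] (S : Geom g μ) (hΩ : (closure Ω)ᶜ.Nonempty)
    (he : IsC11Chart e) {K : Set (E d)} (hK : IsCompact K) (hKt : K ⊆ e.target) :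
    ∃ C : ℝ≥0, ∀ u : H10 g μ Ω,
      eLpNorm (fun y => (u : M → ℝ) (e.symm y)) 2 (volume.restrict K) ≤
        C * ENNReal.ofReal (h10Norm u) := by
  obtain ⟨C, hC⟩ := S.exists_eLpNorm_le_h10Norm hΩ
  obtain ⟨C', hC'⟩ := S.exists_eLpNorm_le he hK hKt
  refine ⟨C' * C, fun u => (hC' _ (h10Diff_spec u).1.1).trans ?_⟩
  rw [ENNReal.coe_mul, mul_assoc]
  gcongr
  exact hC u

end Poincare

/-! ### Domains below a Hölder graph and the admissible directions -/

section Graph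

variable {d : ℕ} {M : Type*} [TopologicalSpace M] [ChartedSpace (E d) M]
  {e : Chart d M} {Ω : Set M}

/-- Projection onto the hyperplane orthogonal to `ξ`. -/
def hproj (ξ : E d) : E d →L[ℝ] (Submodule.span ℝ {ξ})ᗮ :=
  (Submodule.span ℝ {ξ})ᗮ.orthogonalProjectionOnto

lemma hproj_smul (ξ : E d) (t : ℝ) : hproj ξ (t • ξ) = 0 :=
  Submodule.orthogonalProjectionOnto_orthogonal_apply_eq_zero
    (Submodule.smul_mem _ _ (Submodule.mem_span_singleton_self ξ))

lemma hproj_add_smul (ξ y : E d) (t : ℝ) : hproj ξ (y + t • ξ) = hproj ξ y := by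
  rw [map_add, hproj_smul, add_zero]

lemma norm_hproj_le (ξ y : E d) : ‖hproj ξ y‖ ≤ ‖y‖ :=
  Submodule.norm_orthogonalProjectionOnto_apply_le _ _

lemma inner_add_smul {ξ : E d} (hξ : ‖ξ‖ = 1) (y : E d) (t : ℝ) :
    inner ℝ (y + t • ξ) ξ = inner ℝ y ξ + t := by
  rw [inner_add_left, inner_smul_left, real_inner_self_eq_norm_sq, hξ]
  simp

/-- In the chart `e`, the set `Ω` lies below the graph of `k` over the hyperplane orthogonal
to `ξ`, its boundary on the graph, and `k` is Hölder continuous. -/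
structure GraphChart (e : Chart d M) (Ω : Set M) (γ L : ℝ) (ξ : E d)
    (k : (Submodule.span ℝ {ξ})ᗮ → ℝ) : Prop where
  norm_eq : ‖ξ‖ = 1
  nonneg : 0 ≤ L
  holder : ∀ p q, |k p - k q| ≤ L * ‖p - q‖ ^ γ
  on_graph : ∀ x ∈ e.source ∩ frontier Ω, inner ℝ (e x) ξ = k (hproj ξ (e x))
  below : ∀ x ∈ e.source ∩ Ω, inner ℝ (e x) ξ < k (hproj ξ (e x))

lemma IsHolderBoundary.graphChart {V : Set (Chart d M)} {γ : ℝ} (h : IsHolderBoundary V γ Ω)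
    (he : e ∈ V) : ∃ L ξ k, GraphChart e Ω γ L ξ k := by
  obtain ⟨ξ, hξ, k, ⟨L, hL⟩, h1, h2⟩ := h e he
  refine ⟨max L 0, ξ, k, hξ, le_max_right _ _, fun p q => (hL p q).trans ?_, h1,
    fun x hx => not_le.1 (h2 x hx)⟩
  gcongr
  exact le_max_left _ _

variable {γ L : ℝ} {ξ : E d} {k : (Submodule.span ℝ {ξ})ᗮ → ℝ}

lemma GraphChart.notMem_closure (h : GraphChart e Ω γ L ξ k) {x : M}
    (hx : x ∈ e.source) (hk : k (hproj ξ (e x)) < inner ℝ (e x) ξ) : x ∉ closure Ω := by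
  rw [closure_eq_self_union_frontier]
  rintro (h1 | h1)
  · exact (h.below x ⟨hx, h1⟩).not_gt hk
  · exact (h.on_graph x ⟨hx, h1⟩).not_gt hk

/-- Moving from a boundary point in the direction `ξ` leads above the graph, where there are no
points of the closure of `Ω`. -/
lemma GraphChart.nonempty_compl_closure (h : GraphChart e Ω γ L ξ k) {x : M}
    (hx : x ∈ e.source) (hxf : x ∈ frontier Ω) : (closure Ω)ᶜ.Nonempty := by
  have h1 : Tendsto (fun t : ℝ => e x + t • ξ) (𝓝[>] 0) (𝓝 (e x)) := by
    have : Continuous fun t : ℝ => e x + t • ξ := by fun_prop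
    simpa using (this.tendsto 0).mono_left nhdsWithin_le_nhds
  obtain ⟨t, ht, ht0⟩ := ((h1.eventually (e.open_target.mem_nhds (e.map_source hx))).and
    self_mem_nhdsWithin).exists
  refine ⟨e.symm (e x + t • ξ), h.notMem_closure (e.map_target ht) ?_⟩
  have ht0' : 0 < t := ht0
  rw [e.right_inv ht, hproj_add_smul, inner_add_smul h.norm_eq, ← h.on_graph x ⟨hx, hxf⟩]
  linarith

lemma nonempty_compl_closure [PreconnectedSpace M] {V : Set (Chart d M)} {γ : ℝ}
    (hV : IsC11Atlas V) (hΩ : IsHolderBoundary V γ Ω) (hne : Ω.Nonempty)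
    (hΩM : Ω ≠ univ) : (closure Ω)ᶜ.Nonempty := by
  obtain ⟨x, hx⟩ : (frontier Ω).Nonempty := by
    by_contra h0
    rw [not_nonempty_iff_eq_empty, ← isClopen_iff_frontier_eq_empty] at h0
    exact hΩM (h0.eq_univ hne)
  obtain ⟨e, he, hxe⟩ := hV.2 x
  obtain ⟨L, ξ, k, h⟩ := hΩ.graphChart he
  exact h.nonempty_compl_closure hxe hx

/-- A segment strictly below the graph does not meet the boundary of `Ω`; being connected, it stays
in `Ω` if it starts there. -/
lemma mem_of_segment_below (h : GraphChart e Ω γ L ξ k) (hΩ : IsOpen Ω) {a b : E d}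
    (hab : segment ℝ a b ⊆ e.target) (ha : e.symm a ∈ Ω)
    (hk : ∀ y ∈ segment ℝ a b, inner ℝ y ξ < k (hproj ξ y)) : e.symm b ∈ Ω := by
  have h1 : IsPreconnected (e.symm '' segment ℝ a b) :=
    (convex_segment a b).isPreconnected.image _ (e.continuousOn_symm.mono hab)
  have h2 : e.symm '' segment ℝ a b ⊆ Ω ∪ (closure Ω)ᶜ := by
    rintro _ ⟨y, hy, rfl⟩
    by_cases hy' : e.symm y ∈ Ω
    · exact Or.inl hy'
    · refine Or.inr fun hc => ?_
      have hf : e.symm y ∈ frontier Ω := ⟨hc, by rwa [hΩ.interior_eq]⟩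
      have := h.on_graph _ ⟨e.map_target (hab hy), hf⟩
      rw [e.right_inv (hab hy)] at this
      exact (hk y hy).ne this
  exact h1.subset_left_of_subset_union hΩ isClosed_closure.isOpen_compl
    (disjoint_compl_right.mono_left subset_closure) h2
    ⟨_, mem_image_of_mem _ (left_mem_segment ℝ a b), ha⟩
    (mem_image_of_mem _ (right_mem_segment ℝ a b))

/-- The directions in which `Ω` may be left only through its boundary graph. -/
def cone (ξ : E d) (γ L : ℝ) : Set (E d) := {h | L * ‖hproj ξ h‖ ^ γ ≤ inner ℝ h ξ}

lemma eq_hproj_add (ξ : E d) (hξ : ‖ξ‖ = 1) (y : E d) :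
    y = (hproj ξ y : E d) + (inner ℝ y ξ) • ξ := by
  have h1 := (Submodule.span ℝ {ξ}).starProjection_add_starProjection_orthogonal y
  rw [Submodule.starProjection_unit_singleton ℝ hξ, real_inner_comm] at h1
  conv_lhs => rw [← h1, add_comm]
  rfl

/-- The point `y + v` is joined to `y` by two segments below the graph: a descent along `ξ` by the
height `t` of `v`, then a move orthogonal to `ξ`. The cone condition says that the descent exceeds
any drop of `k` along the second segment. -/
lemma GraphChart.mem_of_add_mem (h : GraphChart e Ω γ L ξ k) (hγ : 0 < γ) (hΩ : IsOpen Ω)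
    {y₀ : E d} {r : ℝ} (hB : Metric.closedBall y₀ (4 * r) ⊆ e.target) {y v : E d}
    (hy : y ∈ Metric.closedBall y₀ (2 * r)) (hv : v ∈ cone ξ γ L) (hvr : ‖v‖ ≤ r)
    (hyv : e.symm (y + v) ∈ Ω) : e.symm y ∈ Ω := by
  have hy' : ‖y - y₀‖ ≤ 2 * r := by simpa [dist_eq_norm] using hy
  set t : ℝ := inner ℝ v ξ
  have ht0 : 0 ≤ t := le_trans (mul_nonneg h.nonneg (by positivity)) hv
  have htv : t ≤ ‖v‖ := (real_inner_le_norm v ξ).trans (by rw [h.norm_eq, mul_one])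
  have hvd : v = (hproj ξ v : E d) + t • ξ := eq_hproj_add ξ h.norm_eq v
  have m0 : y + v ∈ Metric.closedBall y₀ (4 * r) := by
    rw [mem_closedBall_iff_norm]
    calc ‖y + v - y₀‖ = ‖(y - y₀) + v‖ := by congr 1; abel
      _ ≤ _ := norm_add_le _ _
      _ ≤ _ := by linarith [norm_nonneg v]
  have m1 : y + v + (-t) • ξ ∈ Metric.closedBall y₀ (4 * r) := by
    rw [mem_closedBall_iff_norm]
    calc ‖y + v + (-t) • ξ - y₀‖ = ‖(y - y₀) + (v + (-t) • ξ)‖ := by congr 1; abel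
      _ ≤ ‖y - y₀‖ + ‖v + (-t) • ξ‖ := norm_add_le _ _
      _ ≤ ‖y - y₀‖ + (‖v‖ + ‖(-t) • ξ‖) := by gcongr; exact norm_add_le _ _
      _ ≤ _ := by
        rw [norm_smul, h.norm_eq, mul_one, Real.norm_eq_abs, abs_neg, abs_of_nonneg ht0]
        linarith
  have m2 : y ∈ Metric.closedBall y₀ (4 * r) := by
    rw [mem_closedBall_iff_norm]; linarith [norm_nonneg v]
  have b0 : inner ℝ (y + v) ξ < k (hproj ξ (y + v)) := by
    have := h.below _ ⟨e.map_target (hB m0), hyv⟩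
    rwa [e.right_inv (hB m0)] at this
  have hconv := convex_closedBall y₀ (4 * r)
  have s1 : e.symm (y + v + (-t) • ξ) ∈ Ω := by
    refine mem_of_segment_below h hΩ ((hconv.segment_subset m0 m1).trans hB) hyv fun p hp => ?_
    rw [segment_eq_image'] at hp
    obtain ⟨a, ⟨ha0, ha1⟩, rfl⟩ := hp
    have : y + v + a • (y + v + (-t) • ξ - (y + v)) = y + v + (-(a * t)) • ξ := by
      rw [add_sub_cancel_left, smul_smul]; congr 2; ring
    simp only [this]
    rw [inner_add_smul h.norm_eq, hproj_add_smul]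
    nlinarith [mul_nonneg ha0 ht0]
  -- On this segment the height is constantly that of `y + v` minus `t`, while `k` has decreased by
  -- at most `L ‖hproj ξ v‖ ^ γ ≤ t`.
  refine mem_of_segment_below h hΩ ((hconv.segment_subset m1 m2).trans hB) s1 fun p hp => ?_
  rw [segment_eq_image'] at hp
  obtain ⟨a, ⟨ha0, ha1⟩, rfl⟩ := hp
  have e1 : y + v + (-t) • ξ + a • (y - (y + v + (-t) • ξ)) =
      (y + v + (-a) • v) + (-((1 - a) * t)) • ξ := by
    module
  have e2 : hproj ξ (y + v + (-a) • v) = hproj ξ (y + v) - a • hproj ξ v := by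
    rw [map_add, map_smul]; module
  have e3 : inner ℝ (y + v + (-a) • v) ξ = inner ℝ (y + v) ξ - a * t := by
    rw [inner_add_left, inner_smul_left]; simp [t]; ring
  simp only [e1]
  rw [inner_add_smul h.norm_eq, hproj_add_smul, e2, e3]
  have h3 := h.holder (hproj ξ (y + v)) (hproj ξ (y + v) - a • hproj ξ v)
  rw [sub_sub_cancel, norm_smul, Real.norm_of_nonneg ha0] at h3
  have h4 : L * (a * ‖hproj ξ v‖) ^ γ ≤ t := by
    refine le_trans ?_ hv
    have := h.nonneg
    gcongr
    exact mul_le_of_le_one_left (norm_nonneg _) ha1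
  have h5 := (abs_le.1 (h3.trans h4)).2
  linarith

end Graph

/-! ### Cut-off functions -/

section Bump

variable {d : ℕ} {M : Type*} [TopologicalSpace M] [T2Space M] [ChartedSpace (E d) M]
  {e : Chart d M}

lemma isCompact_symm_image (e : Chart d M) {K : Set (E d)} (hK : IsCompact K) (hKt : K ⊆ e.target) :
    IsCompact (e.symm '' K) := hK.image_of_continuousOn (e.continuousOn_symm.mono hKt)

/-- A Euclidean bump function, extended by zero. The extension is regular because the image of the
ball is compact, hence closed in the Hausdorff space `M`. -/
lemma exists_isC11Fun_bump (he : IsC11Chart e) {y₀ : E d} {r : ℝ} (hr : 0 < r)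
    (hB : Metric.closedBall y₀ (2 * r) ⊆ e.target) :
    ∃ φ : M → ℝ, IsC11Fun d φ ∧ (∀ x, 0 ≤ φ x) ∧ (∀ x, φ x ≤ 1) ∧
      (∀ y ∈ Metric.closedBall y₀ r, φ (e.symm y) = 1) ∧
      ∀ x, x ∉ e.symm '' Metric.closedBall y₀ (2 * r) → φ x = 0 := by
  classical
  let b : ContDiffBump y₀ := ⟨r, 2 * r, hr, by linarith⟩
  have hK := isCompact_symm_image e (isCompact_closedBall y₀ (2 * r)) hB
  have hval : ∀ x ∈ e.source, e.source.indicator (fun x => b (e x)) x = b (e x) := fun x hx => by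
    rw [indicator_of_mem hx]
  have h0 : ∀ x, x ∉ e.symm '' Metric.closedBall y₀ (2 * r) →
      e.source.indicator (fun x => b (e x)) x = 0 := fun x hx => by
    by_cases hxs : x ∈ e.source
    · rw [hval x hxs]
      refine b.zero_of_le_dist (le_of_lt (not_le.1 fun hd => hx ⟨e x, hd, e.left_inv hxs⟩))
    · rw [indicator_of_notMem hxs]
  refine ⟨e.source.indicator fun x => b (e x), fun c hc => c11On_of_c11At fun y hy => ?_,
    fun x => indicator_nonneg (fun x _ => b.nonneg) x,
    fun x => indicator_le_self' (fun _ _ => b.nonneg) x |>.trans b.le_one,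
    fun y hy => ?_, h0⟩
  · by_cases hys : c.symm y ∈ e.source
    · have hcc : C11At (e ∘ c.symm) y :=
        (he c hc).2.c11At (c.symm.trans e).open_source (by simp [hy, hys])
      have hb : C11At b ((e ∘ c.symm) y) := b.contDiffAt.c11At
      refine (hb.comp hcc).congr ?_
      filter_upwards [(c.continuousAt_symm hy).eventually (e.open_source.mem_nhds hys)] with z hz
      exact (hval _ hz).symm
    · refine (c11At_const (0 : ℝ) y).congr ?_
      have : (e.symm '' Metric.closedBall y₀ (2 * r))ᶜ ∈ 𝓝 (c.symm y) := by
        refine hK.isClosed.isOpen_compl.mem_nhds ?_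
        rintro ⟨z, hz, hzy⟩
        exact hys (hzy ▸ e.map_target (hB hz))
      filter_upwards [(c.continuousAt_symm hy).eventually this] with z hz
      exact (h0 _ hz).symm
  · have hyt : y ∈ e.target := hB (Metric.closedBall_subset_closedBall (by linarith) hy)
    rw [hval _ (e.map_target hyt), e.right_inv hyt]
    exact b.one_of_mem_closedBall hy

end Bump

/-! ### Elements of `H^1_0(Ω)` built in a single chart -/

section Congr

variable {V : Type*} [NormedAddCommGroup V] [NormedSpace ℝ V] [FiniteDimensional ℝ V]
  [MeasureSpace V] [BorelSpace V] [(volume : Measure V).IsAddHaarMeasure] {U : Set V}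
  {u u' : V → ℝ} {G G' : V → V →L[ℝ] ℝ} {w w' : ℕ → V → ℝ}

lemma H1Lim.congr (h : H1Lim U u G w) (hU : IsOpen U) (hu : ∀ y ∈ U, u y = u' y)
    (hw : ∀ n, ∀ y ∈ U, w n y = w' n y) : H1Lim U u' G w' := by
  have hd : ∀ n, ∀ y ∈ U, fderiv ℝ (w n) y = fderiv ℝ (w' n) y := fun n y hy =>
    Filter.EventuallyEq.fderiv_eq (by filter_upwards [hU.mem_nhds hy] with z hz using hw n z hz)
  refine ⟨fun n => (h.contDiffOn n).congr fun y hy => (hw n y hy).symm, h.meas.congr ?_,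
    h.meas_grad, fun K hK hKU => (h.lim K hK hKU).congr fun n => eLpNorm_congr_ae ?_,
    fun K hK hKU => (h.lim_grad K hK hKU).congr fun n => eLpNorm_congr_ae ?_⟩
  · filter_upwards [ae_restrict_mem hU.measurableSet] with y hy using hu y hy
  · filter_upwards [ae_restrict_mem hK.measurableSet] with y hy
    rw [hu y (hKU hy), hw n y (hKU hy)]
  · filter_upwards [ae_restrict_mem hK.measurableSet] with y hy
    rw [hd n y (hKU hy)]

end Congr

section Chart

variable {d : ℕ} {M : Type*} [TopologicalSpace M] [CompactSpace M] [T2Space M]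
  [ChartedSpace (E d) M] [MeasurableSpace M] [IsManifold (𝓡 d) 1 M] [BorelSpace M]
  {g : Metric d M} {μ : Measure M} {e : Chart d M} {Ω : Set M}

lemma IsC11Chart.cgrad_comp_dch (he : IsC11Chart e) {y : E d} (hy : y ∈ e.target)
    (θ : ∀ x : M, Cot d x) :
    (cgrad e θ y).comp (dch e (e.symm y)) = (θ (e.symm y) : E d →L[ℝ] ℝ) := by
  let Θ : E d →L[ℝ] ℝ := θ (e.symm y)
  change (Θ.comp (dsy e y)).comp (dch e (e.symm y)) = Θ
  have h := he.dsy_dch (e.map_target hy)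
  rw [e.right_inv hy] at h
  rw [ContinuousLinearMap.comp_assoc, h, ContinuousLinearMap.comp_id]

lemma IsC11Chart.eq_of_cgrad_eq (he : IsC11Chart e) {x : M} (hx : x ∈ e.source)
    {θ θ' : ∀ x : M, Cot d x} (h : cgrad e θ (e x) = cgrad e θ' (e x)) : θ x = θ' x := by
  obtain ⟨y, hy, rfl⟩ : ∃ y ∈ e.target, e.symm y = x := ⟨e x, e.map_source hx, e.left_inv hx⟩
  rw [e.right_inv hy] at h
  have h1 := he.cgrad_comp_dch hy θ
  rw [h, he.cgrad_comp_dch hy θ'] at h1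
  exact h1.symm

lemma ae_of_charts {p : M → Prop} (h : ∀ e ∈ atlas (E d) M, ∀ᵐ x ∂(μ.restrict e.source), p x) :
    ∀ᵐ x ∂μ, p x := by
  obtain ⟨t, -, ht⟩ := isCompact_univ.elim_nhds_subcover (fun x : M => (chartAt (E d) x).source)
    fun x _ => (chartAt (E d) x).open_source.mem_nhds (mem_chart_source _ _)
  have h1 : ∀ x ∈ t, ∀ᵐ z ∂μ, z ∈ (chartAt (E d) x).source → p z := fun x _ =>
    (ae_restrict_iff' (chartAt (E d) x).open_source.measurableSet).1 (h _ (chart_mem_atlas _ _))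
  filter_upwards [(Finset.eventually_all t).2 h1] with z hz
  obtain ⟨x, hxt, hzx⟩ := mem_iUnion₂.1 (ht (mem_univ z))
  exact hz x hxt hzx

/-- The field `h10Diff` is an arbitrary choice; uniqueness allows its replacement by an explicit
differential under integrals. -/
lemma IsH10Diff.ae_eq {u : M → ℝ} {θ θ' : ∀ x : M, Cot d x} (h : IsH10Diff g μ Ω u θ)
    (h' : IsH10Diff g μ Ω u θ') (S : Geom g μ) : ∀ᵐ x ∂μ, θ x = θ' x := by
  refine ae_of_charts (d := d) fun e hea => ?_
  have he := S.c11 e hea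
  obtain ⟨w, hw⟩ := h.exists_h1Lim S he
  obtain ⟨w', hw'⟩ := h'.exists_h1Lim S he
  filter_upwards [S.ae_source he (hw.grad_ae_eq hw' e.open_target (ae_of_all _ fun _ => rfl)),
    ae_restrict_mem e.open_source.measurableSet] with x hx hxs
  exact he.eq_of_cgrad_eq hxs hx

lemma Geom.aestronglyMeasurable_extend (S : Geom g μ) (he : IsC11Chart e) {Y : Type*}
    [TopologicalSpace Y] [Zero Y] {f : E d → Y}
    (hf : AEStronglyMeasurable f (volume.restrict e.target)) :
    AEStronglyMeasurable (e.source.indicator fun x => f (e x)) μ :=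
  (aestronglyMeasurable_indicator_iff e.open_source.measurableSet).2
    (S.aestronglyMeasurable_comp_chart he hf)

lemma Geom.exists_lintegral_le_of_eq_zero (S : Geom g μ) (he : IsC11Chart e) {K : Set (E d)}
    (hK : IsCompact K) (hKt : K ⊆ e.target) :
    ∃ C : ℝ≥0, ∀ f : M → ℝ≥0∞, AEMeasurable f μ → (∀ x, x ∉ e.symm '' K → f x = 0) →
      ∫⁻ x, f x ∂μ ≤ C * ∫⁻ y in K, f (e.symm y) := by
  obtain ⟨C, hC⟩ := S.exists_lintegral_preimage_le he hK hKt
  refine ⟨C, fun f hf h0 => le_trans (le_of_eq ?_) (hC f hf.restrict)⟩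
  rw [← lintegral_indicator (measurableSet_source_inter_preimage e hK.measurableSet)]
  congr 1
  ext x
  by_cases hx : x ∈ e.source ∩ e ⁻¹' K
  · rw [indicator_of_mem hx]
  · rw [indicator_of_notMem hx, h0 x]
    rintro ⟨y, hy, rfl⟩
    exact hx ⟨e.map_target (hKt hy), by simpa [e.right_inv (hKt hy)]⟩

variable {K U : Set (E d)} {v : M → ℝ} {H : E d → Du d} {vn : ℕ → M → ℝ}

lemma aestronglyMeasurable_of_chart (S : Geom g μ) (he : IsC11Chart e) (hK : IsCompact K)
    (hKt : K ⊆ e.target) (hv : ∀ x, x ∉ e.symm '' K → v x = 0)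
    (hm : AEStronglyMeasurable (fun y => v (e.symm y)) (volume.restrict K)) :
    AEStronglyMeasurable v μ := by
  have h1 : AEStronglyMeasurable (K.indicator fun y => v (e.symm y)) (volume.restrict e.target) := by
    rw [aestronglyMeasurable_indicator_iff hK.measurableSet, Measure.restrict_restrict
      hK.measurableSet, inter_eq_left.2 hKt]
    exact hm
  refine (S.aestronglyMeasurable_extend he h1).congr (ae_of_all _ fun x => ?_)
  by_cases hx : x ∈ e.symm '' K
  · obtain ⟨y, hy, rfl⟩ := hx
    rw [indicator_of_mem (e.map_target (hKt hy)), e.right_inv (hKt hy), indicator_of_mem hy]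
  · rw [hv x hx]
    by_cases hxs : x ∈ e.source
    · rw [indicator_of_mem hxs, indicator_of_notMem]
      exact fun hxK => hx ⟨e x, hxK, e.left_inv hxs⟩
    · rw [indicator_of_notMem hxs]

open Classical in
/-- The differential on `M` which is `H` in the chart `e` over `K`, and zero elsewhere. -/
def extendDiff (e : Chart d M) (K : Set (E d)) (H : E d → Du d) (x : M) : Cot d x :=
  if x ∈ e.symm '' K then (H (e x)).comp (dch e x) else (0 : Du d)

lemma extendDiff_of_notMem {x : M} (hx : x ∉ e.symm '' K) :
    extendDiff e K H x = (0 : Du d) := if_neg hx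

lemma cgrad_extendDiff (he : IsC11Chart e) (hKt : K ⊆ e.target) {y : E d} (hy : y ∈ K) :
    cgrad e (extendDiff e K H) y = H y := by
  have h : extendDiff e K H (e.symm y) = (H (e (e.symm y))).comp (dch e (e.symm y)) :=
    if_pos (mem_image_of_mem _ hy)
  rw [cgrad, h, e.right_inv (hKt hy)]
  change ((H y).comp (dch e (e.symm y))).comp (dsy e y) = H y
  rw [ContinuousLinearMap.comp_assoc, he.dch_dsy (hKt hy)]
  exact ContinuousLinearMap.comp_id _

lemma diff_eq_zero_of_notMem {K' : Set M} (hK : IsClosed K') (hv : ∀ x, x ∉ K' → v x = 0) {x : M}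
    (hx : x ∉ K') : diff (d := d) v x = 0 :=
  diff_eq_zero fun h => hx (closure_minimal (fun z hz => by
    by_contra h0
    exact hz (hv z h0)) hK h)

/-- The function and its approximants vanish off the image of `K`, where both measures and both
norms are comparable, so convergence in coordinates is convergence on `M`. The majorants demanded by
`IsH10Diff` are multiples of the coordinate norm, measurable because `H` is. -/
lemma isH10Diff_extendDiff (S : Geom g μ) (he : IsC11Chart e) (hK : IsCompact K) (hKU : K ⊆ U)
    (hUt : U ⊆ e.target) (hv : ∀ x, x ∉ e.symm '' K → v x = 0)
    (hvn : ∀ n x, x ∉ e.symm '' K → vn n x = 0) (ht : ∀ n, IsTest d Ω (vn n))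
    (hl : H1Lim U (fun y => v (e.symm y)) H fun n y => vn n (e.symm y)) :
    IsH10Diff g μ Ω v (extendDiff e K H) := by
  have hKt := hKU.trans hUt
  have hKM := (isCompact_symm_image e hK hKt).isClosed
  obtain ⟨C, hC⟩ := S.exists_lintegral_le_of_eq_zero he hK hKt
  obtain ⟨_, c, _, hc, hcb⟩ := S.cometric_bounds he hK hKt
  have hm : AEStronglyMeasurable v μ :=
    aestronglyMeasurable_of_chart S he hK hKt hv (hl.meas.mono_set hKU)
  refine ⟨⟨hm, ?_⟩, vn, fun n => e.source.indicator fun x => K.indicator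
    (fun y => ENNReal.ofReal c * ‖H y - fderiv ℝ (fun y => vn n (e.symm y)) y‖ₑ ^ 2) (e x),
    ht, ?_, fun n => ?_, fun n => ae_of_all _ fun x => ?_, ?_⟩
  · suffices h : eLpNorm v 2 μ ^ 2 < ⊤ from (ENNReal.pow_lt_top_iff.1 h).resolve_right two_ne_zero
    rw [eLpNorm_two_sq]
    refine (hC _ (hm.enorm.pow_const 2) fun x hx => by simp [hv x hx]).trans_lt ?_
    rw [← eLpNorm_two_sq]
    exact ENNReal.mul_lt_top ENNReal.coe_lt_top (ENNReal.pow_lt_top (hl.memLp hK hKU).2)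
  · rw [tendsto_eLpNorm_two_zero_iff]
    have h1 := tendsto_eLpNorm_two_zero_iff.1 (hl.lim K hK hKU)
    have h2 := ENNReal.Tendsto.const_mul h1 (Or.inr ENNReal.coe_ne_top) (a := C)
    rw [mul_zero] at h2
    refine tendsto_of_tendsto_of_tendsto_of_le_of_le tendsto_const_nhds h2 (fun _ => bot_le)
      fun n => hC _ ((hm.sub ((ht n).aestronglyMeasurable μ)).enorm.pow_const 2) fun x hx => ?_
    simp [hv x hx, hvn n x hx]
  · refine (S.aestronglyMeasurable_extend he (AEMeasurable.aestronglyMeasurable ?_)).aemeasurable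
    rw [aemeasurable_indicator_iff hK.measurableSet, Measure.restrict_restrict
      hK.measurableSet, inter_eq_left.2 hKt]
    refine (AEStronglyMeasurable.enorm ?_).pow_const 2 |>.const_mul _
    exact (hl.meas_grad.mono_set hKU).sub
      (((ht n).aestronglyMeasurable_fderiv he).mono_set hKt)
  · dsimp only
    by_cases hx : x ∈ e.symm '' K
    · obtain ⟨y, hy, rfl⟩ := hx
      rw [indicator_of_mem (e.map_target (hKt hy)), e.right_inv (hKt hy), indicator_of_mem hy,
        enorm_sq_eq_ofReal, ← ENNReal.ofReal_mul hc.le]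
      refine ENNReal.ofReal_le_ofReal ?_
      have := (hcb y hy fun x => extendDiff e K H x - diff (vn n) x).2
      rwa [cgrad_sub, cgrad_extendDiff he hKt hy, (ht n).cgrad_eq he (hKt hy)] at this
    · rw [diff_eq_zero_of_notMem hKM (hvn n) hx, extendDiff_of_notMem hx]
      have h1 : (0 : Cot d x) - 0 = 0 := sub_zero _
      refine le_of_eq_of_le (ENNReal.ofReal_eq_zero.2 ?_) zero_le
      exact (congrArg (fun ξ : Cot d x => cometric g x ξ ξ) h1).le.trans (by simp [cometric])
  · have h1 := tendsto_eLpNorm_two_zero_iff.1 (hl.lim_grad K hK hKU)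
    have h2 := ENNReal.Tendsto.const_mul h1 (Or.inr ENNReal.ofReal_ne_top) (a := ENNReal.ofReal c)
    have h3 := ENNReal.Tendsto.const_mul h2 (Or.inr ENNReal.coe_ne_top) (a := C)
    rw [mul_zero, mul_zero] at h3
    refine tendsto_of_tendsto_of_tendsto_of_le_of_le tendsto_const_nhds h3 (fun _ => bot_le)
      fun n => ?_
    refine (hC _ ?_ fun x hx => ?_).trans ?_
    · refine (S.aestronglyMeasurable_extend he (AEMeasurable.aestronglyMeasurable ?_)).aemeasurable
      rw [aemeasurable_indicator_iff hK.measurableSet, Measure.restrict_restrict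
        hK.measurableSet, inter_eq_left.2 hKt]
      refine (AEStronglyMeasurable.enorm ?_).pow_const 2 |>.const_mul _
      exact (hl.meas_grad.mono_set hKU).sub
        (((ht n).aestronglyMeasurable_fderiv he).mono_set hKt)
    · dsimp only
      by_cases hxs : x ∈ e.source
      · rw [indicator_of_mem hxs, indicator_of_notMem]
        exact fun hxK => hx ⟨e x, hxK, e.left_inv hxs⟩
      · rw [indicator_of_notMem hxs]
    · dsimp only
      rw [← lintegral_const_mul' _ _ ENNReal.ofReal_ne_top]
      refine mul_le_mul_right ?_ _
      refine setLIntegral_mono' hK.measurableSet fun y hy => ?_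
      rw [indicator_of_mem (e.map_target (hKt hy)), e.right_inv (hKt hy), indicator_of_mem hy]

end Chart

/-! ### The localized differences `φ (u - u_h)` in `H^1_0(Ω)` -/

section Translate

variable {d : ℕ} {M : Type*} [TopologicalSpace M] [CompactSpace M] [T2Space M]
  [ChartedSpace (E d) M] [MeasurableSpace M] [IsManifold (𝓡 d) 1 M] [BorelSpace M]
  {g : Metric d M} {μ : Measure M} {e : Chart d M} {Ω : Set M} {y₀ : E d} {r : ℝ}

lemma IsC11Fun.contDiffOn {φ : M → ℝ} (hφ : IsC11Fun d φ) (he : IsC11Chart e) :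
    ContDiffOn ℝ 1 (fun y => φ (e.symm y)) e.target :=
  fun _ hy => (hφ.c11At he hy).1.contDiffWithinAt

lemma IsC11Fun.contMDiffAt {φ : M → ℝ} (hφ : IsC11Fun d φ) (x : M)  (hM : IsC11Manifold d M):
    ContMDiffAt (𝓡 d) 𝓘(ℝ, ℝ) 1 φ x := by
  set c := chartAt (E d) x
  have hx : x ∈ c.source := mem_chart_source _ _
  have hc : IsC11Chart c := hM _ (chart_mem_atlas _ _)
  have h1 : ContMDiffAt (𝓡 d) 𝓘(ℝ, ℝ) 1 (φ ∘ c.symm) (c x) :=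
    contMDiffAt_iff_contDiffAt.2 (hφ.c11At hc (c.map_source hx)).1
  refine (h1.comp x (contMDiffAt_of_mem_maximalAtlas hc.mem_maximalAtlas hx)).congr_of_eventuallyEq ?_
  filter_upwards [c.open_source.mem_nhds hx] with z hz
  simp [c.left_inv hz]

lemma translateDiff_symm (e : Chart d M) (φ u : M → ℝ) (h : E d) {y : E d} (hy : y ∈ e.target) :
    translateDiff e φ u h (e.symm y) = φ (e.symm y) * (u (e.symm y) - u (e.symm (y + h))) := by
  rw [translateDiff, e.right_inv hy]

lemma add_mem_closedBall {V : Type*} [SeminormedAddCommGroup V] {y₀ y h : V} {a b : ℝ}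
    (hy : y ∈ Metric.closedBall y₀ a) (hh : ‖h‖ ≤ b) : y + h ∈ Metric.closedBall y₀ (a + b) := by
  rw [mem_closedBall_iff_norm] at hy ⊢
  calc ‖y + h - y₀‖ = ‖(y - y₀) + h‖ := by congr 1; abel
    _ ≤ ‖y - y₀‖ + ‖h‖ := norm_add_le _ _
    _ ≤ a + b := add_le_add hy hh

/-- The support lies in that of `w` together with the set `T` of points of the cut-off ball whose
translates are in the support of `w`. `T` is closed, and `hin` places it in `Ω`. -/
lemma IsTest.translateDiff {φ w : M → ℝ} {h : E d} (hM : IsC11Manifold d M) (he : IsC11Chart e)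
    (hr : 0 < r) (hB : Metric.closedBall y₀ (4 * r) ⊆ e.target) (hh : ‖h‖ ≤ r)
    (hin : ∀ y ∈ Metric.closedBall y₀ (2 * r), e.symm (y + h) ∈ Ω → e.symm y ∈ Ω)
    (hφ : IsC11Fun d φ) (hφ0 : ∀ x, x ∉ e.symm '' Metric.closedBall y₀ (2 * r) → φ x = 0)
    (hw : IsTest d Ω w) : IsTest d Ω (translateDiff e φ w h) := by
  set K := Metric.closedBall y₀ (2 * r)
  have hKt : K ⊆ e.target := (Metric.closedBall_subset_closedBall (by linarith)).trans hB
  have hKh : ∀ y ∈ K, y + h ∈ e.target := fun y hy =>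
    hB (Metric.closedBall_subset_closedBall (by linarith) (add_mem_closedBall hy hh))
  have hKc := isCompact_symm_image e (isCompact_closedBall y₀ (2 * r)) hKt
  have hKM : e.symm '' K ⊆ e.source := by
    rintro _ ⟨y, hy, rfl⟩; exact e.map_target (hKt hy)
  have hKM' : ∀ x ∈ e.symm '' K, e x + h ∈ e.target := by
    rintro _ ⟨y, hy, rfl⟩; rw [e.right_inv (hKt hy)]; exact hKh y hy
  constructor
  · intro x
    by_cases hx : x ∈ e.symm '' K
    · have h1 : ContMDiffAt (𝓡 d) 𝓘(ℝ, ℝ) 1 (fun x => w (e.symm (e x + h))) x := by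
        refine ContMDiffAt.comp x (hw.1 _)
          (ContMDiffAt.comp x (contMDiffAt_symm_of_mem_maximalAtlas he.mem_maximalAtlas (hKM' x hx)) ?_)
        exact ContMDiffAt.comp x (g := fun y : E d => y + h)
          (contMDiffAt_iff_contDiffAt.2 (by fun_prop))
          (contMDiffAt_of_mem_maximalAtlas he.mem_maximalAtlas (hKM hx))
      exact (hφ.contMDiffAt x hM).mul ((hw.1 x).sub h1)
    · refine (contMDiffAt_const (c := (0 : ℝ))).congr_of_eventuallyEq ?_
      filter_upwards [hKc.isClosed.isOpen_compl.mem_nhds hx] with z hz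
      rw [HolderElliptic.translateDiff, hφ0 z hz, zero_mul]
  · set T := e.symm '' K ∩ (fun x => e.symm (e x + h)) ⁻¹' tsupport w
    have hT : IsClosed T := by
      refine ContinuousOn.preimage_isClosed_of_isClosed ?_ hKc.isClosed (isClosed_tsupport w)
      exact e.continuousOn_symm.comp ((e.continuousOn.mono hKM).add continuousOn_const) hKM'
    refine (closure_minimal (t := tsupport w ∪ T) (fun x hx => ?_)
      ((isClosed_tsupport w).union hT)).trans (union_subset hw.2 ?_)
    · by_contra h0
      rw [mem_union, not_or] at h0
      refine hx ?_
      rw [HolderElliptic.translateDiff]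
      by_cases hxK : x ∈ e.symm '' K
      · rw [image_eq_zero_of_notMem_tsupport h0.1,
          image_eq_zero_of_notMem_tsupport fun hm => h0.2 ⟨hxK, hm⟩, sub_zero, mul_zero]
      · rw [hφ0 x hxK, zero_mul]
    · rintro _ ⟨⟨y, hy, rfl⟩, hyw⟩
      refine hin y hy (hw.2 ?_)
      have : e.symm (e (e.symm y) + h) ∈ tsupport w := hyw
      rwa [e.right_inv (hKt hy)] at this

/-- The differential of `φ (u - u_h)` in the chart. -/
def tdGrad (e : Chart d M) (φ u : M → ℝ) (θ : ∀ x : M, Cot d x) (h y : E d) : Du d :=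
  φ (e.symm y) • (cgrad e θ y - cgrad e θ (y + h)) +
    (u (e.symm y) - u (e.symm (y + h))) • fderiv ℝ (fun y => φ (e.symm y)) y

lemma Approx.h1Lim_translateDiff {φ u : M → ℝ} {θ : ∀ x : M, Cot d x} {w : ℕ → M → ℝ}
    {F : ℕ → M → ℝ≥0∞} {h : E d} (ha : Approx g μ Ω u θ w F) (S : Geom g μ) (he : IsC11Chart e)
    (hr : 0 < r) (hB : Metric.closedBall y₀ (4 * r) ⊆ e.target) (hh : ‖h‖ ≤ r)
    (hφ : IsC11Fun d φ) :
    H1Lim (Metric.ball y₀ (3 * r)) (fun y => HolderElliptic.translateDiff e φ u h (e.symm y))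
      (tdGrad e φ u θ h) (fun n y => HolderElliptic.translateDiff e φ (w n) h (e.symm y)) := by
  have hU : IsOpen (Metric.ball y₀ (3 * r)) := Metric.isOpen_ball
  have hUt : Metric.ball y₀ (3 * r) ⊆ e.target :=
    Metric.ball_subset_closedBall.trans ((Metric.closedBall_subset_closedBall (by linarith)).trans hB)
  have h0 := ha.h1Lim S he
  have h1 := h0.mono hUt
  have h2 : H1Lim (Metric.ball y₀ (3 * r)) (fun y => u (e.symm (y + h)))
      (fun y => cgrad e θ (y + h)) (fun n y => w n (e.symm (y + h))) :=
    h0.translate e.open_target fun y hy => hB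
      (Metric.closedBall_subset_closedBall (by linarith)
        (add_mem_closedBall (Metric.ball_subset_closedBall hy) hh))
  refine ((h1.sub h2 hU).mul ((hφ.contDiffOn he).mono hUt) hU).congr hU (fun y hy => ?_)
    fun n y hy => ?_
  · rw [translateDiff_symm _ _ _ _ (hUt hy)]
  · rw [translateDiff_symm _ _ _ _ (hUt hy)]
    rfl

lemma IsH10Diff.translateDiff {φ u : M → ℝ} {θ : ∀ x : M, Cot d x} {h : E d}
    (hu : IsH10Diff g μ Ω u θ) (S : Geom g μ) (he : IsC11Chart e) (hr : 0 < r)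
    (hB : Metric.closedBall y₀ (4 * r) ⊆ e.target) (hh : ‖h‖ ≤ r)
    (hin : ∀ y ∈ Metric.closedBall y₀ (2 * r), e.symm (y + h) ∈ Ω → e.symm y ∈ Ω)
    (hφ : IsC11Fun d φ) (hφ0 : ∀ x, x ∉ e.symm '' Metric.closedBall y₀ (2 * r) → φ x = 0) :
    IsH10Diff g μ Ω (HolderElliptic.translateDiff e φ u h)
      (extendDiff e (Metric.closedBall y₀ (2 * r)) (tdGrad e φ u θ h)) := by
  obtain ⟨w, F, ha⟩ := hu.exists_approx
  refine isH10Diff_extendDiff S he (isCompact_closedBall _ _)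
    (Metric.closedBall_subset_ball (by linarith))
    (Metric.ball_subset_closedBall.trans
      ((Metric.closedBall_subset_closedBall (by linarith)).trans hB))
    (fun x hx => by rw [HolderElliptic.translateDiff, hφ0 x hx, zero_mul])
    (fun n x hx => by rw [HolderElliptic.translateDiff, hφ0 x hx, zero_mul])
    (fun n => (ha.test n).translateDiff S.c11 he hr hB hh hin hφ hφ0)
    (ha.h1Lim_translateDiff S he hr hB hh hφ)

end Translate

/-! ### Uniform Hölder constants on compact sets -/

section Compact

/-- Points closer than a Lebesgue number `δ` of the cover share a neighbourhood with a local
constant. For the others the difference is at most twice the maximum, and `1 ≤ (‖y - z‖ / δ) ^ γ`.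
-/
lemma exists_holder_of_isCompact {X Y : Type*} [NormedAddCommGroup X] [NormedAddCommGroup Y]
    {γ : ℝ} (hγ : 0 < γ) {f : X → Y} {K : Set X} (hK : IsCompact K)
    (hf : ∀ x ∈ K, HolderAt γ f x) :
    ∃ C : ℝ, 0 ≤ C ∧ ∀ y ∈ K, ∀ z ∈ K, ‖f y - f z‖ ≤ C * ‖y - z‖ ^ γ := by
  have hc : ContinuousOn f K := fun x hx => ((hf x hx).continuousAt hγ).continuousWithinAt
  obtain ⟨S, hS⟩ := hK.bddAbove_image hc.norm
  have hS' : ∀ y ∈ K, ‖f y‖ ≤ max S 0 := fun y hy =>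
    (hS (mem_image_of_mem _ hy)).trans (le_max_left _ _)
  choose! C hC t ht H using hf
  obtain ⟨s, hsK, hs⟩ := hK.elim_nhds_subcover (fun x => interior (t x))
    fun x hx => interior_mem_nhds.2 (ht x hx)
  obtain ⟨δ, hδ, hL⟩ := lebesgue_number_lemma_of_metric (c := fun x : s => interior (t x)) hK
    (fun _ => isOpen_interior) (by rwa [iUnion_subtype])
  have hCn : 0 ≤ ∑ x ∈ s, C x := Finset.sum_nonneg fun x hx => hC x (hsK x hx)
  refine ⟨(∑ x ∈ s, C x) + 2 * max S 0 / δ ^ γ, by positivity, fun y hy z hz => ?_⟩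
  rw [add_mul]
  rcases lt_or_ge ‖z - y‖ δ with h | h
  · obtain ⟨⟨x, hx⟩, hxb⟩ := hL y hy
    have h1 := H x (hsK x hx) y (interior_subset (hxb (Metric.mem_ball_self hδ))) z
      (interior_subset (hxb (mem_ball_iff_norm.2 h)))
    have h2 : C x ≤ ∑ x ∈ s, C x :=
      Finset.single_le_sum (fun x hx => hC x (hsK x hx)) hx
    calc _ ≤ C x * ‖y - z‖ ^ γ := h1
      _ ≤ (∑ x ∈ s, C x) * ‖y - z‖ ^ γ := by gcongr
      _ ≤ _ := le_add_of_nonneg_right (by positivity)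
  · rw [norm_sub_rev] at h
    have h1 : 1 ≤ ‖y - z‖ ^ γ / δ ^ γ := by
      rw [le_div_iff₀ (by positivity), one_mul]
      gcongr
    calc ‖f y - f z‖ ≤ ‖f y‖ + ‖f z‖ := norm_sub_le _ _
      _ ≤ 2 * max S 0 := by linarith [hS' y hy, hS' z hz]
      _ ≤ 2 * max S 0 * (‖y - z‖ ^ γ / δ ^ γ) :=
        le_mul_of_one_le_right (by positivity) h1
      _ = 2 * max S 0 / δ ^ γ * ‖y - z‖ ^ γ := by ring
      _ ≤ _ := le_add_of_nonneg_left (by positivity)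

end Compact

/-! ### The energy inequality for difference quotients -/

section Energy

variable {W : Type*} [NormedAddCommGroup W] [NormedSpace ℝ W]

/-- Convexity of the quadratic form: the two sides differ by `t (1 - t) a (v - w) (v - w)`. -/
lemma bilin_convex_le {a : W →L[ℝ] W →L[ℝ] ℝ} (hs : ∀ v w, a v w = a w v) (hp : ∀ v, 0 ≤ a v v)
    {t : ℝ} (h0 : 0 ≤ t) (h1 : t ≤ 1) (v w : W) :
    a ((1 - t) • v + t • w) ((1 - t) • v + t • w) ≤ (1 - t) * a v v + t * a w w := by
  have h2 := hp (v - w)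
  simp only [map_add, map_sub, map_smul, add_apply, sub_apply, smul_apply, smul_eq_mul] at h2 ⊢
  rw [hs w v] at h2 ⊢
  nlinarith [mul_nonneg (mul_nonneg h0 (sub_nonneg.2 h1)) h2]

/-- The square is expanded around `G`, so that `a G H`, the integrand of the weak form, appears
linearly. What remains is the energy of `G - H`, a convex combination of `G` and `G'` up to the
cut-off error `δ • D`. -/
lemma bilin_energy_le {a : W →L[ℝ] W →L[ℝ] ℝ} (hs : ∀ v w, a v w = a w v) (hp : ∀ v, 0 ≤ a v v)
    {Λ Λ' f t δ : ℝ} (hΛ : ‖a‖ ≤ Λ) (h0 : 0 ≤ f) (h1 : f ≤ 1) (ht : 0 < t) (ht1 : t ≤ 1)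
    {D : W} (hD : ‖D‖ ≤ Λ') (G G' : W) {H : W} (hH : H = f • (G - G') + δ • D) :
    a H H ≤ (f * a G' G' - f * a G G) + 2 * a G H +
      (2 * Λ * Λ' + Λ * Λ' ^ 2) * (t * (‖G‖ ^ 2 + ‖G'‖ ^ 2) + t⁻¹ * δ ^ 2) := by
  have hΛ0 : 0 ≤ Λ := (norm_nonneg _).trans hΛ
  have hΛ' : 0 ≤ Λ' := (norm_nonneg _).trans hD
  set P := (1 - f) • G + f • G'
  have hP : G - H = P - δ • D := by rw [hH]; simp only [P]; module
  have e1 : a H H = a (G - H) (G - H) - a G G + 2 * a G H := by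
    simp only [map_sub, sub_apply]; rw [hs H G]; ring
  have e2 : a (G - H) (G - H) = a P P - 2 * δ * a P D + δ ^ 2 * a D D := by
    rw [hP]; simp only [map_sub, map_smul, sub_apply, smul_apply, smul_eq_mul]; rw [hs D P]; ring
  have b1 := bilin_convex_le hs hp h0 h1 G G'
  have nP : ‖P‖ ≤ ‖G‖ + ‖G'‖ := by
    refine (norm_add_le _ _).trans ?_
    rw [norm_smul, norm_smul, Real.norm_of_nonneg h0, Real.norm_of_nonneg (sub_nonneg.2 h1)]
    exact add_le_add (mul_le_of_le_one_left (norm_nonneg _) (by linarith))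
      (mul_le_of_le_one_left (norm_nonneg _) h1)
  have b2 : |a P D| ≤ Λ * (‖G‖ + ‖G'‖) * Λ' :=
    (a.le_opNorm₂ P D).trans (by gcongr)
  have b3 : a D D ≤ Λ * Λ' ^ 2 := by
    refine (le_abs_self _).trans ((a.le_opNorm₂ D D).trans ?_)
    rw [pow_two, mul_assoc]
    gcongr
  -- Young's inequality with weight `t`. With `t = ‖h‖` and the integral of `δ²` of order `‖h‖²`,
  -- both terms become of order `‖h‖`.
  have b4 : 2 * |δ| * (‖G‖ + ‖G'‖) ≤ 2 * (t * (‖G‖ ^ 2 + ‖G'‖ ^ 2) + t⁻¹ * δ ^ 2) := by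
    have e3 : t⁻¹ * δ ^ 2 = t * (t⁻¹ * |δ|) ^ 2 := by
      rw [mul_pow, sq_abs]; field_simp
    have e4 : |δ| = t * (t⁻¹ * |δ|) := by field_simp
    rw [e3]
    conv_lhs => rw [e4]
    nlinarith [mul_nonneg ht.le (sq_nonneg (t⁻¹ * |δ| - ‖G‖)),
      mul_nonneg ht.le (sq_nonneg (t⁻¹ * |δ| - ‖G'‖))]
  have b5 : δ ^ 2 ≤ t * (‖G‖ ^ 2 + ‖G'‖ ^ 2) + t⁻¹ * δ ^ 2 := by
    have : 1 ≤ t⁻¹ := (one_le_inv₀ ht).2 ht1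
    nlinarith [sq_nonneg δ, mul_nonneg ht.le (add_nonneg (sq_nonneg ‖G‖) (sq_nonneg ‖G'‖))]
  have b6 : -(2 * δ * a P D) ≤ 2 * Λ * Λ' * (t * (‖G‖ ^ 2 + ‖G'‖ ^ 2) + t⁻¹ * δ ^ 2) := by
    calc -(2 * δ * a P D) ≤ |2 * δ * a P D| := neg_le_abs _
      _ = 2 * |δ| * |a P D| := by rw [abs_mul, abs_mul, abs_of_pos (two_pos : (0 : ℝ) < 2)]
      _ ≤ 2 * |δ| * (Λ * (‖G‖ + ‖G'‖) * Λ') := by gcongr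
      _ = Λ * Λ' * (2 * |δ| * (‖G‖ + ‖G'‖)) := by ring
      _ ≤ Λ * Λ' * (2 * (t * (‖G‖ ^ 2 + ‖G'‖ ^ 2) + t⁻¹ * δ ^ 2)) := by gcongr
      _ = _ := by ring
  have b7 : δ ^ 2 * a D D ≤ Λ * Λ' ^ 2 * (t * (‖G‖ ^ 2 + ‖G'‖ ^ 2) + t⁻¹ * δ ^ 2) := by
    calc δ ^ 2 * a D D ≤ δ ^ 2 * (Λ * Λ' ^ 2) := by gcongr
      _ = Λ * Λ' ^ 2 * δ ^ 2 := mul_comm _ _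
      _ ≤ _ := by gcongr
  rw [e1, e2]
  linarith

variable {V : Type*} [NormedAddCommGroup V] [NormedSpace ℝ V] [FiniteDimensional ℝ V]
  [MeasureSpace V] [BorelSpace V] [(volume : Measure V).IsAddHaarMeasure]

lemma integrable_bilin {X : Type*} [MeasurableSpace X] {ν : Measure X}
    {m : X → W →L[ℝ] W →L[ℝ] ℝ} {P Q : X → W} {Λ : ℝ} (hm : AEStronglyMeasurable m ν)
    (hb : ∀ᵐ y ∂ν, ‖m y‖ ≤ Λ) (hP : MemLp P 2 ν) (hQ : MemLp Q 2 ν) :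
    Integrable (fun y => m y (P y) (Q y)) ν := by
  have h1 := hP.norm.integrable_mul hQ.norm (p := 2) (q := 2)
  refine (h1.const_mul Λ).mono' (aestronglyMeasurable_bilin_apply hm hP.1 hQ.1) ?_
  filter_upwards [hb] with y hy
  refine ((m y).le_opNorm₂ _ _).trans ?_
  rw [mul_assoc]
  exact mul_le_mul_of_nonneg_right hy (by positivity)

/-- No regularity of `G` is needed: a translation of the variable in the first term moves the
increment from `G` to the coefficient `m`. -/
lemma integral_bilin_shift_le {m : V → W →L[ℝ] W →L[ℝ] ℝ} {G : V → W} {B B' : Set V} {h : V}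
    {Λ ε : ℝ} (hB : MeasurableSet B) (hB' : MeasurableSet B') (hBB : B ⊆ B')
    (hBh : ∀ y ∈ B, y + h ∈ B') (hm : AEStronglyMeasurable m volume)
    (hm0 : ∀ y, y ∉ B → m y = 0) (hb : ∀ y, ‖m y‖ ≤ Λ)
    (hε : ∀ y ∈ B', ‖m (y - h) - m y‖ ≤ ε) (hG : MemLp G 2 (volume.restrict B')) :
    ∫ y in B, (m y (G (y + h)) (G (y + h)) - m y (G y) (G y)) ≤
      ε * ∫ y in B', ‖G y‖ ^ 2 := by
  set G₀ := B'.indicator G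
  have hG0 : MemLp G₀ 2 volume := (memLp_indicator_iff_restrict hB').2 hG
  have hmp : MeasurePreserving (fun y : V => y + h) volume volume :=
    measurePreserving_add_right volume h
  have hmp' : MeasurePreserving (fun y : V => y - h) volume volume :=
    measurePreserving_sub_right volume h
  have hG1 : MemLp (fun y => G₀ (y + h)) 2 volume := hG0.comp_measurePreserving hmp
  have i1 := integrable_bilin hm (ae_of_all _ hb) hG1 hG1
  have i2 := integrable_bilin hm (ae_of_all _ hb) hG0 hG0
  have hm1 : AEStronglyMeasurable (fun y => m (y - h)) volume := hm.comp_measurePreserving hmp'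
  have i3 := integrable_bilin hm1 (ae_of_all _ fun y => hb (y - h)) hG0 hG0
  have e1 : ∫ y in B, (m y (G (y + h)) (G (y + h)) - m y (G y) (G y)) =
      ∫ y, (m y (G₀ (y + h)) (G₀ (y + h)) - m y (G₀ y) (G₀ y)) := by
    rw [← integral_indicator hB]
    congr 1
    ext y
    by_cases hy : y ∈ B
    · rw [indicator_of_mem hy]
      simp only [G₀]
      rw [indicator_of_mem (hBh y hy), indicator_of_mem (hBB hy)]
    · rw [indicator_of_notMem hy, hm0 y hy]
      simp
  have e2 : ∫ y, m y (G₀ (y + h)) (G₀ (y + h)) = ∫ y, m (y - h) (G₀ y) (G₀ y) := by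
    rw [← integral_add_right_eq_self (fun y => m (y - h) (G₀ y) (G₀ y)) h]
    simp
  rw [e1, integral_sub i1 i2, e2, ← integral_sub i3 i2, ← integral_indicator hB',
    ← integral_const_mul]
  have i4 : Integrable (fun y => ‖G₀ y‖ ^ 2) volume := hG0.integrable_norm_pow two_ne_zero
  have e3 : ∀ y, B'.indicator (fun y => ‖G y‖ ^ 2) y = ‖G₀ y‖ ^ 2 := fun y => by
    by_cases hy : y ∈ B'
    · simp only [G₀]; rw [indicator_of_mem hy, indicator_of_mem hy]
    · simp only [G₀]; rw [indicator_of_notMem hy, indicator_of_notMem hy]; simp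
  simp_rw [e3]
  refine integral_mono (i3.sub i2) (i4.const_mul ε) fun y => ?_
  by_cases hy : y ∈ B'
  · calc m (y - h) (G₀ y) (G₀ y) - m y (G₀ y) (G₀ y) = (m (y - h) - m y) (G₀ y) (G₀ y) := by simp
      _ ≤ ‖m (y - h) - m y‖ * ‖G₀ y‖ * ‖G₀ y‖ := (le_abs_self _).trans ((m (y - h) - m y).le_opNorm₂ _ _)
      _ ≤ ε * ‖G₀ y‖ ^ 2 := by
        rw [pow_two, ← mul_assoc]
        gcongr
        exact hε y hy
  · have : G₀ y = 0 := indicator_of_notMem hy _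
    simp [this]

/-- `bilin_energy_le` with `t = ‖h‖`, integrated; the leading difference is handled by
`integral_bilin_shift_le` with the coefficient `f • a`. -/
lemma energy_estimate {a : V → W →L[ℝ] W →L[ℝ] ℝ} {f δ : V → ℝ} {D G H : V → W}
    {B B' : Set V} {h : V} {c Λ Λ' ε X : ℝ} (hB : MeasurableSet B) (hB' : MeasurableSet B')
    (hBB : B ⊆ B') (hBh : ∀ y ∈ B, y + h ∈ B') (h0 : h ≠ 0) (h1 : ‖h‖ ≤ 1)
    (ham : AEStronglyMeasurable a (volume.restrict B)) (haΛ : ∀ y ∈ B, ‖a y‖ ≤ Λ)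
    (has : ∀ y ∈ B, ∀ v w, a y v w = a y w v)
    (hac : ∀ y ∈ B, ∀ v, c * ‖v‖ ^ 2 ≤ a y v v) (hc : 0 ≤ c)
    (hfm : AEStronglyMeasurable f (volume.restrict B)) (hf0 : ∀ y ∈ B, 0 ≤ f y)
    (hf1 : ∀ y ∈ B, f y ≤ 1) (hD : ∀ y ∈ B, ‖D y‖ ≤ Λ')
    (hDm : AEStronglyMeasurable D (volume.restrict B))
    (hG : MemLp G 2 (volume.restrict B')) (hδ : MemLp δ 2 (volume.restrict B))
    (hX : ∫ y in B', ‖G y‖ ^ 2 ≤ X) (hδX : ∫ y in B, δ y ^ 2 ≤ ‖h‖ ^ 2 * X)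
    (hε0 : 0 ≤ ε) (hΛ : 0 ≤ Λ) (hΛ' : 0 ≤ Λ')
    (hε : ∀ y ∈ B', ‖B.indicator (fun y => f y • a y) (y - h) -
      B.indicator (fun y => f y • a y) y‖ ≤ ε)
    (hH : ∀ y ∈ B, H y = f y • (G y - G (y + h)) + δ y • D y) :
    c * ∫ y in B, ‖H y‖ ^ 2 ≤ (ε + 3 * (2 * Λ * Λ' + Λ * Λ' ^ 2) * ‖h‖) * X +
      2 * ∫ y in B, a y (G y) (H y) := by
  have ht : 0 < ‖h‖ := norm_pos_iff.2 h0
  set L := 2 * Λ * Λ' + Λ * Λ' ^ 2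
  have hL : 0 ≤ L := by positivity
  have hGB : MemLp G 2 (volume.restrict B) := hG.mono_measure (Measure.restrict_mono_set _ hBB)
  have hGh : MemLp (fun y => G (y + h)) 2 (volume.restrict B) := by
    have : MemLp (fun y => G (y + h)) 2 (volume.restrict ((fun y => y + h) ⁻¹' B')) :=
      hG.comp_measurePreserving
        ((measurePreserving_add_right (volume : Measure V) h).restrict_preimage hB')
    exact this.mono_measure (Measure.restrict_mono_set _ hBh)
  have hHm : MemLp H 2 (volume.restrict B) := by
    have m1 : MemLp (fun y => f y • (G y - G (y + h))) 2 (volume.restrict B) := by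
      refine (hGB.sub hGh).mono (hfm.smul (hGB.sub hGh).1) ?_
      filter_upwards [ae_restrict_mem hB] with y hy
      rw [norm_smul, Real.norm_of_nonneg (hf0 y hy)]
      exact mul_le_of_le_one_left (norm_nonneg _) (hf1 y hy)
    have m2 : MemLp (fun y => δ y • D y) 2 (volume.restrict B) := by
      refine (hδ.const_mul Λ').mono (hδ.1.smul hDm) ?_
      filter_upwards [ae_restrict_mem hB] with y hy
      rw [norm_smul, norm_mul, Real.norm_of_nonneg hΛ', mul_comm]
      gcongr
      exact hD y hy
    refine (m1.add m2).ae_eq ?_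
    filter_upwards [ae_restrict_mem hB] with y hy using (hH y hy).symm
  have haΛ' : ∀ᵐ y ∂(volume.restrict B), ‖a y‖ ≤ Λ := by
    filter_upwards [ae_restrict_mem hB] with y hy using haΛ y hy
  set m := B.indicator fun y => f y • a y
  have hmm : AEStronglyMeasurable m volume :=
    (aestronglyMeasurable_indicator_iff hB).2 (hfm.smul ham)
  have hmb : ∀ y, ‖m y‖ ≤ Λ := fun y => by
    by_cases hy : y ∈ B
    · simp only [m]
      rw [indicator_of_mem hy, norm_smul, Real.norm_of_nonneg (hf0 y hy)]
      exact (mul_le_of_le_one_left (norm_nonneg _) (hf1 y hy)).trans (haΛ y hy)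
    · simp only [m]; rw [indicator_of_notMem hy, norm_zero]; exact hΛ
  have s1 := integral_bilin_shift_le (Λ := Λ) hB hB' hBB hBh hmm
    (fun y hy => indicator_of_notMem hy _) hmb hε hG
  have i1 : Integrable (fun y => m y (G (y + h)) (G (y + h)) - m y (G y) (G y))
      (volume.restrict B) :=
    (integrable_bilin hmm.restrict (ae_of_all _ hmb) hGh hGh).sub
      (integrable_bilin hmm.restrict (ae_of_all _ hmb) hGB hGB)
  have i2 := integrable_bilin ham haΛ' hGB hHm
  have i3 : Integrable (fun y => ‖G y‖ ^ 2) (volume.restrict B) :=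
    hGB.integrable_norm_pow two_ne_zero
  have i4 : Integrable (fun y => ‖G (y + h)‖ ^ 2) (volume.restrict B) :=
    hGh.integrable_norm_pow two_ne_zero
  have i5 : Integrable (fun y => δ y ^ 2) (volume.restrict B) := hδ.integrable_sq
  have i6 : Integrable (fun y => ‖H y‖ ^ 2) (volume.restrict B) :=
    hHm.integrable_norm_pow two_ne_zero
  have i7 : Integrable (fun y => ‖G y‖ ^ 2) (volume.restrict B') :=
    hG.integrable_norm_pow two_ne_zero
  have p1 : ∫ y in B, ‖G y‖ ^ 2 ≤ X :=
    (setIntegral_mono_set i7 (ae_of_all _ fun y => by positivity)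
      (LE.le.eventuallyLE hBB)).trans hX
  have p2 : ∫ y in B, ‖G (y + h)‖ ^ 2 ≤ X := by
    refine le_trans ?_ hX
    rw [← integral_indicator hB, ← integral_indicator hB',
      ← integral_add_right_eq_self (B'.indicator fun y => ‖G y‖ ^ 2) h]
    refine integral_mono_of_nonneg (ae_of_all _ fun y => indicator_nonneg (fun y _ => by positivity) y)
      ?_ (ae_of_all _ fun y => ?_)
    · exact ((integrable_indicator_iff hB').2 i7).comp_add_right h
    · show _ ≤ B'.indicator (fun y => ‖G y‖ ^ 2) (y + h)
      by_cases hy : y ∈ B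
      · rw [indicator_of_mem hy, indicator_of_mem (hBh y hy)]
      · rw [indicator_of_notMem hy]
        exact indicator_nonneg (fun y _ => by positivity) _
  have key : ∀ y ∈ B, c * ‖H y‖ ^ 2 ≤
      ((m y (G (y + h)) (G (y + h)) - m y (G y) (G y)) + 2 * a y (G y) (H y)) +
      (L * (‖h‖ * (‖G y‖ ^ 2 + ‖G (y + h)‖ ^ 2) + ‖h‖⁻¹ * δ y ^ 2)) := fun y hy => by
    refine (hac y hy _).trans ?_
    have := bilin_energy_le (has y hy) (fun v => le_trans (by positivity) (hac y hy v)) (haΛ y hy)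
      (hf0 y hy) (hf1 y hy) ht h1 (hD y hy) (G y) (G (y + h)) (hH y hy)
    have e : m y = f y • a y := indicator_of_mem hy _
    rw [e]
    simpa only [smul_apply, smul_eq_mul] using this
  have i8 : Integrable (fun y => (m y (G (y + h)) (G (y + h)) - m y (G y) (G y)) +
      2 * a y (G y) (H y)) (volume.restrict B) := i1.add (i2.const_mul 2)
  have i9 : Integrable (fun y => ‖h‖ * (‖G y‖ ^ 2 + ‖G (y + h)‖ ^ 2)) (volume.restrict B) :=
    (i3.add i4).const_mul _
  have i10 : Integrable (fun y => ‖h‖ * (‖G y‖ ^ 2 + ‖G (y + h)‖ ^ 2) + ‖h‖⁻¹ * δ y ^ 2)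
      (volume.restrict B) := i9.add (i5.const_mul _)
  have h2 := setIntegral_mono_on (i6.const_mul c) (i8.add (i10.const_mul L)) hB key
  simp only [Pi.add_apply] at h2
  rw [integral_const_mul, integral_add i8 (i10.const_mul L), integral_add i1 (i2.const_mul 2),
    integral_const_mul, integral_const_mul, integral_add i9 (i5.const_mul _), integral_const_mul,
    integral_const_mul, integral_add i3 i4] at h2
  -- The factor 3 counts the two gradient integrals and that of `δ²`, each contributing at most `‖h‖
  -- * X`.
  have q1 : ‖h‖ * ((∫ y in B, ‖G y‖ ^ 2) + ∫ y in B, ‖G (y + h)‖ ^ 2) + ‖h‖⁻¹ * ∫ y in B, δ y ^ 2 ≤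
      3 * ‖h‖ * X := by
    have : ‖h‖⁻¹ * ∫ y in B, δ y ^ 2 ≤ ‖h‖⁻¹ * (‖h‖ ^ 2 * X) := by gcongr
    have e : ‖h‖⁻¹ * (‖h‖ ^ 2 * X) = ‖h‖ * X := by field_simp
    have := mul_le_mul_of_nonneg_left (add_le_add p1 p2) ht.le
    linarith
  have q2 : ε * ∫ y in B', ‖G y‖ ^ 2 ≤ ε * X := by gcongr
  have q3 := mul_le_mul_of_nonneg_left q1 hL
  have s1' := s1.trans q2
  refine h2.trans (le_trans (add_le_add (add_le_add s1' le_rfl) q3) (le_of_eq ?_))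
  ring

end Energy

lemma ofReal_integral_norm_sq {X Y : Type*} [MeasurableSpace X] [NormedAddCommGroup Y]
    {ν : Measure X} {f : X → Y} (hf : MemLp f 2 ν) :
    ENNReal.ofReal (∫ x, ‖f x‖ ^ 2 ∂ν) = ∫⁻ x, ‖f x‖ₑ ^ 2 ∂ν := by
  rw [ofReal_integral_eq_lintegral_ofReal (hf.integrable_norm_pow two_ne_zero)
    (ae_of_all _ fun x => by positivity)]
  simp_rw [enorm_sq_eq_ofReal]

lemma integral_norm_sq_le {X Y : Type*} [MeasurableSpace X] [NormedAddCommGroup Y]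
    {ν : Measure X} {f : X → Y} (hf : MemLp f 2 ν) {b : ℝ} (hb : 0 ≤ b)
    (h : eLpNorm f 2 ν ≤ ENNReal.ofReal b) : ∫ x, ‖f x‖ ^ 2 ∂ν ≤ b ^ 2 := by
  rw [← ENNReal.ofReal_le_ofReal_iff (by positivity), ofReal_integral_norm_sq hf, ← eLpNorm_two_sq,
    ENNReal.ofReal_pow hb]
  gcongr

/-! ### The principal part in a chart and its energy estimate -/

section Tensor

variable {d : ℕ} {M : Type*} [TopologicalSpace M] [ChartedSpace (E d) M] [IsManifold (𝓡 d) 1 M]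
  {g : Metric d M} {e : Chart d M} {A : Tensor2 d M}

lemma ach_symm (hA : ∀ x (ξ η : Cot d x), A x ξ η = A x η ξ) (y : E d) (G H : Du d) :
    ach A e y G H = ach A e y H G := by
  rw [ach_apply, ach_apply]
  exact hA _ _ _

lemma cgrad_comp_dch (he : IsC11Chart e) {y : E d} (hy : y ∈ e.target) (G : Du d) :
    cgrad e (fun x => (G.comp (dch e x) : Du d)) y = G := by
  change (G.comp (dch e (e.symm y))).comp (dsy e y) = G
  rw [ContinuousLinearMap.comp_assoc, he.dch_dsy hy]
  exact ContinuousLinearMap.comp_id _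

lemma ach_coercive (he : IsC11Chart e) {α : ℝ}
    (hA : ∀ x (ξ : Cot d x), α * cometric g x ξ ξ ≤ A x ξ ξ) {y : E d} (hy : y ∈ e.target)
    (G : Du d) : α * qch g e y G G ≤ ach A e y G G := by
  let θ : ∀ x : M, Cot d x := fun x => (G.comp (dch e x) : Du d)
  have h := hA (e.symm y) (θ (e.symm y))
  rw [he.cometric_eq g hy θ θ, he.ach_cgrad A hy θ θ, cgrad_comp_dch he hy G] at h
  exact h

end Tensor

section Energy

variable {d : ℕ} {M : Type*} [TopologicalSpace M] [CompactSpace M] [T2Space M]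
  [ChartedSpace (E d) M] [MeasurableSpace M] [IsManifold (𝓡 d) 1 M] [BorelSpace M]
  {g : Metric d M} {μ : Measure M} {e : Chart d M} {Ω : Set M} {A : Tensor2 d M} {γ : ℝ}

/-- The coefficients of the principal part of the form `Φ₀` in a chart. -/
def coef (g : Metric d M) (A : Tensor2 d M) (e : Chart d M) (y : E d) : Du d →L[ℝ] Du d →L[ℝ] ℝ :=
  rho g e y • ach A e y

lemma coef_apply (y : E d) (G H : Du d) : coef g A e y G H = rho g e y * ach A e y G H := rfl

lemma holderAt_coef (S : Geom g μ) (he : IsC11Chart e) (hA : CondA2 γ A) {y : E d}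
    (hy : y ∈ e.target) : HolderAt γ (coef g A e) y :=
  HolderAt.smul ((he.holderAt_rho S.c11 S.lip hy).mono hA.2.1 hA.1)
    (he.holderAt_ach S.c11 hA hy) hA.1

lemma continuousOn_coef (S : Geom g μ) (he : IsC11Chart e) (hA : CondA2 γ A) :
    ContinuousOn (coef g A e) e.target := fun _ hy =>
  ((holderAt_coef S he hA hy).continuousAt hA.1).continuousWithinAt

/-- By uniqueness of the weak differential, that of `v` may be taken as `extendDiff`, which vanishes
off the image of `K`; the density is contained in `coef`. -/
lemma Geom.formΦ₀_eq (S : Geom g μ) (he : IsC11Chart e) (hA : CondA2 γ A) {K : Set (E d)}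
    (hK : IsCompact K) (hKt : K ⊆ e.target) {u v : H10 g μ Ω} {H : E d → Du d}
    (hv : IsH10Diff g μ Ω v (extendDiff e K H))
    (hH : AEStronglyMeasurable H (volume.restrict K)) :
    formΦ₀ A u v = ∫ y in K, coef g A e y (cgrad e (h10Diff u) y) (H y) := by
  have hm := measurableSet_source_inter_preimage e hK.measurableSet
  have h1 : formΦ₀ A u v = ∫ x, A x (h10Diff u x) (extendDiff e K H x) ∂μ := by
    refine integral_congr_ae ?_
    filter_upwards [(h10Diff_spec v).ae_eq hv S] with x hx
    rw [hx]
  have h0 : ∀ x, x ∉ e.symm '' K → A x (h10Diff u x) (extendDiff e K H x) = 0 := fun x hx => by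
    rw [extendDiff_of_notMem hx]
    exact map_zero _
  have h2 : ∫ x, A x (h10Diff u x) (extendDiff e K H x) ∂μ =
      ∫ x in e.source, A x (h10Diff u x) (extendDiff e K H x) ∂μ := by
    refine (setIntegral_eq_integral_of_forall_compl_eq_zero fun x hx => h0 x ?_).symm
    rintro ⟨y, hy, rfl⟩
    exact hx (e.map_target (hKt hy))
  have hval : ∀ y ∈ e.target, A (e.symm y) (h10Diff u (e.symm y)) (extendDiff e K H (e.symm y)) =
      ach A e y (cgrad e (h10Diff u) y) (K.indicator H y) := fun y hy => by
    by_cases hyK : y ∈ K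
    · rw [he.ach_cgrad A hy, cgrad_extendDiff he hKt hyK, indicator_of_mem hyK]
    · rw [indicator_of_notMem hyK, map_zero]
      refine h0 _ ?_
      rintro ⟨z, hz, hzy⟩
      exact hyK (e.symm.injOn (hKt hz) hy hzy ▸ hz)
  have hac : ContinuousOn (ach A e) e.target := fun y hy =>
    ((he.holderAt_ach S.c11 hA hy).continuousAt hA.1).continuousWithinAt
  have hHK : AEStronglyMeasurable (K.indicator H) (volume.restrict e.target) := by
    rw [aestronglyMeasurable_indicator_iff hK.measurableSet, Measure.restrict_restrict
      hK.measurableSet, inter_eq_left.2 hKt]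
    exact hH
  have hms : AEStronglyMeasurable (fun x => A x (h10Diff u x) (extendDiff e K H x))
      (μ.restrict e.source) := by
    refine (S.aestronglyMeasurable_comp_chart he (aestronglyMeasurable_bilin_apply
      (hac.aestronglyMeasurable (measurableSet_target e))
      (S.aestronglyMeasurable_cgrad he (h10Diff_spec u)) hHK)).congr ?_
    filter_upwards [ae_restrict_mem e.open_source.measurableSet] with x hx
    rw [← hval _ (e.map_source hx), e.left_inv hx]
  rw [h1, h2, S.integral_source he hms, ← integral_indicator hK.measurableSet,
    ← integral_indicator (measurableSet_target e)]
  congr 1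
  ext y
  by_cases hy : y ∈ K
  · rw [indicator_of_mem hy, indicator_of_mem (hKt hy), hval y (hKt hy), indicator_of_mem hy,
      coef_apply]
  · rw [indicator_of_notMem hy]
    by_cases hyt : y ∈ e.target
    · rw [indicator_of_mem hyt, hval y hyt, indicator_of_notMem hy, map_zero, mul_zero]
    · rw [indicator_of_notMem hyt]

lemma Geom.exists_coef_coercive (S : Geom g μ) (he : IsC11Chart e) (hA : CondA1 g A)
    {K : Set (E d)} (hK : IsCompact K) (hKt : K ⊆ e.target) :
    ∃ c : ℝ, 0 < c ∧ ∀ y ∈ K, ∀ G : Du d, c * ‖G‖ ^ 2 ≤ coef g A e y G G := by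
  obtain ⟨α, hα, hAα⟩ := hA.2
  obtain ⟨c, _, hc, _, Hr⟩ := S.rho_bounds he hK hKt
  obtain ⟨c', _, hc', _, Hq⟩ := S.qch_bounds he hK hKt
  refine ⟨c * (α * c'), by positivity, fun y hy G => ?_⟩
  have h1 := ach_coercive he hAα (hKt hy) G
  have h2 := (Hq y hy G).1
  have h3 := (Hr y hy).1
  rw [coef_apply, mul_assoc]
  have h4 : α * c' * ‖G‖ ^ 2 ≤ ach A e y G G := by
    rw [mul_assoc]
    exact (mul_le_mul_of_nonneg_left h2 hα.le).trans h1
  exact mul_le_mul h3 h4 (by positivity) (hc.le.trans h3)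

/-- `energy_estimate` on nested balls: `φ` lives on radius `2 r`, translates reach `3 r`, and
coefficients are compared on `4 r`. Where `φ = 1` the gradient of the test function is the bare
difference of the gradients of `u`. -/
lemma Geom.exists_energy_estimate (S : Geom g μ) (he : IsC11Chart e) (hA1 : CondA1 g A)
    (hA2 : CondA2 γ A) {y₀ : E d} {r : ℝ} (hr : 0 < r) (hr1 : r ≤ 1)
    (hB : Metric.closedBall y₀ (4 * r) ⊆ e.target) {φ : M → ℝ} (hφ : IsC11Fun d φ)
    (hφ0 : ∀ x, 0 ≤ φ x) (hφ1 : ∀ x, φ x ≤ 1)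
    (hφr : ∀ y ∈ Metric.closedBall y₀ r, φ (e.symm y) = 1)
    (hφs : ∀ x, x ∉ e.symm '' Metric.closedBall y₀ (2 * r) → φ x = 0) :
    ∃ C : ℝ, 0 ≤ C ∧ ∀ (u : H10 g μ Ω) (h : E d), h ≠ 0 → ‖h‖ ≤ r →
      ∀ hz : IsH10Diff g μ Ω (translateDiff e φ u h)
        (extendDiff e (Metric.closedBall y₀ (2 * r)) (tdGrad e φ u (h10Diff u) h)),
      ∫⁻ y in Metric.closedBall y₀ (r / 2),
        ‖cgrad e (h10Diff u) (y + h) - cgrad e (h10Diff u) y‖ₑ ^ 2 ≤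
        ENNReal.ofReal (C * (‖h‖ ^ γ * h10Norm u ^ 2 +
          |formΦ₀ A u ⟨translateDiff e φ u h, _, hz⟩|)) := by
  set B := Metric.closedBall y₀ (2 * r)
  set B' := Metric.closedBall y₀ (3 * r)
  have hBc : IsCompact B := isCompact_closedBall _ _
  have hBc' : IsCompact B' := isCompact_closedBall _ _
  have hBB : B ⊆ B' := Metric.closedBall_subset_closedBall (by linarith)
  have hB't : B' ⊆ e.target := (Metric.closedBall_subset_closedBall (by linarith)).trans hB
  have hBt : B ⊆ e.target := hBB.trans hB't
  set f : E d → ℝ := fun y => φ (e.symm y)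
  have hfc : ContDiffOn ℝ 1 f e.target := hφ.contDiffOn he
  have hfd : ContinuousOn (fderiv ℝ f) e.target :=
    hfc.continuousOn_fderiv_of_isOpen e.open_target le_rfl
  obtain ⟨c, hc, hcoer⟩ := S.exists_coef_coercive he hA1 hBc hBt
  obtain ⟨Λ, hΛ, haΛ⟩ := exists_bilin_le hBc ((continuousOn_coef S he hA2).mono hBt)
  obtain ⟨Λ', hΛ'⟩ := hBc.bddAbove_image (hfd.mono hBt).norm
  obtain ⟨Cm, hCm, hm⟩ := exists_holder_of_isCompact (f := fun y => f y • coef g A e y) hA2.1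
    (isCompact_closedBall y₀ (4 * r)) fun y hy =>
      HolderAt.smul ((hfc.contDiffAt (e.open_target.mem_nhds (hB hy))).holderAt.mono hA2.2.1 hA2.1)
        (holderAt_coef S he hA2 (hB hy)) hA2.1
  obtain ⟨C3, hC3⟩ := S.exists_eLpNorm_cgrad_le (Ω := Ω) he hBc' hB't
  set L := 3 * (2 * Λ * max Λ' 0 + Λ * max Λ' 0 ^ 2)
  have hL : 0 ≤ L := by positivity
  refine ⟨((Cm + L) * C3 ^ 2 + 2) / c, by positivity, fun u h h0 hh hz => ?_⟩
  have hu := h10Diff_spec u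
  obtain ⟨w, hw⟩ := hu.exists_h1Lim S he
  set G := cgrad e (h10Diff u)
  set H := tdGrad e φ u (h10Diff u) h
  set δ : E d → ℝ := fun y => (u : M → ℝ) (e.symm y) - (u : M → ℝ) (e.symm (y + h))
  have hN := h10Norm_nonneg u
  have hGm : MemLp G 2 (volume.restrict B') := hw.memLp_grad e.open_target hBc' hB't
  have hGN : eLpNorm G 2 (volume.restrict B') ≤ ENNReal.ofReal (C3 * h10Norm u) := by
    rw [ENNReal.ofReal_mul C3.coe_nonneg, ENNReal.ofReal_coe_nnreal]
    exact hC3 u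
  have hBh : ∀ y ∈ B, y + h ∈ B' := fun y hy =>
    Metric.closedBall_subset_closedBall (by linarith) (add_mem_closedBall hy hh)
  have huh : MemLp (fun y => (u : M → ℝ) (e.symm (y + h))) 2 (volume.restrict B) := by
    have h1 : MemLp (fun y => (u : M → ℝ) (e.symm y)) 2 (volume.restrict B') := hw.memLp hBc' hB't
    have h2 : MemLp (fun y => (u : M → ℝ) (e.symm (y + h))) 2
        (volume.restrict ((fun y => y + h) ⁻¹' B')) := h1.comp_measurePreserving
      ((measurePreserving_add_right (volume : Measure (E d)) h).restrict_preimage hBc'.measurableSet)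
    exact h2.mono_measure (Measure.restrict_mono_set _ hBh)
  have hδm : MemLp δ 2 (volume.restrict B) := (hw.memLp hBc hBt).sub huh
  have hδN : eLpNorm δ 2 (volume.restrict B) ≤ ENNReal.ofReal (‖h‖ * (C3 * h10Norm u)) := by
    have h1 := hw.eLpNorm_translate_sub_le e.open_target hBc hBc' hB't (h := h) fun y hy t ht =>
      Metric.closedBall_subset_closedBall (by linarith) (add_mem_closedBall hy
        (show ‖t • h‖ ≤ r by
          rw [norm_smul, Real.norm_of_nonneg ht.1]
          exact (mul_le_of_le_one_left (norm_nonneg _) ht.2).trans hh))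
    have h2 : eLpNorm δ 2 (volume.restrict B) = _ := eLpNorm_sub_comm
      (fun y => (u : M → ℝ) (e.symm y)) (fun y => (u : M → ℝ) (e.symm (y + h))) 2 _
    rw [h2, ENNReal.ofReal_mul (norm_nonneg _), ofReal_norm]
    exact h1.trans (mul_le_mul_right hGN _)
  have hHm : AEStronglyMeasurable H (volume.restrict B) := by
    obtain ⟨w', F, ha⟩ := hu.exists_approx
    exact (ha.h1Lim_translateDiff S he hr hB hh hφ).meas_grad.mono_set
      (Metric.closedBall_subset_ball (by linarith))
  -- As `φ` vanishes outside the ball of radius `2 r`, cutting off at its boundary creates no jump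
  -- and the Hölder bound of the product remains valid.
  have hsupp : ∀ y ∈ Metric.closedBall y₀ (4 * r),
      B.indicator (fun y => f y • coef g A e y) y = f y • coef g A e y := fun y hy => by
    by_cases hyB : y ∈ B
    · rw [indicator_of_mem hyB]
    · have : f y = 0 := hφs _ (by
        rintro ⟨z, hz, hzy⟩
        exact hyB (e.symm.injOn (hBt hz) (hB hy) hzy ▸ hz))
      rw [indicator_of_notMem hyB, this]
      exact (zero_smul ℝ (coef g A e y)).symm
  have key := energy_estimate (a := coef g A e) (f := f) (δ := δ) (D := fderiv ℝ f) (G := G)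
    (H := H) (B := B) (B' := B') (h := h) (c := c) (Λ := Λ) (Λ' := max Λ' 0)
    (ε := Cm * ‖h‖ ^ γ) (X := (C3 * h10Norm u) ^ 2) hBc.measurableSet hBc'.measurableSet hBB hBh
    h0 (hh.trans hr1)
    (((continuousOn_coef S he hA2).mono hBt).aestronglyMeasurable hBc.measurableSet) haΛ
    (fun y _ v w => by rw [coef_apply, coef_apply, ach_symm hA1.1]) hcoer hc.le
    ((hfc.continuousOn.mono hBt).aestronglyMeasurable hBc.measurableSet)
    (fun y _ => hφ0 _) (fun y _ => hφ1 _)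
    (fun y hy => (hΛ' (mem_image_of_mem _ hy)).trans (le_max_left _ _))
    ((hfd.mono hBt).aestronglyMeasurable hBc.measurableSet) hGm hδm
    (integral_norm_sq_le hGm (by positivity) hGN)
    (by
      have := integral_norm_sq_le hδm (by positivity) hδN
      simpa only [Real.norm_eq_abs, sq_abs, mul_pow] using this)
    (by positivity) hΛ.le (le_max_right _ _)
    (fun y hy => by
      have h1 : y - h ∈ Metric.closedBall y₀ (4 * r) := by
        rw [sub_eq_add_neg]
        exact Metric.closedBall_subset_closedBall (by linarith)
          (add_mem_closedBall hy (show ‖-h‖ ≤ r by rwa [norm_neg]))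
      have h2 : y ∈ Metric.closedBall y₀ (4 * r) :=
        Metric.closedBall_subset_closedBall (by linarith) hy
      rw [hsupp _ h1, hsupp _ h2]
      refine (hm _ h1 _ h2).trans_eq ?_
      rw [sub_sub_cancel_left, norm_neg])
    (fun y hy => rfl)
  rw [← S.formΦ₀_eq (v := ⟨translateDiff e φ u h, _, hz⟩) he hA2 hBc hBt hz hHm] at key
  have hH2 : MemLp H 2 (volume.restrict B) := by
    obtain ⟨w', F, ha⟩ := hu.exists_approx
    exact (ha.h1Lim_translateDiff S he hr hB hh hφ).memLp_grad Metric.isOpen_ball hBc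
      (Metric.closedBall_subset_ball (by linarith))
  have hloc : ∀ y ∈ Metric.closedBall y₀ (r / 2), ‖G (y + h) - G y‖ₑ ^ 2 = ‖H y‖ₑ ^ 2 :=
      fun y hy => by
    have h1 : f =ᶠ[𝓝 y] fun _ => (1 : ℝ) := by
      filter_upwards [Metric.isOpen_ball.mem_nhds
        (Metric.closedBall_subset_ball (by linarith : r / 2 < r) hy)] with z hz
      exact hφr z (Metric.ball_subset_closedBall hz)
    have h2 : fderiv ℝ f y = 0 := by rw [h1.fderiv_eq]; simp
    have h3 : H y = f y • (G y - G (y + h)) + δ y • fderiv ℝ f y := rfl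
    rw [h3, h2, smul_zero, add_zero, h1.self_of_nhds, one_smul, enorm_sub_rev]
  rw [setLIntegral_congr_fun Metric.isClosed_closedBall.measurableSet hloc]
  have hsub : Metric.closedBall y₀ (r / 2) ⊆ B := Metric.closedBall_subset_closedBall (by linarith)
  refine (lintegral_mono_set hsub).trans ?_
  rw [← ofReal_integral_norm_sq hH2]
  refine ENNReal.ofReal_le_ofReal ?_
  rw [div_mul_eq_mul_div, le_div_iff₀ hc, mul_comm]
  -- The cut-off errors of order `‖h‖` are absorbed into the Hölder term of the coefficients.
  have hpow : ‖h‖ ≤ ‖h‖ ^ γ := by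
    conv_lhs => rw [← Real.rpow_one ‖h‖]
    exact Real.rpow_le_rpow_of_exponent_ge (norm_pos_iff.2 h0) (hh.trans hr1) hA2.2.1
  have t1 : 0 ≤ (C3 * h10Norm u) ^ 2 := by positivity
  have t2 := mul_le_mul_of_nonneg_right (mul_le_mul_of_nonneg_left hpow hL) t1
  have t3 := le_abs_self (formΦ₀ A u ⟨translateDiff e φ u h, _, hz⟩)
  have t4 : 0 ≤ (Cm + L) * C3 ^ 2 * |formΦ₀ A u ⟨translateDiff e φ u h, _, hz⟩| := by positivity
  have t5 : 0 ≤ 2 * (‖h‖ ^ γ * h10Norm u ^ 2) := by positivity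
  refine key.trans ?_
  rw [mul_pow] at t1 t2 ⊢
  linarith

end Energy

/-! ### Hölder conditions in quadratic mean, from the cone to all directions -/

section Nik

variable {V Y : Type*} [NormedAddCommGroup V] [MeasureSpace V] [NormedAddCommGroup Y]

/-- A Hölder condition of order `σ` in quadratic mean on `B`, for translations of length at
most `ρ`. -/
def NikOn (G : V → Y) (B : Set V) (ρ σ : ℝ) (R : ℝ≥0∞) : Prop :=
  ∀ h : V, ‖h‖ ≤ ρ → ∫⁻ y in B, ‖G (y + h) - G y‖ₑ ^ 2 ≤ ENNReal.ofReal (‖h‖ ^ (2 * σ)) * R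

lemma NikOn.mono {G : V → Y} {B B' : Set V} {ρ ρ' σ : ℝ} {R R' : ℝ≥0∞} (h : NikOn G B ρ σ R)
    (hB : B' ⊆ B) (hρ : ρ' ≤ ρ) (hR : R ≤ R') : NikOn G B' ρ' σ R' := fun v hv =>
  (lintegral_mono_set hB).trans ((h v (hv.trans hρ)).trans (mul_le_mul_right hR _))

end Nik

section Directions

variable {d : ℕ} {γΩ L : ℝ} {ξ : E d}

lemma smul_mem_cone (hξ : ‖ξ‖ = 1) (hγ : 0 < γΩ) {T : ℝ} (hT : 0 ≤ T) :
    T • ξ ∈ cone ξ γΩ L := by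
  show L * ‖hproj ξ (T • ξ)‖ ^ γΩ ≤ inner ℝ (T • ξ) ξ
  rw [hproj_smul, norm_zero, Real.zero_rpow hγ.ne', mul_zero, inner_smul_left,
    real_inner_self_eq_norm_sq, hξ]
  simpa using hT

/-- Adding a multiple of `ξ` raises the height without changing the projection. The summand `L` pays
for the cone condition, the summand 1 for a negative height of `h`, since `‖h‖ ≤ ‖h‖ ^ γΩ`. -/
lemma add_smul_mem_cone (hξ : ‖ξ‖ = 1) (hγ : 0 < γΩ) (hγ1 : γΩ ≤ 1) (hL : 0 ≤ L) {h : E d}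
    (hh : ‖h‖ ≤ 1) : h + ((L + 1) * ‖h‖ ^ γΩ) • ξ ∈ cone ξ γΩ L := by
  show L * ‖hproj ξ (h + ((L + 1) * ‖h‖ ^ γΩ) • ξ)‖ ^ γΩ ≤
    inner ℝ (h + ((L + 1) * ‖h‖ ^ γΩ) • ξ) ξ
  rw [hproj_add_smul, inner_add_smul hξ]
  have h1 : ‖h‖ ≤ ‖h‖ ^ γΩ := Real.self_le_rpow_of_le_one (norm_nonneg _) hh hγ1
  have h2 : L * ‖hproj ξ h‖ ^ γΩ ≤ L * ‖h‖ ^ γΩ := by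
    gcongr
    exact norm_hproj_le ξ h
  have h3 := (abs_le.1 (abs_real_inner_le_norm h ξ)).1
  rw [hξ, mul_one] at h3
  linarith

/-- Every `h` is `(h + v) - v` with both vectors in the cone, `v` being a multiple of `ξ` of length
`(L + 1) ‖h‖ ^ γΩ`. Trading `‖h‖` for `‖h‖ ^ γΩ` is the origin of the factor `γΩ` in the order of
smoothness. The radius `ρ` does not depend on `m`. -/
lemma exists_nikOn_of_cone (hξ : ‖ξ‖ = 1) (hγ : 0 < γΩ) (hγ1 : γΩ ≤ 1) (hL : 0 ≤ L) {y₀ : E d}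
    {r : ℝ} (hr : 0 < r) :
    ∃ ρ, 0 < ρ ∧ ρ ≤ r / 4 ∧ ∀ (G : E d → Du d) (U : Set (E d)), IsOpen U →
      Metric.closedBall y₀ (2 * r) ⊆ U → AEStronglyMeasurable G (volume.restrict U) →
      ∀ (m : ℝ) (R : ℝ≥0∞), 0 < m → m ≤ 1 →
      (∀ h ∈ cone ξ γΩ L, ‖h‖ < r → ∫⁻ y in Metric.closedBall y₀ (r / 2),
        ‖G (y + h) - G y‖ₑ ^ 2 ≤ ENNReal.ofReal (‖h‖ ^ m) * R) →
      NikOn G (Metric.closedBall y₀ ρ) ρ (γΩ * m / 2) (ENNReal.ofReal (4 * (L + 2)) * R) := by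
  -- Chosen so that `‖h‖ ≤ κ` implies `(L + 2) ‖h‖ ^ γΩ ≤ r / 2`: both auxiliary translations are
  -- then shorter than `r`.
  set κ := (r / (2 * (L + 2))) ^ γΩ⁻¹
  have hκ : 0 < κ := by positivity
  refine ⟨min (min (r / 4) 1) κ, by positivity, (min_le_left _ _).trans (min_le_left _ _),
    fun G U hU hBU hG m R hm0 hm1 H h hh => ?_⟩
  have hh1 : ‖h‖ ≤ 1 := hh.trans ((min_le_left _ _).trans (min_le_right _ _))
  have hhr : ‖h‖ ≤ r / 4 := hh.trans ((min_le_left _ _).trans (min_le_left _ _))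
  have hhκ : ‖h‖ ^ γΩ ≤ r / (2 * (L + 2)) := by
    have h1 : ‖h‖ ^ γΩ ≤ κ ^ γΩ := by gcongr; exact hh.trans (min_le_right _ _)
    refine h1.trans_eq ?_
    rw [← Real.rpow_mul (by positivity), inv_mul_cancel₀ hγ.ne', Real.rpow_one]
  set q := ‖h‖ ^ γΩ
  have hq0 : 0 ≤ q := by positivity
  have hhq : ‖h‖ ≤ q := Real.self_le_rpow_of_le_one (norm_nonneg _) hh1 hγ1
  have hqr : (L + 2) * q ≤ r / 2 := by
    calc (L + 2) * q ≤ (L + 2) * (r / (2 * (L + 2))) := by gcongr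
      _ = r / 2 := by field_simp
  set v : E d := ((L + 1) * q) • ξ
  have hv : ‖v‖ = (L + 1) * q := by
    rw [norm_smul, hξ, mul_one, Real.norm_of_nonneg (by positivity)]
  have hv' : ‖v‖ ≤ (L + 2) * q := by rw [hv]; nlinarith
  have hw' : ‖h + v‖ ≤ (L + 2) * q := (norm_add_le _ _).trans (by rw [hv]; linarith)
  have b1 := H v (smul_mem_cone hξ hγ (by positivity)) (hv'.trans_lt (by linarith))
  have b2 := H (h + v) (add_smul_mem_cone hξ hγ hγ1 hL hh1) (hw'.trans_lt (by linarith))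
  set B := Metric.closedBall y₀ (min (min (r / 4) 1) κ)
  have hBr : B ⊆ Metric.closedBall y₀ (r / 4) :=
    Metric.closedBall_subset_closedBall ((min_le_left _ _).trans (min_le_left _ _))
  have hBU' : ∀ w : E d, ‖w‖ ≤ r → ∀ y ∈ B, y + w ∈ U := fun w hw y hy =>
    hBU (Metric.closedBall_subset_closedBall (by linarith) (add_mem_closedBall (hBr hy) hw))
  have hmeas : ∀ w : E d, ‖w‖ ≤ r →
      AEStronglyMeasurable (fun y => G (y + w)) (volume.restrict B) := fun w hw =>
    (aestronglyMeasurable_comp_add_right w hU.measurableSet hG).mono_set (hBU' w hw)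
  have m0 : AEStronglyMeasurable G (volume.restrict B) := by
    simpa using hmeas 0 (by simpa using hr.le)
  have m1 := hmeas h (by linarith)
  have m2 := hmeas (h + v) (by linarith)
  have e1 : (fun y => G (y + h) - G y) =
      (fun y => G (y + (h + v)) - G y) - fun y => G (y + (h + v)) - G (y + h) := by
    ext y; simp
  have pm : ∀ w : E d, ‖w‖ ≤ (L + 2) * q →
      ENNReal.ofReal (‖w‖ ^ m) * R ≤ ENNReal.ofReal ((L + 2) * q ^ m) * R := fun w hw => by
    gcongr
    calc ‖w‖ ^ m ≤ ((L + 2) * q) ^ m := by gcongr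
      _ = (L + 2) ^ m * q ^ m := Real.mul_rpow (by positivity) hq0
      _ ≤ (L + 2) * q ^ m := by
        gcongr
        exact Real.rpow_le_self_of_one_le (by linarith) hm1
  have b3 : ∫⁻ y in B, ‖G (y + (h + v)) - G y‖ₑ ^ 2 ≤ ENNReal.ofReal ((L + 2) * q ^ m) * R :=
    ((lintegral_mono_set (hBr.trans (Metric.closedBall_subset_closedBall (by linarith)))).trans
      b2).trans (pm _ hw')
  have b4 : ∫⁻ y in B, ‖G (y + (h + v)) - G (y + h)‖ₑ ^ 2 ≤
      ENNReal.ofReal ((L + 2) * q ^ m) * R := by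
    refine le_trans ?_ (b1.trans (pm _ hv'))
    rw [← eLpNorm_two_sq, ← eLpNorm_two_sq]
    gcongr
    refine le_trans (le_of_eq ?_) (eLpNorm_comp_add_right_le (fun y => G (y + v) - G y) h
      Metric.isClosed_closedBall.measurableSet fun y hy => Metric.closedBall_subset_closedBall
        (by linarith) (add_mem_closedBall (hBr hy) hhr))
    simp only [add_assoc]
  rw [← eLpNorm_two_sq, e1]
  calc _ ≤ (eLpNorm (fun y => G (y + (h + v)) - G y) 2 (volume.restrict B) +
        eLpNorm (fun y => G (y + (h + v)) - G (y + h)) 2 (volume.restrict B)) ^ 2 := by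
        gcongr
        exact eLpNorm_sub_le (m2.sub m0) (m2.sub m1) one_le_two
    _ ≤ 2 * (eLpNorm (fun y => G (y + (h + v)) - G y) 2 (volume.restrict B) ^ 2 +
        eLpNorm (fun y => G (y + (h + v)) - G (y + h)) 2 (volume.restrict B) ^ 2) :=
        ennreal_add_sq_le _ _
    _ ≤ 2 * (ENNReal.ofReal ((L + 2) * q ^ m) * R + ENNReal.ofReal ((L + 2) * q ^ m) * R) := by
        rw [eLpNorm_two_sq, eLpNorm_two_sq]
        gcongr
    _ = ENNReal.ofReal (‖h‖ ^ (2 * (γΩ * m / 2))) * (ENNReal.ofReal (4 * (L + 2)) * R) := by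
        have e2 : ‖h‖ ^ (2 * (γΩ * m / 2)) = q ^ m := by
          rw [← Real.rpow_mul (norm_nonneg _)]; congr 1; ring
        rw [e2, ENNReal.ofReal_mul (by positivity : (0 : ℝ) ≤ L + 2),
          ENNReal.ofReal_mul (by norm_num : (0 : ℝ) ≤ 4), ENNReal.ofReal_ofNat]
        ring

end Directions

/-! ### The local estimate for weak solutions -/

section Solution

variable {d : ℕ} {M : Type*} [TopologicalSpace M] [CompactSpace M] [T2Space M]
  [ChartedSpace (E d) M] [MeasurableSpace M] [IsManifold (𝓡 d) 1 M] [BorelSpace M]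
  {g : Metric d M} {μ : Measure M} {e : Chart d M} {Ω : Set M} {A : Tensor2 d M} {γ : ℝ}

lemma lt_dist_frontier {y₀ y : E d} {r : ℝ} {T : Set (E d)} (hT : IsOpen T)
    (hB : Metric.closedBall y₀ (4 * r) ⊆ T) {z : E d} (hz : z ∈ Metric.closedBall y₀ (2 * r))
    (hy : y ∈ frontier T) : 2 * r < dist z y := by
  have h1 : y ∉ T := fun h => by
    rw [hT.frontier_eq] at hy
    exact hy.2 h
  have h2 : 4 * r < dist y y₀ := not_le.1 fun h => h1 (hB h)
  have h3 : dist z y₀ ≤ 2 * r := hz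
  have h4 := dist_triangle y z y₀
  rw [dist_comm y z] at h4
  linarith

/-- For `h` in the cone, `z = φ (u - u_h)` is an admissible test function, so `Φ₀(u, z)` in the
energy estimate equals `f z - Φ_r(u, z)`, and both terms are Hölder in `h`. The abstract space `Hs`
allows both assertions of the theorem to be treated at once. -/
lemma Geom.exists_nikOn_of_isWeakSolution (S : Geom g μ) (hA1 : CondA1 g A) (hA2 : CondA2 γ A)
    {V : Set (Chart d M)} (hV : IsC11Atlas V) (he : e ∈ V) {γΩ : ℝ} (hγ : 0 < γΩ) (hγ1 : γΩ ≤ 1)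
    (hΩo : IsOpen Ω) (hΩ : IsHolderBoundary V γΩ Ω) {x : M} (hx : x ∈ e.source)
    (b : ∀ x : M, Tan d x) (c : productSpace g μ Ω →ₗ[ℝ] ℝ) (K : Chart d M → (M → ℝ) → ℝ) :
    ∃ r ρ C : ℝ, 0 < r ∧ 0 < ρ ∧ 0 ≤ C ∧ Metric.closedBall (e x) (4 * r) ⊆ e.target ∧
      Metric.closedBall (e x) (2 * ρ) ⊆ e.target ∧
      ∀ (f : H10 g μ Ω →ₗ[ℝ] ℝ) (u : H10 g μ Ω), IsWeakSolution A b c f u →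
      ∀ (Hs : Set (M → ℝ)) (nH : Hs → ℝ) (β Cτ CΦ : ℝ), 0 < β → β ≤ 1 → 0 ≤ Cτ → 0 ≤ CΦ →
      ∀ huH : (u : M → ℝ) ∈ Hs, 0 ≤ nH ⟨u, huH⟩ →
      IsHolderForm V K Hs nH β Cτ f → IsHolderForm V K Hs nH β CΦ (formΦr b c u) →
      (∀ (φ : M → ℝ) (h : E d), IsC11Fun d φ →
        (∀ x', x' ∉ e.symm '' Metric.closedBall (e x) (2 * r) → φ x' = 0) → ‖h‖ ≤ r →
        translateDiff e φ u h ∈ H10 g μ Ω → translateDiff e φ u h ∈ Hs) →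
      NikOn (cgrad e (h10Diff u)) (Metric.closedBall (e x) ρ) ρ (γΩ * min γ β / 2)
        (ENNReal.ofReal (C * (h10Norm u ^ 2 + nH ⟨u, huH⟩ * (Cτ + CΦ)))) := by
  have hec := hV.1 e he
  obtain ⟨L, ξ, k, hgr⟩ := hΩ.graphChart he
  obtain ⟨r₀, hr₀, hr₀t⟩ := exists_closedBall_subset e hx
  set r := min (r₀ / 4) 1
  have hr : 0 < r := by positivity
  have hr1 : r ≤ 1 := min_le_right _ _
  have hB : Metric.closedBall (e x) (4 * r) ⊆ e.target :=
    (Metric.closedBall_subset_closedBall (by linarith [min_le_left (r₀ / 4) 1])).trans hr₀t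
  have hKt : Metric.closedBall (e x) (2 * r) ⊆ e.target :=
    (Metric.closedBall_subset_closedBall (by linarith)).trans hB
  obtain ⟨φ, hφ, hφ0, hφ1, hφr, hφs⟩ := exists_isC11Fun_bump hec hr hKt
  obtain ⟨C, hC, hen⟩ := S.exists_energy_estimate (Ω := Ω) hec hA1 hA2 hr hr1 hB hφ hφ0 hφ1 hφr hφs
  obtain ⟨ρ, hρ, hρr, hnik⟩ := exists_nikOn_of_cone hgr.norm_eq hγ hγ1 hgr.nonneg (y₀ := e x) hr
  have hL := hgr.nonneg
  have hφts : tsupport φ ⊆ e.symm '' Metric.closedBall (e x) (2 * r) :=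
    closure_minimal (fun z hz => by
      by_contra h0
      exact hz (hφs z h0))
      (isCompact_symm_image e (isCompact_closedBall _ _) hKt).isClosed
  have hφe : tsupport φ ⊆ e.source := by
    rintro z hz
    obtain ⟨y, hy, rfl⟩ := hφts hz
    exact e.map_target (hKt hy)
  refine ⟨r, ρ, 4 * (L + 2) * (C * (1 + |K e φ|)), hr, hρ, by positivity, hB,
    (Metric.closedBall_subset_closedBall (by linarith)).trans hB,
    fun f u hu Hs nH β Cτ CΦ hβ hβ1 hCτ hCΦ huH hn hτ hΦ hmem => ?_⟩
  set R := h10Norm u ^ 2 + nH ⟨u, huH⟩ * (Cτ + CΦ)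
  have hm0 : 0 < min γ β := lt_min hA2.1 hβ
  have hm1 : min γ β ≤ 1 := (min_le_right _ _).trans hβ1
  rw [mul_assoc (4 * (L + 2)), ENNReal.ofReal_mul (by positivity)]
  refine hnik _ e.target e.open_target ((Metric.closedBall_subset_closedBall (by linarith)).trans hB)
    (S.aestronglyMeasurable_cgrad hec (h10Diff_spec u)) _ _ hm0 hm1 fun h hcone hhr => ?_
  rcases eq_or_ne h 0 with rfl | h0
  · simp
  have hz := (h10Diff_spec u).translateDiff S hec hr hB hhr.le
    (fun y hy hyΩ => hgr.mem_of_add_mem hγ hΩo hB hy hcone hhr.le hyΩ) hφ hφs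
  have hzm : translateDiff e φ u h ∈ H10 g μ Ω := ⟨_, hz⟩
  refine (hen u h h0 hhr.le hz).trans ?_
  rw [← ENNReal.ofReal_mul (by positivity)]
  refine ENNReal.ofReal_le_ofReal ?_
  -- The support of `φ` is at distance more than `2 r` from the boundary of the target, so `h` is
  -- among the displacements admitted by `IsHolderForm`.
  have hfr : ∀ x' ∈ tsupport φ, ∀ y ∈ frontier e.target, ‖h‖ < dist (e x') y := fun x' hx' y hy => by
    obtain ⟨z, hz, rfl⟩ := hφts hx'
    rw [e.right_inv (hKt hz)]
    have := lt_dist_frontier e.open_target hB hz hy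
    linarith
  have hzH := hmem φ h hφ hφs hhr.le hzm
  have i1 := hτ e he φ hφ hφe ⟨u, huH⟩ h hfr hzm hzH
  have i2 := hΦ e he φ hφ hφe ⟨u, huH⟩ h hfr hzm hzH
  have i3 := hu ⟨translateDiff e φ u h, hzm⟩
  have hh1 : ‖h‖ ≤ 1 := hhr.le.trans hr1
  have hhp : 0 < ‖h‖ := norm_pos_iff.2 h0
  have p1 : ‖h‖ ^ γ ≤ ‖h‖ ^ min γ β :=
    Real.rpow_le_rpow_of_exponent_ge hhp hh1 (min_le_left _ _)
  have p2 : ‖h‖ ^ β ≤ ‖h‖ ^ min γ β :=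
    Real.rpow_le_rpow_of_exponent_ge hhp hh1 (min_le_right _ _)
  set n := nH ⟨u, huH⟩
  -- No sign is assumed for `K e φ`, hence its absolute value.
  have bound : ∀ Cζ : ℝ, 0 ≤ Cζ → ∀ t : ℝ, |t| ≤ K e φ * Cζ * n * ‖h‖ ^ β →
      |t| ≤ |K e φ| * Cζ * n * ‖h‖ ^ min γ β := fun Cζ hCζ t ht => ht.trans (by
    calc K e φ * Cζ * n * ‖h‖ ^ β ≤ |K e φ| * Cζ * n * ‖h‖ ^ β := by
          gcongr
          exact le_abs_self _
      _ ≤ _ := by gcongr)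
  have i4 := bound Cτ hCτ _ i1
  have i5 := bound CΦ hCΦ _ i2
  have i6 : |formΦ₀ A u ⟨translateDiff e φ u h, hzm⟩| ≤
      |K e φ| * (n * (Cτ + CΦ)) * ‖h‖ ^ min γ β := by
    have : formΦ₀ A u ⟨translateDiff e φ u h, hzm⟩ = f ⟨translateDiff e φ u h, hzm⟩ -
        formΦr b c u ⟨translateDiff e φ u h, hzm⟩ := by linarith
    rw [this]
    refine (abs_sub _ _).trans ((add_le_add i4 i5).trans_eq (by ring))
  have hnC : 0 ≤ n * (Cτ + CΦ) := by positivity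
  have hpm : 0 ≤ ‖h‖ ^ min γ β := by positivity
  have hN2 : 0 ≤ h10Norm u ^ 2 := by positivity
  calc C * (‖h‖ ^ γ * h10Norm u ^ 2 + |formΦ₀ A u ⟨translateDiff e φ u h, hzm⟩|)
      ≤ C * (‖h‖ ^ min γ β * h10Norm u ^ 2 + |K e φ| * (n * (Cτ + CΦ)) * ‖h‖ ^ min γ β) := by
        gcongr
    _ ≤ C * (‖h‖ ^ min γ β * ((1 + |K e φ|) * R)) := by
        gcongr
        have : 0 ≤ |K e φ| * h10Norm u ^ 2 + n * (Cτ + CΦ) := by positivity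
        have e2 : ‖h‖ ^ min γ β * ((1 + |K e φ|) * R) = ‖h‖ ^ min γ β * h10Norm u ^ 2 +
          |K e φ| * (n * (Cτ + CΦ)) * ‖h‖ ^ min γ β +
          ‖h‖ ^ min γ β * (|K e φ| * h10Norm u ^ 2 + n * (Cτ + CΦ)) := by
          simp only [R]; ring
        rw [e2]
        exact le_add_of_nonneg_right (mul_nonneg hpm this)
    _ = _ := by ring

end Solution

/-! ### Change of coordinates in Hölder conditions -/

section Translation

variable {V Z Z' : Type*} [NormedAddCommGroup V] [NormedSpace ℝ V] [FiniteDimensional ℝ V]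
  [MeasureSpace V] [BorelSpace V] [(volume : Measure V).IsAddHaarMeasure]
  [NormedAddCommGroup Z] [NormedSpace ℝ Z] [NormedAddCommGroup Z'] [NormedSpace ℝ Z']

lemma ae_restrict_comp_add_right {p : V → Prop} {B T : Set V} (hB : MeasurableSet B)
    (hT : MeasurableSet T) (hp : ∀ᵐ y ∂(volume.restrict T), p y) {h : V}
    (hBT : ∀ y ∈ B, y + h ∈ T) : ∀ᵐ y ∂(volume.restrict B), p (y + h) := by
  rw [ae_restrict_iff' hT] at hp
  have h1 := (measurePreserving_add_right (volume : Measure V) h).quasiMeasurePreserving.ae hp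
  filter_upwards [ae_restrict_of_ae h1, ae_restrict_mem hB] with y hy hyB using hy (hBT y hyB)

lemma NikOn.congr_ae {G G' : V → Z} {y₀ : V} {ρ σ : ℝ} {R : ℝ≥0∞} (hρ : 0 ≤ ρ)
    (h : NikOn G (Metric.closedBall y₀ ρ) ρ σ R)
    (he : ∀ᵐ y ∂(volume.restrict (Metric.closedBall y₀ (2 * ρ))), G y = G' y) :
    NikOn G' (Metric.closedBall y₀ ρ) ρ σ R := fun v hv => by
  refine le_of_eq_of_le (lintegral_congr_ae ?_) (h v hv)
  have h1 := ae_restrict_comp_add_right (B := Metric.closedBall y₀ ρ)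
    Metric.isClosed_closedBall.measurableSet
    Metric.isClosed_closedBall.measurableSet he (h := v) fun y hy =>
      Metric.closedBall_subset_closedBall (by linarith) (add_mem_closedBall hy hv)
  filter_upwards [h1, ae_restrict_of_ae_restrict_of_subset
    (Metric.closedBall_subset_closedBall (by linarith)) he] with y h2 h3
  rw [h2, h3]

/-- The increment splits into `J` applied to the increment of `G ∘ τ`, bounded by
`lintegral_comp_sub_le`, and the increment of the Lipschitz `J` applied to `G ∘ τ`, bounded by the
`L_2` norm of `G`. The constant depends neither on `G` nor on `σ`. -/
lemma exists_nikOn_comp {τ : V → V} {τ' : V → V →L[ℝ] V} {J : V → Z →L[ℝ] Z'} {y₀ p₀ : V}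
    {ρ ρ' L Λ κ : ℝ} (hρ' : 0 < ρ') (hρ1 : ρ' ≤ 1) (hL : 0 ≤ L) (hκ : 0 < κ)
    (hLρ : (L + 1) * ρ' ≤ ρ)
    (hτ : ∀ y ∈ Metric.closedBall y₀ (2 * ρ'), HasFDerivAt τ (τ' y) y)
    (hinj : InjOn τ (Metric.closedBall y₀ (2 * ρ')))
    (hdet : ∀ y ∈ Metric.closedBall y₀ (2 * ρ'), κ ≤ |(τ' y).det|)
    (hmaps : MapsTo τ (Metric.closedBall y₀ (2 * ρ')) (Metric.closedBall p₀ ρ))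
    (hlip : ∀ y ∈ Metric.closedBall y₀ (2 * ρ'), ∀ z ∈ Metric.closedBall y₀ (2 * ρ'),
      ‖τ y - τ z‖ ≤ L * ‖y - z‖)
    (hJ : ∀ y ∈ Metric.closedBall y₀ (2 * ρ'), ‖J y‖ ≤ Λ)
    (hJl : ∀ y ∈ Metric.closedBall y₀ (2 * ρ'), ∀ z ∈ Metric.closedBall y₀ (2 * ρ'),
      ‖J y - J z‖ ≤ Λ * ‖y - z‖) :
    ∃ C : ℝ≥0, ∀ G : V → Z,
      AEStronglyMeasurable G (volume.restrict (Metric.closedBall p₀ (2 * ρ))) →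
      ∀ (σ : ℝ) (R : ℝ≥0∞), 0 ≤ σ → σ ≤ 1 → NikOn G (Metric.closedBall p₀ ρ) ρ σ R →
      NikOn (fun y => J y (G (τ y))) (Metric.closedBall y₀ ρ') ρ' σ
        (C * (R + ∫⁻ p in Metric.closedBall p₀ ρ, ‖G p‖ₑ ^ 2)) := by
  have hρ : 0 < ρ := lt_of_lt_of_le (by positivity) hLρ
  set B := Metric.closedBall y₀ ρ'
  set B2 := Metric.closedBall y₀ (2 * ρ')
  set D := Metric.closedBall p₀ ρ
  have hBm : MeasurableSet B := Metric.isClosed_closedBall.measurableSet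
  have hB2m : MeasurableSet B2 := Metric.isClosed_closedBall.measurableSet
  have hDm : MeasurableSet D := Metric.isClosed_closedBall.measurableSet
  have hBB : B ⊆ B2 := Metric.closedBall_subset_closedBall (by linarith)
  have hBh : ∀ h : V, ‖h‖ ≤ ρ' → ∀ y ∈ B, y + h ∈ B2 := fun h hh y hy =>
    Metric.closedBall_subset_closedBall (by linarith) (add_mem_closedBall hy hh)
  have hτc : ContinuousOn τ B2 := fun y hy => (hτ y hy).continuousAt.continuousWithinAt
  have hτm : AEMeasurable τ (volume.restrict B2) := hτc.aemeasurable hB2m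
  set c := ENNReal.ofReal κ⁻¹
  have hc2 : ∀ f : V → ℝ≥0∞, ∫⁻ y in B2, f (τ y) ≤ c * ∫⁻ p in D, f p := fun f => by
    have h1 := lintegral_image_eq_lintegral_abs_det_fderiv_mul volume hB2m
      (fun y hy => (hτ y hy).hasFDerivWithinAt) hinj f
    have h2 : ∫⁻ y in B2, f (τ y) ≤ ∫⁻ y in B2, c * (ENNReal.ofReal |(τ' y).det| * f (τ y)) := by
      refine setLIntegral_mono' hB2m fun y hy => ?_
      rw [← mul_assoc, ← ENNReal.ofReal_mul (by positivity)]
      refine le_mul_of_one_le_left' ?_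
      rw [ENNReal.one_le_ofReal, inv_mul_eq_div, one_le_div hκ]
      exact hdet y hy
    refine h2.trans ?_
    rw [lintegral_const_mul' _ _ ENNReal.ofReal_ne_top, ← h1]
    gcongr
    exact hmaps.image_subset
  have hc : ∀ f : V → ℝ≥0∞, ∫⁻ y in B, f (τ y) ≤ c * ∫⁻ p in D, f p := fun f =>
    (lintegral_mono_set hBB).trans (hc2 f)
  have hc' : ∀ h : V, ‖h‖ ≤ ρ' → ∀ f : V → ℝ≥0∞,
      ∫⁻ y in B, f (τ (y + h)) ≤ c * ∫⁻ p in D, f p := fun h hh f => by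
    refine le_trans ?_ (hc2 f)
    have h1 := (measurePreserving_add_right (volume : Measure V) h).restrict_preimage hB2m
    rw [← h1.lintegral_comp_emb (measurableEmbedding_addRight h) (fun y => f (τ y))]
    exact lintegral_mono_set (hBh h hh)
  set C₁ := ENNReal.ofReal (2 * Λ ^ 2) *
    (4 * ENNReal.ofReal ((L + 1) ^ Module.finrank ℝ V) * (c * ENNReal.ofReal ((L + 1) ^ 2)))
  set C₂ := ENNReal.ofReal (2 * Λ ^ 2) * c
  have hC1 : C₁ ≠ ⊤ := by finiteness
  have hC2 : C₂ ≠ ⊤ := by finiteness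
  refine ⟨C₁.toNNReal + C₂.toNNReal, fun G hG σ R hσ hσ1 hN => ?_⟩
  rw [ENNReal.coe_add, ENNReal.coe_toNNReal hC1, ENNReal.coe_toNNReal hC2]
  -- The averaging argument uses Tonelli's theorem and needs a genuinely measurable function.
  set Gm := hG.mk G
  have hGm : StronglyMeasurable Gm := hG.stronglyMeasurable_mk
  have hGe : ∀ᵐ p ∂(volume.restrict (Metric.closedBall p₀ (2 * ρ))), G p = Gm p := hG.ae_eq_mk
  have hN' := hN.congr_ae hρ.le hGe
  have hX : ∫⁻ p in D, ‖G p‖ₑ ^ 2 = ∫⁻ p in D, ‖Gm p‖ₑ ^ 2 := by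
    refine lintegral_congr_ae ?_
    filter_upwards [ae_restrict_of_ae_restrict_of_subset
      (Metric.closedBall_subset_closedBall (by linarith)) hGe] with p hp
    rw [hp]
  -- The bound `hc2` for the indicator function of a null set shows that `τ` pulls null sets back to
  -- null sets.
  have hGτ : ∀ᵐ y ∂(volume.restrict B2), Gm (τ y) = G (τ y) := by
    have h0 : volume.restrict D {p | G p ≠ Gm p} = 0 :=
      ae_restrict_of_ae_restrict_of_subset (Metric.closedBall_subset_closedBall (by linarith)) hGe
    set N := toMeasurable (volume.restrict D) {p | G p ≠ Gm p}
    have hNm : MeasurableSet N := measurableSet_toMeasurable _ _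
    have h1 := hc2 (N.indicator 1)
    rw [lintegral_indicator_one hNm, measure_toMeasurable, h0, mul_zero] at h1
    have h2 := (lintegral_eq_zero_iff' (((measurable_one.indicator hNm)).comp_aemeasurable hτm)).1
      (le_antisymm h1 bot_le)
    filter_upwards [h2] with y hy
    by_contra hne
    have : τ y ∈ N := subset_toMeasurable _ _ fun h => hne h.symm
    simp [this] at hy
  rw [hX]
  refine NikOn.congr_ae (G := fun y => J y (Gm (τ y))) hρ'.le (fun h hh => ?_) ?_
  · rcases eq_or_ne h 0 with rfl | h0
    · simp
    have hh1 : ‖h‖ ≤ 1 := hh.trans hρ1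
    have hhp : 0 < ‖h‖ := norm_pos_iff.2 h0
    -- The bound `σ ≤ 1` makes the constant independent of `σ`.
    have e1 : ((L + 1) * ‖h‖) ^ (2 * σ) ≤ (L + 1) ^ 2 * ‖h‖ ^ (2 * σ) := by
      rw [Real.mul_rpow (by positivity) hhp.le]
      gcongr
      rw [← Real.rpow_two]
      exact Real.rpow_le_rpow_of_exponent_le (by linarith) (by linarith)
    have main := lintegral_comp_sub_le hGm h0 hL (R := ENNReal.ofReal ((L + 1) ^ 2) *
      (ENNReal.ofReal (‖h‖ ^ (2 * σ)) * R)) hBm (hτm.mono_set hBB) hc (hc' h hh)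
      (fun y hy => by
        have := hlip _ (hBh h hh y hy) _ (hBB hy)
        rwa [add_sub_cancel_left] at this)
      (fun η hη => by
        refine (hN' η (hη.trans (le_trans (by gcongr) hLρ))).trans ?_
        rw [← mul_assoc, ← ENNReal.ofReal_mul (by positivity)]
        gcongr
        refine le_trans ?_ e1
        gcongr)
    have hpt : ∀ y ∈ B, ‖J (y + h) (Gm (τ (y + h))) - J y (Gm (τ y))‖ₑ ^ 2 ≤
        ENNReal.ofReal (2 * Λ ^ 2) * ‖Gm (τ (y + h)) - Gm (τ y)‖ₑ ^ 2 +
          ENNReal.ofReal (2 * Λ ^ 2) * ENNReal.ofReal (‖h‖ ^ (2 * σ)) * ‖Gm (τ y)‖ₑ ^ 2 :=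
      fun y hy => by
        have i1 : J (y + h) (Gm (τ (y + h))) - J y (Gm (τ y)) =
          J (y + h) (Gm (τ (y + h)) - Gm (τ y)) + (J (y + h) - J y) (Gm (τ y)) := by simp
        have i2 : ‖J (y + h) (Gm (τ (y + h))) - J y (Gm (τ y))‖ ≤
            Λ * ‖Gm (τ (y + h)) - Gm (τ y)‖ + Λ * ‖h‖ * ‖Gm (τ y)‖ := by
          rw [i1]
          refine (norm_add_le _ _).trans (add_le_add ?_ ?_)
          · refine ((J (y + h)).le_opNorm _).trans ?_
            gcongr
            exact hJ _ (hBh h hh y hy)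
          · refine ((J (y + h) - J y).le_opNorm _).trans ?_
            gcongr
            have := hJl _ (hBh h hh y hy) _ (hBB hy)
            rwa [add_sub_cancel_left] at this
        have i3 : ‖h‖ ^ 2 ≤ ‖h‖ ^ (2 * σ) := by
          rw [← Real.rpow_two]
          exact Real.rpow_le_rpow_of_exponent_ge hhp hh1 (by linarith)
        rw [enorm_sq_eq_ofReal, enorm_sq_eq_ofReal, enorm_sq_eq_ofReal,
          ← ENNReal.ofReal_mul (by positivity), ← ENNReal.ofReal_mul (by positivity),
          ← ENNReal.ofReal_mul (by positivity), ← ENNReal.ofReal_add (by positivity)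
          (by positivity)]
        refine ENNReal.ofReal_le_ofReal ?_
        set a := ‖Gm (τ (y + h)) - Gm (τ y)‖
        set b := ‖Gm (τ y)‖
        calc ‖J (y + h) (Gm (τ (y + h))) - J y (Gm (τ y))‖ ^ 2 ≤ (Λ * a + Λ * ‖h‖ * b) ^ 2 := by
              gcongr
          _ ≤ 2 * Λ ^ 2 * a ^ 2 + 2 * Λ ^ 2 * ‖h‖ ^ 2 * b ^ 2 := by
              nlinarith [sq_nonneg (Λ * a - Λ * ‖h‖ * b)]
          _ ≤ _ := by gcongr
    calc ∫⁻ y in B, ‖J (y + h) (Gm (τ (y + h))) - J y (Gm (τ y))‖ₑ ^ 2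
        ≤ ∫⁻ y in B, (ENNReal.ofReal (2 * Λ ^ 2) * ‖Gm (τ (y + h)) - Gm (τ y)‖ₑ ^ 2 +
          ENNReal.ofReal (2 * Λ ^ 2) * ENNReal.ofReal (‖h‖ ^ (2 * σ)) * ‖Gm (τ y)‖ₑ ^ 2) :=
          setLIntegral_mono' hBm hpt
      _ = (∫⁻ y in B, ENNReal.ofReal (2 * Λ ^ 2) * ‖Gm (τ (y + h)) - Gm (τ y)‖ₑ ^ 2) +
          ∫⁻ y in B, ENNReal.ofReal (2 * Λ ^ 2) * ENNReal.ofReal (‖h‖ ^ (2 * σ)) *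
            ‖Gm (τ y)‖ₑ ^ 2 := by
          refine lintegral_add_right' _ (AEMeasurable.const_mul ?_ _)
          exact (hGm.enorm.pow_const 2).comp_aemeasurable (hτm.mono_set hBB)
      _ ≤ ENNReal.ofReal (2 * Λ ^ 2) * (4 * ENNReal.ofReal ((L + 1) ^ Module.finrank ℝ V) *
            (c * (ENNReal.ofReal ((L + 1) ^ 2) * (ENNReal.ofReal (‖h‖ ^ (2 * σ)) * R)))) +
          ENNReal.ofReal (2 * Λ ^ 2) * ENNReal.ofReal (‖h‖ ^ (2 * σ)) *
            (c * ∫⁻ p in D, ‖Gm p‖ₑ ^ 2) := by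
          rw [lintegral_const_mul' _ _ ENNReal.ofReal_ne_top,
            lintegral_const_mul' _ _ (by finiteness)]
          gcongr
          exact hc fun p => ‖Gm p‖ₑ ^ 2
      _ = ENNReal.ofReal (‖h‖ ^ (2 * σ)) * (C₁ * R + C₂ * ∫⁻ p in D, ‖Gm p‖ₑ ^ 2) := by
          simp only [C₁, C₂]; ring
      _ ≤ _ := by
          gcongr
          rw [add_mul]
          gcongr
          · exact le_self_add
          · exact le_add_self
  · filter_upwards [hGτ] with y hy
    rw [hy]

end Translation

section Charts

variable {d : ℕ} {M : Type*} [TopologicalSpace M] [CompactSpace M] [T2Space M]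
  [ChartedSpace (E d) M] [MeasurableSpace M] [IsManifold (𝓡 d) 1 M] [BorelSpace M]
  {g : Metric d M} {μ : Measure M} {e e' : Chart d M} {Ω : Set M}

lemma exists_closedBall_of_eventually {V : Type*} [PseudoMetricSpace V] {p : V → Prop} {y : V}
    (h : ∀ᶠ z in 𝓝 y, p z) : ∃ r > 0, ∀ z ∈ Metric.closedBall y r, p z :=
  Metric.nhds_basis_closedBall.mem_iff.1 h

lemma IsC11Chart.det_fderiv_ne_zero (he : IsC11Chart e) (he' : IsC11Chart e') (g : Metric d M)
    {y : E d} (hy : y ∈ e.target) (hy' : e.symm y ∈ e'.source) :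
    (fderiv ℝ (e' ∘ e.symm) y).det ≠ 0 := fun h => by
  have h1 := he.rho_eq g he' hy hy'
  rw [h, abs_zero, zero_mul] at h1
  exact (he.rho_pos g hy).ne' h1

/-- The gradient transforms by composition with the transition map and with its Jacobian. Both are
Lipschitz and the determinant is bounded away from zero near the point, so `exists_nikOn_comp`
applies on a small ball. -/
lemma Geom.exists_nikOn_chart_change (S : Geom g μ) (he : IsC11Chart e) (he' : IsC11Chart e')
    {x : M} (hx : x ∈ e.source) (hx' : x ∈ e'.source) {ρ : ℝ} (hρ : 0 < ρ)
    (hB : Metric.closedBall (e x) (2 * ρ) ⊆ e.target) :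
    ∃ ρ' > 0, Metric.closedBall (e' x) (2 * ρ') ⊆ e'.target ∧ ∃ C : ℝ≥0,
      ∀ (u : M → ℝ) (θ : ∀ x : M, Cot d x), IsH10Diff g μ Ω u θ → ∀ (σ : ℝ) (R : ℝ≥0∞),
      0 ≤ σ → σ ≤ 1 → NikOn (cgrad e θ) (Metric.closedBall (e x) ρ) ρ σ R →
      NikOn (cgrad e' θ) (Metric.closedBall (e' x) ρ') ρ' σ
        (C * (R + ∫⁻ p in Metric.closedBall (e x) ρ, ‖cgrad e θ p‖ₑ ^ 2)) := by
  set y₀ := e' x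
  have hy₀ : y₀ ∈ e'.target := e'.map_source hx'
  have hy₀s : e'.symm y₀ = x := e'.left_inv hx'
  have hy₀' : e'.symm y₀ ∈ e.source := by rwa [hy₀s]
  set τ : E d → E d := e ∘ e'.symm
  have hτ0 : τ y₀ = e x := by simp only [τ, Function.comp_apply, hy₀s]
  have hc : C11At τ y₀ := he'.c11At_symm_trans he hy₀ hy₀'
  let Q : (E d →L[ℝ] E d) →L[ℝ] (Du d →L[ℝ] Du d) :=
    (ContinuousLinearMap.compL ℝ (E d) (E d) ℝ).flip
  have hdc : ContinuousAt (fderiv ℝ τ) y₀ := hc.2.continuousAt one_pos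
  have hJ : HolderAt 1 (fun y => Q (fderiv ℝ τ y)) y₀ := hc.2.clm Q
  have hJc : ContinuousAt (fun y => Q (fderiv ℝ τ y)) y₀ := hJ.continuousAt one_pos
  have hdet0 := he'.det_fderiv_ne_zero he g hy₀ hy₀'
  have hdetc : ContinuousAt (fun y => |(fderiv ℝ τ y).det|) y₀ :=
    (ContinuousLinearMap.continuous_det.continuousAt.comp hdc).abs
  set κ := |(fderiv ℝ τ y₀).det| / 2
  have hκ : 0 < κ := half_pos (abs_pos.2 hdet0)
  obtain ⟨L, hL, t, ht, hlip⟩ := hc.holderAt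
  obtain ⟨Lj, hLj, tj, htj, hJl⟩ := hJ
  have ev : ∀ᶠ y in 𝓝 y₀, y ∈ e'.target ∧ e'.symm y ∈ e.source ∧ DifferentiableAt ℝ τ y ∧
      y ∈ t ∧ y ∈ tj ∧ κ ≤ |(fderiv ℝ τ y).det| ∧ ‖Q (fderiv ℝ τ y)‖ ≤ ‖Q (fderiv ℝ τ y₀)‖ + 1 ∧
      τ y ∈ Metric.closedBall (e x) ρ := by
    filter_upwards [e'.open_target.mem_nhds hy₀,
      (e'.continuousAt_symm hy₀).eventually (e.open_source.mem_nhds hy₀'),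
      hc.1.eventually_differentiableAt, ht, htj,
      hdetc.eventually (le_mem_nhds (half_lt_self (abs_pos.2 hdet0))),
      hJc.norm.eventually (ge_mem_nhds (lt_add_one _)),
      hc.1.continuousAt.eventually (by
        rw [hτ0]; exact Metric.closedBall_mem_nhds _ hρ)] with y h1 h2 h3 h4 h5 h6 h7 h8
    exact ⟨h1, h2, h3, h4, h5, h6, h7, h8⟩
  obtain ⟨r, hr, hev⟩ := exists_closedBall_of_eventually ev
  set ρ' := min (min (r / 2) 1) (ρ / (L + 1))
  have hρ' : 0 < ρ' := by positivity
  have hsub : Metric.closedBall y₀ (2 * ρ') ⊆ Metric.closedBall y₀ r :=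
    Metric.closedBall_subset_closedBall (by
      linarith [(min_le_left _ _).trans (min_le_left _ _) (a := ρ') (c := r / 2)])
  set Λ := max (‖Q (fderiv ℝ τ y₀)‖ + 1) Lj
  have hΛ : 0 ≤ Λ := hLj.trans (le_max_right _ _)
  obtain ⟨C, hC⟩ := exists_nikOn_comp (τ := τ) (τ' := fderiv ℝ τ)
    (J := fun y => Q (fderiv ℝ τ y)) (y₀ := y₀) (p₀ := e x) (ρ := ρ) hρ'
    ((min_le_left _ _).trans (min_le_right _ _)) hL hκ
    (by
      have : ρ' ≤ ρ / (L + 1) := min_le_right _ _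
      rwa [le_div_iff₀ (by positivity), mul_comm] at this)
    (fun y hy => (hev y (hsub hy)).2.2.1.hasFDerivAt)
    (fun y hy z hz hyz => by
      have h1 := hev y (hsub hy)
      have h2 := hev z (hsub hz)
      exact e'.symm.injOn h1.1 h2.1 (e.injOn h1.2.1 h2.2.1 hyz))
    (fun y hy => (hev y (hsub hy)).2.2.2.2.2.1)
    (fun y hy => (hev y (hsub hy)).2.2.2.2.2.2.2)
    (fun y hy z hz => by
      have := hlip y (hev y (hsub hy)).2.2.2.1 z (hev z (hsub hz)).2.2.2.1
      rwa [Real.rpow_one] at this)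
    (fun y hy => (hev y (hsub hy)).2.2.2.2.2.2.1.trans (le_max_left _ _))
    (fun y hy z hz => by
      have := hJl y (hev y (hsub hy)).2.2.2.2.1 z (hev z (hsub hz)).2.2.2.2.1
      rw [Real.rpow_one] at this
      refine this.trans ?_
      gcongr
      exact le_max_right _ _)
  refine ⟨ρ', hρ', fun y hy => (hev y (hsub hy)).1, C, fun u θ hu σ R hσ hσ1 hN => ?_⟩
  refine (hC (cgrad e θ) ((S.aestronglyMeasurable_cgrad he hu).mono_set hB) σ R hσ hσ1 hN).congr_ae
    hρ'.le ?_
  filter_upwards [ae_restrict_mem Metric.isClosed_closedBall.measurableSet] with y hy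
  have h1 := hev y (hsub hy)
  exact (he'.cgrad_eq he θ h1.1 h1.2.1).symm

end Charts

/-! ### Multiplication by `C^{1,1}` functions and extension by zero -/

section Product

variable {V : Type*} [NormedAddCommGroup V] [NormedSpace ℝ V] [FiniteDimensional ℝ V]
  [MeasureSpace V] [BorelSpace V] [(volume : Measure V).IsAddHaarMeasure] {U : Set V}

lemma sq_enorm_le_of_norm_le {Y Z₁ Z₂ Z₃ Z₄ : Type*} [NormedAddCommGroup Y]
    [NormedAddCommGroup Z₁] [NormedAddCommGroup Z₂] [NormedAddCommGroup Z₃]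
    [NormedAddCommGroup Z₄] {Λ t : ℝ} {F : Y} {a : Z₁} {b : Z₂} {c : Z₃} {d : Z₄}
    (h : ‖F‖ ≤ Λ * (‖a‖ + t * ‖b‖ + ‖c‖ + t * ‖d‖)) :
    ‖F‖ₑ ^ 2 ≤ ENNReal.ofReal (4 * Λ ^ 2) * (‖a‖ₑ ^ 2 + (ENNReal.ofReal (t ^ 2) * ‖b‖ₑ ^ 2 +
      (‖c‖ₑ ^ 2 + ENNReal.ofReal (t ^ 2) * ‖d‖ₑ ^ 2))) := by
  simp only [enorm_sq_eq_ofReal]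
  rw [← ENNReal.ofReal_mul (by positivity), ← ENNReal.ofReal_mul (by positivity),
    ← ENNReal.ofReal_add (by positivity) (by positivity),
    ← ENNReal.ofReal_add (by positivity) (by positivity),
    ← ENNReal.ofReal_add (by positivity) (by positivity), ← ENNReal.ofReal_mul (by positivity)]
  refine ENNReal.ofReal_le_ofReal ?_
  have h1 : (‖a‖ + t * ‖b‖ + ‖c‖ + t * ‖d‖) ^ 2 ≤
      4 * (‖a‖ ^ 2 + (t ^ 2 * ‖b‖ ^ 2 + (‖c‖ ^ 2 + t ^ 2 * ‖d‖ ^ 2))) := by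
    nlinarith [sq_nonneg (‖a‖ - t * ‖b‖), sq_nonneg (‖a‖ - ‖c‖), sq_nonneg (‖a‖ - t * ‖d‖),
      sq_nonneg (t * ‖b‖ - ‖c‖), sq_nonneg (t * ‖b‖ - t * ‖d‖), sq_nonneg (‖c‖ - t * ‖d‖)]
  calc ‖F‖ ^ 2 ≤ (Λ * (‖a‖ + t * ‖b‖ + ‖c‖ + t * ‖d‖)) ^ 2 := by gcongr
    _ = Λ ^ 2 * (‖a‖ + t * ‖b‖ + ‖c‖ + t * ‖d‖) ^ 2 := by ring
    _ ≤ Λ ^ 2 * (4 * (‖a‖ ^ 2 + (t ^ 2 * ‖b‖ ^ 2 + (‖c‖ ^ 2 + t ^ 2 * ‖d‖ ^ 2)))) := by gcongr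
    _ = _ := by ring

/-- Multiplication by a function of class `C^{1,1}` preserves Hölder conditions in quadratic mean
for differentials. -/
lemma exists_nikOn_mul (hU : IsOpen U) {η : V → ℝ} {y₀ : V} {ρ : ℝ}
    (hρ1 : ρ ≤ 1) (hBU : Metric.closedBall y₀ (2 * ρ) ⊆ U)
    (hη : ∀ y ∈ Metric.closedBall y₀ (2 * ρ), C11At η y) :
    ∃ C : ℝ≥0, ∀ (u : V → ℝ) (G : V → V →L[ℝ] ℝ) (w : ℕ → V → ℝ), H1Lim U u G w →
      ∀ (σ : ℝ) (R : ℝ≥0∞), 0 ≤ σ → σ ≤ 1 → NikOn G (Metric.closedBall y₀ ρ) ρ σ R →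
      NikOn (fun y => η y • G y + u y • fderiv ℝ η y) (Metric.closedBall y₀ ρ) ρ σ
        (C * (R + ((∫⁻ y in Metric.closedBall y₀ (2 * ρ), ‖G y‖ₑ ^ 2) +
          ∫⁻ y in Metric.closedBall y₀ (2 * ρ), ‖u y‖ₑ ^ 2))) := by
  set B := Metric.closedBall y₀ ρ
  set B2 := Metric.closedBall y₀ (2 * ρ)
  have hB2 : IsCompact B2 := isCompact_closedBall _ _
  have hB : IsCompact B := isCompact_closedBall _ _
  have hηc : ContinuousOn η B2 := fun y hy => (hη y hy).1.continuousAt.continuousWithinAt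
  have hηd : ContinuousOn (fderiv ℝ η) B2 := fun y hy =>
    ((hη y hy).2.continuousAt one_pos).continuousWithinAt
  obtain ⟨Λ₁, hΛ₁⟩ := hB2.bddAbove_image hηc.norm
  obtain ⟨Λ₂, hΛ₂⟩ := hB2.bddAbove_image hηd.norm
  obtain ⟨Λ₃, hΛ₃, h3⟩ := exists_holder_of_isCompact one_pos hB2 fun y hy => (hη y hy).holderAt
  obtain ⟨Λ₄, hΛ₄, h4⟩ := exists_holder_of_isCompact one_pos hB2 fun y hy => (hη y hy).2
  set Λ := max (max Λ₁ Λ₂) (max Λ₃ Λ₄)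
  have hΛ : 0 ≤ Λ := hΛ₃.trans ((le_max_left _ _).trans (le_max_right _ _))
  have b1 : ∀ y ∈ B2, ‖η y‖ ≤ Λ := fun y hy => (hΛ₁ (mem_image_of_mem _ hy)).trans
    ((le_max_left _ _).trans (le_max_left _ _))
  have b2 : ∀ y ∈ B2, ‖fderiv ℝ η y‖ ≤ Λ := fun y hy => (hΛ₂ (mem_image_of_mem _ hy)).trans
    ((le_max_right _ _).trans (le_max_left _ _))
  have b3 : ∀ y ∈ B2, ∀ z ∈ B2, ‖η y - η z‖ ≤ Λ * ‖y - z‖ := fun y hy z hz => by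
    have := h3 y hy z hz
    rw [Real.rpow_one] at this
    refine this.trans ?_
    gcongr
    exact (le_max_left _ _).trans (le_max_right _ _)
  have b4 : ∀ y ∈ B2, ∀ z ∈ B2, ‖fderiv ℝ η y - fderiv ℝ η z‖ ≤ Λ * ‖y - z‖ := fun y hy z hz => by
    have := h4 y hy z hz
    rw [Real.rpow_one] at this
    refine this.trans ?_
    gcongr
    exact (le_max_right _ _).trans (le_max_right _ _)
  -- Four increments enter, hence `4 * Λ ^ 2`; the factor 2 is due to the integral of `‖G‖²`, which
  -- also bounds the increment of `u` and so occurs twice.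
  refine ⟨(4 * Λ ^ 2).toNNReal * 2, fun u G w H σ R hσ hσ1 hN h hh => ?_⟩
  rcases eq_or_ne h 0 with rfl | h0
  · simp
  have hhp : 0 < ‖h‖ := norm_pos_iff.2 h0
  have hBB : B ⊆ B2 := Metric.closedBall_subset_closedBall (by linarith)
  have hBh : ∀ y ∈ B, y + h ∈ B2 := fun y hy =>
    Metric.closedBall_subset_closedBall (by linarith) (add_mem_closedBall hy hh)
  have hGB2 := H.meas_grad.mono_set hBU
  have huB2 := H.meas.mono_set hBU
  have mGh := (aestronglyMeasurable_comp_add_right h hB2.measurableSet hGB2).mono_set hBh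
  have muh := (aestronglyMeasurable_comp_add_right h hB2.measurableSet huB2).mono_set hBh
  have mG := hGB2.mono_set hBB
  have mu := huB2.mono_set hBB
  have hpt : ∀ y ∈ B, ‖(η (y + h) • G (y + h) + u (y + h) • fderiv ℝ η (y + h)) -
      (η y • G y + u y • fderiv ℝ η y)‖ₑ ^ 2 ≤ ENNReal.ofReal (4 * Λ ^ 2) *
      (‖G (y + h) - G y‖ₑ ^ 2 + (ENNReal.ofReal (‖h‖ ^ 2) * ‖G y‖ₑ ^ 2 +
        (‖u (y + h) - u y‖ₑ ^ 2 + ENNReal.ofReal (‖h‖ ^ 2) * ‖u y‖ₑ ^ 2))) := fun y hy => by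
    refine sq_enorm_le_of_norm_le ?_
    have e : (η (y + h) • G (y + h) + u (y + h) • fderiv ℝ η (y + h)) -
        (η y • G y + u y • fderiv ℝ η y) = η (y + h) • (G (y + h) - G y) +
        (η (y + h) - η y) • G y + (u (y + h) - u y) • fderiv ℝ η (y + h) +
        u y • (fderiv ℝ η (y + h) - fderiv ℝ η y) := by module
    have i3 := b3 _ (hBh y hy) _ (hBB hy)
    have i4 := b4 _ (hBh y hy) _ (hBB hy)
    rw [add_sub_cancel_left] at i3 i4
    rw [e]
    refine (norm_add_le _ _).trans ((add_le_add ((norm_add_le _ _).trans (add_le_add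
      (norm_add_le _ _) le_rfl)) le_rfl).trans ?_)
    rw [norm_smul, norm_smul, norm_smul, norm_smul]
    calc _ ≤ Λ * ‖G (y + h) - G y‖ + Λ * ‖h‖ * ‖G y‖ + ‖u (y + h) - u y‖ * Λ +
          ‖u y‖ * (Λ * ‖h‖) := by
          gcongr
          · exact b1 _ (hBh y hy)
          · exact b2 _ (hBh y hy)
      _ = _ := by ring
  have hu2 : ∫⁻ y in B, ‖u (y + h) - u y‖ₑ ^ 2 ≤
      ENNReal.ofReal (‖h‖ ^ 2) * ∫⁻ y in B2, ‖G y‖ₑ ^ 2 := by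
    have := H.eLpNorm_translate_sub_le hU hB hB2 hBU (h := h) fun y hy t ht =>
      Metric.closedBall_subset_closedBall (by linarith) (add_mem_closedBall hy
        (show ‖t • h‖ ≤ ρ by
          rw [norm_smul, Real.norm_of_nonneg ht.1]
          exact (mul_le_of_le_one_left (norm_nonneg _) ht.2).trans hh))
    rw [← eLpNorm_two_sq, ← eLpNorm_two_sq, ← enorm_sq_eq_ofReal, ← mul_pow]
    gcongr
  have i3 : ENNReal.ofReal (‖h‖ ^ 2) ≤ ENNReal.ofReal (‖h‖ ^ (2 * σ)) := by
    refine ENNReal.ofReal_le_ofReal ?_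
    rw [← Real.rpow_two]
    exact Real.rpow_le_rpow_of_exponent_ge hhp (hh.trans hρ1) (by linarith)
  have k1 : AEMeasurable (fun y => ‖G (y + h) - G y‖ₑ ^ 2) (volume.restrict B) :=
    (mGh.sub mG).enorm.pow_const 2
  have k2 : AEMeasurable (fun y => ‖u (y + h) - u y‖ₑ ^ 2) (volume.restrict B) :=
    (muh.sub mu).enorm.pow_const 2
  refine (setLIntegral_mono' hB.measurableSet hpt).trans ?_
  rw [lintegral_const_mul' _ _ ENNReal.ofReal_ne_top, lintegral_add_left' k1,
    lintegral_add_left' ((mG.enorm.pow_const 2).const_mul _), lintegral_add_left' k2,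
    lintegral_const_mul' _ _ ENNReal.ofReal_ne_top, lintegral_const_mul' _ _ ENNReal.ofReal_ne_top]
  set X := ∫⁻ y in B2, ‖G y‖ₑ ^ 2
  set X' := ∫⁻ y in B2, ‖u y‖ₑ ^ 2
  set t := ENNReal.ofReal (‖h‖ ^ (2 * σ))
  calc _ ≤ ENNReal.ofReal (4 * Λ ^ 2) * (t * R + (t * X + (t * X + t * X'))) := by
        exact mul_le_mul' le_rfl (add_le_add (hN h hh) (add_le_add
          (mul_le_mul' i3 (lintegral_mono_set hBB)) (add_le_add
          (hu2.trans (mul_le_mul_left i3 _)) (mul_le_mul' i3 (lintegral_mono_set hBB)))))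
    _ ≤ ENNReal.ofReal (4 * Λ ^ 2) * (t * R + (t * X + (t * X + t * X')) + (t * R + t * X')) :=
        mul_le_mul' le_rfl le_self_add
    _ = _ := by
        rw [ENNReal.coe_mul, ENNReal.ofReal]
        push_cast
        ring

lemma eLpNorm_restrict_le_of_eq_zero {Y : Type*} [NormedAddCommGroup Y] {f f' : V → Y}
    {K K' : Set V} (hK : MeasurableSet K) (h1 : ∀ y ∈ K, f y = f' y) (h2 : ∀ y, y ∉ K → f y = 0) :
    eLpNorm f 2 (volume.restrict K') ≤ eLpNorm f' 2 (volume.restrict K) := by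
  have h3 : f = K.indicator f' := by
    ext y
    by_cases hy : y ∈ K
    · rw [indicator_of_mem hy, h1 y hy]
    · rw [indicator_of_notMem hy, h2 y hy]
  rw [h3, ← eLpNorm_indicator_eq_eLpNorm_restrict hK]
  exact eLpNorm_mono_measure _ Measure.restrict_le_self

/-- Extension by zero. -/
lemma H1Lim.indicator {u : V → ℝ} {G : V → V →L[ℝ] ℝ} {w : ℕ → V → ℝ} (h : H1Lim U u G w)
    (hU : IsOpen U) {K : Set V} (hK : IsCompact K) (hKU : K ⊆ U) (hu : ∀ y ∈ U, y ∉ K → u y = 0)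
    (hG : ∀ y ∈ U, y ∉ K → G y = 0) (hw : ∀ n, ∀ y ∈ U, y ∉ K → w n y = 0) :
    H1Lim univ (U.indicator u) (U.indicator G) (fun n => U.indicator (w n)) := by
  have hz : ∀ n, ∀ y, y ∉ K → U.indicator (w n) =ᶠ[𝓝 y] fun _ => 0 := fun n y hy => by
    filter_upwards [hK.isClosed.isOpen_compl.mem_nhds hy] with z hz
    by_cases hzU : z ∈ U
    · rw [indicator_of_mem hzU, hw n z hzU hz]
    · rw [indicator_of_notMem hzU]
  have he : ∀ n, ∀ y ∈ U, U.indicator (w n) =ᶠ[𝓝 y] w n := fun n y hy => by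
    filter_upwards [hU.mem_nhds hy] with z hz
    rw [indicator_of_mem hz]
  refine ⟨fun n => contDiffOn_univ.2 (contDiff_iff_contDiffAt.2 fun y => ?_), ?_, ?_,
    fun K' _ _ => ?_, fun K' _ _ => ?_⟩
  · by_cases hy : y ∈ U
    · exact ((h.contDiffOn n).contDiffAt (hU.mem_nhds hy)).congr_of_eventuallyEq (he n y hy)
    · exact contDiffAt_const.congr_of_eventuallyEq (hz n y fun hyK => hy (hKU hyK))
  · rw [Measure.restrict_univ]
    exact (aestronglyMeasurable_indicator_iff hU.measurableSet).2 h.meas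
  · rw [Measure.restrict_univ]
    exact (aestronglyMeasurable_indicator_iff hU.measurableSet).2 h.meas_grad
  · refine tendsto_of_tendsto_of_tendsto_of_le_of_le tendsto_const_nhds (h.lim K hK hKU)
      (fun _ => bot_le) fun n => eLpNorm_restrict_le_of_eq_zero hK.measurableSet (fun y hy => ?_) fun y hy => ?_
    · rw [indicator_of_mem (hKU hy), indicator_of_mem (hKU hy)]
    · by_cases hyU : y ∈ U
      · rw [indicator_of_mem hyU, indicator_of_mem hyU, hu y hyU hy, hw n y hyU hy, sub_zero]
      · rw [indicator_of_notMem hyU, indicator_of_notMem hyU, sub_zero]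
  · refine tendsto_of_tendsto_of_tendsto_of_le_of_le tendsto_const_nhds (h.lim_grad K hK hKU)
      (fun _ => bot_le) fun n => eLpNorm_restrict_le_of_eq_zero hK.measurableSet (fun y hy => ?_) fun y hy => ?_
    · rw [indicator_of_mem (hKU hy), (he n y (hKU hy)).fderiv_eq]
    · rw [(hz n y hy).fderiv_eq, fderiv_fun_const, Pi.zero_apply, sub_zero]
      by_cases hyU : y ∈ U
      · rw [indicator_of_mem hyU, hG y hyU hy]
      · rw [indicator_of_notMem hyU]

end Product

/-! ### The Nikolskii norm on `ℝ^d` -/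

section WeakGrad

variable {d : ℕ} {v : E d → ℝ} {W : E d → Du d} {w : ℕ → E d → ℝ}

lemma isWeakGrad_of_h1Lim (h : H1Lim univ v W w) (hv : MemLp v 2 volume) (hW : MemLp W 2 volume) :
    IsWeakGrad v fun i y => W y (bas i) := by
  refine ⟨hv, fun i => ?_, fun i φ hφ hs => ?_⟩
  · exact (ContinuousLinearMap.apply ℝ ℝ (bas i : E d)).comp_memLp' hW
  · exact h.integral_mul_fderiv isOpen_univ (hφ.of_le (by exact_mod_cast le_top)) hs
      (subset_univ _) (bas i)

/-- The field `weakGrad` is a choice; this identifies it with the gradient obtained from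
approximations. -/
lemma IsWeakGrad.ae_eq {w w' : Fin d → E d → ℝ} (h : IsWeakGrad v w) (h' : IsWeakGrad v w')
    (i : Fin d) : w i =ᵐ[volume] w' i := by
  have hl : ∀ {f : E d → ℝ}, MemLp f 2 volume → LocallyIntegrable f volume := fun hf =>
    hf.locallyIntegrable one_le_two
  have h1 := ae_eq_of_integral_contDiff_smul_eq (hl (h.2.1 i)) (hl (h'.2.1 i)) fun φ hφ hs => by
    have e1 := h.2.2 i φ hφ hs
    have e2 := h'.2.2 i φ hφ hs
    have e3 := neg_injective (e1.symm.trans e2)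
    simp only [smul_eq_mul]
    simp_rw [mul_comm (φ _)]
    exact e3
  exact h1

lemma isWeakGrad_weakGrad (h : MemW12 v) : IsWeakGrad v (weakGrad v) := by
  rw [weakGrad, dif_pos h]
  exact Classical.choose_spec h

lemma norm_le_sum_bas (G : Du d) : ‖G‖ ≤ ∑ i, ‖G (bas i)‖ := by
  conv_lhs => rw [← sum_coord_smul_cobas G]
  refine (norm_sum_le _ _).trans (Finset.sum_le_sum fun i _ => ?_)
  rw [norm_smul]
  refine mul_le_of_le_one_right (norm_nonneg _) ?_
  exact ContinuousLinearMap.opNorm_le_bound _ zero_le_one fun x => by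
    rw [one_mul]; exact PiLp.norm_apply_le x i

lemma norm_apply_bas_le (G : Du d) (i : Fin d) : ‖G (bas i)‖ ≤ ‖G‖ := by
  have := G.le_opNorm (bas i)
  simpa [bas] using this

/-- Bound of the Nikolskii norm by Hölder conditions in quadratic mean. -/
lemma nikNormRd_le (h : H1Lim univ v W w) (hv : MemLp v 2 volume) (hW : MemLp W 2 volume) {σ : ℝ}
    {Y : ℝ≥0∞} (h1 : ∫⁻ y, ‖v y‖ₑ ^ 2 ≤ Y) (h2 : ∫⁻ y, ‖W y‖ₑ ^ 2 ≤ Y)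
    (h3 : ∀ η : E d, η ≠ 0 → ∫⁻ y, ‖W (y + η) - W y‖ₑ ^ 2 ≤ ENNReal.ofReal (‖η‖ ^ (2 * σ)) * Y) :
    MemW12 v ∧ nikNormRd σ v ^ 2 ≤ (d + 2) ^ 2 * Y := by
  have hw := isWeakGrad_of_h1Lim h hv hW
  have hm : MemW12 v := ⟨_, hw⟩
  refine ⟨hm, ?_⟩
  set y : ℝ≥0∞ := Y ^ (1 / 2 : ℝ)
  have hy : y ^ 2 = Y := by
    rw [← ENNReal.rpow_two, ← ENNReal.rpow_mul]; norm_num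
  have he : ∀ i, weakGrad v i =ᵐ[volume] fun y => W y (bas i) := fun i =>
    (isWeakGrad_weakGrad hm).ae_eq hw i
  have a1 : eLpNorm v 2 volume ≤ y := eLpNorm_two_le_of_sq_le (by rwa [hy])
  have a2 : ∀ i, eLpNorm (weakGrad v i) 2 volume ≤ y := fun i => by
    rw [eLpNorm_congr_ae (he i)]
    exact (eLpNorm_mono fun z => norm_apply_bas_le (W z) i).trans
      (eLpNorm_two_le_of_sq_le (by rwa [hy]))
  have a3 : (⨆ i : Fin d, ⨆ η : {η : E d // η ≠ 0},
      eLpNorm (fun z => weakGrad v i (z + η.1) - weakGrad v i z) 2 volume /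
        ENNReal.ofReal (‖η.1‖ ^ σ)) ≤ y := by
    refine iSup_le fun i => iSup_le fun η => ?_
    have hηp : 0 < ‖η.1‖ := norm_pos_iff.2 η.2
    refine ENNReal.div_le_of_le_mul ?_
    have e1 : (fun z => weakGrad v i (z + η.1) - weakGrad v i z) =ᵐ[volume]
        fun z => (W (z + η.1) - W z) (bas i) := by
      have := (measurePreserving_add_right (volume : Measure (E d))
        η.1).quasiMeasurePreserving.ae (he i)
      filter_upwards [this, he i] with z hz hz'
      rw [hz, hz', sub_apply]
    rw [eLpNorm_congr_ae e1]
    refine (eLpNorm_mono fun z => norm_apply_bas_le (W (z + η.1) - W z) i).trans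
      (eLpNorm_two_le_of_sq_le ((h3 η.1 η.2).trans_eq ?_))
    rw [mul_pow, hy, mul_comm, ← ENNReal.ofReal_pow (by positivity)]
    congr 2
    rw [← Real.rpow_natCast, ← Real.rpow_mul hηp.le, mul_comm]
    norm_num
  -- The norm of the function, the `d` norms of derivatives and the Hölder seminorm are each at most
  -- `y`.
  have a4 : nikNormRd σ v ≤ (d + 2) * y := by
    rw [nikNormRd]
    calc _ ≤ y + (∑ _i : Fin d, y) + y := by
          gcongr with i
          exact a2 i
      _ = _ := by
          rw [Finset.sum_const, Finset.card_univ, Fintype.card_fin, nsmul_eq_mul]; ring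
  calc nikNormRd σ v ^ 2 ≤ ((d + 2) * y) ^ 2 := by gcongr
    _ = _ := by rw [mul_pow, hy]

/-- Functions with finite Nikolskii norm satisfy Hölder conditions in quadratic mean. -/
lemma exists_nikOn_of_nikNormRd (h : H1Lim univ v W w) (hv : MemLp v 2 volume)
    (hW : MemLp W 2 volume) {σ : ℝ} (hm : MemW12 v) (hn : nikNormRd σ v < ⊤) :
    ∃ R : ℝ≥0∞, R < ⊤ ∧ ∀ B ρ, NikOn W B ρ σ R := by
  have hw := isWeakGrad_of_h1Lim h hv hW
  have he : ∀ i, weakGrad v i =ᵐ[volume] fun y => W y (bas i) := fun i =>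
    (isWeakGrad_weakGrad hm).ae_eq hw i
  set T := nikNormRd σ v
  have b1 : ∀ (i : Fin d) (η : E d), η ≠ 0 →
      eLpNorm (fun z => W (z + η) (bas i) - W z (bas i)) 2 volume ≤
        T * ENNReal.ofReal (‖η‖ ^ σ) := fun i η hη => by
    have hηp : 0 < ‖η‖ := norm_pos_iff.2 hη
    have e1 : (fun z => W (z + η) (bas i) - W z (bas i)) =ᵐ[volume]
        fun z => weakGrad v i (z + η) - weakGrad v i z := by
      have := (measurePreserving_add_right (volume : Measure (E d))
        η).quasiMeasurePreserving.ae (he i)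
      filter_upwards [this, he i] with z hz hz'
      rw [hz, hz']
    rw [eLpNorm_congr_ae e1, ← ENNReal.div_le_iff (by
      simpa using Real.rpow_pos_of_pos hηp σ) ENNReal.ofReal_ne_top]
    have h1 := le_iSup (fun η : {η : E d // η ≠ 0} =>
      eLpNorm (fun z => weakGrad v i (z + η.1) - weakGrad v i z) 2 volume /
        ENNReal.ofReal (‖η.1‖ ^ σ)) ⟨η, hη⟩
    have h2 := le_iSup (fun i : Fin d => ⨆ η : {η : E d // η ≠ 0},
      eLpNorm (fun z => weakGrad v i (z + η.1) - weakGrad v i z) 2 volume /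
        ENNReal.ofReal (‖η.1‖ ^ σ)) i
    exact (h1.trans h2).trans le_add_self
  -- The norm of a functional is at most the sum of its `d` components, each with increment bounded
  -- by `T ‖η‖ ^ σ`.
  refine ⟨(d * T) ^ 2, by finiteness, fun B ρ η _ => ?_⟩
  rcases eq_or_ne η 0 with rfl | hη
  · simp
  refine (setLIntegral_le_lintegral _ _).trans ?_
  rw [← eLpNorm_two_sq]
  have hsh : MemLp (fun z => W (z + η)) 2 volume :=
    hW.comp_measurePreserving (measurePreserving_add_right (volume : Measure (E d)) η)
  have hmi : ∀ i : Fin d, AEStronglyMeasurable (fun z => ‖W (z + η) (bas i) - W z (bas i)‖)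
      volume := fun i =>
    (((ContinuousLinearMap.apply ℝ ℝ (bas i : E d)).comp_memLp' hsh).1.sub
      ((ContinuousLinearMap.apply ℝ ℝ (bas i : E d)).comp_memLp' hW).1).norm
  have b2 : eLpNorm (fun z => W (z + η) - W z) 2 volume ≤ d * T * ENNReal.ofReal (‖η‖ ^ σ) := by
    calc _ ≤ eLpNorm (∑ i : Fin d, fun z => ‖W (z + η) (bas i) - W z (bas i)‖) 2 volume := by
          refine eLpNorm_mono_real fun z => ?_
          rw [Finset.sum_apply]
          exact norm_le_sum_bas (W (z + η) - W z)
      _ ≤ ∑ i : Fin d, eLpNorm (fun z => ‖W (z + η) (bas i) - W z (bas i)‖) 2 volume :=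
          eLpNorm_sum_le (fun i _ => hmi i) one_le_two
      _ ≤ ∑ _i : Fin d, T * ENNReal.ofReal (‖η‖ ^ σ) := by
          refine Finset.sum_le_sum fun i _ => ?_
          rw [eLpNorm_norm]
          exact b1 i η hη
      _ = _ := by
          rw [Finset.sum_const, Finset.card_univ, Fintype.card_fin, nsmul_eq_mul, mul_assoc]
  calc _ ≤ (d * T * ENNReal.ofReal (‖η‖ ^ σ)) ^ 2 := by gcongr
    _ = _ := by
      rw [mul_pow, mul_comm, ← ENNReal.ofReal_pow (by positivity)]
      congr 2
      rw [← Real.rpow_natCast, ← Real.rpow_mul (norm_nonneg _), mul_comm]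
      norm_num

end WeakGrad

/-! ### From local Hölder conditions to a global one -/

section Cover

variable {V : Type*} [NormedAddCommGroup V] [NormedSpace ℝ V] [FiniteDimensional ℝ V]
  [MeasureSpace V] [BorelSpace V] [(volume : Measure V).IsAddHaarMeasure] {U : Set V}

lemma lintegral_sq_translate_sub_le {Y : Type*} [NormedAddCommGroup Y] {W : V → Y}
    (hW : AEStronglyMeasurable W volume) (h : V) :
    ∫⁻ y, ‖W (y + h) - W y‖ₑ ^ 2 ≤ 4 * ∫⁻ y, ‖W y‖ₑ ^ 2 := by
  have hm : AEMeasurable (fun y => ‖W y‖ₑ ^ 2) volume := hW.enorm.pow_const 2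
  have hm' : AEMeasurable (fun y => ‖W (y + h)‖ₑ ^ 2) volume :=
    (hW.comp_measurePreserving (measurePreserving_add_right volume h)).enorm.pow_const 2
  calc _ ≤ ∫⁻ y, 2 * (‖W (y + h)‖ₑ ^ 2 + ‖W y‖ₑ ^ 2) := lintegral_mono fun y =>
        (pow_le_pow_left' enorm_sub_le 2).trans (ennreal_add_sq_le _ _)
    _ = 2 * ((∫⁻ y, ‖W (y + h)‖ₑ ^ 2) + ∫⁻ y, ‖W y‖ₑ ^ 2) := by
        rw [lintegral_const_mul' _ _ ENNReal.ofNat_ne_top, lintegral_add_left' hm']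
    _ = 4 * ∫⁻ y, ‖W y‖ₑ ^ 2 := by
        rw [lintegral_add_right_eq_self (fun y => ‖W y‖ₑ ^ 2) h, ← two_mul, ← mul_assoc]
        norm_num

lemma fderiv_eq_zero_of_notMem {η : V → ℝ} (hU : IsOpen U) {K : Set V} (hK : IsClosed K)
    (h0 : ∀ y ∈ U, y ∉ K → η y = 0) {y : V} (hy : y ∈ U) (hyK : y ∉ K) : fderiv ℝ η y = 0 := by
  have h : η =ᶠ[𝓝 y] fun _ => 0 := by
    filter_upwards [hU.mem_nhds hy, hK.isOpen_compl.mem_nhds hyK] with z hz hz' using h0 z hz hz'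
  rw [h.fderiv_eq, fderiv_fun_const, Pi.zero_apply]

/-- The product with a cut-off function, extended by zero. -/
lemma H1Lim.cutoff {u : V → ℝ} {G : V → V →L[ℝ] ℝ} {w : ℕ → V → ℝ} (H : H1Lim U u G w)
    (hU : IsOpen U) {K : Set V} (hK : IsCompact K) (hKU : K ⊆ U) {η : V → ℝ}
    (hη : ContDiffOn ℝ 1 η U) (h0 : ∀ y ∈ U, y ∉ K → η y = 0) :
    H1Lim univ (U.indicator fun y => η y * u y)
      (U.indicator fun y => η y • G y + u y • fderiv ℝ η y)
      (fun n => U.indicator fun y => η y * w n y) ∧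
    MemLp (U.indicator fun y => η y * u y) 2 volume ∧
    MemLp (U.indicator fun y => η y • G y + u y • fderiv ℝ η y) 2 volume := by
  have hd0 : ∀ y ∈ U, y ∉ K → fderiv ℝ η y = 0 := fun y hy hyK =>
    fderiv_eq_zero_of_notMem hU hK.isClosed h0 hy hyK
  set v := U.indicator fun y => η y * u y
  set W := U.indicator fun y => η y • G y + u y • fderiv ℝ η y
  have hv0 : ∀ y, y ∉ K → v y = 0 := fun y hy => by
    by_cases hyU : y ∈ U
    · show U.indicator _ y = 0
      rw [indicator_of_mem hyU, h0 y hyU hy, zero_mul]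
    · exact indicator_of_notMem hyU _
  have hW0 : ∀ y, y ∉ K → W y = 0 := fun y hy => by
    by_cases hyU : y ∈ U
    · show U.indicator _ y = 0
      rw [indicator_of_mem hyU, h0 y hyU hy, hd0 y hyU hy, zero_smul, smul_zero, add_zero]
    · exact indicator_of_notMem hyU _
  have hH : H1Lim univ v W (fun n => U.indicator fun y => η y * w n y) :=
    (H.mul hη hU).indicator hU hK hKU (fun y hy hyK => by rw [h0 y hy hyK, zero_mul])
      (fun y hy hyK => by rw [h0 y hy hyK, hd0 y hy hyK, zero_smul, smul_zero, add_zero])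
      fun n y hy hyK => by rw [h0 y hy hyK, zero_mul]
  have hvK : K.indicator v = v := indicator_eq_self.2 fun y hy => by
    by_contra h1; exact hy (hv0 y h1)
  have hWK : K.indicator W = W := indicator_eq_self.2 fun y hy => by
    by_contra h1; exact hy (hW0 y h1)
  refine ⟨hH, ?_, ?_⟩
  · rw [← hvK, memLp_indicator_iff_restrict hK.measurableSet]
    exact hH.memLp hK (subset_univ _)
  · rw [← hWK, memLp_indicator_iff_restrict hK.measurableSet]
    exact hH.memLp_grad isOpen_univ hK (subset_univ _)

/-- Local Hölder conditions in quadratic mean around the points of a compact set imply a global one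
for the product with a cut-off function supported in this set. -/
lemma exists_nikolskii_of_cover (hU : IsOpen U) {K : Set V} (hK : IsCompact K) (hKU : K ⊆ U)
    {η : V → ℝ} (hη : ∀ y ∈ U, C11At η y) (h0 : ∀ y ∈ U, y ∉ K → η y = 0) {t : Finset V}
    {ρ : V → ℝ} (hρ : ∀ y ∈ t, 0 < ρ y) (hρ1 : ∀ y ∈ t, ρ y ≤ 1)
    (hB : ∀ y ∈ t, Metric.closedBall y (2 * ρ y) ⊆ U)
    (ht : K ⊆ ⋃ y ∈ t, Metric.ball y (ρ y / 2)) :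
    ∃ C : ℝ≥0, ∃ K', IsCompact K' ∧ K' ⊆ U ∧ ∀ (u : V → ℝ) (G : V → V →L[ℝ] ℝ) (w : ℕ → V → ℝ),
      H1Lim U u G w → ∀ (σ : ℝ) (R Y : ℝ≥0∞), 0 ≤ σ → σ ≤ 1 →
      (∀ y ∈ t, NikOn G (Metric.closedBall y (ρ y)) (ρ y) σ R) →
      C * (R + ((∫⁻ y in K', ‖G y‖ₑ ^ 2) + ∫⁻ y in K', ‖u y‖ₑ ^ 2)) ≤ Y →
      H1Lim univ (U.indicator fun y => η y * u y)
        (U.indicator fun y => η y • G y + u y • fderiv ℝ η y)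
        (fun n => U.indicator fun y => η y * w n y) ∧
      MemLp (U.indicator fun y => η y * u y) 2 volume ∧
      MemLp (U.indicator fun y => η y • G y + u y • fderiv ℝ η y) 2 volume ∧
      ∫⁻ y, ‖U.indicator (fun y => η y * u y) y‖ₑ ^ 2 ≤ Y ∧
      ∫⁻ y, ‖U.indicator (fun y => η y • G y + u y • fderiv ℝ η y) y‖ₑ ^ 2 ≤ Y ∧
      ∀ h, ∫⁻ y, ‖U.indicator (fun y => η y • G y + u y • fderiv ℝ η y) (y + h) -
        U.indicator (fun y => η y • G y + u y • fderiv ℝ η y) y‖ₑ ^ 2 ≤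
          ENNReal.ofReal (‖h‖ ^ (2 * σ)) * Y := by
  have hηC1 : ContDiffOn ℝ 1 η U := fun y hy => (hη y hy).1.contDiffWithinAt
  have hd0 : ∀ y ∈ U, y ∉ K → fderiv ℝ η y = 0 := fun y hy hyK =>
    fderiv_eq_zero_of_notMem hU hK.isClosed h0 hy hyK
  have hex : ∀ y : V, ∃ c : ℝ≥0, y ∈ t → ∀ (u : V → ℝ) (G : V → V →L[ℝ] ℝ) (w : ℕ → V → ℝ),
      H1Lim U u G w → ∀ (σ : ℝ) (R : ℝ≥0∞), 0 ≤ σ → σ ≤ 1 →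
      NikOn G (Metric.closedBall y (ρ y)) (ρ y) σ R →
      NikOn (fun y => η y • G y + u y • fderiv ℝ η y) (Metric.closedBall y (ρ y)) (ρ y) σ
        (c * (R + ((∫⁻ y in Metric.closedBall y (2 * ρ y), ‖G y‖ₑ ^ 2) +
          ∫⁻ y in Metric.closedBall y (2 * ρ y), ‖u y‖ₑ ^ 2))) := fun y => by
    by_cases hy : y ∈ t
    · obtain ⟨c, hc⟩ := exists_nikOn_mul hU (hρ1 y hy) (hB y hy) fun z hz => hη z (hB y hy hz)
      exact ⟨c, fun _ => hc⟩
    · exact ⟨0, fun h => (hy h).elim⟩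
  choose c hc using hex
  obtain ⟨Λ₁, hΛ₁⟩ := hK.bddAbove_image (hηC1.continuousOn.mono hKU).norm
  obtain ⟨Λ₂, hΛ₂⟩ := hK.bddAbove_image
    ((hηC1.continuousOn_fderiv_of_isOpen hU le_rfl).mono hKU).norm
  set Λ := max (max Λ₁ Λ₂) 0
  have hΛ : 0 ≤ Λ := le_max_right _ _
  have b1 : ∀ y ∈ K, ‖η y‖ ≤ Λ := fun y hy => (hΛ₁ (mem_image_of_mem _ hy)).trans
    ((le_max_left _ _).trans (le_max_left _ _))
  have b2 : ∀ y ∈ K, ‖fderiv ℝ η y‖ ≤ Λ := fun y hy => (hΛ₂ (mem_image_of_mem _ hy)).trans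
    ((le_max_right _ _).trans (le_max_left _ _))
  -- The half-radius balls cover `K`. For `‖h‖ ≤ δ`, a point outside all the full balls is therefore
  -- outside `K` together with its translate, and the increment vanishes there.
  obtain ⟨δ, hδt, hδ1, hδ⟩ : ∃ δ : ℝ, (∀ y ∈ t, δ ≤ ρ y / 2) ∧ δ ≤ 1 ∧ 0 < δ := by
    have e1 : ∀ᶠ δ : ℝ in 𝓝[>] 0, ∀ y ∈ t, δ ≤ ρ y / 2 :=
      (Finset.eventually_all t).2 fun y hy =>
        nhdsWithin_le_nhds (ge_mem_nhds (half_pos (hρ y hy)))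
    have e2 : ∀ᶠ δ : ℝ in 𝓝[>] 0, δ ≤ 1 := nhdsWithin_le_nhds (ge_mem_nhds one_pos)
    exact (e1.and (e2.and self_mem_nhdsWithin)).exists
  set K' := K ∪ ⋃ y ∈ t, Metric.closedBall y (2 * ρ y)
  have hK' : IsCompact K' := hK.union (t.isCompact_biUnion fun y _ => isCompact_closedBall _ _)
  have hKK' : K ⊆ K' := subset_union_left
  have hBK' : ∀ y ∈ t, Metric.closedBall y (2 * ρ y) ⊆ K' := fun y hy =>
    (subset_biUnion_of_mem (u := fun y => Metric.closedBall y (2 * ρ y)) hy).trans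
      subset_union_right
  set C₁ : ℝ≥0 := (2 * Λ ^ 2).toNNReal
  set C₂ : ℝ≥0 := ((δ ^ 2)⁻¹).toNNReal
  refine ⟨(∑ y ∈ t, c y) + (C₁ + C₂ * (4 * C₁)), K', hK', union_subset hKU (iUnion₂_subset hB),
    fun u G w H σ R Y hσ hσ1 hN hY => ?_⟩
  set v := U.indicator fun y => η y * u y
  set W := U.indicator fun y => η y • G y + u y • fderiv ℝ η y
  set X := (∫⁻ y in K', ‖G y‖ₑ ^ 2) + ∫⁻ y in K', ‖u y‖ₑ ^ 2
  have hv0 : ∀ y, y ∉ K → v y = 0 := fun y hy => by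
    by_cases hyU : y ∈ U
    · show U.indicator _ y = 0
      rw [indicator_of_mem hyU, h0 y hyU hy, zero_mul]
    · exact indicator_of_notMem hyU _
  have hW0 : ∀ y, y ∉ K → W y = 0 := fun y hy => by
    by_cases hyU : y ∈ U
    · show U.indicator _ y = 0
      rw [indicator_of_mem hyU, h0 y hyU hy, hd0 y hyU hy, zero_smul, smul_zero, add_zero]
    · exact indicator_of_notMem hyU _
  have hWU : ∀ y ∈ U, W y = η y • G y + u y • fderiv ℝ η y := fun y hy => indicator_of_mem hy _
  obtain ⟨hH, hvL, hWL⟩ : H1Lim univ v W (fun n => U.indicator fun y => η y * w n y) ∧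
      MemLp v 2 volume ∧ MemLp W 2 volume := H.cutoff hU hK hKU hηC1 h0
  have hGm : AEMeasurable (fun y => ‖G y‖ₑ ^ 2) (volume.restrict K) :=
    (H.meas_grad.mono_set hKU).enorm.pow_const 2
  have hXK : (∫⁻ y in K, ‖G y‖ₑ ^ 2) + ∫⁻ y in K, ‖u y‖ₑ ^ 2 ≤ X :=
    add_le_add (lintegral_mono_set hKK') (lintegral_mono_set hKK')
  have hs : ∀ F : V → ℝ≥0∞, (∀ y, y ∉ K → F y = 0) →
      ∫⁻ y, F y = ∫⁻ y in K, F y := fun F hF => by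
    rw [← lintegral_indicator hK.measurableSet]
    congr 1
    ext y
    by_cases hy : y ∈ K
    · rw [indicator_of_mem hy]
    · rw [indicator_of_notMem hy, hF y hy]
  have hv2 : ∫⁻ y, ‖v y‖ₑ ^ 2 ≤ C₁ * X := by
    rw [hs _ fun y hy => by rw [hv0 y hy]; simp]
    refine (setLIntegral_mono' (g := fun y => C₁ * ‖u y‖ₑ ^ 2) hK.measurableSet fun y hy => ?_).trans
      ?_
    · show ‖U.indicator _ y‖ₑ ^ 2 ≤ _
      rw [indicator_of_mem (hKU hy), enorm_sq_eq_ofReal, enorm_sq_eq_ofReal, ← ENNReal.ofReal,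
        ← ENNReal.ofReal_mul (by positivity)]
      refine ENNReal.ofReal_le_ofReal ?_
      rw [norm_mul, mul_pow]
      have := pow_le_pow_left₀ (norm_nonneg _) (b1 y hy) 2
      nlinarith [sq_nonneg ‖u y‖, sq_nonneg Λ]
    · rw [lintegral_const_mul' _ _ ENNReal.coe_ne_top]
      exact mul_le_mul' le_rfl (le_add_self.trans hXK)
  have hW2 : ∫⁻ y, ‖W y‖ₑ ^ 2 ≤ C₁ * X := by
    rw [hs _ fun y hy => by rw [hW0 y hy]; simp]
    refine (setLIntegral_mono' (g := fun y => C₁ * (‖G y‖ₑ ^ 2 + ‖u y‖ₑ ^ 2)) hK.measurableSet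
      fun y hy => ?_).trans ?_
    · rw [hWU y (hKU hy)]
      simp only [enorm_sq_eq_ofReal]
      rw [← ENNReal.ofReal_add (by positivity) (by positivity), ← ENNReal.ofReal,
        ← ENNReal.ofReal_mul (by positivity)]
      refine ENNReal.ofReal_le_ofReal ?_
      have i1 : ‖η y • G y + u y • fderiv ℝ η y‖ ≤ Λ * (‖G y‖ + ‖u y‖) := by
        refine (norm_add_le _ _).trans ?_
        rw [norm_smul, norm_smul]
        nlinarith [mul_le_mul_of_nonneg_right (b1 y hy) (norm_nonneg (G y)),
          mul_le_mul_of_nonneg_right (b2 y hy) (norm_nonneg (u y))]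
      calc _ ≤ (Λ * (‖G y‖ + ‖u y‖)) ^ 2 := by gcongr
        _ = Λ ^ 2 * (‖G y‖ + ‖u y‖) ^ 2 := by ring
        _ ≤ Λ ^ 2 * (2 * (‖G y‖ ^ 2 + ‖u y‖ ^ 2)) := by
          gcongr
          nlinarith [sq_nonneg (‖G y‖ - ‖u y‖)]
        _ = _ := by ring
    · rw [lintegral_const_mul' _ _ ENNReal.coe_ne_top, lintegral_add_left' hGm]
      exact mul_le_mul' le_rfl hXK
  have hYc : ((∑ y ∈ t, c y : ℝ≥0) : ℝ≥0∞) * (R + X) ≤ Y := by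
    refine le_trans ?_ hY
    rw [ENNReal.coe_add, add_mul]
    exact le_self_add
  have hYC : (C₁ : ℝ≥0∞) * X ≤ Y := by
    refine le_trans ?_ hY
    rw [ENNReal.coe_add, ENNReal.coe_add, add_mul, add_mul]
    exact (mul_le_mul' le_rfl le_add_self).trans (le_self_add.trans le_add_self)
  have hYD : (C₂ : ℝ≥0∞) * (4 * (C₁ * X)) ≤ Y := by
    refine le_trans ?_ hY
    rw [ENNReal.coe_add, ENNReal.coe_add, add_mul, add_mul]
    refine le_trans ?_ (le_add_self.trans le_add_self)
    push_cast
    rw [mul_assoc, mul_assoc]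
    exact mul_le_mul' le_rfl (mul_le_mul' le_rfl (mul_le_mul' le_rfl le_add_self))
  refine ⟨hH, hvL, hWL, hv2.trans hYC, hW2.trans hYC, fun h => ?_⟩
  rcases le_or_gt ‖h‖ δ with hh | hh
  · have hsupp : ∀ y, y ∉ ⋃ z ∈ t, Metric.closedBall z (ρ z) → W (y + h) - W y = 0 :=
      fun y hy => by
      have hmem : ∀ z ∈ t, y ∉ Metric.closedBall z (ρ z) := fun z hz hyz =>
        hy (mem_iUnion₂.2 ⟨z, hz, hyz⟩)
      rw [hW0 (y + h) fun hyK => ?_, hW0 y fun hyK => ?_, sub_zero]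
      · obtain ⟨z, hz, hyz⟩ := mem_iUnion₂.1 (ht hyK)
        refine hmem z hz (Metric.ball_subset_closedBall (Metric.ball_subset_ball ?_ hyz))
        linarith [hρ z hz]
      · obtain ⟨z, hz, hyz⟩ := mem_iUnion₂.1 (ht hyK)
        refine hmem z hz ?_
        have := add_mem_closedBall (Metric.ball_subset_closedBall hyz) (h := -h)
          (show ‖-h‖ ≤ ρ z / 2 by rw [norm_neg]; exact hh.trans (hδt z hz))
        rwa [add_neg_cancel_right, add_halves] at this
    have hmeas : MeasurableSet (⋃ z ∈ t, Metric.closedBall z (ρ z)) :=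
      t.measurableSet_biUnion fun z _ => Metric.isClosed_closedBall.measurableSet
    calc ∫⁻ y, ‖W (y + h) - W y‖ₑ ^ 2
        = ∫⁻ y in ⋃ z ∈ t, Metric.closedBall z (ρ z), ‖W (y + h) - W y‖ₑ ^ 2 := by
          rw [← lintegral_indicator hmeas]
          congr 1
          ext y
          by_cases hy : y ∈ ⋃ z ∈ t, Metric.closedBall z (ρ z)
          · rw [indicator_of_mem hy]
          · rw [indicator_of_notMem hy, hsupp y hy]; simp
      _ ≤ ∑ z ∈ t, ∫⁻ y in Metric.closedBall z (ρ z), ‖W (y + h) - W y‖ₑ ^ 2 := by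
          have := lintegral_iUnion_le (μ := volume)
            (fun z : t => Metric.closedBall (z : V) (ρ z)) fun y => ‖W (y + h) - W y‖ₑ ^ 2
          rw [tsum_fintype, Finset.sum_coe_sort t fun z =>
            ∫⁻ y in Metric.closedBall z (ρ z), ‖W (y + h) - W y‖ₑ ^ 2] at this
          rwa [iUnion_subtype (fun z => z ∈ t) fun z => Metric.closedBall (z : V) (ρ z)] at this
      _ ≤ ∑ z ∈ t, ENNReal.ofReal (‖h‖ ^ (2 * σ)) * (c z * (R + X)) := by
          refine Finset.sum_le_sum fun z hz => ?_
          have hhz : ‖h‖ ≤ ρ z := (hh.trans (hδt z hz)).trans (by linarith [hρ z hz])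
          have e1 : ∫⁻ y in Metric.closedBall z (ρ z), ‖W (y + h) - W y‖ₑ ^ 2 =
              ∫⁻ y in Metric.closedBall z (ρ z), ‖(η (y + h) • G (y + h) +
                u (y + h) • fderiv ℝ η (y + h)) - (η y • G y + u y • fderiv ℝ η y)‖ₑ ^ 2 := by
            refine setLIntegral_congr_fun Metric.isClosed_closedBall.measurableSet fun y hy => ?_
            rw [hWU y (hB z hz (Metric.closedBall_subset_closedBall (by linarith [hρ z hz]) hy)),
              hWU (y + h) (hB z hz (Metric.closedBall_subset_closedBall (by linarith)
                (add_mem_closedBall hy hhz)))]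
          rw [e1]
          refine (hc z hz u G w H σ R hσ hσ1 (hN z hz) h hhz).trans ?_
          refine mul_le_mul' le_rfl (mul_le_mul' le_rfl (add_le_add le_rfl (add_le_add ?_ ?_)))
          · exact lintegral_mono_set (hBK' z hz)
          · exact lintegral_mono_set (hBK' z hz)
      _ = ENNReal.ofReal (‖h‖ ^ (2 * σ)) * (((∑ y ∈ t, c y : ℝ≥0) : ℝ≥0∞) * (R + X)) := by
          rw [← Finset.mul_sum, ← Finset.sum_mul, ENNReal.ofNNReal_finsetSum]
      _ ≤ _ := mul_le_mul' le_rfl hYc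
  · refine (lintegral_sq_translate_sub_le hWL.1 h).trans ?_
    -- Large translations need only the trivial bound by the norm, since `‖h‖ ^ (2 σ) ≥ δ ^ 2`.
    have hp : 1 ≤ ENNReal.ofReal (‖h‖ ^ (2 * σ)) * C₂ := by
      have i1 : δ ^ 2 ≤ ‖h‖ ^ (2 * σ) := by
        calc δ ^ 2 = δ ^ (2 : ℝ) := (Real.rpow_two δ).symm
          _ ≤ δ ^ (2 * σ) := Real.rpow_le_rpow_of_exponent_ge hδ hδ1 (by linarith)
          _ ≤ _ := Real.rpow_le_rpow hδ.le hh.le (by linarith)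
      have i2 : 0 < δ ^ 2 := by positivity
      rw [← ENNReal.ofReal, ← ENNReal.ofReal_mul (by positivity), ENNReal.one_le_ofReal]
      calc (1 : ℝ) = δ ^ 2 * (δ ^ 2)⁻¹ := (mul_inv_cancel₀ i2.ne').symm
        _ ≤ _ := by gcongr
    calc 4 * ∫⁻ y, ‖W y‖ₑ ^ 2 ≤ 1 * (4 * (C₁ * X)) := by
          rw [one_mul]; exact mul_le_mul' le_rfl hW2
      _ ≤ (ENNReal.ofReal (‖h‖ ^ (2 * σ)) * C₂) * (4 * (C₁ * X)) := mul_le_mul' hp le_rfl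
      _ = ENNReal.ofReal (‖h‖ ^ (2 * σ)) * (C₂ * (4 * (C₁ * X))) := mul_assoc _ _ _
      _ ≤ _ := mul_le_mul' le_rfl hYD

end Cover

/-! ### Stability of finite Hölder conditions -/

section General

lemma exists_radius {V : Type*} [PseudoMetricSpace V] {U : Set V} {y₀ : V} (hU : U ∈ 𝓝 y₀) {a : ℝ}
    (ha : 0 < a) : ∃ ρ > 0, ρ ≤ a ∧ Metric.closedBall y₀ (2 * ρ) ⊆ U := by
  obtain ⟨r, hr, h⟩ := Metric.nhds_basis_closedBall.mem_iff.1 hU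
  refine ⟨min a (r / 2), by positivity, min_le_left _ _,
    (Metric.closedBall_subset_closedBall ?_).trans h⟩
  linarith [min_le_right a (r / 2)]

lemma lintegral_sq_lt_top {α Y : Type*} [MeasurableSpace α] {μ : Measure α} [NormedAddCommGroup Y]
    {f : α → Y} (h : MemLp f 2 μ) : ∫⁻ x, ‖f x‖ₑ ^ 2 ∂μ < ⊤ := by
  rw [← eLpNorm_two_sq]
  exact ENNReal.pow_lt_top h.2

variable {V : Type*} [NormedAddCommGroup V] [NormedSpace ℝ V] [FiniteDimensional ℝ V]
  [MeasureSpace V] [BorelSpace V] [(volume : Measure V).IsAddHaarMeasure] {U : Set V}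

lemma NikOn.mul_lt_top {η u : V → ℝ} {G : V → V →L[ℝ] ℝ} {w : ℕ → V → ℝ} (H : H1Lim U u G w)
    (hU : IsOpen U) {y₀ : V} {ρ : ℝ} (hρ1 : ρ ≤ 1) (hBU : Metric.closedBall y₀ (2 * ρ) ⊆ U)
    (hη : ∀ y ∈ Metric.closedBall y₀ (2 * ρ), C11At η y) {σ : ℝ} {R : ℝ≥0∞} (hσ : 0 ≤ σ)
    (hσ1 : σ ≤ 1) (hR : R < ⊤) (h : NikOn G (Metric.closedBall y₀ ρ) ρ σ R) :
    ∃ R' < ⊤, NikOn (fun y => η y • G y + u y • fderiv ℝ η y) (Metric.closedBall y₀ ρ) ρ σ R' := by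
  obtain ⟨C, hC⟩ := exists_nikOn_mul hU hρ1 hBU hη
  exact ⟨_, ENNReal.mul_lt_top ENNReal.coe_lt_top (ENNReal.add_lt_top.2 ⟨hR, ENNReal.add_lt_top.2
    ⟨lintegral_sq_lt_top (H.memLp_grad hU (isCompact_closedBall _ _) hBU),
      lintegral_sq_lt_top (H.memLp (isCompact_closedBall _ _) hBU)⟩⟩), hC u G w H σ R hσ hσ1 h⟩

lemma NikOn.sub_translate {Y : Type*} [NormedAddCommGroup Y] {G : V → Y} (hU : IsOpen U)
    (hG : AEStronglyMeasurable G (volume.restrict U)) {y₀ h : V} {ρ σ : ℝ} {R R' : ℝ≥0∞}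
    (hρ : 0 ≤ ρ) (hBU : Metric.closedBall y₀ (2 * ρ) ⊆ U)
    (h1 : NikOn G (Metric.closedBall y₀ ρ) ρ σ R)
    (h2 : NikOn G (Metric.closedBall (y₀ + h) ρ) ρ σ R') :
    NikOn (fun y => G y - G (y + h)) (Metric.closedBall y₀ ρ) ρ σ (2 * (R + R')) := fun v hv => by
  have hB : MeasurableSet (Metric.closedBall y₀ ρ) := Metric.isClosed_closedBall.measurableSet
  have mG : AEStronglyMeasurable G (volume.restrict (Metric.closedBall y₀ ρ)) :=
    hG.mono_set ((Metric.closedBall_subset_closedBall (by linarith)).trans hBU)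
  have hsub : Metric.closedBall y₀ ρ ⊆ (fun y => y + v) ⁻¹' U := fun y hy =>
    hBU (Metric.closedBall_subset_closedBall (by linarith) (add_mem_closedBall hy hv))
  have mGv : AEStronglyMeasurable (fun y => G (y + v)) (volume.restrict (Metric.closedBall y₀ ρ)) :=
    (aestronglyMeasurable_comp_add_right v hU.measurableSet hG).mono_set hsub
  have k1 : AEMeasurable (fun y => ‖G (y + v) - G y‖ₑ ^ 2)
      (volume.restrict (Metric.closedBall y₀ ρ)) := (mGv.sub mG).enorm.pow_const 2
  have e1 : ∫⁻ y in Metric.closedBall y₀ ρ, ‖G (y + h + v) - G (y + h)‖ₑ ^ 2 =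
      ∫⁻ y in Metric.closedBall (y₀ + h) ρ, ‖G (y + v) - G y‖ₑ ^ 2 := by
    have hp : Metric.closedBall y₀ ρ = (fun y => y + h) ⁻¹' Metric.closedBall (y₀ + h) ρ := by
      ext y
      simp
    rw [hp]
    exact (measurePreserving_add_right volume h).setLIntegral_comp_preimage_emb
      (measurableEmbedding_addRight h) (fun y => ‖G (y + v) - G y‖ₑ ^ 2) _
  calc _ ≤ ∫⁻ y in Metric.closedBall y₀ ρ,
        2 * (‖G (y + v) - G y‖ₑ ^ 2 + ‖G (y + h + v) - G (y + h)‖ₑ ^ 2) := by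
        refine lintegral_mono fun y => ?_
        have e : G (y + v) - G (y + v + h) - (G y - G (y + h)) =
            (G (y + v) - G y) - (G (y + h + v) - G (y + h)) := by
          rw [add_right_comm]; abel
        show ‖G (y + v) - G (y + v + h) - (G y - G (y + h))‖ₑ ^ 2 ≤ _
        rw [e]
        exact (pow_le_pow_left' enorm_sub_le 2).trans (ennreal_add_sq_le _ _)
    _ = 2 * ((∫⁻ y in Metric.closedBall y₀ ρ, ‖G (y + v) - G y‖ₑ ^ 2) +
          ∫⁻ y in Metric.closedBall (y₀ + h) ρ, ‖G (y + v) - G y‖ₑ ^ 2) := by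
        rw [lintegral_const_mul' _ _ ENNReal.ofNat_ne_top, lintegral_add_left' k1, e1]
    _ ≤ 2 * (ENNReal.ofReal (‖v‖ ^ (2 * σ)) * R + ENNReal.ofReal (‖v‖ ^ (2 * σ)) * R') :=
        mul_le_mul' le_rfl (add_le_add (h1 v hv) (h2 v hv))
    _ = _ := by ring

end General

/-! ### The Nikolskii spaces on `M` and their local description -/

section Manifold

variable {d : ℕ} {M : Type*} [TopologicalSpace M] [T2Space M] [CompactSpace M] [ChartedSpace (E d) M]
  [MeasurableSpace M] [IsManifold (𝓡 d) 1 M] [BorelSpace M] {g : Metric d M} {μ : Measure M}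
  {e e' : Chart d M} {Ω : Set M}

lemma isCompact_image_tsupport {ψ : M → ℝ} (hs : tsupport ψ ⊆ e.source) :
    IsCompact (e '' tsupport ψ) :=
  (isClosed_tsupport ψ).isCompact.image_of_continuousOn (e.continuousOn.mono hs)

lemma image_tsupport_subset {ψ : M → ℝ} (hs : tsupport ψ ⊆ e.source) :
    e '' tsupport ψ ⊆ e.target := by
  rintro _ ⟨x, hx, rfl⟩
  exact e.map_source (hs hx)

lemma eq_zero_of_notMem_image_tsupport {ψ : M → ℝ} {y : E d} (hy : y ∈ e.target)
    (h : y ∉ e '' tsupport ψ) : ψ (e.symm y) = 0 := by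
  by_contra h0
  exact h ⟨e.symm y, subset_tsupport _ h0, e.right_inv hy⟩

/-- Bound of the Nikolskii norm of a localized function by local Hölder conditions. -/
lemma Geom.exists_nikNormRd_le (S : Geom g μ) (he : IsC11Chart e) {ψ : M → ℝ} (hψ : IsC11Fun d ψ)
    (hs : tsupport ψ ⊆ e.source) {ρ : E d → ℝ} (hρ : ∀ y ∈ e '' tsupport ψ, 0 < ρ y ∧ ρ y ≤ 1 ∧
      Metric.closedBall y (2 * ρ y) ⊆ e.target) :
    ∃ t : Finset (E d), (∀ y ∈ t, y ∈ e '' tsupport ψ) ∧ ∃ C : ℝ≥0, ∃ K', IsCompact K' ∧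
      K' ⊆ e.target ∧ ∀ (u : M → ℝ) (θ : ∀ x : M, Cot d x), IsH10Diff g μ Ω u θ →
      ∀ (σ : ℝ) (R Y : ℝ≥0∞), 0 ≤ σ → σ ≤ 1 →
      (∀ y ∈ t, NikOn (cgrad e θ) (Metric.closedBall y (ρ y)) (ρ y) σ R) →
      C * (R + ((∫⁻ y in K', ‖cgrad e θ y‖ₑ ^ 2) + ∫⁻ y in K', ‖u (e.symm y)‖ₑ ^ 2)) ≤ Y →
      MemW12 (inChart e (ψ * u)) ∧ nikNormRd σ (inChart e (ψ * u)) ^ 2 ≤ (d + 2) ^ 2 * Y := by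
  have hK := isCompact_image_tsupport (e := e) hs
  have hKt := image_tsupport_subset (e := e) hs
  obtain ⟨t, htK, ht⟩ := hK.elim_nhds_subcover (fun y => Metric.ball y (ρ y / 2)) fun y hy =>
    Metric.ball_mem_nhds y (half_pos (hρ y hy).1)
  obtain ⟨C, K', hK', hK't, H⟩ := exists_nikolskii_of_cover (η := fun y => ψ (e.symm y))
    e.open_target hK hKt (fun y hy => hψ.c11At he hy)
    (fun y hy hyK => eq_zero_of_notMem_image_tsupport hy hyK) (fun y hy => (hρ y (htK y hy)).1)
    (fun y hy => (hρ y (htK y hy)).2.1) (fun y hy => (hρ y (htK y hy)).2.2) ht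
  refine ⟨t, htK, C, K', hK', hK't, fun u θ hu σ R Y hσ hσ1 hN hY => ?_⟩
  obtain ⟨w, hw⟩ := hu.exists_h1Lim S he
  obtain ⟨h1, h2, h3, h4, h5, h6⟩ := H _ _ w hw σ R Y hσ hσ1 hN hY
  exact nikNormRd_le h1 h2 h3 h4 h5 fun h _ => h6 h

/-- The differential `θ` satisfies a Hölder condition in quadratic mean near `x`. -/
def LocNik (e : Chart d M) (θ : ∀ x : M, Cot d x) (s : ℝ) (x : M) : Prop :=
  ∃ ρ > 0, ρ ≤ 1 ∧ Metric.closedBall (e x) (2 * ρ) ⊆ e.target ∧ ∃ R : ℝ≥0∞, R < ⊤ ∧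
    NikOn (cgrad e θ) (Metric.closedBall (e x) ρ) ρ s R

variable {u : M → ℝ} {θ : ∀ x : M, Cot d x} {s : ℝ} {x : M}

lemma LocNik.chart_change (h : LocNik e θ s x) (hu : IsH10Diff g μ Ω u θ) (S : Geom g μ)
    (he : IsC11Chart e) (he' : IsC11Chart e') (hx : x ∈ e.source) (hx' : x ∈ e'.source)
    (hs : 0 ≤ s) (hs1 : s ≤ 1) : LocNik e' θ s x := by
  obtain ⟨ρ, hρ, hρ1, hB, R, hR, hN⟩ := h
  obtain ⟨ρ', hρ', hB', C, H⟩ := S.exists_nikOn_chart_change (Ω := Ω) he he' hx hx' hρ hB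
  obtain ⟨w, hw⟩ := hu.exists_h1Lim S he
  have hf := lintegral_sq_lt_top (hw.memLp_grad e.open_target (isCompact_closedBall (e x) ρ)
    ((Metric.closedBall_subset_closedBall (by linarith)).trans hB))
  refine ⟨min ρ' 1, by positivity, min_le_right _ _, (Metric.closedBall_subset_closedBall
    (by linarith [min_le_left ρ' 1])).trans hB', _, ?_, (H u θ hu s R hs hs1 hN).mono
    (Metric.closedBall_subset_closedBall (min_le_left _ _)) (min_le_left _ _) le_rfl⟩
  exact ENNReal.mul_lt_top ENNReal.coe_lt_top (ENNReal.add_lt_top.2 ⟨hR, hf⟩)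

/-- With `MemNik.exists_locNik` this describes membership by conditions at points, which
`LocNik.chart_change` makes independent of the chart. -/
lemma MemNik.of_locNik {P : FiniteAtlas d M} (hu : IsH10Diff g μ Ω u θ) (S : Geom g μ)
    (hs : 0 ≤ s) (hs1 : s ≤ 1)
    (h : ∀ i, ∀ x ∈ (P.chart i).source, LocNik (P.chart i) θ s x) : MemNik P μ s u := by
  refine ⟨hu.1, fun i => ?_⟩
  have he := P.isC11Chart i
  have hK := image_tsupport_subset (P.tsupport_subset i)
  have hex : ∀ y : E d, ∃ ρ : ℝ, ∃ R : ℝ≥0∞, y ∈ P.chart i '' tsupport (P.ψ i) → 0 < ρ ∧ ρ ≤ 1 ∧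
      Metric.closedBall y (2 * ρ) ⊆ (P.chart i).target ∧ R < ⊤ ∧
      NikOn (cgrad (P.chart i) θ) (Metric.closedBall y ρ) ρ s R := fun y => by
    by_cases hy : y ∈ P.chart i '' tsupport (P.ψ i)
    · have := h i _ ((P.chart i).map_target (hK hy))
      rw [LocNik, (P.chart i).right_inv (hK hy)] at this
      obtain ⟨ρ, h1, h2, h3, R, h4, h5⟩ := this
      exact ⟨ρ, R, fun _ => ⟨h1, h2, h3, h4, h5⟩⟩
    · exact ⟨0, 0, fun h => (hy h).elim⟩
  choose ρ R hρ using hex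
  obtain ⟨t, ht, C, K', hK', hK't, H⟩ := S.exists_nikNormRd_le (Ω := Ω) (ρ := ρ) he (P.isC11Fun i)
    (P.tsupport_subset i) fun y hy => ⟨(hρ y hy).1, (hρ y hy).2.1, (hρ y hy).2.2.1⟩
  obtain ⟨w, hw⟩ := hu.exists_h1Lim S he
  have f1 := lintegral_sq_lt_top (hw.memLp_grad (P.chart i).open_target hK' hK't)
  have f2 := lintegral_sq_lt_top (hw.memLp hK' hK't)
  obtain ⟨h1, h2⟩ := H u θ hu s (∑ y ∈ t, R y) _ hs hs1 (fun y hy =>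
    (hρ y (ht y hy)).2.2.2.2.mono subset_rfl le_rfl
      (Finset.single_le_sum (f := R) (fun _ _ => zero_le) hy)) le_rfl
  refine ⟨h1, lt_top_iff_ne_top.2 fun h0 => ?_⟩
  have f3 : ∑ y ∈ t, R y < ⊤ := ENNReal.sum_lt_top.2 fun y hy => (hρ y (ht y hy)).2.2.2.1
  rw [h0, ENNReal.top_pow two_ne_zero, top_le_iff] at h2
  refine absurd h2 (ENNReal.mul_lt_top (by finiteness) (ENNReal.mul_lt_top ENNReal.coe_lt_top
    (ENNReal.add_lt_top.2 ⟨f3, ENNReal.add_lt_top.2 ⟨f1, f2⟩⟩))).ne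

/-- Some `ψ i` is non-zero at `x`. Near `x`, `u` is the product of `ψ i * u`, whose gradient
satisfies a global condition, with the `C^{1,1}` function `1 / ψ i`. -/
lemma MemNik.exists_locNik {P : FiniteAtlas d M} (h : MemNik P μ s u) (hu : IsH10Diff g μ Ω u θ)
    (S : Geom g μ) (hs : 0 ≤ s) (hs1 : s ≤ 1) (x : M) :
    ∃ i, x ∈ (P.chart i).source ∧ LocNik (P.chart i) θ s x := by
  obtain ⟨i, hi⟩ : ∃ i, P.ψ i x ≠ 0 := by
    by_contra! h0
    have := P.sum_eq_one x
    simp [h0] at this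
  have hx : x ∈ (P.chart i).source := P.tsupport_subset i (subset_tsupport _ hi)
  refine ⟨i, hx, ?_⟩
  set e := P.chart i
  have he : IsC11Chart e := P.isC11Chart i
  have hη : ∀ y ∈ e.target, C11At (fun y => P.ψ i (e.symm y)) y := fun y hy =>
    (P.isC11Fun i).c11At he hy
  have hc : ContDiffOn ℝ 1 (fun y => P.ψ i (e.symm y)) e.target := (P.isC11Fun i).contDiffOn he
  obtain ⟨w, hw⟩ := hu.exists_h1Lim S he
  obtain ⟨h1, h2, h3⟩ := hw.cutoff e.open_target (isCompact_image_tsupport (P.tsupport_subset i))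
    (image_tsupport_subset (P.tsupport_subset i)) hc
    fun y hy hyK => eq_zero_of_notMem_image_tsupport hy hyK
  obtain ⟨R, hR, hN⟩ := exists_nikOn_of_nikNormRd h1 h2 h3 (h.2 i).1 (h.2 i).2
  set U := e.target ∩ (fun y => P.ψ i (e.symm y)) ⁻¹' {0}ᶜ
  have hU : IsOpen U := hc.continuousOn.isOpen_inter_preimage e.open_target isOpen_compl_singleton
  have hxU : e x ∈ U := ⟨e.map_source hx, by
    show P.ψ i (e.symm (e x)) ≠ 0
    rwa [e.left_inv hx]⟩
  obtain ⟨ρ, hρ, hρ1, hB⟩ := exists_radius (hU.mem_nhds hxU) one_pos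
  have hη' : ∀ y ∈ U, C11At (fun y => (P.ψ i (e.symm y))⁻¹) y := fun y hy =>
    C11At.comp (f := Inv.inv) (g := fun y => P.ψ i (e.symm y)) (contDiffAt_inv ℝ hy.2).c11At
      (hη y hy.1)
  have h1' := h1.mono (subset_univ U)
  obtain ⟨R', hR', hN'⟩ := NikOn.mul_lt_top h1' hU hρ1 hB (fun y hy => hη' y (hB hy)) hs hs1 hR
    (hN _ _)
  refine ⟨ρ, hρ, hρ1, hB.trans inter_subset_left, R', hR', hN'.congr_ae hρ.le ?_⟩
  refine ae_restrict_of_ae_restrict_of_subset hB ((h1'.mul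
    (fun y hy => (hη' y hy).1.contDiffWithinAt) hU).grad_ae_eq (hw.mono inter_subset_left) hU ?_)
  filter_upwards [ae_restrict_mem hU.measurableSet] with y hy
  rw [indicator_of_mem hy.1, inv_mul_cancel_left₀ hy.2]

end Manifold

/-! ### The differences `φ (u - u_h)` in the spaces `Ñ_2^{1+s}(Ω)` -/

section Membership

variable {d : ℕ} {M : Type*} [TopologicalSpace M] [T2Space M] [CompactSpace M]
  [ChartedSpace (E d) M]
  [MeasurableSpace M] [IsManifold (𝓡 d) 1 M] [BorelSpace M] {g : Metric d M} {μ : Measure M}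
  {e e' : Chart d M} {Ω : Set M}
  {u v : M → ℝ} {θ ζ : ∀ x : M, Cot d x} {s : ℝ} {x : M}

lemma H1Lim.zero {V : Type*} [NormedAddCommGroup V] [NormedSpace ℝ V] [MeasureSpace V]
    (U : Set V) : H1Lim U (fun _ => (0 : ℝ)) (fun _ => 0) (fun _ _ => 0) :=
  ⟨fun _ => contDiffOn_const, aestronglyMeasurable_const, aestronglyMeasurable_const,
    fun _ _ _ => by simp, fun _ _ _ => by simp⟩

lemma LocNik.of_eq_zero (hv : IsH10Diff g μ Ω v ζ) (S : Geom g μ) (he : IsC11Chart e)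
    {K : Set M} (hK : IsClosed K) (h0 : ∀ x, x ∉ K → v x = 0) (hx : x ∈ e.source) (hxK : x ∉ K) :
    LocNik e ζ s x := by
  set U := e.target ∩ e.symm ⁻¹' Kᶜ
  have hU : IsOpen U := e.continuousOn_symm.isOpen_inter_preimage e.open_target hK.isOpen_compl
  have hxU : e x ∈ U := ⟨e.map_source hx, by
    show e.symm (e x) ∉ K
    rwa [e.left_inv hx]⟩
  obtain ⟨ρ, hρ, hρ1, hB⟩ := exists_radius (hU.mem_nhds hxU) one_pos
  obtain ⟨w, hw⟩ := hv.exists_h1Lim S he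
  refine ⟨ρ, hρ, hρ1, hB.trans inter_subset_left, 0, ENNReal.zero_lt_top,
    NikOn.congr_ae (G := fun _ => (0 : Du d)) hρ.le (fun h _ => by simp) ?_⟩
  refine ae_restrict_of_ae_restrict_of_subset hB
    ((H1Lim.zero U).grad_ae_eq (hw.mono inter_subset_left) hU ?_)
  filter_upwards [ae_restrict_mem hU.measurableSet] with y hy
  exact (h0 _ hy.2).symm

/-- The condition for the difference at `y` comes from those for `u` at `y` and at `y + h`, on the
smaller of the two balls; the cut-off function is a `C^{1,1}` multiplier. -/
lemma LocNik.translateDiff {φ : M → ℝ} {h y₀ : E d} {r : ℝ} (hu : IsH10Diff g μ Ω u θ)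
    (hv : IsH10Diff g μ Ω (HolderElliptic.translateDiff e φ u h) ζ) (S : Geom g μ)
    (he : IsC11Chart e) (hr : 0 < r) (hB : Metric.closedBall y₀ (4 * r) ⊆ e.target)
    (hh : ‖h‖ ≤ r) (hφ : IsC11Fun d φ) (hs : 0 ≤ s) (hs1 : s ≤ 1)
    (hloc : ∀ x ∈ e.source, LocNik e θ s x) {y : E d} (hy : y ∈ Metric.closedBall y₀ (2 * r)) :
    LocNik e ζ s (e.symm y) := by
  set U := Metric.ball y₀ (3 * r)
  have hU : IsOpen U := Metric.isOpen_ball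
  have hUt : U ⊆ e.target :=
    Metric.ball_subset_closedBall.trans ((Metric.closedBall_subset_closedBall (by linarith)).trans hB)
  have hyU : y ∈ U := Metric.closedBall_subset_ball (by linarith) hy
  have hUh : ∀ y ∈ U, y + h ∈ e.target := fun y hy => hB
    (Metric.closedBall_subset_closedBall (by linarith)
      (add_mem_closedBall (Metric.ball_subset_closedBall hy) hh))
  have hl1 := hloc _ (e.map_target (hUt hyU))
  have hl2 := hloc _ (e.map_target (hUh y hyU))
  rw [LocNik, e.right_inv (hUt hyU)] at hl1
  rw [LocNik, e.right_inv (hUh y hyU)] at hl2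
  obtain ⟨ρ₁, hρ₁, -, -, R₁, hR₁, hN₁⟩ := hl1
  obtain ⟨ρ₂, hρ₂, -, -, R₂, hR₂, hN₂⟩ := hl2
  obtain ⟨ρ, hρ, hρa, hρU⟩ := exists_radius (hU.mem_nhds hyU)
    (lt_min one_pos (lt_min hρ₁ hρ₂))
  have hρ1 : ρ ≤ 1 := hρa.trans (min_le_left _ _)
  have hρρ₁ : ρ ≤ ρ₁ := hρa.trans ((min_le_right _ _).trans (min_le_left _ _))
  have hρρ₂ : ρ ≤ ρ₂ := hρa.trans ((min_le_right _ _).trans (min_le_right _ _))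
  obtain ⟨w, hw⟩ := hu.exists_h1Lim S he
  obtain ⟨w', hw'⟩ := hv.exists_h1Lim S he
  have h1 := hw.mono hUt
  have h2 : H1Lim U (fun y => u (e.symm (y + h))) (fun y => cgrad e θ (y + h))
      (fun n y => w n (y + h)) := hw.translate e.open_target hUh
  have h3 := h1.sub h2 hU
  have hc : ContDiffOn ℝ 1 (fun y => φ (e.symm y)) U := (hφ.contDiffOn he).mono hUt
  have hN : NikOn (fun y => cgrad e θ y - cgrad e θ (y + h)) (Metric.closedBall y ρ) ρ s
      (2 * (R₁ + R₂)) :=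
    NikOn.sub_translate e.open_target hw.meas_grad hρ.le (hρU.trans hUt)
      (hN₁.mono (Metric.closedBall_subset_closedBall hρρ₁) hρρ₁ le_rfl)
      (hN₂.mono (Metric.closedBall_subset_closedBall hρρ₂) hρρ₂ le_rfl)
  obtain ⟨R, hR, hN'⟩ := hN.mul_lt_top h3 hU hρ1 hρU (η := fun y => φ (e.symm y))
    (fun z hz => hφ.c11At he (hUt (hρU hz))) hs hs1
    (ENNReal.mul_lt_top ENNReal.ofNat_lt_top (ENNReal.add_lt_top.2 ⟨hR₁, hR₂⟩))
  rw [LocNik, e.right_inv (hUt hyU)]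
  refine ⟨ρ, hρ, hρ1, hρU.trans hUt, R, hR, hN'.congr_ae hρ.le ?_⟩
  refine ae_restrict_of_ae_restrict_of_subset hρU
    ((h3.mul hc hU).grad_ae_eq (hw'.mono hUt) hU ?_)
  filter_upwards [ae_restrict_mem hU.measurableSet] with z hz
  rw [translateDiff_symm _ _ _ _ (hUt hz)]

/-- In the second assertion `IsHolderForm` applies only to differences lying in `Ñ_2^{1+s}(Ω)`.
Membership alone matters, so no bound uniform in `h` is sought. -/
lemma MemNikTilde.translateDiff {P : FiniteAtlas d M} {φ : M → ℝ} {h y₀ : E d} {r : ℝ}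
    (hm : MemNikTilde P μ Ω s u) (hu : IsH10Diff g μ Ω u θ)
    (hv : IsH10Diff g μ Ω (HolderElliptic.translateDiff e φ u h) ζ) (S : Geom g μ)
    (he : IsC11Chart e) (hr : 0 < r) (hB : Metric.closedBall y₀ (4 * r) ⊆ e.target)
    (hh : ‖h‖ ≤ r) (hφ : IsC11Fun d φ)
    (hφ0 : ∀ x, x ∉ e.symm '' Metric.closedBall y₀ (2 * r) → φ x = 0) (hs : 0 ≤ s) (hs1 : s ≤ 1) :
    MemNikTilde P μ Ω s (HolderElliptic.translateDiff e φ u h) := by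
  have hKt : Metric.closedBall y₀ (2 * r) ⊆ e.target :=
    (Metric.closedBall_subset_closedBall (by linarith)).trans hB
  have hloc : ∀ x ∈ e.source, LocNik e θ s x := fun x hx => by
    obtain ⟨i, hi, h⟩ := hm.1.exists_locNik hu S hs hs1 x
    exact h.chart_change hu S (P.isC11Chart i) he hi hx hs hs1
  refine ⟨MemNik.of_locNik hv S hs hs1 fun i x hx => ?_, ?_⟩
  · by_cases hxK : x ∈ e.symm '' Metric.closedBall y₀ (2 * r)
    · obtain ⟨y, hy, rfl⟩ := hxK
      exact (LocNik.translateDiff hu hv S he hr hB hh hφ hs hs1 hloc hy).chart_change hv S he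
        (P.isC11Chart i) (e.map_target (hKt hy)) hx hs hs1
    · refine LocNik.of_eq_zero hv S (P.isC11Chart i)
        (isCompact_symm_image e (isCompact_closedBall _ _) hKt).isClosed (fun z hz => ?_) hx hxK
      rw [HolderElliptic.translateDiff, hφ0 z hz, zero_mul]
  · filter_upwards [hv.ae_eq_zero] with x hx hxΩ
    exact hx fun h => hxΩ (subset_closure h)

end Membership

/-! ### The a priori estimate -/

section Estimate

variable {d : ℕ} {M : Type*} [TopologicalSpace M] [T2Space M] [CompactSpace M]
  [ChartedSpace (E d) M]
  [MeasurableSpace M] [IsManifold (𝓡 d) 1 M] [BorelSpace M] {g : Metric d M} {μ : Measure M}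
  {e e' : Chart d M} {Ω : Set M} {V : Set (Chart d M)} {A : Tensor2 d M}
  {b : ∀ x : M, Tan d x} {c : productSpace g μ Ω →ₗ[ℝ] ℝ} {K : Chart d M → (M → ℝ) → ℝ}
  {γΩ γc σ X : ℝ}

variable (A b c V K γΩ γc) in
/-- `u` is a weak solution for which `f` and `Φ_r(u, ·)` are Hölder continuous in some space stable
under differences of translates; `σ` is the resulting order of smoothness and `X` the bound of the
squared norm. -/
def EstimateData (u : H10 g μ Ω) (σ X : ℝ) : Prop :=
  ∃ (f : H10 g μ Ω →ₗ[ℝ] ℝ) (Hs : Set (M → ℝ)) (nH : Hs → ℝ) (β Cτ CΦ : ℝ)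
    (huH : (u : M → ℝ) ∈ Hs), IsWeakSolution A b c f u ∧ 0 < β ∧ β ≤ 1 ∧ 0 ≤ Cτ ∧ 0 ≤ CΦ ∧
    0 ≤ nH ⟨u, huH⟩ ∧ IsHolderForm V K Hs nH β Cτ f ∧ IsHolderForm V K Hs nH β CΦ (formΦr b c u) ∧
    (∀ e ∈ V, ∀ (y₀ : E d) (r : ℝ) (φ : M → ℝ) (h : E d), 0 < r →
      Metric.closedBall y₀ (4 * r) ⊆ e.target → IsC11Fun d φ →
      (∀ x', x' ∉ e.symm '' Metric.closedBall y₀ (2 * r) → φ x' = 0) → ‖h‖ ≤ r →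
      translateDiff e φ u h ∈ H10 g μ Ω → translateDiff e φ u h ∈ Hs) ∧
    σ = γΩ * min γc β / 2 ∧ X = h10Norm u ^ 2 + nH ⟨u, huH⟩ * (Cτ + CΦ)

lemma EstimateData.sq_le {u : H10 g μ Ω} (h : EstimateData V A b c K γΩ γc u σ X) :
    h10Norm u ^ 2 ≤ X := by
  obtain ⟨f, Hs, nH, β, Cτ, CΦ, huH, -, -, -, h1, h2, h3, -, -, -, -, rfl⟩ := h
  exact le_add_of_nonneg_right (mul_nonneg h3 (add_nonneg h1 h2))

lemma EstimateData.order {u : H10 g μ Ω} (h : EstimateData V A b c K γΩ γc u σ X) (hγ : 0 < γΩ)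
    (hγ1 : γΩ ≤ 1) (hγc : 0 < γc) : 0 ≤ σ ∧ σ ≤ 1 := by
  obtain ⟨f, Hs, nH, β, Cτ, CΦ, huH, -, h0, h1, -, -, -, -, -, -, rfl, -⟩ := h
  have h2 : 0 < min γc β := lt_min hγc h0
  have h3 : min γc β ≤ 1 := (min_le_right _ _).trans h1
  exact ⟨by positivity, by nlinarith⟩

lemma EstimateData.lintegral_le {Y : Type*} [NormedAddCommGroup Y] {α : Type*} [MeasurableSpace α]
    {ν : Measure α} {F : α → Y} {C : ℝ≥0} {u : H10 g μ Ω}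
    (h : EstimateData V A b c K γΩ γc u σ X)
    (hF : eLpNorm F 2 ν ≤ C * ENNReal.ofReal (h10Norm u)) :
    ∫⁻ y, ‖F y‖ₑ ^ 2 ∂ν ≤ (C ^ 2 : ℝ≥0) * ENNReal.ofReal X := by
  rw [← eLpNorm_two_sq]
  calc _ ≤ (C * ENNReal.ofReal (h10Norm u)) ^ 2 := by gcongr
    _ = (C ^ 2 : ℝ≥0) * ENNReal.ofReal (h10Norm u ^ 2) := by
      rw [mul_pow, ENNReal.ofReal_pow (h10Norm_nonneg u), ENNReal.coe_pow]
    _ ≤ _ := mul_le_mul' le_rfl (ENNReal.ofReal_le_ofReal h.sq_le)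

/-- The estimate holds in a chart of `V` adapted to the boundary and is carried to the given chart.
The `L_2` norm of the gradient produced by the change of chart is bounded by the squared energy
norm, hence by `X`. -/
lemma Geom.exists_nikOn_of_estimateData (S : Geom g μ) (hA1 : CondA1 g A) (hA2 : CondA2 γc A)
    (hV : IsC11Atlas V) (hγ : 0 < γΩ) (hγ1 : γΩ ≤ 1) (hΩo : IsOpen Ω)
    (hΩ : IsHolderBoundary V γΩ Ω) (he' : IsC11Chart e') {x : M} (hx' : x ∈ e'.source) :
    ∃ ρ > 0, ρ ≤ 1 ∧ Metric.closedBall (e' x) (2 * ρ) ⊆ e'.target ∧ ∃ C : ℝ≥0,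
      ∀ (u : H10 g μ Ω) (σ X : ℝ), EstimateData V A b c K γΩ γc u σ X →
        NikOn (cgrad e' (h10Diff u)) (Metric.closedBall (e' x) ρ) ρ σ
          (C * ENNReal.ofReal X) := by
  obtain ⟨e, he, hx⟩ := hV.2 x
  have hec := hV.1 e he
  obtain ⟨r, ρ, C, hr, hρ, hC, hB4, hB, H⟩ :=
    S.exists_nikOn_of_isWeakSolution hA1 hA2 hV he hγ hγ1 hΩo hΩ hx b c K
  obtain ⟨ρ', hρ', hB', C', H'⟩ := S.exists_nikOn_chart_change (Ω := Ω) hec he' hx hx' hρ hB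
  obtain ⟨C'', H''⟩ := S.exists_eLpNorm_cgrad_le (Ω := Ω) hec (isCompact_closedBall (e x) ρ)
    ((Metric.closedBall_subset_closedBall (by linarith)).trans hB)
  refine ⟨min ρ' 1, by positivity, min_le_right _ _, (Metric.closedBall_subset_closedBall
    (by linarith [min_le_left ρ' 1])).trans hB', C' * (C.toNNReal + C'' ^ 2),
    fun u σ X hD => ?_⟩
  obtain ⟨hσ, hσ1⟩ := hD.order hγ hγ1 hA2.1
  have hI := hD.lintegral_le (H'' u)
  obtain ⟨f, Hs, nH, β, Cτ, CΦ, huH, hu, hβ, hβ1, hCτ, hCΦ, hn, hτ, hΦ, hmem, rfl, rfl⟩ := hD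
  have h1 := H f u hu Hs nH β Cτ CΦ hβ hβ1 hCτ hCΦ huH hn hτ hΦ
    fun φ h hφ hφ0 hh hz => hmem e he _ r φ h hr hB4 hφ hφ0 hh hz
  refine (H' _ _ (h10Diff_spec u) _ _ hσ hσ1 h1).mono
    (Metric.closedBall_subset_closedBall (min_le_left _ _)) (min_le_left _ _) ?_
  rw [ENNReal.coe_mul, mul_assoc, ENNReal.coe_add, add_mul, ENNReal.ofReal_mul hC]
  exact mul_le_mul' le_rfl (add_le_add le_rfl hI)

/-- Finitely many local estimates cover the compact support of `ψ i`. The `L_2` norm of `u` itself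
enters through the derivatives of `ψ i` and is bounded by the Poincaré inequality. -/
lemma Geom.exists_nikNormRd_le_of_estimateData [ConnectedSpace M] (S : Geom g μ)
    (hA1 : CondA1 g A) (hA2 : CondA2 γc A) (hV : IsC11Atlas V) (hγ : 0 < γΩ) (hγ1 : γΩ ≤ 1)
    (hΩo : IsOpen Ω) (hΩ : IsHolderBoundary V γΩ Ω) (hΩc : (closure Ω)ᶜ.Nonempty)
    (P : FiniteAtlas d M) (i : Fin P.n) :
    ∃ C : ℝ≥0, ∀ (u : H10 g μ Ω) (σ X : ℝ), EstimateData V A b c K γΩ γc u σ X →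
      MemW12 (inChart (P.chart i) (P.ψ i * u)) ∧
      nikNormRd σ (inChart (P.chart i) (P.ψ i * u)) ^ 2 ≤ C * ENNReal.ofReal X := by
  have he := P.isC11Chart i
  have hK := image_tsupport_subset (P.tsupport_subset i)
  have hex : ∀ y : E d, ∃ (ρ : ℝ) (C : ℝ≥0), y ∈ P.chart i '' tsupport (P.ψ i) → 0 < ρ ∧ ρ ≤ 1 ∧
      Metric.closedBall y (2 * ρ) ⊆ (P.chart i).target ∧
      ∀ (u : H10 g μ Ω) (σ X : ℝ), EstimateData V A b c K γΩ γc u σ X →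
        NikOn (cgrad (P.chart i) (h10Diff u)) (Metric.closedBall y ρ) ρ σ
          (C * ENNReal.ofReal X) := fun y => by
    by_cases hy : y ∈ P.chart i '' tsupport (P.ψ i)
    · have := S.exists_nikOn_of_estimateData (b := b) (c := c) (K := K) hA1 hA2 hV hγ hγ1 hΩo hΩ he
        ((P.chart i).map_target (hK hy))
      rw [(P.chart i).right_inv (hK hy)] at this
      obtain ⟨ρ, h1, h2, h3, C, h4⟩ := this
      exact ⟨ρ, C, fun _ => ⟨h1, h2, h3, h4⟩⟩
    · exact ⟨0, 0, fun h => (hy h).elim⟩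
  choose ρ C₀ hρ using hex
  obtain ⟨t, ht, C, K', hK', hK't, H⟩ := S.exists_nikNormRd_le (Ω := Ω) (ρ := ρ) he (P.isC11Fun i)
    (P.tsupport_subset i) fun y hy => ⟨(hρ y hy).1, (hρ y hy).2.1, (hρ y hy).2.2.1⟩
  obtain ⟨C₁, H₁⟩ := S.exists_eLpNorm_cgrad_le (Ω := Ω) he hK' hK't
  obtain ⟨C₂, H₂⟩ := S.exists_eLpNorm_chart_le hΩc he hK' hK't
  refine ⟨(d + 2) ^ 2 * (C * (∑ y ∈ t, C₀ y + (C₁ ^ 2 + C₂ ^ 2))), fun u σ X hD => ?_⟩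
  obtain ⟨hσ, hσ1⟩ := hD.order hγ hγ1 hA2.1
  have hR : ∀ y ∈ t, NikOn (cgrad (P.chart i) (h10Diff u)) (Metric.closedBall y (ρ y)) (ρ y) σ
      ((∑ y ∈ t, C₀ y : ℝ≥0) * ENNReal.ofReal X) := fun y hy =>
    ((hρ y (ht y hy)).2.2.2 u σ X hD).mono subset_rfl le_rfl (mul_le_mul'
      (ENNReal.coe_le_coe.2 (Finset.single_le_sum (f := C₀) (fun _ _ => zero_le) hy)) le_rfl)
  obtain ⟨h1, h2⟩ := H u _ (h10Diff_spec u) σ _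
    ((C * (∑ y ∈ t, C₀ y + (C₁ ^ 2 + C₂ ^ 2)) : ℝ≥0) * ENNReal.ofReal X) hσ hσ1 hR (by
    rw [ENNReal.coe_mul, mul_assoc, ENNReal.coe_add, add_mul, ENNReal.coe_add, add_mul]
    exact mul_le_mul' le_rfl (add_le_add le_rfl (add_le_add (hD.lintegral_le (H₁ u))
      (hD.lintegral_le (H₂ u)))))
  refine ⟨h1, h2.trans_eq ?_⟩
  push_cast
  ring

/-- The a priori estimate in the Nikolskii norm. -/
lemma Geom.exists_nikNorm_sq_le [ConnectedSpace M] (S : Geom g μ)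
    (hA1 : CondA1 g A) (hA2 : CondA2 γc A) (hV : IsC11Atlas V) (hγ : 0 < γΩ) (hγ1 : γΩ ≤ 1)
    (hΩo : IsOpen Ω) (hΩ : IsHolderBoundary V γΩ Ω) (hΩc : (closure Ω)ᶜ.Nonempty)
    (P : FiniteAtlas d M) (b : ∀ x : M, Tan d x) (c : productSpace g μ Ω →ₗ[ℝ] ℝ)
    (K : Chart d M → (M → ℝ) → ℝ) :
    ∃ C : ℝ, 0 < C ∧ ∀ (u : H10 g μ Ω) (σ X : ℝ), EstimateData V A b c K γΩ γc u σ X →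
      MemNikTilde P μ Ω σ u ∧ nikNorm P σ u ^ 2 ≤ C * X := by
  choose C hC using S.exists_nikNormRd_le_of_estimateData (b := b) (c := c) (K := K)
    hA1 hA2 hV hγ hγ1 hΩo hΩ hΩc P
  -- The factor `P.n` comes from the Cauchy–Schwarz inequality for the sum over the charts; the
  -- summand 1 only ensures positivity.
  refine ⟨P.n * ∑ i, (C i : ℝ) + 1, by positivity, fun u σ X hD => ?_⟩
  have hX : 0 ≤ X := (sq_nonneg _).trans hD.sq_le
  have hsq : ∀ i, (nikNormRd σ (inChart (P.chart i) (P.ψ i * u))).toReal ^ 2 ≤ C i * X :=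
    fun i => by
    rw [← ENNReal.toReal_pow]
    refine (ENNReal.toReal_mono (by finiteness) (hC i u σ X hD).2).trans_eq ?_
    rw [ENNReal.toReal_mul, ENNReal.toReal_ofReal hX, ENNReal.coe_toReal]
  refine ⟨⟨⟨(h10Diff_spec u).1, fun i => ⟨(hC i u σ X hD).1, lt_top_iff_ne_top.2 fun h0 => ?_⟩⟩, ?_⟩,
    ?_⟩
  · have := (hC i u σ X hD).2
    rw [h0, ENNReal.top_pow two_ne_zero, top_le_iff] at this
    exact absurd this (by finiteness)
  · filter_upwards [(h10Diff_spec u).ae_eq_zero] with x hx hxΩ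
    exact hx fun h => hxΩ (subset_closure h)
  · calc nikNorm P σ u ^ 2 ≤ P.n * ∑ i, (nikNormRd σ
          (inChart (P.chart i) (P.ψ i * u))).toReal ^ 2 := by
          have := sq_sum_le_card_mul_sum_sq (s := Finset.univ)
            (f := fun i => (nikNormRd σ (inChart (P.chart i) (P.ψ i * u))).toReal)
          rwa [Finset.card_univ, Fintype.card_fin] at this
      _ ≤ P.n * ∑ i, (C i * X : ℝ) := by
          gcongr with i
          exact hsq i
      _ = P.n * (∑ i, (C i : ℝ)) * X := by rw [← Finset.sum_mul, mul_assoc]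
      _ ≤ _ := by nlinarith

end Estimate

end HolderElliptic

end

/-! ### The two regularity assertions -/

open HolderElliptic in
theorem mainTheorem2 {d : ℕ} {M : Type*} [TopologicalSpace M] [T2Space M] [CompactSpace M]
    [ConnectedSpace M] [MeasurableSpace M] [BorelSpace M] [ChartedSpace (E d) M]
    [IsManifold (𝓡 d) 1 M] (hM : IsC11Manifold d M)
    (g : Metric d M) (hg : IsLipschitzMetric g)
    (P : FiniteAtlas d M) (μ : Measure M) (hμ : μ = riemannianMeasure P g)
    (Ω : Set M) (hΩo : IsOpen Ω) (hΩne : Ω.Nonempty) (hΩM : Ω ≠ univ)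
    (V : Set (Chart d M)) (hV : IsC11Atlas V)
    (γΩ : ℝ) (hγΩ0 : 0 < γΩ) (hγΩ1 : γΩ ≤ 1) (hΩ : IsHolderBoundary V γΩ Ω)
    (γc : ℝ) (A : Tensor2 d M) (b : ∀ x : M, Tan d x) (c : productSpace g μ Ω →ₗ[ℝ] ℝ)
    (hA1 : CondA1 g A) (hA2 : CondA2 γc A) (hA3 : CondA3 A b c)
    (K : Chart d M → (M → ℝ) → ℝ) :
    ∃ C : ℝ, 0 < C ∧ ∀ (f : H10 g μ Ω →ₗ[ℝ] ℝ) (u : H10 g μ Ω),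
      IsHm1 f → IsWeakSolution A b c f u →
      (∀ β₀ : ℝ, 0 < β₀ → β₀ ≤ 1 → ∀ Cτ CΦ : ℝ, 0 ≤ Cτ → 0 ≤ CΦ →
        IsHolderForm V K (H10 g μ Ω : Set (M → ℝ)) h10Norm β₀ Cτ f →
        IsHolderForm V K (H10 g μ Ω : Set (M → ℝ)) h10Norm β₀ CΦ (formΦr b c u) →
        MemNikTilde P μ Ω (γΩ * min γc β₀ / 2) u ∧
        nikNorm P (γΩ * min γc β₀ / 2) u ^ 2 ≤ C * h10Norm u * (h10Norm u + Cτ + CΦ)) ∧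
      (∀ s : ℝ, 0 < s → s < 1 / 2 → MemNikTilde P μ Ω s u →
        ∀ βs : ℝ, 0 < βs → βs ≤ 1 → ∀ Cτ CΦ : ℝ, 0 ≤ Cτ → 0 ≤ CΦ →
        IsHolderForm V K {w | MemNikTilde P μ Ω s w} (fun w => nikNorm P s w) βs Cτ f →
        IsHolderForm V K {w | MemNikTilde P μ Ω s w} (fun w => nikNorm P s w) βs CΦ
          (formΦr b c u) →
        MemNikTilde P μ Ω (γΩ * min γc βs / 2) u ∧
        nikNorm P (γΩ * min γc βs / 2) u ^ 2 ≤
          C * (h10Norm u ^ 2 + nikNorm P s u * (Cτ + CΦ))) := by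
  subst hμ
  have S : Geom g (riemannianMeasure P g) :=
    ⟨hM, hg, fun e he => he.restrict_source_eq hM hg P⟩
  obtain ⟨C, hC, H⟩ := S.exists_nikNorm_sq_le hA1 hA2 hV hγΩ0 hγΩ1 hΩo hΩ
    (nonempty_compl_closure hV hΩ hΩne hΩM) P b c K
  refine ⟨C, hC, fun f u _ hu => ⟨fun β hβ hβ1 Cτ CΦ hτ0 hΦ0 hτ hΦ => ?_,
    fun s hs hs2 hus β hβ hβ1 Cτ CΦ hτ0 hΦ0 hτ hΦ => ?_⟩⟩
  -- Here the auxiliary space is `H10` itself, so its stability under the differences is immediate.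
  · obtain ⟨h1, h2⟩ := H u _ _ ⟨f, _, _, β, Cτ, CΦ, u.2, hu, hβ, hβ1, hτ0, hΦ0, h10Norm_nonneg u,
      hτ, hΦ, fun _ _ _ _ _ _ _ _ _ _ _ hz => hz, rfl, rfl⟩
    have h3 : nikNorm P (γΩ * min γc β / 2) u ^ 2 ≤
        C * (h10Norm u ^ 2 + h10Norm u * (Cτ + CΦ)) := h2
    exact ⟨h1, h3.trans_eq (by ring)⟩
  -- Here the auxiliary space is `Ñ_2^{1+s}(Ω)`, whose stability is `MemNikTilde.translateDiff`.
  · exact H u _ _ ⟨f, _, _, β, Cτ, CΦ, hus, hu, hβ, hβ1, hτ0, hΦ0,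
      Finset.sum_nonneg fun _ _ => ENNReal.toReal_nonneg, hτ, hΦ,
      fun e he y₀ r φ h hr hB hφ hφ0 hh hz => hus.translateDiff (h10Diff_spec u)
        (h10Diff_spec ⟨_, hz⟩) S (hV.1 e he) hr hB hh hφ hφ0 hs.le (by linarith), rfl, rfl⟩
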